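/- **Setting.** For each $n$ let $V$ be a set of $n$ vertices with degrees $\deg(v)=\deg_n(v)$. Attach $\deg(v)$ half-edges to $v$, let $H=H_n$ be the set of all half-edges and $v(h)$ the vertex of $h\in H$. Distinct half-edges at the same vertex are *siblings*, and $\deg_H(h)=\deg(v(h))-1$ is the number of siblings of $h$. A *configuration* is a map $\xi:H\to H$ with $\xi(h)\ne h$ and $\xi(\xi(h))=h$ for all $h$; its *edges* are the pairs $\{h,\xi(h)\}$, and $\mathrm{Conf}_H$ is the set of all configurations. Limits $n\to\infty$ are along those $n$ for which $|H|$ is even, so that configurations exist. For a configuration $\xi$ let $P_\xi(x,y)=1/\deg_H(y)$ if $y$ is a sibling of $\xi(x)$, and $P_\xi(x,y)=0$ otherwise (non-backtracking random walk). **Dynamics.** Let $\alpha_n\in(0,1]$ and $r_n\in\mathbb N$. Consider the Markov chain $(X_t,C_t)_{t\ge 0}$ on $H\times\mathrm{Conf}_H$ with law $\mathbb P_{x,\xi}$ when started from $X_0=x$, $C_0=\xi$, and with the following step at time $t\ge1$. 1. Let $L=L_t$ be the set of all edges of $C_{t-1}$, and let $K_t\subseteq L_t$ be * *local-to-global*: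 $K_t=\{\{X_{t-1},C_{t-1}(X_{t-1})\}\}$; * *near-to-global*: $K_t$ is the set of edges $\{k,C_{t-1}(k)\}$ such that $P_{C_{t-1}}^{\,j}(X_{t-1},k)>0$ for some $0\le j<r_n$; * *global-to-global*: $K_t=L_t$. 2. Each edge of $K_t$ is selected with probability $\alpha_n$, independently of everything else. Let $R_t$ be the set of selected edges. 3. If $|R_t|\ge|L_t\setminus R_t|$, break up all edges, pick half of the half-edges and order them uniformly at random, order the others uniformly at random, and pair the $i$-th elements of the two lists. Otherwise draw a set $R_t'\subseteq L_t\setminus R_t$ with $|R_t'|=|R_t|$ uniformly at random (without replacement), match the half-edges of $R_t$ with those of $R_t'$ by a uniformly random bijection, and keep all other pairs. The result is $C_t$. 4. The walk moves from $X_{t-1}$ to $X_t$ with transition probabilities $P_{C_t}(X_{t-1},\cdot)$. Let $$\tau=\min\{t\in\mathbb N:\ X_{t-1}\text{ belongs to an edge of }R_1\cup\dots\cup R_t\}$$ be the first time the walk steps along a previously rewired edge. For $t_n\in\mathbb N_0$ and $\ell\in\mathbb R$ write $\mathbb P_{x,\xi}(\tau>t_n)\to\ell$ if the convergence holds in probability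 for $(x,\xi)$ uniformly distributed on $H\times\mathrm{Conf}_H$, i.e. if for every $\varepsilon>0$ the proportion of pairs $(x,\xi)$ with $|\mathbb P_{x,\xi}(\tau>t_n)-\ell|<\varepsilon$ tends to $1$. **Theorem 1.2 (Scaling of cross-rewired time).** Assume $\alpha_n\to0$, $|H_n|=\Theta(n)$, and $\deg(v)\ge2$ for all $v$. **(A)** Local-to-global rewiring: for every $c\in(0,\infty)$, if $t_n=\lfloor c/\alpha_n\rfloor=O(\log n)$, then $\mathbb P_{x,\xi}(\tau>t_n)\to e^{-c}$. **(B)** Near-to-global rewiring: assume in addition that the empirical degree distribution $p_n=\frac1n\sum_{v}\delta_{\deg(v)}$ converges pointwise to a probability distribution $p$, that $\sum_m m\,p_n(m)\to\sum_m m\,p(m)<\infty$ and $\sum_m m^2p_n(m)\to\sum_m m^2p(m)<\infty$, that $\nu=\sum_m m(m-1)p(m)\big/\sum_m m\,p(m)>1$, and that $r_n>1$ and $r_n/\log n\to\rho$ for some $\rho\in[0,1/\log\nu)$. Let $c\in(0,\infty)$. * (i) If $\alpha_nr_n^2\to\infty$ and $t_n=\lfloor c/\sqrt{\alpha_n}\rfloor=O(\log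 n)$, then $\mathbb P_{x,\xi}(\tau>t_n)\to e^{-c^2/2}$. * (ii) If $\alpha_nr_n^2\to\beta\in(0,\infty)$ and $t_n=\lfloor c\,r_n\rfloor$ (which is automatically $O(\log n)$), then $\mathbb P_{x,\xi}(\tau>t_n)\to e^{-\beta c^2/2}$ for $c\le1$ and $\mathbb P_{x,\xi}(\tau>t_n)\to e^{-\beta(2c-1)/2}$ for $c>1$. * (iii) If $\alpha_nr_n^2\to0$ and $t_n=\lfloor c/(\alpha_nr_n)\rfloor=O(\log n)$, then $\mathbb P_{x,\xi}(\tau>t_n)\to e^{-c}$. **(C)** Global-to-global rewiring: for every $c\in(0,\infty)$, if $t_n=\lfloor c/\sqrt{\alpha_n}\rfloor=O(\log n)$, then $\mathbb P_{x,\xi}(\tau>t_n)\to e^{-c^2/2}$. -/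

import Mathlib

open Filter Topology Asymptotics

noncomputable section

namespace DynCM

/-! ### Half-edges, configurations and the non-backtracking walk

The vertex set is `Fin n`, and `d v` is the degree of the vertex `v`. -/

/-- The set `H` of half-edges: the vertex `v` carries `d v` half-edges.
The vertex `v(h)` of a half-edge `h` is `h.1`. -/
abbrev HalfEdge {n : ℕ} (d : Fin n → ℕ) : Type := Σ v : Fin n, Fin (d v)

/-- Distinct half-edges attached to the same vertex. -/
def Sibling {n : ℕ} {d : Fin n → ℕ} (x y : HalfEdge d) : Prop := x.1 = y.1 ∧ x ≠ y

open Classical in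
/-- The degree `deg_H(h)` of a half-edge: the number of its siblings. -/
def degH {n : ℕ} {d : Fin n → ℕ} (h : HalfEdge d) : ℕ :=
  (Finset.univ.filter fun g : HalfEdge d => Sibling g h).card

/-- A configuration: a pairing `ξ` of the half-edges, `ξ(h) ≠ h` and `ξ(ξ(h)) = h`. -/
abbrev Config {n : ℕ} (d : Fin n → ℕ) : Type :=
  {ξ : HalfEdge d → HalfEdge d // ∀ h, ξ h ≠ h ∧ ξ (ξ h) = h}

/-- An edge is an unordered pair of half-edges. -/
abbrev Edge {n : ℕ} (d : Fin n → ℕ) : Type := Sym2 (HalfEdge d)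

/-- The edge of the configuration `ξ` that contains the half-edge `h`. -/
def edgeAt {n : ℕ} {d : Fin n → ℕ} (ξ : Config d) (h : HalfEdge d) : Edge d := s(h, ξ.1 h)

/-- The set of all edges of a configuration. -/
def edges {n : ℕ} {d : Fin n → ℕ} (ξ : Config d) : Finset (Edge d) :=
  Finset.univ.image (edgeAt ξ)

/-- The half-edges that form a set of edges. -/
def halfEdges {n : ℕ} {d : Fin n → ℕ} (R : Finset (Edge d)) : Finset (HalfEdge d) :=
  Finset.univ.filter fun h => ∃ e ∈ R, h ∈ e

open Classical in
/-- Transition probability of the non-backtracking walk on the configuration `ξ`: from `x` the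
walk moves to a uniformly chosen sibling of `ξ(x)`. -/
def nbProb {n : ℕ} {d : Fin n → ℕ} (ξ : Config d) (x y : HalfEdge d) : ℝ :=
  if Sibling (ξ.1 x) y then 1 / (degH y : ℝ) else 0

/-- The transition matrix of the non-backtracking walk on the static configuration `ξ`. -/
def nbMatrix {n : ℕ} {d : Fin n → ℕ} (ξ : Config d) : Matrix (HalfEdge d) (HalfEdge d) ℝ :=
  Matrix.of (nbProb ξ)

/-! ### Sets of edges that are candidates for rewiring -/

/-- A rule that assigns to the current configuration and the current position of the walk the
set of edges that are candidates for rewiring. -/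
abbrev Rule {n : ℕ} (d : Fin n → ℕ) : Type := Config d → HalfEdge d → Finset (Edge d)

/-- Local: only the edge at the current position of the walk. -/
def localRule {n : ℕ} {d : Fin n → ℕ} : Rule d := fun ξ h => {edgeAt ξ h}

open Classical in
/-- Near, with radius `r`: the edges `{k, ξ(k)}` such that the walk on the static configuration
`ξ`, started from `h`, is at `k` with positive probability after `j` steps, for some `j < r`. -/
def nearRule {n : ℕ} {d : Fin n → ℕ} (r : ℕ) : Rule d := fun ξ h =>
  (Finset.univ.filter fun k : HalfEdge d => ∃ j : ℕ, j < r ∧ 0 < (nbMatrix ξ ^ j) h k).image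
    (edgeAt ξ)

/-- Global: all edges. -/
def globalRule {n : ℕ} {d : Fin n → ℕ} : Rule d := fun ξ _ => edges ξ

/-! ### Rewiring with the global set of edges, and the joint Markov chain -/

open Classical in
/-- Probability of the event `E` under the uniform distribution on the finite set `Ω`. -/
def uniformProb {Ω : Type*} [Fintype Ω] (E : Ω → Prop) : ℝ :=
  ((Finset.univ.filter E).card : ℝ) / (Fintype.card Ω : ℝ)

/-- Probability that `R` is the set of edges selected for rewiring, when each edge of `K` is
selected with probability `α`, independently of the others. -/
def selectProb {n : ℕ} {d : Fin n → ℕ} (α : ℝ) (K R : Finset (Edge d)) : ℝ :=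
  if R ⊆ K then α ^ R.card * (1 - α) ^ (K \ R).card else 0

/-- Probability that the new configuration is `η`, when the edges in `R` have been selected for
rewiring in the configuration `ξ`. Write `L` for the set of all edges of `ξ`.

* If `|R| ≥ |L \ R|`, then all edges are broken up. Half of the half-edges are picked and ordered
  at random, the other half is ordered at random as well (that is, `σ` is a uniformly random
  enumeration), and the `i`-th elements of the two lists are paired.
* Otherwise a set `R'` of `|R|` edges is drawn uniformly without replacement from `L \ R`, and
  the half-edges forming `R` are matched by a uniformly random bijection `f` with those forming
  `R'`. All other pairs of `ξ` are kept. -/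
def repairProb {n : ℕ} {d : Fin n → ℕ} (ξ : Config d) (R : Finset (Edge d)) (η : Config d) : ℝ :=
  if (edges ξ \ R).card ≤ R.card then
    uniformProb fun σ : Fin (edges ξ).card ⊕ Fin (edges ξ).card ≃ HalfEdge d =>
      ∀ i, η.1 (σ (Sum.inl i)) = σ (Sum.inr i)
  else
    (∑ R' ∈ (edges ξ \ R).powersetCard R.card,
      uniformProb fun f : halfEdges R ≃ halfEdges R' =>
        (∀ h : halfEdges R, η.1 h = f h) ∧
          ∀ h : HalfEdge d, h ∉ halfEdges R → h ∉ halfEdges R' → η.1 h = ξ.1 h) /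
      (((edges ξ \ R).powersetCard R.card).card : ℝ)

/-- The state `(X_t, C_t, R_t)` at time `t`: the position of the walk, the configuration, and the
set of edges (of `C_{t-1}`) that were selected for rewiring at time `t`. -/
abbrev State {n : ℕ} (d : Fin n → ℕ) : Type := HalfEdge d × Config d × Finset (Edge d)

/-- Transition probability of the joint chain: select edges, update the configuration, and then
let the walk move on the updated configuration. -/
def transProb {n : ℕ} {d : Fin n → ℕ} (α : ℝ) (K : Rule d) (s s' : State d) : ℝ :=
  selectProb α (K s.2.1 s.1) s'.2.2 * repairProb s.2.1 s'.2.2 s'.2.1 * nbProb s'.2.1 s.1 s'.1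

/-- The trajectory of the chain up to time `t`. -/
abbrev Path {n : ℕ} (d : Fin n → ℕ) (t : ℕ) : Type := Fin (t + 1) → State d

open Classical in
/-- Probability, under the law `P_{x,ξ}` of the chain started from `X_0 = x`, `C_0 = ξ`, of an
event `E` that depends on the trajectory up to time `t` only. -/
def pathProb {n : ℕ} {d : Fin n → ℕ} (α : ℝ) (K : Rule d) (x : HalfEdge d) (ξ : Config d)
    (t : ℕ) (E : Path d t → Prop) : ℝ :=
  ∑ ω ∈ Finset.univ.filter fun ω : Path d t => ω 0 = (x, ξ, ∅) ∧ E ω,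
    ∏ i : Fin t, transProb α K (ω i.castSucc) (ω i.succ)

/-- The event `I_{s+1} = 1`: at time `s + 1` the walk steps along a previously rewired edge, that
is, `X_s` belongs to an edge of `R_1 ∪ ⋯ ∪ R_{s+1}`. -/
def Crosses {n : ℕ} {d : Fin n → ℕ} {t : ℕ} (ω : Path d t) (s : Fin t) : Prop :=
  ∃ u : Fin t, u ≤ s ∧ (ω s.castSucc).1 ∈ halfEdges (ω u.succ).2.2

/-- The first time `τ` at which the walk steps along a previously rewired edge, with the value
`⊤` if this does not happen up to time `t`. -/
def crossTime {n : ℕ} {d : Fin n → ℕ} {t : ℕ} (ω : Path d t) : ℕ∞ :=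
  ⨅ s : {s : Fin t // Crosses ω s}, ((s.1.1 + 1 : ℕ) : ℕ∞)

/-- The probability `P_{x,ξ}(τ > t)`. -/
def tailProb {n : ℕ} {d : Fin n → ℕ} (α : ℝ) (K : Rule d) (x : HalfEdge d) (ξ : Config d)
    (t : ℕ) : ℝ :=
  pathProb α K x ξ t fun ω => (t : ℕ∞) < crossTime ω

/-! ### Asymptotic notions

`d n` is the degree sequence of the graph on `n` vertices. -/

/-- The limit `n → ∞`, taken along the `n` for which the number of half-edges is even, i.e. for
which configurations exist. -/
def evenAtTop (d : (n : ℕ) → Fin n → ℕ) : Filter ℕ :=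
  atTop ⊓ 𝓟 {n | Even (∑ v, d n v)}

/-- `P_{x,ξ}(τ > t_n) = o_P(1) + ℓ`: convergence in probability, for a uniformly chosen pair
`(x, ξ)` of an initial half-edge and an initial configuration. -/
def TailTendsto (d : (n : ℕ) → Fin n → ℕ) (α : ℕ → ℝ) (K : (n : ℕ) → Rule (d n))
    (t : ℕ → ℕ) (ℓ : ℝ) : Prop :=
  ∀ ε : ℝ, 0 < ε →
    Tendsto (fun n => uniformProb fun p : HalfEdge (d n) × Config (d n) =>
      |tailProb (α n) (K n) p.1 p.2 (t n) - ℓ| < ε) (evenAtTop d) (𝓝 1)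

/-- The empirical degree distribution `p_n`. -/
def empDist {n : ℕ} (d : Fin n → ℕ) (m : ℕ) : ℝ :=
  ((Finset.univ.filter fun v => d v = m).card : ℝ) / n

/-- The size-biased mean minus one of `p`. -/
def sizeBiasedMean (p : ℕ → ℝ) : ℝ :=
  (∑' m : ℕ, (m : ℝ) * ((m : ℝ) - 1) * p m) / ∑' m : ℕ, (m : ℝ) * p m

/-- The empirical degree distribution converges to the probability distribution `p`, together
with its first and second moments, and `p` has size-biased mean minus one larger than `1`. -/
structure DegreeRegular (d : (n : ℕ) → Fin n → ℕ) (p : ℕ → ℝ) : Prop where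
  nonneg : ∀ m, 0 ≤ p m
  hasSum_one : HasSum p 1
  tendsto_dist : ∀ m, Tendsto (fun n => empDist (d n) m) (evenAtTop d) (𝓝 (p m))
  summable_first : Summable fun m : ℕ => (m : ℝ) * p m
  tendsto_first : Tendsto (fun n => ∑' m : ℕ, (m : ℝ) * empDist (d n) m) (evenAtTop d)
    (𝓝 (∑' m : ℕ, (m : ℝ) * p m))
  summable_second : Summable fun m : ℕ => (m : ℝ) ^ 2 * p m
  tendsto_second : Tendsto (fun n => ∑' m : ℕ, (m : ℝ) ^ 2 * empDist (d n) m) (evenAtTop d)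
    (𝓝 (∑' m : ℕ, (m : ℝ) ^ 2 * p m))
  one_lt : 1 < sizeBiasedMean p

end DynCM

end

/-!
The event that no rewired edge is crossed during the first `t` steps depends on the walk and on the
set of half-edges that have not been rewired so far. Its probability `tailProb` satisfies a backward
recursion `tailVal` in these data (`tailProb_eq`), and unfolding the recursion writes it as a sum
over trajectories (`tailVal_eq_pathSum`). Here a trajectory is the list of the pairs of half-edges
that the walk traverses: `val` is the probability that the environment produces these pairs without
a crossing, and `pathSum` averages over the choices of siblings. In each of the three models the
probability is compared, in average over the uniform initial state, to an explicit product;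
`tailTendsto_of_sum_le` turns this into convergence in probability by Markov's inequality.

**Local rewiring.** The only candidate is the edge that the walk is about to traverse, so a
crossing occurs as soon as any edge is rewired, and the probability is exactly `(1 - α) ^ t`
(`tailProb_local`).

**Global rewiring.** The model is invariant under relabelling of the half-edges (`envStep_conj`).
If neither the current half-edge nor its initial partner has been seen by the walk, then an
automorphism of the initial configuration that fixes the trajectory exchanges it with any other such
half-edge (`val_mem_eq`). Hence the conditional probability that it has not been rewired is about
the fraction of the half-edges that have not been rewired, and after `s` steps this fraction is
concentrated at `(1 - α) ^ s` (`envVal_abs_card_sub_le`). Averaged over the initial configuration,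
the walk rarely meets a half-edge that it has seen, or the partner of one (`pathSum_return_le`,
`pathSum_partner_le`). The result is the product of the factors `(1 - α) ^ (s + 1)`
(`sum_abs_tailProb_global_sub_le`).

**Near rewiring.** As long as there is no crossing and no edge ahead is lost, the walk follows a
path of the *initial* configuration: crossings aside, an edge that the walk is going to traverse has
never been rewired. So one may fix the whole path of length `T` in advance and ask at each time for
the probability that none of its remaining edges is selected. With `i` edges remaining, the
candidates on the path are the next `min r i` edges, unless there is a shortcut between two parts of
the path through the rest of the graph (`NoShortcut.card_inter`). This gives the product of the
factors `keepProb α r i = (1 - α) ^ min r i`, and its limit in the three regimes is elementary.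
The errors are of three kinds.

* The path is not self-avoiding or visits a vertex of large degree (`pathSum_not_nice_le`).
* There is a shortcut.
* A selected edge off the path is matched with an edge of the path ahead (`lossProb_le`). The
  probability is proportional to the number of candidates.

Shortcuts and candidates are both counted by excursions from the path, which are chains of pairs of
the current configuration joined by siblings. Their expected number is a first moment: in a uniform
configuration each prescribed pair costs a factor about `1 / N`, with `N` the number of half-edges,
even if several pairs are prescribed and a path is given (`pairBound_uniform`). The environment at a
later time is not uniform, since the candidates depend on it. What survives is the bound itself: the
property `PairBound` persists under one step of the dynamics, with `κ` replaced by
`κ * (1 + 44 * α)` (`sum_envStep_joins_le`), because a pair is created by a rewiring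
only if the edge of one of its half-edges is selected, and this half-edge is then matched with the
other. As `α * T * r = o(log n)`, the factors
`(1 + 44 * α) ^ T` do not matter. A chain of `m` steps then has at most about `ν ^ m` continuations
per starting point, each with an end point of probability of order `1 / n`, and
`ρ < 1 / log ν` makes `ν ^ r` smaller than `n ^ (1 - δ)` for some `δ > 0`. All errors are therefore
at most a power of `log n` times a negative power of `n` (`sum_abs_tailProb_near_sub_le`,
`tailTendsto_near`).
-/

/-! ### The sibling kernel, edges and half-edges -/

namespace DynCM

variable {n : ℕ} {d : Fin n → ℕ}

open Classical in
/-- The kernel that sends a half-edge to a uniformly chosen sibling, so that the non-backtracking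
walk on `ξ` applies `ξ` and then this kernel. -/
noncomputable def sibKer (z y : HalfEdge d) : ℝ := if Sibling z y then 1 / (degH y : ℝ) else 0

lemma nbProb_eq (ξ : Config d) (x y : HalfEdge d) : nbProb ξ x y = sibKer (ξ.1 x) y := rfl

lemma Sibling.symm {x y : HalfEdge d} (h : Sibling x y) : Sibling y x := ⟨h.1.symm, h.2.symm⟩

lemma card_fiber_vertex (v : Fin n) :
    (Finset.univ.filter fun g : HalfEdge d => g.1 = v).card = d v := by
  classical
  have : (Finset.univ.filter fun g : HalfEdge d => g.1 = v)
      = Finset.univ.map ⟨fun i : Fin (d v) => (⟨v, i⟩ : HalfEdge d),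
        fun i j h => by simpa using h⟩ := by
    ext g
    simp only [Finset.mem_filter, Finset.mem_univ, true_and, Finset.mem_map]
    constructor
    · rintro rfl
      exact ⟨g.2, rfl⟩
    · rintro ⟨i, rfl⟩
      rfl
  rw [this, Finset.card_map, Finset.card_univ, Fintype.card_fin]

lemma degH_add_one (h : HalfEdge d) : degH h + 1 = d h.1 := by
  classical
  rw [← card_fiber_vertex (d := d) h.1, degH]
  have : (Finset.univ.filter fun g : HalfEdge d => Sibling g h)
      = (Finset.univ.filter fun g : HalfEdge d => g.1 = h.1).erase h := by
    ext g
    rw [Finset.mem_erase, Finset.mem_filter, Finset.mem_filter]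
    simp only [Sibling, Finset.mem_univ, true_and, and_comm, ne_eq]
  rw [this, Finset.card_erase_add_one]
  simp

lemma degH_congr {g h : HalfEdge d} (e : g.1 = h.1) : degH g = degH h := by
  have h1 := degH_add_one g
  have h2 := degH_add_one h
  rw [e] at h1
  omega

lemma degH_pos (hd : ∀ v, 2 ≤ d v) (h : HalfEdge d) : 0 < degH h := by
  have h1 := degH_add_one h
  have h2 := hd h.1
  omega

lemma sibKer_nonneg (z y : HalfEdge d) : 0 ≤ sibKer z y := by
  unfold sibKer
  split_ifs <;> positivity

lemma sibKer_comm (z y : HalfEdge d) : sibKer z y = sibKer y z := by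
  unfold sibKer
  by_cases h : Sibling z y
  · rw [if_pos h, if_pos h.symm, degH_congr h.1]
  · rw [if_neg h, if_neg fun h' => h h'.symm]

lemma sum_sibKer_left (hd : ∀ v, 2 ≤ d v) (y : HalfEdge d) : ∑ z, sibKer z y = 1 := by
  classical
  unfold sibKer
  rw [← Finset.sum_filter, Finset.sum_const]
  have : (Finset.univ.filter fun z : HalfEdge d => Sibling z y).card = degH y := by
    unfold degH
    congr
  rw [this, nsmul_eq_mul]
  have := degH_pos hd y
  field_simp

lemma sum_sibKer_right (hd : ∀ v, 2 ≤ d v) (z : HalfEdge d) : ∑ y, sibKer z y = 1 := by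
  rw [← sum_sibKer_left hd z]
  exact Finset.sum_congr rfl fun y _ => sibKer_comm z y

lemma config_ne (ξ : Config d) (h : HalfEdge d) : ξ.1 h ≠ h := (ξ.2 h).1

lemma config_invol (ξ : Config d) (h : HalfEdge d) : ξ.1 (ξ.1 h) = h := (ξ.2 h).2

lemma config_injective (ξ : Config d) : Function.Injective ξ.1 := fun a b h => by
  rw [← config_invol ξ a, h, config_invol]

lemma mem_edges {ξ : Config d} {e : Edge d} : e ∈ edges ξ ↔ ∃ h, edgeAt ξ h = e := by
  simp [edges]

lemma edgeAt_mem_edges (ξ : Config d) (h : HalfEdge d) : edgeAt ξ h ∈ edges ξ :=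
  mem_edges.2 ⟨h, rfl⟩

lemma mem_edgeAt {ξ : Config d} {h g : HalfEdge d} : g ∈ edgeAt ξ h ↔ g = h ∨ g = ξ.1 h := by
  simp [edgeAt]

lemma edgeAt_partner (ξ : Config d) (h : HalfEdge d) : edgeAt ξ (ξ.1 h) = edgeAt ξ h := by
  simp [edgeAt, config_invol, Sym2.eq_swap]

lemma edgeAt_eq_of_mem {ξ : Config d} {e : Edge d} {h : HalfEdge d} (he : e ∈ edges ξ)
    (hh : h ∈ e) : edgeAt ξ h = e := by
  obtain ⟨g, rfl⟩ := mem_edges.1 he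
  rcases mem_edgeAt.1 hh with rfl | rfl
  · rfl
  · exact edgeAt_partner ξ g

lemma edgeAt_eq_iff {ξ : Config d} {h g : HalfEdge d} :
    edgeAt ξ g = edgeAt ξ h ↔ g = h ∨ g = ξ.1 h := by
  rw [← mem_edgeAt]
  exact ⟨fun e => e ▸ mem_edgeAt.2 (Or.inl rfl), edgeAt_eq_of_mem (edgeAt_mem_edges ξ h)⟩

lemma mem_halfEdges {R : Finset (Edge d)} {h : HalfEdge d} :
    h ∈ halfEdges R ↔ ∃ e ∈ R, h ∈ e := by
  simp [halfEdges]

lemma mem_halfEdges_iff {ξ : Config d} {R : Finset (Edge d)} (hR : R ⊆ edges ξ)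
    {h : HalfEdge d} : h ∈ halfEdges R ↔ edgeAt ξ h ∈ R := by
  rw [mem_halfEdges]
  constructor
  · rintro ⟨e, he, hh⟩
    rwa [edgeAt_eq_of_mem (hR he) hh]
  · exact fun he => ⟨_, he, mem_edgeAt.2 (Or.inl rfl)⟩

lemma partner_mem_halfEdges {ξ : Config d} {R : Finset (Edge d)} (hR : R ⊆ edges ξ)
    {h : HalfEdge d} : ξ.1 h ∈ halfEdges R ↔ h ∈ halfEdges R := by
  rw [mem_halfEdges_iff hR, mem_halfEdges_iff hR, edgeAt_partner]

lemma card_halfEdges {ξ : Config d} {R : Finset (Edge d)} (hR : R ⊆ edges ξ) :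
    (halfEdges R).card = 2 * R.card := by
  classical
  rw [Finset.card_eq_sum_card_fiberwise (f := edgeAt ξ) (t := R)
    (fun h hh => (mem_halfEdges_iff hR).1 hh)]
  rw [Finset.sum_const_nat (m := 2), mul_comm]
  intro e he
  obtain ⟨g, rfl⟩ := mem_edges.1 (hR he)
  have : (halfEdges R).filter (fun a => edgeAt ξ a = edgeAt ξ g) = {g, ξ.1 g} := by
    ext a
    simp only [Finset.mem_filter, Finset.mem_insert, Finset.mem_singleton, edgeAt_eq_iff,
      mem_halfEdges_iff hR]
    constructor
    · exact fun h => h.2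
    · rintro (rfl | rfl)
      · exact ⟨he, Or.inl rfl⟩
      · exact ⟨by rwa [edgeAt_partner], Or.inr rfl⟩
  rw [this, Finset.card_pair (config_ne ξ g).symm]

lemma halfEdges_edges (ξ : Config d) : halfEdges (edges ξ) = Finset.univ := by
  ext h
  simp [mem_halfEdges_iff (le_refl (edges ξ)), edgeAt_mem_edges]

lemma card_halfEdge_eq (ξ : Config d) : Fintype.card (HalfEdge d) = 2 * (edges ξ).card := by
  rw [← card_halfEdges (le_refl (edges ξ)), halfEdges_edges, Finset.card_univ]

/-! ### Selecting edges -/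

lemma selectProb_nonneg {α : ℝ} (h0 : 0 ≤ α) (h1 : α ≤ 1) (K R : Finset (Edge d)) :
    0 ≤ selectProb α K R := by
  unfold selectProb
  have : 0 ≤ 1 - α := by linarith
  split_ifs <;> positivity

lemma selectProb_eq_zero {α : ℝ} {K R : Finset (Edge d)} (h : ¬ R ⊆ K) :
    selectProb α K R = 0 := if_neg h

/-- The probability that no edge of `A` is selected. -/
lemma sum_selectProb_disjoint (α : ℝ) (K A : Finset (Edge d)) :
    ∑ R, (if Disjoint R A then selectProb α K R else 0) = (1 - α) ^ (K ∩ A).card := by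
  classical
  have h1 : ∀ R : Finset (Edge d), (if Disjoint R A then selectProb α K R else 0)
      = if R ∈ (K \ A).powerset then
        (1 - α) ^ (K ∩ A).card * (α ^ R.card * (1 - α) ^ ((K \ A) \ R).card) else 0 := by
    intro R
    unfold selectProb
    rw [← ite_and]
    have : (Disjoint R A ∧ R ⊆ K) ↔ R ∈ (K \ A).powerset := by
      rw [Finset.mem_powerset, Finset.subset_sdiff, and_comm]
    rw [if_congr this rfl rfl]
    split_ifs with h
    · have hR := Finset.mem_powerset.1 h
      have hc : (K \ R).card = (K ∩ A).card + ((K \ A) \ R).card := by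
        rw [← Finset.card_union_of_disjoint]
        · congr 1
          ext e
          simp only [Finset.mem_sdiff, Finset.mem_union, Finset.mem_inter]
          have := @hR e
          simp only [Finset.mem_sdiff] at this
          tauto
        · rw [Finset.disjoint_left]
          simp only [Finset.mem_sdiff, Finset.mem_inter]
          tauto
      rw [hc, pow_add]
      ring
    · rfl
  rw [Finset.sum_congr rfl fun R _ => h1 R, ← Finset.sum_filter, Finset.filter_univ_mem]
  rw [← Finset.mul_sum]
  have h2 := Finset.prod_add (fun _ : Edge d => α) (fun _ => 1 - α) (K \ A)
  simp only [Finset.prod_const, add_sub_cancel, one_pow] at h2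
  rw [← h2, mul_one]

lemma sum_selectProb (α : ℝ) (K : Finset (Edge d)) : ∑ R, selectProb α K R = 1 := by
  have := sum_selectProb_disjoint α K ∅
  simpa using this

/-- The probability that all edges of `T` are selected. -/
lemma sum_selectProb_superset {α : ℝ} {K T : Finset (Edge d)} (hT : T ⊆ K) :
    ∑ R, (if T ⊆ R then selectProb α K R else 0) = α ^ T.card := by
  classical
  have h2 := Finset.prod_add (fun _ : Edge d => α) (fun _ => 1 - α) (K \ T)
  simp only [Finset.prod_const, add_sub_cancel, one_pow] at h2
  rw [← mul_one (α ^ T.card), h2, Finset.mul_sum, ← Finset.sum_filter]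
  have h3 : ∑ R ∈ Finset.univ.filter (fun R => T ⊆ R), selectProb α K R
      = ∑ R ∈ Finset.univ.filter (fun R => T ⊆ R ∧ R ⊆ K), selectProb α K R := by
    symm
    apply Finset.sum_subset
    · intro R
      simp only [Finset.mem_filter, Finset.mem_univ, true_and]
      exact fun h => h.1
    · intro R
      simp only [Finset.mem_filter, Finset.mem_univ, true_and, not_and]
      exact fun h h' => selectProb_eq_zero (h' h)
  rw [h3]
  refine Finset.sum_nbij' (fun R => R \ T) (fun S => S ∪ T) ?_ ?_ ?_ ?_ ?_
  · intro R hR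
    simp only [Finset.mem_filter, Finset.mem_univ, true_and] at hR
    exact Finset.mem_powerset.2 (Finset.sdiff_subset_sdiff hR.2 le_rfl)
  · intro S hS
    rw [Finset.mem_powerset] at hS
    simp only [Finset.mem_filter, Finset.mem_univ, true_and]
    exact ⟨Finset.subset_union_right,
      Finset.union_subset (hS.trans Finset.sdiff_subset) hT⟩
  · intro R hR
    simp only [Finset.mem_filter, Finset.mem_univ, true_and] at hR
    exact Finset.sdiff_union_of_subset hR.1
  · intro S hS
    rw [Finset.mem_powerset, Finset.subset_sdiff] at hS
    exact Finset.union_sdiff_cancel_right hS.2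
  · intro R hR
    simp only [Finset.mem_filter, Finset.mem_univ, true_and] at hR
    unfold selectProb
    rw [if_pos hR.2, ← mul_assoc, ← pow_add, Finset.card_sdiff_of_subset hR.1,
      Nat.add_sub_cancel' (Finset.card_le_card hR.1)]
    congr 3
    ext e
    simp only [Finset.mem_sdiff]
    have := @hR.1 e
    tauto

lemma sum_selectProb_notMem {α : ℝ} {K : Finset (Edge d)} {e : Edge d} (he : e ∈ K) :
    ∑ R, (if e ∈ R then 0 else selectProb α K R) = 1 - α := by
  classical
  have := sum_selectProb_disjoint α K {e}
  rw [Finset.inter_singleton_of_mem he, Finset.card_singleton, pow_one] at this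
  rw [← this]
  refine Finset.sum_congr rfl fun R _ => ?_
  by_cases h : e ∈ R <;> simp [h]

/-! ### Repairing the broken edges -/

open Classical in
/-- The involution that results from `ξ` when the half-edges of `R` are matched with those of `R'`
by `f`. -/
noncomputable def rewireFun (ξ : Config d) (R R' : Finset (Edge d))
    (f : halfEdges R ≃ halfEdges R') (h : HalfEdge d) : HalfEdge d :=
  if hR : h ∈ halfEdges R then f ⟨h, hR⟩
  else if hR' : h ∈ halfEdges R' then f.symm ⟨h, hR'⟩ else ξ.1 h

lemma notMem_halfEdges_of_mem {ξ : Config d} {R R' : Finset (Edge d)} (hR : R ⊆ edges ξ)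
    (hR' : R' ⊆ edges ξ \ R) {h : HalfEdge d} (hh : h ∈ halfEdges R') : h ∉ halfEdges R := by
  rw [mem_halfEdges_iff hR]
  rw [mem_halfEdges_iff (hR'.trans Finset.sdiff_subset)] at hh
  exact (Finset.mem_sdiff.1 (hR' hh)).2

lemma rewireFun_spec {ξ : Config d} {R R' : Finset (Edge d)} (hR : R ⊆ edges ξ)
    (hR' : R' ⊆ edges ξ \ R) (f : halfEdges R ≃ halfEdges R') (h : HalfEdge d) :
    rewireFun ξ R R' f h ≠ h ∧ rewireFun ξ R R' f (rewireFun ξ R R' f h) = h := by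
  have hdis : ∀ g, g ∈ halfEdges R' → g ∉ halfEdges R :=
    fun g hg => notMem_halfEdges_of_mem hR hR' hg
  have hRs : R' ⊆ edges ξ := hR'.trans Finset.sdiff_subset
  by_cases h1 : h ∈ halfEdges R
  · have e1 : rewireFun ξ R R' f h = f ⟨h, h1⟩ := by simp [rewireFun, h1]
    have m1 : (f ⟨h, h1⟩ : HalfEdge d) ∈ halfEdges R' := (f ⟨h, h1⟩).2
    rw [e1]
    refine ⟨fun e => hdis _ m1 (by rw [e]; exact h1), ?_⟩
    simp [rewireFun, hdis _ m1]
  · by_cases h2 : h ∈ halfEdges R'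
    · have e1 : rewireFun ξ R R' f h = f.symm ⟨h, h2⟩ := by simp [rewireFun, h1, h2]
      have m1 : (f.symm ⟨h, h2⟩ : HalfEdge d) ∈ halfEdges R := (f.symm ⟨h, h2⟩).2
      rw [e1]
      refine ⟨fun e => h1 (e ▸ m1), ?_⟩
      simp [rewireFun]
    · have e1 : rewireFun ξ R R' f h = ξ.1 h := by simp [rewireFun, h1, h2]
      rw [e1]
      refine ⟨config_ne ξ h, ?_⟩
      simp [rewireFun, partner_mem_halfEdges hR, partner_mem_halfEdges hRs, h1, h2, config_invol]

open Classical in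
/-- The configuration that results from `ξ` when the half-edges of `R` are matched with those of
`R'` by `f`; it is `ξ` if `R` and `R'` are not disjoint sets of edges of `ξ`. -/
noncomputable def rewire (ξ : Config d) (R R' : Finset (Edge d))
    (f : halfEdges R ≃ halfEdges R') : Config d :=
  if h : R ⊆ edges ξ ∧ R' ⊆ edges ξ \ R then ⟨rewireFun ξ R R' f, rewireFun_spec h.1 h.2 f⟩ else ξ

lemma rewire_apply {ξ : Config d} {R R' : Finset (Edge d)} (hR : R ⊆ edges ξ)
    (hR' : R' ⊆ edges ξ \ R) (f : halfEdges R ≃ halfEdges R') (h : HalfEdge d) :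
    (rewire ξ R R' f).1 h = rewireFun ξ R R' f h := by
  unfold rewire
  rw [dif_pos ⟨hR, hR'⟩]

lemma eq_rewire_iff {ξ : Config d} {R R' : Finset (Edge d)} (hR : R ⊆ edges ξ)
    (hR' : R' ⊆ edges ξ \ R) (f : halfEdges R ≃ halfEdges R') (η : Config d) :
    ((∀ h : halfEdges R, η.1 h = f h) ∧
      ∀ h : HalfEdge d, h ∉ halfEdges R → h ∉ halfEdges R' → η.1 h = ξ.1 h) ↔
      rewire ξ R R' f = η := by
  constructor
  · rintro ⟨h1, h2⟩
    apply Subtype.ext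
    funext h
    rw [rewire_apply hR hR']
    unfold rewireFun
    split_ifs with a b
    · exact (h1 ⟨h, a⟩).symm
    · have := h1 (f.symm ⟨h, b⟩)
      rw [Equiv.apply_symm_apply] at this
      rw [← config_invol η (f.symm ⟨h, b⟩), this]
    · exact (h2 h a b).symm
  · rintro rfl
    refine ⟨fun h => ?_, fun h a b => ?_⟩
    · rw [rewire_apply hR hR']
      simp [rewireFun]
    · rw [rewire_apply hR hR']
      simp [rewireFun, a, b]

lemma sum_uniformProb_mul {Ω : Type*} [Fintype Ω] {S : Type*} [Fintype S] (P : S → Ω → Prop)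
    (g : Ω → S) (hP : ∀ s ω, P s ω ↔ g ω = s) (Φ : S → ℝ) :
    ∑ s, uniformProb (P s) * Φ s = (∑ ω, Φ (g ω)) / Fintype.card Ω := by
  classical
  have h1 : ∀ s, uniformProb (P s) * Φ s
      = (∑ ω, if g ω = s then Φ s else 0) / Fintype.card Ω := by
    intro s
    unfold uniformProb
    rw [div_mul_eq_mul_div, ← Finset.sum_filter, Finset.sum_const, nsmul_eq_mul]
    congr 4
    ext ω
    simp [hP]
  rw [Finset.sum_congr rfl fun s _ => h1 s, ← Finset.sum_div, Finset.sum_comm]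
  simp

/-- Averages over the repaired configuration in the case where not all edges are broken up. -/
lemma sum_repairProb_mul {ξ : Config d} {R : Finset (Edge d)} (hR : R ⊆ edges ξ)
    (hlt : R.card < (edges ξ \ R).card) (Φ : Config d → ℝ) :
    ∑ η, repairProb ξ R η * Φ η
      = (∑ R' ∈ (edges ξ \ R).powersetCard R.card,
          (∑ f : halfEdges R ≃ halfEdges R', Φ (rewire ξ R R' f)) /
            Fintype.card (halfEdges R ≃ halfEdges R')) /
          ((edges ξ \ R).powersetCard R.card).card := by
  classical
  unfold repairProb
  simp only [if_neg (not_le.2 hlt), div_mul_eq_mul_div, ← Finset.sum_div]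
  congr 1
  simp only [Finset.sum_mul]
  rw [Finset.sum_comm]
  refine Finset.sum_congr rfl fun R' hR' => ?_
  convert sum_uniformProb_mul _ (fun f : halfEdges R ≃ halfEdges R' => rewire ξ R R' f)
    (fun η f => eq_rewire_iff hR (Finset.mem_powersetCard.1 hR').1 f η) Φ using 2

/-- The pairing of the `i`-th elements of two lists that together enumerate all half-edges. -/
noncomputable def pairUp {k : ℕ} (σ : Fin k ⊕ Fin k ≃ HalfEdge d) : Config d :=
  ⟨fun h => σ (σ.symm h).swap, fun h => by
    refine ⟨fun e => ?_, by simp⟩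
    have e2 : (σ.symm h).swap = σ.symm h := by
      apply σ.injective
      exact e.trans (Equiv.apply_symm_apply _ _).symm
    rcases hs : σ.symm h with i | i <;> rw [hs] at e2 <;> simp at e2⟩

lemma eq_pairUp_iff {k : ℕ} (σ : Fin k ⊕ Fin k ≃ HalfEdge d) (η : Config d) :
    (∀ i, η.1 (σ (Sum.inl i)) = σ (Sum.inr i)) ↔ pairUp σ = η := by
  constructor
  · intro h
    apply Subtype.ext
    funext x
    obtain ⟨i, rfl⟩ := σ.surjective x
    simp only [pairUp, Equiv.symm_apply_apply]
    rcases i with i | i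
    · simp [h]
    · simp only [Sum.swap_inr]
      rw [← h i, config_invol]
  · rintro rfl i
    simp [pairUp]

lemma repairProb_nonneg (ξ : Config d) (R : Finset (Edge d)) (η : Config d) :
    0 ≤ repairProb ξ R η := by
  unfold repairProb uniformProb
  split_ifs
  · positivity
  · exact div_nonneg (Finset.sum_nonneg fun _ _ => by positivity) (by positivity)

lemma card_equiv_halfEdges_pos {ξ : Config d} {R R' : Finset (Edge d)} (hR : R ⊆ edges ξ)
    (hR' : R' ⊆ edges ξ) (hc : R'.card = R.card) :
    0 < Fintype.card (halfEdges R ≃ halfEdges R') := by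
  rw [Fintype.card_pos_iff]
  refine ⟨Fintype.equivOfCardEq ?_⟩
  rw [Fintype.card_coe, Fintype.card_coe, card_halfEdges hR, card_halfEdges hR', hc]

lemma sum_repairProb {ξ : Config d} {R : Finset (Edge d)} (hR : R ⊆ edges ξ) :
    ∑ η, repairProb ξ R η = 1 := by
  classical
  by_cases hlt : (edges ξ \ R).card ≤ R.card
  · have h := sum_uniformProb_mul (S := Config d)
      (fun η (σ : Fin (edges ξ).card ⊕ Fin (edges ξ).card ≃ HalfEdge d) =>
        ∀ i, η.1 (σ (Sum.inl i)) = σ (Sum.inr i)) pairUp (fun η σ => eq_pairUp_iff σ η)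
        (fun _ => 1)
    simp only [mul_one, Finset.sum_const, Finset.card_univ, nsmul_eq_mul] at h
    simp only [repairProb, if_pos hlt]
    rw [h, div_self]
    have : 0 < Fintype.card (Fin (edges ξ).card ⊕ Fin (edges ξ).card ≃ HalfEdge d) := by
      rw [Fintype.card_pos_iff]
      refine ⟨Fintype.equivOfCardEq ?_⟩
      rw [card_halfEdge_eq ξ]
      simp
      omega
    positivity
  · rw [not_le] at hlt
    have h := sum_repairProb_mul hR hlt (fun _ => 1)
    simp only [mul_one] at h
    rw [h]
    have : ∀ R' ∈ (edges ξ \ R).powersetCard R.card,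
        (∑ f : halfEdges R ≃ halfEdges R', (1 : ℝ)) /
            Fintype.card (halfEdges R ≃ halfEdges R') = 1 := by
      intro R' hR'
      rw [Finset.mem_powersetCard] at hR'
      have := card_equiv_halfEdges_pos hR (hR'.1.trans Finset.sdiff_subset) hR'.2
      rw [Finset.sum_const, Finset.card_univ, nsmul_eq_mul, mul_one, div_self]
      positivity
    rw [Finset.sum_congr rfl this, Finset.sum_const, nsmul_eq_mul, mul_one, div_self]
    rw [Finset.card_powersetCard]
    have := Nat.choose_pos hlt.le
    positivity

end DynCM

/-! ### One step of the environment -/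

namespace DynCM

variable {n : ℕ} {d : Fin n → ℕ}

/-- The expectation of `F R η` when `R` is selected from the edges `S` and the configuration `C`
is then repaired to `η`. -/
noncomputable def envStep (α : ℝ) (S : Finset (Edge d)) (C : Config d)
    (F : Finset (Edge d) → Config d → ℝ) : ℝ :=
  ∑ R, ∑ η, selectProb α S R * repairProb C R η * F R η

section envStep

variable {α : ℝ} {S : Finset (Edge d)} {C : Config d}

lemma envStep_mono (h0 : 0 ≤ α) (h1 : α ≤ 1) {F G : Finset (Edge d) → Config d → ℝ}
    (h : ∀ R η, R ⊆ S → F R η ≤ G R η) : envStep α S C F ≤ envStep α S C G := by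
  refine Finset.sum_le_sum fun R _ => Finset.sum_le_sum fun η _ => ?_
  by_cases hR : R ⊆ S
  · exact mul_le_mul_of_nonneg_left (h R η hR)
      (mul_nonneg (selectProb_nonneg h0 h1 _ _) (repairProb_nonneg _ _ _))
  · simp [selectProb_eq_zero hR]

lemma envStep_congr {F G : Finset (Edge d) → Config d → ℝ}
    (h : ∀ R η, R ⊆ S → F R η = G R η) : envStep α S C F = envStep α S C G := by
  refine Finset.sum_congr rfl fun R _ => Finset.sum_congr rfl fun η _ => ?_
  by_cases hR : R ⊆ S
  · rw [h R η hR]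
  · simp [selectProb_eq_zero hR]

lemma envStep_add (F G : Finset (Edge d) → Config d → ℝ) :
    envStep α S C (fun R η => F R η + G R η) = envStep α S C F + envStep α S C G := by
  simp only [envStep, mul_add, Finset.sum_add_distrib]

lemma envStep_sub (F G : Finset (Edge d) → Config d → ℝ) :
    envStep α S C (fun R η => F R η - G R η) = envStep α S C F - envStep α S C G := by
  simp only [envStep, mul_sub, Finset.sum_sub_distrib]

lemma envStep_const_mul (c : ℝ) (F : Finset (Edge d) → Config d → ℝ) :
    envStep α S C (fun R η => c * F R η) = c * envStep α S C F := by
  simp only [envStep, Finset.mul_sum]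
  refine Finset.sum_congr rfl fun R _ => Finset.sum_congr rfl fun η _ => by ring

lemma envStep_sum {ι : Type*} (s : Finset ι) (F : ι → Finset (Edge d) → Config d → ℝ) :
    envStep α S C (fun R η => ∑ i ∈ s, F i R η) = ∑ i ∈ s, envStep α S C (F i) := by
  simp only [envStep, Finset.mul_sum]
  symm
  rw [Finset.sum_comm]
  exact Finset.sum_congr rfl fun R _ => Finset.sum_comm

lemma envStep_nonneg (h0 : 0 ≤ α) (h1 : α ≤ 1) {F : Finset (Edge d) → Config d → ℝ}
    (h : ∀ R η, R ⊆ S → 0 ≤ F R η) : 0 ≤ envStep α S C F := by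
  have := envStep_mono (C := C) h0 h1 (F := fun _ _ => 0) (G := F) h
  simpa [envStep] using this

/-- The repair has total mass one. -/
lemma envStep_select (hS : S ⊆ edges C) (F : Finset (Edge d) → ℝ) :
    envStep α S C (fun R _ => F R) = ∑ R, selectProb α S R * F R := by
  refine Finset.sum_congr rfl fun R _ => ?_
  by_cases hR : R ⊆ S
  · rw [← Finset.sum_mul, ← Finset.mul_sum, sum_repairProb (hR.trans hS), mul_one]
  · simp [selectProb_eq_zero hR]

lemma envStep_const (hS : S ⊆ edges C) (c : ℝ) : envStep α S C (fun _ _ => c) = c := by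
  rw [envStep_select hS, ← Finset.sum_mul, sum_selectProb, one_mul]

end envStep

/-! ### The probability of not crossing, as a recursion -/

/-- The probability that the walk, started from `x` in the configuration `C`, makes `t` steps
without stepping along a rewired edge, when `Y` is the set of half-edges that have not been
rewired so far. -/
noncomputable def tailVal (α : ℝ) (K : Rule d) :
    ℕ → HalfEdge d → Config d → Finset (HalfEdge d) → ℝ
  | 0, _, _, _ => 1
  | t + 1, x, C, Y => envStep α (K C x) C fun R η =>
      if x ∈ Y \ halfEdges R then
        ∑ y, sibKer (η.1 x) y * tailVal α K t y η (Y \ halfEdges R)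
      else 0

open Classical in
/-- The recursion `tailVal` sums the transition probabilities over all paths of the chain, with `Y`
in the role of the half-edges that have not been rewired in the past. -/
lemma sum_path_eq_tailVal (α : ℝ) (K : Rule d) (t : ℕ) (x : HalfEdge d) (C : Config d)
    (R₀ : Finset (Edge d)) (Y : Finset (HalfEdge d)) :
    (∑ ω : Path d t, if ω 0 = (x, C, R₀) ∧ (∀ s : Fin t, (ω s.castSucc).1 ∈ Y ∧
        ∀ u : Fin t, u ≤ s → (ω s.castSucc).1 ∉ halfEdges (ω u.succ).2.2) then
        ∏ i : Fin t, transProb α K (ω i.castSucc) (ω i.succ) else 0) = tailVal α K t x C Y := by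
  induction t generalizing x C R₀ Y with
  | zero =>
    simp only [IsEmpty.forall_iff, and_true, Finset.univ_eq_empty, Finset.prod_empty, tailVal]
    rw [Finset.sum_eq_single (fun _ => (x, C, R₀))]
    · simp
    · intro ω _ hω
      rw [if_neg]
      rintro h
      apply hω
      funext i
      obtain rfl : i = 0 := Fin.ext (by omega)
      exact h
    · simp
  | succ t ih =>
    have key : ∀ ω' : Path d t, (∑ s₀ : State d,
        (if (Fin.cons s₀ ω' : Path d (t + 1)) 0 = (x, C, R₀) ∧
          (∀ s : Fin (t + 1), ((Fin.cons s₀ ω' : Path d (t + 1)) s.castSucc).1 ∈ Y ∧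
            ∀ u : Fin (t + 1), u ≤ s → ((Fin.cons s₀ ω' : Path d (t + 1)) s.castSucc).1 ∉
              halfEdges ((Fin.cons s₀ ω' : Path d (t + 1)) u.succ).2.2) then
        ∏ i : Fin (t + 1), transProb α K ((Fin.cons s₀ ω' : Path d (t + 1)) i.castSucc)
          ((Fin.cons s₀ ω' : Path d (t + 1)) i.succ) else 0)) =
        ∑ s₁ : State d, transProb α K (x, C, R₀) s₁ *
          (if x ∈ Y \ halfEdges s₁.2.2 then
            (if ω' 0 = s₁ ∧ (∀ s : Fin t, (ω' s.castSucc).1 ∈ Y \ halfEdges s₁.2.2 ∧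
              ∀ u : Fin t, u ≤ s → (ω' s.castSucc).1 ∉ halfEdges (ω' u.succ).2.2) then
              ∏ i : Fin t, transProb α K (ω' i.castSucc) (ω' i.succ) else 0) else 0) := by
      intro ω'
      rw [Finset.sum_eq_single (x, C, R₀), Finset.sum_eq_single (ω' 0)]
      · have e1 : ((Fin.cons (x, C, R₀) ω' : Path d (t + 1)) 0 = (x, C, R₀) ∧
          (∀ s : Fin (t + 1), ((Fin.cons (x, C, R₀) ω' : Path d (t + 1)) s.castSucc).1 ∈ Y ∧
            ∀ u : Fin (t + 1), u ≤ s → ((Fin.cons (x, C, R₀) ω' : Path d (t + 1)) s.castSucc).1 ∉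
              halfEdges ((Fin.cons (x, C, R₀) ω' : Path d (t + 1)) u.succ).2.2)) ↔
          (x ∈ Y \ halfEdges (ω' 0).2.2 ∧ (∀ s : Fin t, (ω' s.castSucc).1 ∈
            Y \ halfEdges (ω' 0).2.2 ∧
              ∀ u : Fin t, u ≤ s → (ω' s.castSucc).1 ∉ halfEdges (ω' u.succ).2.2)) := by
          simp only [Fin.cons_zero, true_and, Fin.forall_fin_succ, Fin.castSucc_zero,
            Fin.cons_succ, Fin.le_zero_iff, Fin.succ_ne_zero, Fin.zero_le, Fin.castSucc_succ,
            Fin.succ_le_succ_iff, Finset.mem_sdiff, forall_const, IsEmpty.forall_iff,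
            implies_true, and_true]
          constructor
          · rintro ⟨⟨h1, h2⟩, h3⟩
            exact ⟨⟨h1, h2⟩, fun s => ⟨⟨(h3 s).1, (h3 s).2.1⟩, (h3 s).2.2⟩⟩
          · rintro ⟨⟨h1, h2⟩, h3⟩
            exact ⟨⟨h1, h2⟩, fun s => ⟨(h3 s).1.1, (h3 s).1.2, (h3 s).2⟩⟩
        rw [if_congr e1 rfl rfl]
        simp only [true_and, ite_and, Fin.prod_univ_succ, Fin.castSucc_zero, Fin.cons_zero,
          Fin.cons_succ, Fin.castSucc_succ, mul_ite, mul_zero]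
      · intro s₁ _ hs
        rw [if_neg (fun h : ω' 0 = s₁ ∧ _ => hs h.1.symm)]
        simp
      · simp
      · intro s₀ _ hs
        rw [if_neg]
        rintro ⟨h, -⟩
        exact hs (by simpa using h)
      · simp
    rw [← (Fin.consEquiv fun _ : Fin (t + 2) => State d).sum_comp, Fintype.sum_prod_type,
      Finset.sum_comm]
    refine (Finset.sum_congr rfl fun ω' _ => key ω').trans ?_
    rw [Finset.sum_comm]
    simp only [← Finset.mul_sum]
    have h2 : ∀ s₁ : State d, (∑ ω' : Path d t, if x ∈ Y \ halfEdges s₁.2.2 then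
            (if ω' 0 = s₁ ∧ (∀ s : Fin t, (ω' s.castSucc).1 ∈ Y \ halfEdges s₁.2.2 ∧
              ∀ u : Fin t, u ≤ s → (ω' s.castSucc).1 ∉ halfEdges (ω' u.succ).2.2) then
              ∏ i : Fin t, transProb α K (ω' i.castSucc) (ω' i.succ) else 0) else 0)
        = if x ∈ Y \ halfEdges s₁.2.2 then
            tailVal α K t s₁.1 s₁.2.1 (Y \ halfEdges s₁.2.2) else 0 := by
      intro s₁
      split_ifs
      · exact ih s₁.1 s₁.2.1 s₁.2.2 _
      · simp
    simp only [h2]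
    rw [Fintype.sum_prod_type, Finset.sum_comm, Fintype.sum_prod_type, Finset.sum_comm]
    rw [tailVal]
    unfold envStep transProb
    refine Finset.sum_congr rfl fun R _ => Finset.sum_congr rfl fun η _ => ?_
    simp only [nbProb_eq]
    split_ifs
    · rw [Finset.mul_sum]
      exact Finset.sum_congr rfl fun y _ => by ring
    · simp

/-- The first crossing happens after time `t` iff none of the first `t` steps is a crossing. -/
lemma lt_crossTime_iff {t : ℕ} (ω : Path d t) :
    (t : ℕ∞) < crossTime ω ↔ ∀ s : Fin t, ¬ Crosses ω s := by
  unfold crossTime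
  constructor
  · intro h s hs
    have h1 := lt_of_lt_of_le h (iInf_le _ (⟨s, hs⟩ : {s : Fin t // Crosses ω s}))
    have h2 : t < s.1 + 1 := by exact_mod_cast h1
    omega
  · intro h
    have : IsEmpty {s : Fin t // Crosses ω s} := ⟨fun s => h s.1 s.2⟩
    rw [iInf_of_empty]
    exact ENat.natCast_lt_top t

lemma tailProb_eq (α : ℝ) (K : Rule d) (x : HalfEdge d) (ξ : Config d) (t : ℕ) :
    tailProb α K x ξ t = tailVal α K t x ξ Finset.univ := by
  classical
  rw [← sum_path_eq_tailVal α K t x ξ ∅ Finset.univ]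
  unfold tailProb pathProb
  rw [Finset.sum_filter]
  refine Finset.sum_congr rfl fun ω _ => ?_
  simp only [lt_crossTime_iff, Crosses, Finset.mem_univ, true_and, not_exists, not_and]

/-! ### Sums over the trajectories of the walk -/

/-- The sum of `F l y` over all `s`-step trajectories `l` of the walk from `x` to `y`, weighted with
the probabilities of the choices of the siblings. A trajectory is the list of the pairs
`(X_i, C_{i+1}(X_i))`. -/
noncomputable def pathSum : ℕ → (List (HalfEdge d × HalfEdge d) → HalfEdge d → ℝ) →
    HalfEdge d → ℝ
  | 0, F, x => F [] x
  | s + 1, F, x => ∑ z, ∑ y, sibKer z y * pathSum s (fun l y' => F ((x, z) :: l) y') y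

/-- The expectation of `Φ` of the final environment, on the event that the walk follows the
trajectory `l` without crossing a rewired edge. -/
noncomputable def val (α : ℝ) (K : Rule d) : List (HalfEdge d × HalfEdge d) → Config d →
    Finset (HalfEdge d) → (Config d → Finset (HalfEdge d) → ℝ) → ℝ
  | [], C, Y, Φ => Φ C Y
  | e :: l, C, Y, Φ => envStep α (K C e.1) C fun R η =>
      if e.1 ∈ Y \ halfEdges R ∧ η.1 e.1 = e.2 then val α K l η (Y \ halfEdges R) Φ else 0

lemma pathSum_snoc (s : ℕ) (F : List (HalfEdge d × HalfEdge d) → HalfEdge d → ℝ)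
    (x : HalfEdge d) : pathSum (s + 1) F x
      = pathSum s (fun l y => ∑ z, ∑ y', sibKer z y' * F (l ++ [(y, z)]) y') x := by
  induction s generalizing F x with
  | zero => simp [pathSum]
  | succ s ih =>
    rw [pathSum]
    conv_rhs => rw [pathSum]
    refine Finset.sum_congr rfl fun z _ => Finset.sum_congr rfl fun y _ => ?_
    rw [ih]
    rfl

/-- Two path sums may be compared on the lists of the right length only. -/
lemma pathSum_mono {s : ℕ} {F G : List (HalfEdge d × HalfEdge d) → HalfEdge d → ℝ}
    (h : ∀ l y, l.length = s → F l y ≤ G l y) (x : HalfEdge d) :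
    pathSum s F x ≤ pathSum s G x := by
  induction s generalizing F G x with
  | zero => exact h [] x rfl
  | succ s ih =>
    unfold pathSum
    refine Finset.sum_le_sum fun z _ => Finset.sum_le_sum fun y _ => ?_
    exact mul_le_mul_of_nonneg_left (ih (fun l y' hl => h _ _ (by simp [hl])) y)
      (sibKer_nonneg z y)

lemma pathSum_congr {s : ℕ} {F G : List (HalfEdge d × HalfEdge d) → HalfEdge d → ℝ}
    (h : ∀ l y, l.length = s → F l y = G l y) (x : HalfEdge d) :
    pathSum s F x = pathSum s G x :=
  le_antisymm (pathSum_mono (fun l y hl => (h l y hl).le) x)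
    (pathSum_mono (fun l y hl => (h l y hl).ge) x)

lemma pathSum_add (s : ℕ) (F G : List (HalfEdge d × HalfEdge d) → HalfEdge d → ℝ)
    (x : HalfEdge d) :
    pathSum s (fun l y => F l y + G l y) x = pathSum s F x + pathSum s G x := by
  induction s generalizing F G x with
  | zero => rfl
  | succ s ih => simp only [pathSum, ih, mul_add, Finset.sum_add_distrib]

lemma pathSum_const_mul (s : ℕ) (c : ℝ) (F : List (HalfEdge d × HalfEdge d) → HalfEdge d → ℝ)
    (x : HalfEdge d) : pathSum s (fun l y => c * F l y) x = c * pathSum s F x := by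
  induction s generalizing F x with
  | zero => rfl
  | succ s ih =>
    simp only [pathSum, ih, Finset.mul_sum]
    exact Finset.sum_congr rfl fun z _ => Finset.sum_congr rfl fun y _ => by ring

lemma pathSum_sum {ι : Type*} (s : ℕ) (A : Finset ι)
    (F : ι → List (HalfEdge d × HalfEdge d) → HalfEdge d → ℝ) (x : HalfEdge d) :
    pathSum s (fun l y => ∑ i ∈ A, F i l y) x = ∑ i ∈ A, pathSum s (F i) x := by
  classical
  induction A using Finset.induction_on with
  | empty =>
    have := pathSum_const_mul s 0 (fun _ _ => 0) x
    simpa using this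
  | insert a A ha ih => simp only [Finset.sum_insert ha, pathSum_add, ih]

lemma pathSum_nonneg {s : ℕ} {F : List (HalfEdge d × HalfEdge d) → HalfEdge d → ℝ}
    (h : ∀ l y, l.length = s → 0 ≤ F l y) (x : HalfEdge d) : 0 ≤ pathSum s F x := by
  have := pathSum_sum s (∅ : Finset ℕ) (fun _ => F) x
  simp only [Finset.sum_empty] at this
  rw [← this]
  exact pathSum_mono h x

section val

variable {α : ℝ} {K : Rule d}

lemma val_append (l l' : List (HalfEdge d × HalfEdge d)) (C : Config d)
    (Y : Finset (HalfEdge d)) (Φ : Config d → Finset (HalfEdge d) → ℝ) :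
    val α K (l ++ l') C Y Φ = val α K l C Y fun C' Y' => val α K l' C' Y' Φ := by
  induction l generalizing C Y with
  | nil => rfl
  | cons e l ih => simp only [List.cons_append, val, ih]

lemma val_mono (h0 : 0 ≤ α) (h1 : α ≤ 1) {l : List (HalfEdge d × HalfEdge d)} {C : Config d}
    {Y : Finset (HalfEdge d)} {Φ Ψ : Config d → Finset (HalfEdge d) → ℝ}
    (h : ∀ C Y, Φ C Y ≤ Ψ C Y) : val α K l C Y Φ ≤ val α K l C Y Ψ := by
  induction l generalizing C Y with
  | nil => exact h C Y
  | cons e l ih =>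
    refine envStep_mono h0 h1 fun R η _ => ?_
    split_ifs
    exacts [ih, le_rfl]

lemma val_nonneg (h0 : 0 ≤ α) (h1 : α ≤ 1) {l : List (HalfEdge d × HalfEdge d)} {C : Config d}
    {Y : Finset (HalfEdge d)} {Φ : Config d → Finset (HalfEdge d) → ℝ}
    (h : ∀ C Y, 0 ≤ Φ C Y) : 0 ≤ val α K l C Y Φ := by
  induction l generalizing C Y with
  | nil => exact h C Y
  | cons e l ih =>
    refine envStep_nonneg h0 h1 fun R η _ => ?_
    split_ifs
    exacts [ih, le_rfl]

lemma val_add (l : List (HalfEdge d × HalfEdge d)) (C : Config d) (Y : Finset (HalfEdge d))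
    (Φ Ψ : Config d → Finset (HalfEdge d) → ℝ) :
    val α K l C Y (fun C Y => Φ C Y + Ψ C Y) = val α K l C Y Φ + val α K l C Y Ψ := by
  induction l generalizing C Y with
  | nil => rfl
  | cons e l ih =>
    simp only [val, ih, ← envStep_add]
    congr 1
    funext R η
    split_ifs <;> simp

lemma val_const_mul (l : List (HalfEdge d × HalfEdge d)) (C : Config d)
    (Y : Finset (HalfEdge d)) (c : ℝ) (Φ : Config d → Finset (HalfEdge d) → ℝ) :
    val α K l C Y (fun C Y => c * Φ C Y) = c * val α K l C Y Φ := by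
  induction l generalizing C Y with
  | nil => rfl
  | cons e l ih =>
    simp only [val, ih, ← envStep_const_mul]
    congr 1
    funext R η
    split_ifs <;> simp

lemma val_sum {ι : Type*} (A : Finset ι) (l : List (HalfEdge d × HalfEdge d)) (C : Config d)
    (Y : Finset (HalfEdge d)) (Φ : ι → Config d → Finset (HalfEdge d) → ℝ) :
    val α K l C Y (fun C Y => ∑ i ∈ A, Φ i C Y) = ∑ i ∈ A, val α K l C Y (Φ i) := by
  classical
  induction A using Finset.induction_on with
  | empty =>
    have := val_const_mul (α := α) (K := K) l C Y 0 (fun _ _ => 0)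
    simpa using this
  | insert a A ha ih => simp only [Finset.sum_insert ha, val_add, ih]

lemma pathSum_val_succ (s : ℕ) (x : HalfEdge d) (C : Config d) (Y : Finset (HalfEdge d))
    (Φ : Config d → Finset (HalfEdge d) → ℝ) :
    pathSum (s + 1) (fun l _ => val α K l C Y Φ) x = envStep α (K C x) C fun R η =>
      if x ∈ Y \ halfEdges R then
        ∑ y, sibKer (η.1 x) y * pathSum s (fun l _ => val α K l η (Y \ halfEdges R) Φ) y
      else 0 := by
  classical
  have h1 : ∀ z y, pathSum s (fun l _ => val α K ((x, z) :: l) C Y Φ) y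
      = envStep α (K C x) C fun R η => if x ∈ Y \ halfEdges R ∧ η.1 x = z then
        pathSum s (fun l _ => val α K l η (Y \ halfEdges R) Φ) y else 0 := by
    intro z y
    have h2 : ∀ (R : Finset (Edge d)) (η : Config d),
        (if x ∈ Y \ halfEdges R ∧ η.1 x = z then
          pathSum s (fun l _ => val α K l η (Y \ halfEdges R) Φ) y else 0)
        = pathSum s (fun l _ => if x ∈ Y \ halfEdges R ∧ η.1 x = z then
            val α K l η (Y \ halfEdges R) Φ else 0) y := by
      intro R η
      split_ifs
      · rfl
      · have := pathSum_const_mul s 0 (fun _ _ => 0) y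
        simpa using this.symm
    simp only [h2, val, envStep, pathSum_sum, pathSum_const_mul]
  rw [pathSum]
  simp only [h1, ← envStep_const_mul, ← envStep_sum]
  congr 1
  funext R η
  by_cases hx : x ∈ Y \ halfEdges R
  · rw [if_pos hx, Finset.sum_comm]
    refine Finset.sum_congr rfl fun y _ => ?_
    simp [hx]
  · simp [hx]

lemma tailVal_eq_pathSum (s : ℕ) (x : HalfEdge d) (C : Config d) (Y : Finset (HalfEdge d)) :
    tailVal α K s x C Y = pathSum s (fun l _ => val α K l C Y fun _ _ => 1) x := by
  induction s generalizing x C Y with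
  | zero => rfl
  | succ s ih => simp only [pathSum_val_succ, tailVal, ih]

lemma tailVal_le_one (hd : ∀ v, 2 ≤ d v) (hK : ∀ C x, K C x ⊆ edges C) (h0 : 0 ≤ α)
    (h1 : α ≤ 1) (s : ℕ) (x : HalfEdge d) (C : Config d) (Y : Finset (HalfEdge d)) :
    tailVal α K s x C Y ≤ 1 := by
  induction s generalizing x C Y with
  | zero => exact le_rfl
  | succ s ih =>
    rw [tailVal, ← envStep_const (α := α) (hK C x) 1]
    refine envStep_mono h0 h1 fun R η _ => ?_
    split_ifs
    · rw [← sum_sibKer_right hd (η.1 x)]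
      exact Finset.sum_le_sum fun y _ => mul_le_of_le_one_right (sibKer_nonneg _ _) (ih _ _ _)
    · exact zero_le_one

lemma pathSum_abs_le (s : ℕ) (F : List (HalfEdge d × HalfEdge d) → HalfEdge d → ℝ)
    (x : HalfEdge d) : |pathSum s F x| ≤ pathSum s (fun l y => |F l y|) x := by
  rw [abs_le]
  constructor
  · have := pathSum_mono (s := s) (F := fun l y => (-1) * |F l y|) (G := F)
      (fun l y _ => by linarith [neg_abs_le (F l y)]) x
    rw [pathSum_const_mul] at this
    linarith
  · exact pathSum_mono (fun l y _ => le_abs_self _) x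

lemma val_abs_le (h0 : 0 ≤ α) (h1 : α ≤ 1) (l : List (HalfEdge d × HalfEdge d)) (C : Config d)
    (Y : Finset (HalfEdge d)) (Φ : Config d → Finset (HalfEdge d) → ℝ) :
    |val α K l C Y Φ| ≤ val α K l C Y fun C Y => |Φ C Y| := by
  rw [abs_le]
  constructor
  · have := val_mono (K := K) h0 h1 (l := l) (C := C) (Y := Y) (Φ := fun C Y => (-1) * |Φ C Y|)
      (Ψ := Φ) (fun C Y => by linarith [neg_abs_le (Φ C Y)])
    rw [val_const_mul] at this
    linarith
  · exact val_mono h0 h1 fun C Y => le_abs_self _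

end val

/-- Under the global rule, the walk does not influence the environment: this is the expectation of
`Φ` of the environment after `s` steps. -/
noncomputable def envVal (α : ℝ) : ℕ → Config d → Finset (HalfEdge d) →
    (Config d → Finset (HalfEdge d) → ℝ) → ℝ
  | 0, C, Y, Φ => Φ C Y
  | s + 1, C, Y, Φ => envStep α (edges C) C fun R η => envVal α s η (Y \ halfEdges R) Φ

end DynCM

/-! ### Local rewiring -/

namespace DynCM

variable {n : ℕ} {d : Fin n → ℕ}

lemma halfEdges_empty : halfEdges (∅ : Finset (Edge d)) = ∅ := by
  simp [halfEdges]

/-- Under the local rule the walk crosses a rewired edge as soon as any edge is rewired. -/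
lemma tailVal_local (hd : ∀ v, 2 ≤ d v) (α : ℝ) (t : ℕ) (x : HalfEdge d) (C : Config d) :
    tailVal α localRule t x C Finset.univ = (1 - α) ^ t := by
  induction t generalizing x C with
  | zero => rfl
  | succ t ih =>
    rw [tailVal]
    have hS : localRule C x ⊆ edges C := by
      simp [localRule, edgeAt_mem_edges]
    rw [envStep_congr (G := fun R _ => (1 - α) ^ t * if edgeAt C x ∈ R then 0 else 1),
      envStep_const_mul, envStep_select hS, pow_succ]
    · congr 1
      simp only [mul_ite, mul_zero, mul_one]
      exact sum_selectProb_notMem (by simp [localRule])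
    · intro R η hR
      rcases Finset.subset_singleton_iff.1 hR with rfl | rfl
      · simp [halfEdges_empty, ih, ← Finset.sum_mul, sum_sibKer_right hd]
      · simp [halfEdges, mem_edgeAt]

lemma tailProb_local (hd : ∀ v, 2 ≤ d v) (α : ℝ) (t : ℕ) (x : HalfEdge d) (ξ : Config d) :
    tailProb α localRule x ξ t = (1 - α) ^ t := by
  rw [tailProb_eq, tailVal_local hd]

/-! ### Symmetries of the half-edges -/

/-- The configuration obtained by renaming the half-edges. -/
def conj (π : Equiv.Perm (HalfEdge d)) (C : Config d) : Config d :=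
  ⟨fun h => π (C.1 (π.symm h)), fun h => by
    refine ⟨fun e => config_ne C (π.symm h) (π.injective (by
      rw [Equiv.apply_symm_apply]; exact e)), by simp [config_invol]⟩⟩

lemma conj_apply (π : Equiv.Perm (HalfEdge d)) (C : Config d) (h : HalfEdge d) :
    (conj π C).1 (π h) = π (C.1 h) := by simp [conj]

lemma conj_symm_conj (π : Equiv.Perm (HalfEdge d)) (C : Config d) :
    conj π.symm (conj π C) = C := by
  apply Subtype.ext
  funext h
  simp [conj]

/-- Renaming the half-edges, as a permutation of the configurations. -/
def conjEquiv (π : Equiv.Perm (HalfEdge d)) : Config d ≃ Config d where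
  toFun := conj π
  invFun := conj π.symm
  left_inv := conj_symm_conj π
  right_inv C := by
    have := conj_symm_conj π.symm C
    simpa using this

/-- Renaming the half-edges, as a permutation of the edges. -/
def edgePerm (π : Equiv.Perm (HalfEdge d)) : Equiv.Perm (Edge d) where
  toFun := Sym2.map π
  invFun := Sym2.map π.symm
  left_inv e := by simp [Sym2.map_map]
  right_inv e := by simp [Sym2.map_map]

lemma edgePerm_mk (π : Equiv.Perm (HalfEdge d)) (a b : HalfEdge d) :
    edgePerm π s(a, b) = s(π a, π b) := rfl

lemma edgePerm_edgeAt (π : Equiv.Perm (HalfEdge d)) (C : Config d) (h : HalfEdge d) :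
    edgePerm π (edgeAt C h) = edgeAt (conj π C) (π h) := by
  rw [edgeAt, edgePerm_mk, edgeAt, conj_apply]

/-- The set of edges obtained by renaming the half-edges. -/
def mapEdges (π : Equiv.Perm (HalfEdge d)) (R : Finset (Edge d)) : Finset (Edge d) :=
  R.map (edgePerm π).toEmbedding

lemma card_mapEdges (π : Equiv.Perm (HalfEdge d)) (R : Finset (Edge d)) :
    (mapEdges π R).card = R.card := Finset.card_map _

lemma mapEdges_subset {π : Equiv.Perm (HalfEdge d)} {R S : Finset (Edge d)} :
    mapEdges π R ⊆ mapEdges π S ↔ R ⊆ S := Finset.map_subset_map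

lemma mapEdges_sdiff (π : Equiv.Perm (HalfEdge d)) (R S : Finset (Edge d)) :
    mapEdges π (R \ S) = mapEdges π R \ mapEdges π S := Finset.map_sdiff _ _

lemma edges_conj (π : Equiv.Perm (HalfEdge d)) (C : Config d) :
    edges (conj π C) = mapEdges π (edges C) := by
  ext e
  simp only [mem_edges, mapEdges, Finset.mem_map, Equiv.coe_toEmbedding]
  constructor
  · rintro ⟨h, rfl⟩
    refine ⟨_, ⟨π.symm h, rfl⟩, ?_⟩
    rw [edgePerm_edgeAt, Equiv.apply_symm_apply]
  · rintro ⟨_, ⟨h, rfl⟩, rfl⟩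
    exact ⟨π h, (edgePerm_edgeAt π C h).symm⟩

lemma mem_edgePerm {π : Equiv.Perm (HalfEdge d)} {e : Edge d} {h : HalfEdge d} :
    π h ∈ edgePerm π e ↔ h ∈ e := by
  induction e using Sym2.ind with
  | _ a b => simp [edgePerm_mk]

lemma mem_halfEdges_mapEdges {π : Equiv.Perm (HalfEdge d)} {R : Finset (Edge d)}
    {h : HalfEdge d} : π h ∈ halfEdges (mapEdges π R) ↔ h ∈ halfEdges R := by
  simp only [mem_halfEdges, mapEdges, Finset.mem_map, Equiv.coe_toEmbedding]
  constructor
  · rintro ⟨_, ⟨e, he, rfl⟩, h⟩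
    exact ⟨e, he, mem_edgePerm.1 h⟩
  · rintro ⟨e, he, h⟩
    exact ⟨_, ⟨e, he, rfl⟩, mem_edgePerm.2 h⟩

lemma halfEdges_mapEdges (π : Equiv.Perm (HalfEdge d)) (R : Finset (Edge d)) :
    halfEdges (mapEdges π R) = (halfEdges R).map π.toEmbedding := by
  ext h
  obtain ⟨h, rfl⟩ := π.surjective h
  rw [mem_halfEdges_mapEdges]
  simp

/-- Renaming, as a permutation of the sets of edges. -/
def mapEdgesEquiv (π : Equiv.Perm (HalfEdge d)) : Finset (Edge d) ≃ Finset (Edge d) :=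
  (edgePerm π).finsetCongr

lemma mapEdgesEquiv_apply (π : Equiv.Perm (HalfEdge d)) (R : Finset (Edge d)) :
    mapEdgesEquiv π R = mapEdges π R := rfl

lemma selectProb_mapEdges (π : Equiv.Perm (HalfEdge d)) (α : ℝ) (K R : Finset (Edge d)) :
    selectProb α (mapEdges π K) (mapEdges π R) = selectProb α K R := by
  unfold selectProb
  rw [if_congr mapEdges_subset rfl rfl, card_mapEdges, ← mapEdges_sdiff, card_mapEdges]

lemma uniformProb_congr {Ω Ω' : Type*} [Fintype Ω] [Fintype Ω'] (e : Ω ≃ Ω') {P : Ω → Prop}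
    {P' : Ω' → Prop} (h : ∀ ω, P' (e ω) ↔ P ω) : uniformProb P' = uniformProb P := by
  classical
  unfold uniformProb
  rw [Fintype.card_congr e]
  congr 2
  refine (Finset.card_bij (fun ω _ => e ω) ?_ ?_ ?_).symm
  · intro ω hω
    simpa [h] using hω
  · intro a _ b _ hab
    exact e.injective hab
  · intro b hb
    refine ⟨e.symm b, ?_, by simp⟩
    simp only [Finset.mem_filter, Finset.mem_univ, true_and] at hb ⊢
    rw [← h]
    simpa using hb

/-- The half-edges of `R` correspond to those of the renamed set of edges. -/
def halfEdgesEquiv (π : Equiv.Perm (HalfEdge d)) (R : Finset (Edge d)) :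
    halfEdges R ≃ halfEdges (mapEdges π R) :=
  π.subtypeEquiv fun _ => mem_halfEdges_mapEdges.symm

/-- Renaming half-edges does not change the repair probabilities. -/
lemma repairProb_conj (π : Equiv.Perm (HalfEdge d)) (ξ : Config d) (R : Finset (Edge d))
    (η : Config d) :
    repairProb (conj π ξ) (mapEdges π R) (conj π η) = repairProb ξ R η := by
  classical
  have hc : (edges (conj π ξ)).card = (edges ξ).card := by rw [edges_conj, card_mapEdges]
  unfold repairProb
  rw [hc, edges_conj, ← mapEdges_sdiff, card_mapEdges, card_mapEdges]
  refine if_congr Iff.rfl ?_ ?_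
  · refine uniformProb_congr (Equiv.equivCongr (Equiv.refl _) π) fun σ => ?_
    refine forall_congr' fun i => ?_
    simp [conj_apply]
  · have hps : ∀ (S : Finset (Edge d)) k, (mapEdges π S).powersetCard k
        = (S.powersetCard k).map (mapEdgesEquiv π).toEmbedding := by
      intro S k
      ext T
      obtain ⟨T, rfl⟩ := (mapEdgesEquiv π).surjective T
      rw [← Equiv.coe_toEmbedding, Finset.mem_map' (mapEdgesEquiv π).toEmbedding,
        Finset.mem_powersetCard, Finset.mem_powersetCard, Equiv.coe_toEmbedding,
        mapEdgesEquiv_apply, mapEdges_subset, card_mapEdges]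
    rw [hps, Finset.sum_map, Finset.card_map]
    congr 1
    refine Finset.sum_congr rfl fun R' _ => ?_
    change uniformProb (fun f : halfEdges (mapEdges π R) ≃ halfEdges (mapEdges π R') =>
      (∀ h : halfEdges (mapEdges π R), (conj π η).1 h = f h) ∧
        ∀ h : HalfEdge d, h ∉ halfEdges (mapEdges π R) → h ∉ halfEdges (mapEdges π R') →
          (conj π η).1 h = (conj π ξ).1 h) = _
    refine uniformProb_congr (Equiv.equivCongr (halfEdgesEquiv π R) (halfEdgesEquiv π R'))
      fun f => and_congr ?_ ?_
    · rw [← (halfEdgesEquiv π R).forall_congr_right]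
      refine forall_congr' fun h => ?_
      have h1 : ((Equiv.equivCongr (halfEdgesEquiv π R) (halfEdgesEquiv π R') f
          (halfEdgesEquiv π R h) : halfEdges (mapEdges π R')) : HalfEdge d) = π (f h) := by
        rw [Equiv.equivCongr_apply_apply, Equiv.symm_apply_apply]
        rfl
      rw [h1]
      change (conj π η).1 (π h) = π (f h) ↔ _
      rw [conj_apply, EmbeddingLike.apply_eq_iff_eq]
    · rw [← π.forall_congr_right]
      refine forall_congr' fun h => ?_
      simp only [mem_halfEdges_mapEdges, conj_apply, EmbeddingLike.apply_eq_iff_eq]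

lemma envStep_conj (π : Equiv.Perm (HalfEdge d)) (α : ℝ) (S : Finset (Edge d)) (C : Config d)
    (F : Finset (Edge d) → Config d → ℝ) :
    envStep α (mapEdges π S) (conj π C) F
      = envStep α S C fun R η => F (mapEdges π R) (conj π η) := by
  unfold envStep
  rw [← (mapEdgesEquiv π).sum_comp]
  refine Finset.sum_congr rfl fun R _ => ?_
  rw [← (conjEquiv π).sum_comp]
  refine Finset.sum_congr rfl fun η _ => ?_
  simp only [mapEdgesEquiv_apply, conjEquiv, Equiv.coe_fn_mk, selectProb_mapEdges,
    repairProb_conj]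

/-- Under the global rule, the law of the environment along a guided trajectory is equivariant
under renaming the half-edges. -/
lemma val_conj (π : Equiv.Perm (HalfEdge d)) (α : ℝ) (l : List (HalfEdge d × HalfEdge d))
    (C : Config d) (Y : Finset (HalfEdge d)) (Φ : Config d → Finset (HalfEdge d) → ℝ) :
    val α globalRule (l.map fun e => (π e.1, π e.2)) (conj π C) (Y.map π.toEmbedding) Φ
      = val α globalRule l C Y fun C Y => Φ (conj π C) (Y.map π.toEmbedding) := by
  classical
  induction l generalizing C Y with
  | nil => rfl
  | cons e l ih =>
    simp only [List.map_cons, val, globalRule, edges_conj, envStep_conj]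
    congr 1
    funext R η
    rw [halfEdges_mapEdges, ← Finset.map_sdiff, ih]
    refine if_congr ?_ rfl rfl
    rw [conj_apply]
    simp

end DynCM

/-! ### Global rewiring: exchangeability and concentration -/

namespace DynCM

variable {n : ℕ} {d : Fin n → ℕ}

open Classical in
/-- The half-edges that occur in a trajectory. -/
noncomputable def trace (l : List (HalfEdge d × HalfEdge d)) : Finset (HalfEdge d) :=
  Finset.univ.filter fun h => ∃ e ∈ l, h = e.1 ∨ h = e.2

lemma mem_trace {l : List (HalfEdge d × HalfEdge d)} {h : HalfEdge d} :
    h ∈ trace l ↔ ∃ e ∈ l, h = e.1 ∨ h = e.2 := by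
  simp [trace]

lemma trace_snoc [DecidableEq (HalfEdge d)] (l : List (HalfEdge d × HalfEdge d))
    (x z : HalfEdge d) : trace (l ++ [(x, z)]) = trace l ∪ {x, z} := by
  ext h
  simp only [mem_trace, List.mem_append, List.mem_singleton, Finset.mem_union,
    Finset.mem_insert, Finset.mem_singleton]
  constructor
  · rintro ⟨e, he | rfl, h⟩
    · exact Or.inl ⟨e, he, h⟩
    · exact Or.inr h
  · rintro (⟨e, he, h⟩ | h)
    · exact ⟨e, Or.inl he, h⟩
    · exact ⟨_, Or.inr rfl, h⟩

lemma card_trace_le (l : List (HalfEdge d × HalfEdge d)) : (trace l).card ≤ 2 * l.length := by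
  classical
  induction l using List.reverseRecOn with
  | nil => simp [trace]
  | append_singleton l e ih =>
    obtain ⟨x, z⟩ := e
    rw [trace_snoc, List.length_append, List.length_singleton]
    have h1 := Finset.card_union_le (trace l) {x, z}
    have h2 := Finset.card_le_two (a := x) (b := z)
    omega

lemma map_eq_self_of_fix {π : Equiv.Perm (HalfEdge d)} {l : List (HalfEdge d × HalfEdge d)}
    (h : ∀ a ∈ trace l, π a = a) : l.map (fun e => (π e.1, π e.2)) = l := by
  conv_rhs => rw [← List.map_id l]
  refine List.map_congr_left fun e he => ?_
  exact Prod.ext (h _ (mem_trace.2 ⟨e, he, Or.inl rfl⟩)) (h _ (mem_trace.2 ⟨e, he, Or.inr rfl⟩))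

lemma univ_map_perm (π : Equiv.Perm (HalfEdge d)) :
    (Finset.univ : Finset (HalfEdge d)).map π.toEmbedding = Finset.univ :=
  Finset.map_univ_equiv π

/-- A nonnegative function that is constant outside of a small set is small there. -/
lemma le_div_of_eq_off {ι : Type*} [Fintype ι] [DecidableEq ι] {F : Finset ι} {G : ι → ℝ}
    {M k : ℝ} (h0 : ∀ y, 0 ≤ G y) (hG : ∀ y y', y ∉ F → y' ∉ F → G y = G y')
    (hM : ∑ y, G y ≤ M) (hF : (F.card : ℝ) ≤ k) (hk : k < Fintype.card ι) {y : ι} (hy : y ∉ F) :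
    G y ≤ M / (Fintype.card ι - k) := by
  rw [le_div_iff₀ (by linarith)]
  have h1 : ∑ y' ∈ Finset.univ \ F, G y' = (Fintype.card ι - F.card : ℝ) * G y := by
    rw [Finset.sum_congr rfl fun y' hy' => hG y' y (Finset.mem_sdiff.1 hy').2 hy,
      Finset.sum_const, nsmul_eq_mul, Finset.card_sdiff_of_subset (Finset.subset_univ F),
      Finset.card_univ, Nat.cast_sub (Finset.card_le_univ F)]
  have h2 : ∑ y' ∈ Finset.univ \ F, G y' ≤ ∑ y', G y' :=
    Finset.sum_le_sum_of_subset_of_nonneg (Finset.subset_univ _) fun y _ _ => h0 y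
  nlinarith [h0 y]

/-- Two half-edges can be exchanged by an automorphism of `ξ` that fixes a set of half-edges
containing neither of the two, nor their partners. -/
lemma exists_perm_comm (ξ : Config d) {F : Finset (HalfEdge d)} {y y' : HalfEdge d}
    (h1 : y ∉ F) (h2 : ξ.1 y ∉ F) (h1' : y' ∉ F) (h2' : ξ.1 y' ∉ F) :
    ∃ π : Equiv.Perm (HalfEdge d), (∀ a ∈ F, π a = a) ∧
      (∀ h, π (ξ.1 h) = ξ.1 (π h)) ∧ π y = y' := by
  have i1 := config_invol ξ y
  have i2 := config_invol ξ y'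
  have n1 := config_ne ξ y
  have n2 := config_ne ξ y'
  by_cases hc : y' = ξ.1 y
  · refine ⟨Equiv.swap y y', fun a ha => ?_, fun h => ?_, Equiv.swap_apply_left _ _⟩
    · exact Equiv.swap_apply_of_ne_of_ne (fun e => h1 (e ▸ ha)) (fun e => h1' (e ▸ ha))
    · subst hc
      by_cases hy1 : h = y
      · subst hy1
        rw [Equiv.swap_apply_right, Equiv.swap_apply_left, i1]
      by_cases hy2 : h = ξ.1 y
      · subst hy2
        rw [i1, Equiv.swap_apply_right, Equiv.swap_apply_left]
      rw [Equiv.swap_apply_of_ne_of_ne hy1 hy2, Equiv.swap_apply_of_ne_of_ne]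
      · exact fun e => hy2 (by rw [← e, config_invol])
      · exact fun e => hy1 (config_injective ξ e)
  · by_cases he : y = y'
    · subst he
      exact ⟨1, fun _ _ => rfl, fun _ => rfl, rfl⟩
    have hne : ξ.1 y ≠ ξ.1 y' := fun e => he (config_injective ξ e)
    have hc' : ξ.1 y' ≠ y := fun e => hc (by rw [← e, config_invol])
    have hfix : ∀ a, a ≠ y → a ≠ y' → a ≠ ξ.1 y → a ≠ ξ.1 y' →
        (Equiv.swap y y' * Equiv.swap (ξ.1 y) (ξ.1 y')) a = a := by
      intro a a1 a2 a3 a4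
      rw [Equiv.Perm.mul_apply, Equiv.swap_apply_of_ne_of_ne a3 a4,
        Equiv.swap_apply_of_ne_of_ne a1 a2]
    have f1 : (Equiv.swap y y' * Equiv.swap (ξ.1 y) (ξ.1 y')) y = y' := by
      rw [Equiv.Perm.mul_apply, Equiv.swap_apply_of_ne_of_ne n1.symm hc'.symm,
        Equiv.swap_apply_left]
    have f2 : (Equiv.swap y y' * Equiv.swap (ξ.1 y) (ξ.1 y')) y' = y := by
      rw [Equiv.Perm.mul_apply, Equiv.swap_apply_of_ne_of_ne hc n2.symm,
        Equiv.swap_apply_right]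
    have f3 : (Equiv.swap y y' * Equiv.swap (ξ.1 y) (ξ.1 y')) (ξ.1 y) = ξ.1 y' := by
      rw [Equiv.Perm.mul_apply, Equiv.swap_apply_left, Equiv.swap_apply_of_ne_of_ne hc' n2]
    have f4 : (Equiv.swap y y' * Equiv.swap (ξ.1 y) (ξ.1 y')) (ξ.1 y') = ξ.1 y := by
      rw [Equiv.Perm.mul_apply, Equiv.swap_apply_right,
        Equiv.swap_apply_of_ne_of_ne n1 fun e => hc e.symm]
    -- the two edges are exchanged
    refine ⟨Equiv.swap y y' * Equiv.swap (ξ.1 y) (ξ.1 y'), fun a ha => ?_, fun h => ?_, f1⟩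
    · exact hfix a (fun e => h1 (e ▸ ha)) (fun e => h1' (e ▸ ha)) (fun e => h2 (e ▸ ha))
        (fun e => h2' (e ▸ ha))
    · by_cases a1 : h = y
      · rw [a1, f1, f3]
      by_cases a2 : h = y'
      · rw [a2, f2, f4]
      by_cases a3 : h = ξ.1 y
      · rw [a3, f3, i1, i2, f1]
      by_cases a4 : h = ξ.1 y'
      · rw [a4, f4, i1, i2, f2]
      rw [hfix h a1 a2 a3 a4, hfix]
      · exact fun e => a3 (by rw [← e, config_invol])
      · exact fun e => a4 (by rw [← e, config_invol])
      · exact fun e => a1 (config_injective ξ e)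
      · exact fun e => a2 (config_injective ξ e)

lemma conj_eq_self {ξ : Config d} {π : Equiv.Perm (HalfEdge d)}
    (hξ : ∀ h, π (ξ.1 h) = ξ.1 (π h)) : conj π ξ = ξ := by
  apply Subtype.ext
  funext a
  obtain ⟨a, rfl⟩ := π.surjective a
  rw [conj_apply, hξ]

section Global

variable {α : ℝ}

/-- The probability that the walk, started in `ξ` under the global rule, follows `l` without
crossing. -/
noncomputable def followProb (α : ℝ) (ξ : Config d) (l : List (HalfEdge d × HalfEdge d)) : ℝ :=
  val α globalRule l ξ Finset.univ fun _ _ => 1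

/-- Two fresh half-edges are equally likely to have been rewired: there is an automorphism of `ξ`
that exchanges them and fixes the trajectory. -/
lemma val_mem_eq (ξ : Config d) {l : List (HalfEdge d × HalfEdge d)} {y y' : HalfEdge d}
    (h1 : y ∉ trace l) (h2 : ξ.1 y ∉ trace l) (h1' : y' ∉ trace l) (h2' : ξ.1 y' ∉ trace l) :
    val α globalRule l ξ Finset.univ (fun _ Y => if y ∈ Y then 1 else 0)
      = val α globalRule l ξ Finset.univ (fun _ Y => if y' ∈ Y then 1 else 0) := by
  obtain ⟨π, hl, hξ, hy⟩ := exists_perm_comm ξ h1 h2 h1' h2'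
  have := val_conj π α l ξ Finset.univ (fun _ Y => if y' ∈ Y then 1 else 0)
  rw [map_eq_self_of_fix hl, conj_eq_self hξ, univ_map_perm] at this
  rw [this]
  congr 1
  funext C Y
  rw [← hy]
  simp

lemma followProb_nonneg (h0 : 0 ≤ α) (h1 : α ≤ 1) (ξ : Config d)
    (l : List (HalfEdge d × HalfEdge d)) : 0 ≤ followProb α ξ l :=
  val_nonneg h0 h1 fun _ _ => zero_le_one

lemma val_ind_le (h0 : 0 ≤ α) (h1 : α ≤ 1) (ξ : Config d) (l : List (HalfEdge d × HalfEdge d))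
    (y : HalfEdge d) :
    val α globalRule l ξ Finset.univ (fun _ Y => if y ∈ Y then 1 else 0) ≤ followProb α ξ l :=
  val_mono h0 h1 fun _ Y => by split_ifs <;> norm_num

open Classical in
/-- The probability that the trajectory is followed and that the fresh half-edge `y` has not been
rewired factorizes approximately, because by symmetry `y` may be replaced by a uniformly chosen
half-edge. -/
lemma abs_val_mem_sub_le (h0 : 0 ≤ α) (h1 : α ≤ 1) (ξ : Config d)
    (l : List (HalfEdge d × HalfEdge d)) (y : HalfEdge d) {w : ℝ} (hw0 : 0 ≤ w)
    (hw1 : w ≤ Fintype.card (HalfEdge d)) :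
    |Fintype.card (HalfEdge d) *
        val α globalRule l ξ Finset.univ (fun _ Y => if y ∈ Y then 1 else 0)
        - w * followProb α ξ l| ≤
      4 * l.length * followProb α ξ l
      + val α globalRule l ξ Finset.univ (fun _ Y => |(Y.card : ℝ) - w|)
      + (if y ∈ trace l ∨ ξ.1 y ∈ trace l then
          Fintype.card (HalfEdge d) * followProb α ξ l else 0) := by
  set N : ℝ := (Fintype.card (HalfEdge d) : ℝ) with hN
  set v : HalfEdge d → ℝ := fun y =>
    val α globalRule l ξ Finset.univ (fun _ Y => if y ∈ Y then 1 else 0) with hv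
  have hm := followProb_nonneg h0 h1 ξ l
  have hN0 : (0 : ℝ) ≤ N := by positivity
  have hv0 : ∀ y, 0 ≤ v y := fun y => val_nonneg h0 h1 fun _ Y => by split_ifs <;> norm_num
  have hv1 : ∀ y, v y ≤ followProb α ξ l := fun y => val_ind_le h0 h1 ξ l y
  have hE : 0 ≤ val α globalRule l ξ Finset.univ (fun _ Y => |(Y.card : ℝ) - w|) :=
    val_nonneg h0 h1 fun _ _ => abs_nonneg _
  change |N * v y - w * followProb α ξ l| ≤ _
  by_cases hy : y ∈ trace l ∨ ξ.1 y ∈ trace l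
  · rw [if_pos hy, abs_le]
    have a1 : N * v y ≤ N * followProb α ξ l := mul_le_mul_of_nonneg_left (hv1 y) hN0
    have a2 : w * followProb α ξ l ≤ N * followProb α ξ l := mul_le_mul_of_nonneg_right hw1 hm
    have a3 : 0 ≤ N * v y := mul_nonneg hN0 (hv0 y)
    have a4 : 0 ≤ w * followProb α ξ l := mul_nonneg hw0 hm
    have a5 : 0 ≤ 4 * (l.length : ℝ) * followProb α ξ l := by positivity
    constructor <;> linarith
  · rw [if_neg hy, add_zero]
    rw [not_or] at hy
    -- all half-edges outside of `S` are exchangeable with `y`, so that `v y` is the average of `v`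
    -- up to a contribution of `S`
    set S : Finset (HalfEdge d) := trace l ∪ (trace l).image ξ.1 with hS
    have hmemS : ∀ a, a ∉ S → a ∉ trace l ∧ ξ.1 a ∉ trace l := by
      intro a ha
      rw [hS, Finset.mem_union, not_or] at ha
      refine ⟨ha.1, fun h => ha.2 (Finset.mem_image.2 ⟨_, h, config_invol ξ a⟩)⟩
    have hScard : (S.card : ℝ) ≤ 4 * l.length := by
      have b1 := card_trace_le l
      have b3 := Finset.card_image_le (s := trace l) (f := ξ.1)
      have : S.card ≤ 4 * l.length := by
        rw [hS]
        refine (Finset.card_union_le _ _).trans ?_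
        omega
      exact_mod_cast this
    have hsum : ∑ a, v a = val α globalRule l ξ Finset.univ (fun _ Y => (Y.card : ℝ)) := by
      rw [hv, ← val_sum]
      congr 1
      funext C Y
      simp
    have hdiff : N * v y - ∑ a, v a = ∑ a ∈ S, (v y - v a) := by
      have c1 : N * v y - ∑ a, v a = ∑ a, (v y - v a) := by
        rw [Finset.sum_sub_distrib, Finset.sum_const, Finset.card_univ, nsmul_eq_mul]
      rw [c1]
      symm
      refine Finset.sum_subset (Finset.subset_univ S) fun a _ ha => ?_
      have := hmemS a ha
      rw [sub_eq_zero]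
      exact val_mem_eq ξ hy.1 hy.2 this.1 this.2
    have hb1 : |∑ a ∈ S, (v y - v a)| ≤ 4 * l.length * followProb α ξ l := by
      refine (Finset.abs_sum_le_sum_abs _ _).trans ?_
      refine (Finset.sum_le_card_nsmul S _ (followProb α ξ l) fun a _ => ?_).trans ?_
      · rw [abs_le]
        constructor <;> linarith [hv0 y, hv0 a, hv1 y, hv1 a]
      · rw [nsmul_eq_mul]
        exact mul_le_mul_of_nonneg_right hScard hm
    have hb2 : |∑ a, v a - w * followProb α ξ l| ≤
        val α globalRule l ξ Finset.univ (fun _ Y => |(Y.card : ℝ) - w|) := by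
      have : ∑ a, v a - w * followProb α ξ l
          = val α globalRule l ξ Finset.univ (fun _ Y => (Y.card : ℝ) - w) := by
        have c2 := val_add (α := α) (K := globalRule) l ξ Finset.univ
          (fun _ Y => (Y.card : ℝ)) (fun _ _ => (-w) * 1)
        rw [val_const_mul] at c2
        rw [hsum, followProb]
        have c3 : (fun (C : Config d) (Y : Finset (HalfEdge d)) => (Y.card : ℝ) + -w * 1)
            = fun _ Y => (Y.card : ℝ) - w := by
          funext C Y
          ring
        rw [c3] at c2
        linarith
      rw [this]
      exact val_abs_le h0 h1 _ _ _ _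
    have e : N * v y - w * followProb α ξ l
        = ∑ a ∈ S, (v y - v a) + (∑ a, v a - w * followProb α ξ l) := by
      rw [← hdiff]
      ring
    rw [e]
    exact (abs_add_le _ _).trans (add_le_add hb1 hb2)

/-! The set of half-edges that have not been rewired has a concentrated size. -/

/-- Under the global rule the environment evolves on its own, so that the requirement not to have
crossed can be dropped together with the walk. -/
lemma pathSum_val_le_envVal (hd : ∀ v, 2 ≤ d v) (h0 : 0 ≤ α) (h1 : α ≤ 1) (s : ℕ)
    (x : HalfEdge d) (C : Config d) (Y : Finset (HalfEdge d))
    {Φ : Config d → Finset (HalfEdge d) → ℝ} (hΦ : ∀ C Y, 0 ≤ Φ C Y) :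
    pathSum s (fun l _ => val α globalRule l C Y Φ) x ≤ envVal α s C Y Φ := by
  induction s generalizing x C Y with
  | zero => exact le_rfl
  | succ s ih =>
    rw [pathSum_val_succ, envVal]
    refine envStep_mono h0 h1 fun R η _ => ?_
    split_ifs
    · calc _ ≤ ∑ y, sibKer (η.1 x) y * envVal α s η (Y \ halfEdges R) Φ :=
            Finset.sum_le_sum fun y _ => mul_le_mul_of_nonneg_left (ih _ _ _) (sibKer_nonneg _ _)
        _ = _ := by rw [← Finset.sum_mul, sum_sibKer_right hd, one_mul]
    · refine le_trans ?_ (ih x _ _)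
      exact pathSum_nonneg (fun l _ _ => val_nonneg h0 h1 hΦ) x

lemma envVal_mono (h0 : 0 ≤ α) (h1 : α ≤ 1) {s : ℕ} {C : Config d} {Y : Finset (HalfEdge d)}
    {Φ Ψ : Config d → Finset (HalfEdge d) → ℝ} (h : ∀ C Y, Φ C Y ≤ Ψ C Y) :
    envVal α s C Y Φ ≤ envVal α s C Y Ψ := by
  induction s generalizing C Y with
  | zero => exact h C Y
  | succ s ih => exact envStep_mono h0 h1 fun R η _ => ih

lemma envVal_add (s : ℕ) (C : Config d) (Y : Finset (HalfEdge d))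
    (Φ Ψ : Config d → Finset (HalfEdge d) → ℝ) :
    envVal α s C Y (fun C Y => Φ C Y + Ψ C Y) = envVal α s C Y Φ + envVal α s C Y Ψ := by
  induction s generalizing C Y with
  | zero => rfl
  | succ s ih => simp only [envVal, ih, envStep_add]

lemma envVal_const_mul (s : ℕ) (C : Config d) (Y : Finset (HalfEdge d)) (c : ℝ)
    (Φ : Config d → Finset (HalfEdge d) → ℝ) :
    envVal α s C Y (fun C Y => c * Φ C Y) = c * envVal α s C Y Φ := by
  induction s generalizing C Y with
  | zero => rfl
  | succ s ih => simp only [envVal, ih, envStep_const_mul]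

lemma envVal_const (s : ℕ) (C : Config d) (Y : Finset (HalfEdge d)) (c : ℝ) :
    envVal α s C Y (fun _ _ => c) = c := by
  induction s generalizing C Y with
  | zero => rfl
  | succ s ih => simp only [envVal, ih, envStep_const (le_refl (edges C))]

open Classical in
lemma sum_selectProb_card_sdiff (C : Config d) (Y : Finset (HalfEdge d)) :
    ∑ R, selectProb α (edges C) R * ((Y \ halfEdges R).card : ℝ) = (1 - α) * Y.card := by
  have h1 : ∀ R, selectProb α (edges C) R * ((Y \ halfEdges R).card : ℝ)
      = ∑ y ∈ Y, if edgeAt C y ∈ R then 0 else selectProb α (edges C) R := by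
    intro R
    by_cases hR : R ⊆ edges C
    · rw [Finset.card_eq_sum_ones, Nat.cast_sum, Finset.mul_sum]
      rw [← Finset.filter_notMem_eq_sdiff, Finset.sum_filter]
      refine Finset.sum_congr rfl fun y _ => ?_
      by_cases hy : edgeAt C y ∈ R <;> simp [mem_halfEdges_iff hR, hy]
    · simp [selectProb_eq_zero hR]
  rw [Finset.sum_congr rfl fun R _ => h1 R, Finset.sum_comm]
  rw [Finset.sum_congr rfl fun y _ => sum_selectProb_notMem (edgeAt_mem_edges C y)]
  rw [Finset.sum_const, nsmul_eq_mul, mul_comm]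

open Classical in
/-- Distinct edges are selected independently, so that only the pairs of half-edges of a common edge
contribute to the variance. -/
lemma sum_selectProb_card_sdiff_sq (h0 : 0 ≤ α) (h1 : α ≤ 1) (C : Config d)
    (Y : Finset (HalfEdge d)) :
    ∑ R, selectProb α (edges C) R * ((Y \ halfEdges R).card : ℝ) ^ 2
      ≤ (1 - α) ^ 2 * (Y.card : ℝ) ^ 2 + 2 * Y.card := by
  have e1 : ∀ R, selectProb α (edges C) R * ((Y \ halfEdges R).card : ℝ) ^ 2
      = ∑ y ∈ Y, ∑ y' ∈ Y, if Disjoint R {edgeAt C y, edgeAt C y'} then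
          selectProb α (edges C) R else 0 := by
    intro R
    by_cases hR : R ⊆ edges C
    · have e2 : ((Y \ halfEdges R).card : ℝ) = ∑ y ∈ Y, if edgeAt C y ∈ R then 0 else 1 := by
        rw [Finset.card_eq_sum_ones, Nat.cast_sum, ← Finset.filter_notMem_eq_sdiff,
          Finset.sum_filter]
        refine Finset.sum_congr rfl fun y _ => ?_
        by_cases hy : edgeAt C y ∈ R <;> simp [mem_halfEdges_iff hR, hy]
      rw [e2, sq, Finset.sum_mul_sum, Finset.mul_sum]
      refine Finset.sum_congr rfl fun y _ => ?_
      rw [Finset.mul_sum]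
      refine Finset.sum_congr rfl fun y' _ => ?_
      by_cases a : edgeAt C y ∈ R <;> by_cases b : edgeAt C y' ∈ R <;>
        simp [a, b]
    · simp [selectProb_eq_zero hR]
  rw [Finset.sum_congr rfl fun R _ => e1 R, Finset.sum_comm]
  have e3 : ∀ y ∈ Y, ∑ R, ∑ y' ∈ Y, (if Disjoint R {edgeAt C y, edgeAt C y'} then
          selectProb α (edges C) R else 0) ≤ (1 - α) ^ 2 * Y.card + 2 := by
    intro y _
    rw [Finset.sum_comm]
    have e4 : ∀ y' ∈ Y, ∑ R, (if Disjoint R {edgeAt C y, edgeAt C y'} then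
          selectProb α (edges C) R else 0)
          ≤ (1 - α) ^ 2 + if y' = y ∨ y' = C.1 y then 1 else 0 := by
      intro y' _
      rw [sum_selectProb_disjoint, Finset.inter_eq_right.2]
      · split_ifs with h
        · have : (1 - α) ^ (({edgeAt C y, edgeAt C y'} : Finset (Edge d)).card) ≤ 1 :=
            pow_le_one₀ (by linarith) (by linarith)
          nlinarith [sq_nonneg (1 - α)]
        · rw [← edgeAt_eq_iff] at h
          rw [Finset.card_pair (fun e => h e.symm), add_zero]
      · intro e
        simp only [Finset.mem_insert, Finset.mem_singleton]
        rintro (rfl | rfl) <;> exact edgeAt_mem_edges _ _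
    refine (Finset.sum_le_sum e4).trans ?_
    rw [Finset.sum_add_distrib, Finset.sum_const, nsmul_eq_mul, mul_comm]
    gcongr
    rw [← Finset.sum_filter, Finset.sum_const, nsmul_eq_mul, mul_one]
    have : (Y.filter fun y' => y' = y ∨ y' = C.1 y) ⊆ {y, C.1 y} := by
      intro a
      simp
    exact_mod_cast (Finset.card_le_card this).trans Finset.card_le_two
  refine (Finset.sum_le_sum e3).trans ?_
  rw [Finset.sum_const, nsmul_eq_mul]
  apply le_of_eq
  ring

lemma envVal_card (s : ℕ) (C : Config d) (Y : Finset (HalfEdge d)) :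
    envVal α s C Y (fun _ Y => (Y.card : ℝ)) = (1 - α) ^ s * Y.card := by
  classical
  induction s generalizing C Y with
  | zero => simp [envVal]
  | succ s ih =>
    simp only [envVal, ih, envStep_const_mul]
    rw [envStep_select (le_refl (edges C)) (fun R => ((Y \ halfEdges R).card : ℝ)),
      sum_selectProb_card_sdiff, pow_succ, mul_assoc]

lemma envVal_card_sq_le (h0 : 0 ≤ α) (h1 : α ≤ 1) (s : ℕ) (C : Config d)
    (Y : Finset (HalfEdge d)) :
    envVal α s C Y (fun _ Y => (Y.card : ℝ) ^ 2)
      ≤ ((1 - α) ^ s) ^ 2 * (Y.card : ℝ) ^ 2 + 2 * s * Fintype.card (HalfEdge d) := by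
  classical
  induction s generalizing C Y with
  | zero => simp [envVal]
  | succ s ih =>
    rw [envVal]
    refine (envStep_mono h0 h1 fun R η _ => ih η (Y \ halfEdges R)).trans ?_
    rw [envStep_add, envStep_const (le_refl (edges C)), envStep_const_mul,
      envStep_select (le_refl (edges C)) (fun R => ((Y \ halfEdges R).card : ℝ) ^ 2)]
    have a := sum_selectProb_card_sdiff_sq h0 h1 C Y
    have hp : ((1 - α) ^ s) ^ 2 ≤ 1 :=
      pow_le_one₀ (by have : 0 ≤ 1 - α := by linarith
                      positivity) (pow_le_one₀ (by linarith) (by linarith))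
    have hp0 : 0 ≤ ((1 - α) ^ s) ^ 2 := sq_nonneg _
    have hY : (Y.card : ℝ) ≤ Fintype.card (HalfEdge d) := by
      exact_mod_cast Finset.card_le_univ Y
    have hY0 : (0 : ℝ) ≤ Y.card := by positivity
    have e : ((1 - α) ^ (s + 1)) ^ 2 = ((1 - α) ^ s) ^ 2 * (1 - α) ^ 2 := by ring
    rw [e]
    push_cast
    nlinarith [mul_le_mul_of_nonneg_left a hp0, mul_le_mul_of_nonneg_right hp hY0]

/-- After `s` steps the number of half-edges that have never been rewired deviates from its mean
`(1 - α) ^ s * N` by an amount of order `s * √N` only, by a second-moment bound. -/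
lemma envVal_abs_card_sub_le (h0 : 0 ≤ α) (h1 : α ≤ 1) (s : ℕ) (C : Config d)
    (hN : 0 < Fintype.card (HalfEdge d)) :
    envVal α s C Finset.univ
      (fun _ Y => |(Y.card : ℝ) - (1 - α) ^ s * Fintype.card (HalfEdge d)|)
      ≤ √(Fintype.card (HalfEdge d)) * (1 / 2 + s) := by
  set N : ℝ := (Fintype.card (HalfEdge d) : ℝ) with hNdef
  have hN0 : 0 < N := by rw [hNdef]; exact_mod_cast hN
  set w : ℝ := (1 - α) ^ s * N with hw
  have hθ : 0 < √N := Real.sqrt_pos.2 hN0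
  have hsq : √N ^ 2 = N := Real.sq_sqrt hN0.le
  -- AM-GM against the standard deviation, which is of order `√N`
  have key : ∀ (C : Config d) (Y : Finset (HalfEdge d)), |(Y.card : ℝ) - w|
      ≤ ((√N / 2 + w ^ 2 / (2 * √N)) + (-(w / √N)) * (Y.card : ℝ))
        + (1 / (2 * √N)) * (Y.card : ℝ) ^ 2 := by
    intro _ Y
    have e : ((√N / 2 + w ^ 2 / (2 * √N)) + (-(w / √N)) * (Y.card : ℝ))
        + (1 / (2 * √N)) * (Y.card : ℝ) ^ 2 = (√N ^ 2 + ((Y.card : ℝ) - w) ^ 2) / (2 * √N) := by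
      field_simp
      ring
    rw [e, le_div_iff₀ (by positivity), ← sq_abs ((Y.card : ℝ) - w)]
    nlinarith [sq_nonneg (√N - |(Y.card : ℝ) - w|)]
  refine (envVal_mono h0 h1 key).trans ?_
  rw [envVal_add, envVal_add, envVal_const, envVal_const_mul, envVal_const_mul, envVal_card]
  have b := envVal_card_sq_le h0 h1 s C Finset.univ
  rw [Finset.card_univ, ← hNdef] at b
  rw [Finset.card_univ, ← hNdef, ← hw]
  have e : ((1 - α) ^ s) ^ 2 * N ^ 2 = w ^ 2 := by rw [hw]; ring
  rw [e] at b
  have b2 := mul_le_mul_of_nonneg_left b (by positivity : 0 ≤ 1 / (2 * √N))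
  refine (add_le_add_right b2 _).trans (le_of_eq ?_)
  have hs2 : N = √N * √N := by rw [← sq, hsq]
  field_simp
  rw [hsq]
  ring

end Global

end DynCM

/-! ### Global rewiring: the walk rarely returns to the half-edges it has seen -/

namespace DynCM

variable {n : ℕ} {d : Fin n → ℕ} {α : ℝ}

/-- Renaming half-edges outside of the trajectory does not change averages over the initial
configuration. -/
lemma sum_val_conj {π : Equiv.Perm (HalfEdge d)} {l : List (HalfEdge d × HalfEdge d)}
    (h : ∀ a ∈ trace l, π a = a) (Φ : Config d → Config d → ℝ) :
    ∑ ξ, val α globalRule l ξ Finset.univ (fun C _ => Φ ξ C)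
      = ∑ ξ, val α globalRule l ξ Finset.univ (fun C _ => Φ (conj π ξ) (conj π C)) := by
  rw [← (conjEquiv π).sum_comp]
  refine Finset.sum_congr rfl fun ξ _ => ?_
  have := val_conj π α l ξ Finset.univ fun C _ => Φ (conj π ξ) C
  rw [map_eq_self_of_fix h, univ_map_perm] at this
  exact this

lemma sum_followProb_le (hd : ∀ v, 2 ≤ d v) (h0 : 0 ≤ α) (h1 : α ≤ 1) (s : ℕ)
    (x : HalfEdge d) :
    pathSum s (fun l _ => ∑ ξ, followProb α ξ l) x ≤ Fintype.card (Config d) := by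
  rw [pathSum_sum, ← nsmul_one, ← Finset.card_univ, ← Finset.sum_const]
  refine Finset.sum_le_sum fun ξ _ => ?_
  unfold followProb
  rw [← tailVal_eq_pathSum]
  exact tailVal_le_one hd (fun C x => le_refl (edges C)) h0 h1 s x ξ _

lemma sum_followProb_nonneg (h0 : 0 ≤ α) (h1 : α ≤ 1) (l : List (HalfEdge d × HalfEdge d)) :
    0 ≤ ∑ ξ, followProb α ξ l := Finset.sum_nonneg fun ξ _ => followProb_nonneg h0 h1 ξ l

lemma swap_fix {l : List (HalfEdge d × HalfEdge d)} {y y' : HalfEdge d} (hy : y ∉ trace l)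
    (hy' : y' ∉ trace l) : ∀ a ∈ trace l, Equiv.swap y y' a = a := fun _ ha =>
  Equiv.swap_apply_of_ne_of_ne (fun e => hy (e ▸ ha)) (fun e => hy' (e ▸ ha))

open Classical in
/-- The initial partner of a half-edge of the trajectory is unlikely to be a given fresh
half-edge. -/
lemma sum_val_partner_le (h0 : 0 ≤ α) (h1 : α ≤ 1) {l : List (HalfEdge d × HalfEdge d)} {k : ℝ}
    (hk : ((trace l).card : ℝ) ≤ k) (hkN : k < Fintype.card (HalfEdge d)) {a y : HalfEdge d}
    (ha : a ∈ trace l) (hy : y ∉ trace l) :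
    ∑ ξ : Config d, (if ξ.1 a = y then followProb α ξ l else 0)
      ≤ (∑ ξ, followProb α ξ l) / (Fintype.card (HalfEdge d) - k) := by
  refine le_div_of_eq_off (F := trace l)
    (G := fun y => ∑ ξ : Config d, (if ξ.1 a = y then followProb α ξ l else 0)) ?_ ?_ ?_ hk hkN hy
  · intro y
    exact Finset.sum_nonneg fun ξ _ => by
      split_ifs
      exacts [followProb_nonneg h0 h1 ξ l, le_rfl]
  · intro y y' hy hy'
    have h2 : ∀ (ξ : Config d) y, (if ξ.1 a = y then followProb α ξ l else 0)
        = val α globalRule l ξ Finset.univ (fun _ _ => if ξ.1 a = y then 1 else 0) := by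
      intro ξ y
      have := val_const_mul (α := α) (K := globalRule) l ξ Finset.univ
        (if ξ.1 a = y then 1 else 0) (fun _ _ => 1)
      simp only [mul_one] at this
      rw [this, followProb]
      split_ifs <;> simp
    simp only [h2]
    rw [sum_val_conj (swap_fix hy hy') (fun ξ _ => if ξ.1 a = y then 1 else 0)]
    refine Finset.sum_congr rfl fun ξ _ => ?_
    congr 1
    funext _ _
    refine if_congr ?_ rfl rfl
    have e := conj_apply (Equiv.swap y y') ξ a
    rw [swap_fix hy hy' a ha] at e
    rw [e, Equiv.swap_apply_eq_iff, Equiv.swap_apply_left]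
  · rw [Finset.sum_comm]
    simp

open Classical in
/-- The weight of the trajectories that continue `l`, with a further step along the edge from `x`
to `z` in the updated configuration. -/
noncomputable def stepWeight (α : ℝ) (l : List (HalfEdge d × HalfEdge d)) (x z : HalfEdge d) : ℝ :=
  ∑ ξ, val α globalRule l ξ Finset.univ fun C _ =>
    envStep α (edges C) C fun _ η => if η.1 x = z then 1 else 0

lemma stepWeight_nonneg (h0 : 0 ≤ α) (h1 : α ≤ 1) (l : List (HalfEdge d × HalfEdge d))
    (x z : HalfEdge d) : 0 ≤ stepWeight α l x z :=
  Finset.sum_nonneg fun ξ _ => val_nonneg h0 h1 fun _ _ => envStep_nonneg h0 h1 fun _ _ _ => by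
    split_ifs <;> norm_num

lemma sum_stepWeight (l : List (HalfEdge d × HalfEdge d)) (x : HalfEdge d) :
    ∑ z, stepWeight α l x z = ∑ ξ, followProb α ξ l := by
  classical
  unfold stepWeight followProb
  rw [Finset.sum_comm]
  refine Finset.sum_congr rfl fun ξ _ => ?_
  rw [← val_sum]
  congr 1
  funext C _
  rw [← envStep_sum]
  simp [envStep_const (le_refl (edges C))]

lemma stepWeight_comm (l : List (HalfEdge d × HalfEdge d)) (x z : HalfEdge d) :
    stepWeight α l x z = stepWeight α l z x := by
  unfold stepWeight
  refine Finset.sum_congr rfl fun ξ _ => ?_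
  congr 1
  funext C _
  congr 1
  funext _ η
  refine if_congr ?_ rfl rfl
  constructor <;> rintro rfl <;> exact config_invol _ _

lemma stepWeight_self (l : List (HalfEdge d × HalfEdge d)) (x : HalfEdge d) :
    stepWeight α l x x = 0 := by
  unfold stepWeight
  refine Finset.sum_eq_zero fun ξ _ => ?_
  have h : val α globalRule l ξ Finset.univ (fun _ _ => 0) = 0 := by
    have := val_const_mul (α := α) (K := globalRule) l ξ Finset.univ 0 (fun _ _ => 0)
    simpa only [mul_zero, zero_mul] using this
  refine Eq.trans ?_ h
  congr 1
  funext C _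
  simp [config_ne, envStep]

/-- The weight of a step depends on its end points only up to permutations of the fresh half-edges,
as the uniform initial law is invariant under relabelling. -/
lemma stepWeight_perm {π : Equiv.Perm (HalfEdge d)} {l : List (HalfEdge d × HalfEdge d)}
    (h : ∀ a ∈ trace l, π a = a) (x z : HalfEdge d) :
    stepWeight α l (π x) (π z) = stepWeight α l x z := by
  classical
  unfold stepWeight
  rw [sum_val_conj h fun _ C => envStep α (edges C) C fun _ η => if η.1 (π x) = π z then 1 else 0]
  refine Finset.sum_congr rfl fun ξ _ => ?_
  congr 1
  funext C _
  rw [edges_conj, envStep_conj]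
  congr 1
  funext _ η
  exact if_congr (by rw [conj_apply, EmbeddingLike.apply_eq_iff_eq]) rfl rfl

/-- A trajectory is unlikely to be continued from a given fresh half-edge to a given half-edge
that has been seen. -/
lemma stepWeight_le_of_mem (h0 : 0 ≤ α) (h1 : α ≤ 1) {l : List (HalfEdge d × HalfEdge d)} {k : ℝ}
    (hk : ((trace l).card : ℝ) ≤ k) (hkN : k < Fintype.card (HalfEdge d)) {x z : HalfEdge d}
    (hz : z ∈ trace l) (hx : x ∉ trace l) :
    stepWeight α l x z ≤ (∑ ξ, followProb α ξ l) / (Fintype.card (HalfEdge d) - k) := by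
  classical
  refine le_div_of_eq_off (F := trace l) (G := fun x => stepWeight α l x z)
    (fun x => stepWeight_nonneg h0 h1 l x z) ?_ ?_ hk hkN hx
  · intro y y' hy hy'
    have := stepWeight_perm (α := α) (swap_fix hy hy') y z
    rw [Equiv.swap_apply_left, swap_fix hy hy' z hz] at this
    exact this.symm
  · simp only [stepWeight_comm l _ z]
    exact (sum_stepWeight l z).le

/-- A trajectory is unlikely to be continued to a given fresh half-edge. -/
lemma stepWeight_le_of_notMem (h0 : 0 ≤ α) (h1 : α ≤ 1) {l : List (HalfEdge d × HalfEdge d)}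
    {k : ℝ} (hk : ((trace l).card : ℝ) + 1 ≤ k) (hkN : k < Fintype.card (HalfEdge d))
    {x z : HalfEdge d} (hz : z ∉ trace l) :
    stepWeight α l x z ≤ (∑ ξ, followProb α ξ l) / (Fintype.card (HalfEdge d) - k) := by
  classical
  have hpos : 0 ≤ (∑ ξ, followProb α ξ l) / (Fintype.card (HalfEdge d) - k) :=
    div_nonneg (sum_followProb_nonneg h0 h1 l) (by linarith)
  by_cases hzx : z = x
  · rw [hzx, stepWeight_self]
    exact hpos
  refine le_div_of_eq_off (F := insert x (trace l)) (G := fun z => stepWeight α l x z)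
    (fun z => stepWeight_nonneg h0 h1 l x z) ?_ (sum_stepWeight l x).le ?_ hkN ?_
  · intro y y' hy hy'
    rw [Finset.mem_insert, not_or] at hy hy'
    have := stepWeight_perm (α := α) (swap_fix hy.2 hy'.2) x y
    rw [Equiv.swap_apply_left, Equiv.swap_apply_of_ne_of_ne (Ne.symm hy.1) (Ne.symm hy'.1)] at this
    exact this.symm
  · refine le_trans ?_ hk
    exact_mod_cast Finset.card_insert_le x (trace l)
  · rw [Finset.mem_insert, not_or]
    exact ⟨hzx, hz⟩

lemma sum_followProb_snoc_le (h0 : 0 ≤ α) (h1 : α ≤ 1) (l : List (HalfEdge d × HalfEdge d))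
    (x z : HalfEdge d) : ∑ ξ, followProb α ξ (l ++ [(x, z)]) ≤ stepWeight α l x z := by
  classical
  refine Finset.sum_le_sum fun ξ _ => ?_
  rw [followProb, val_append]
  refine val_mono h0 h1 fun C Y => ?_
  rw [val]
  refine envStep_mono h0 h1 fun R η _ => ?_
  simp only [val]
  split_ifs with h h' <;> first | exact le_rfl | exact zero_le_one | skip
  exact absurd h.2 h'

lemma card_insert_trace_le {l : List (HalfEdge d × HalfEdge d)} {s : ℕ} (hl : l.length = s)
    (y : HalfEdge d) : ((insert y (trace l)).card : ℝ) ≤ 2 * s + 1 := by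
  have h : (insert y (trace l)).card ≤ 2 * s + 1 := by
    have h1 := card_trace_le l
    rw [hl] at h1
    exact (Finset.card_insert_le _ _).trans (Nat.succ_le_succ h1)
  exact_mod_cast h

open Classical in
/-- The weight of the continuations of `l` through the edge from `y` to `z`, whose endpoint has
been seen before. -/
noncomputable def returnWeight (α : ℝ) (l : List (HalfEdge d × HalfEdge d)) (y z : HalfEdge d) :
    ℝ :=
  ∑ y', sibKer z y' * (if y' ∈ trace (l ++ [(y, z)]) then
    ∑ ξ, followProb α ξ (l ++ [(y, z)]) else 0)

lemma returnWeight_le (hd : ∀ v, 2 ≤ d v) (h0 : 0 ≤ α) (h1 : α ≤ 1)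
    (l : List (HalfEdge d × HalfEdge d)) (y z : HalfEdge d) :
    returnWeight α l y z ≤ stepWeight α l y z := by
  unfold returnWeight
  rw [← one_mul (stepWeight α l y z), ← sum_sibKer_right hd z, Finset.sum_mul]
  refine Finset.sum_le_sum fun y' _ => mul_le_mul_of_nonneg_left ?_ (sibKer_nonneg _ _)
  split_ifs
  · exact sum_followProb_snoc_le h0 h1 l y z
  · exact stepWeight_nonneg h0 h1 l y z

open Classical in
/-- From the fresh half-edge `y` the walk can return only if the half-edge `z` at the other end has
been seen before, or is a sibling of a half-edge that has been seen. -/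
lemma returnWeight_le_of_notMem (hd : ∀ v, 2 ≤ d v) (h0 : 0 ≤ α) (h1 : α ≤ 1)
    {l : List (HalfEdge d × HalfEdge d)} {k q : ℝ} (hk : ((trace l).card : ℝ) + 1 ≤ k)
    (hkN : k < Fintype.card (HalfEdge d)) (hq0 : 0 ≤ q)
    (hq : (∑ ξ, followProb α ξ l) / (Fintype.card (HalfEdge d) - k) ≤ q)
    {y : HalfEdge d} (hy : y ∉ trace l) (z : HalfEdge d) :
    returnWeight α l y z ≤ (if z ∈ trace l then q else 0)
      + ∑ y' ∈ insert y (trace l), sibKer z y' * q := by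
  have hB : 0 ≤ ∑ y' ∈ insert y (trace l), sibKer z y' * q :=
    Finset.sum_nonneg fun y' _ => mul_nonneg (sibKer_nonneg _ _) hq0
  by_cases hz : z ∈ trace l
  · rw [if_pos hz]
    have h2 := (stepWeight_le_of_mem h0 h1 (by linarith) hkN hz hy).trans hq
    have h3 := returnWeight_le hd h0 h1 l y z
    linarith
  · rw [if_neg hz, zero_add]
    have hw := (stepWeight_le_of_notMem (x := y) h0 h1 hk hkN hz).trans hq
    have e0 : ∑ y' ∈ insert y (trace l), sibKer z y' * q
        = ∑ y', sibKer z y' * (if y' ∈ insert y (trace l) then q else 0) := by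
      simp only [mul_ite, mul_zero]
      rw [Finset.sum_ite_mem, Finset.univ_inter]
    rw [e0]
    unfold returnWeight
    refine Finset.sum_le_sum fun y' _ => ?_
    by_cases hsib : Sibling z y'
    · refine mul_le_mul_of_nonneg_left ?_ (sibKer_nonneg _ _)
      rw [trace_snoc]
      have hne : y' ≠ z := fun e => hsib.2 e.symm
      split_ifs with a b
      · exact (sum_followProb_snoc_le h0 h1 l y z).trans hw
      · simp only [Finset.mem_union, Finset.mem_insert, Finset.mem_singleton] at a b
        tauto
      · exact hq0
      · exact le_rfl
    · simp [sibKer, hsib]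

open Classical in
/-- Summed over the edge that is traversed next, the weight of a return is of order `k * q`. -/
lemma sum_returnWeight_le (hd : ∀ v, 2 ≤ d v) (h0 : 0 ≤ α) (h1 : α ≤ 1)
    {l : List (HalfEdge d × HalfEdge d)} {k q : ℝ} {y : HalfEdge d}
    (hk : ((insert y (trace l)).card : ℝ) ≤ k) (hk' : ((trace l).card : ℝ) + 1 ≤ k)
    (hkN : k < Fintype.card (HalfEdge d)) (hq0 : 0 ≤ q)
    (hq : (∑ ξ, followProb α ξ l) / (Fintype.card (HalfEdge d) - k) ≤ q) :
    ∑ z, returnWeight α l y z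
      ≤ (if y ∈ trace l then ∑ ξ, followProb α ξ l else 0) + 2 * k * q := by
  have hk0 : 0 ≤ k := le_trans (by positivity) hk
  by_cases hy : y ∈ trace l
  · rw [if_pos hy]
    have := (Finset.sum_le_sum fun z (_ : z ∈ Finset.univ) => returnWeight_le hd h0 h1 l y z).trans
      (sum_stepWeight l y).le
    have : 0 ≤ 2 * k * q := by positivity
    linarith
  · rw [if_neg hy, zero_add]
    refine (Finset.sum_le_sum fun z _ =>
      returnWeight_le_of_notMem hd h0 h1 hk' hkN hq0 hq hy z).trans ?_
    rw [Finset.sum_add_distrib, Finset.sum_comm]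
    have e1 : ∑ z, (if z ∈ trace l then q else 0) = (trace l).card * q := by
      rw [Finset.sum_ite_mem, Finset.univ_inter, Finset.sum_const, nsmul_eq_mul]
    have e2 : ∑ y' ∈ insert y (trace l), ∑ z, sibKer z y' * q
        = (insert y (trace l)).card * q := by
      rw [← nsmul_eq_mul, ← Finset.sum_const]
      refine Finset.sum_congr rfl fun y' _ => ?_
      rw [← Finset.sum_mul, sum_sibKer_left hd, one_mul]
    rw [e1, e2, ← add_mul]
    refine mul_le_mul_of_nonneg_right ?_ hq0
    linarith

open Classical in
/-- The total weight of the trajectories whose endpoint has been seen before. -/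
lemma pathSum_return_le (hd : ∀ v, 2 ≤ d v) (h0 : 0 ≤ α) (h1 : α ≤ 1) {T : ℕ}
    (hT : 4 * T + 4 ≤ Fintype.card (HalfEdge d)) {s : ℕ} (hs : s ≤ T) (x : HalfEdge d) :
    pathSum s (fun l y => if y ∈ trace l then ∑ ξ, followProb α ξ l else 0) x
      ≤ s * ((4 * T + 1) * (2 / Fintype.card (HalfEdge d)) * Fintype.card (Config d)) := by
  set N : ℝ := (Fintype.card (HalfEdge d) : ℝ) with hN
  have hTN : 4 * (T : ℝ) + 4 ≤ N := by rw [hN]; exact_mod_cast hT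
  have hT0 : (0 : ℝ) ≤ T := by positivity
  have hNpos : 0 < N := by linarith
  induction s with
  | zero => simp [pathSum, trace]
  | succ s ih =>
    have ih := ih (by omega)
    rw [pathSum_snoc]
    have hsT : (s : ℝ) + 1 ≤ T := by exact_mod_cast hs
    have key : ∀ (l : List (HalfEdge d × HalfEdge d)) (y : HalfEdge d), l.length = s →
        (∑ z, ∑ y', sibKer z y' * (if y' ∈ trace (l ++ [(y, z)]) then
          ∑ ξ, followProb α ξ (l ++ [(y, z)]) else 0))
        ≤ (if y ∈ trace l then ∑ ξ, followProb α ξ l else 0)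
          + ((4 * T + 1) * (2 / N)) * ∑ ξ, followProb α ξ l := by
      intro l y hl
      have hm0 : 0 ≤ ∑ ξ, followProb α ξ l := sum_followProb_nonneg h0 h1 l
      have hcard : ((trace l).card : ℝ) ≤ 2 * s := by
        have := card_trace_le l
        rw [hl] at this
        exact_mod_cast this
      have hq : (∑ ξ, followProb α ξ l) / (N - (2 * s + 1)) ≤ 2 / N * ∑ ξ, followProb α ξ l := by
        rw [div_le_iff₀ (by linarith)]
        have : 1 ≤ 2 / N * (N - (2 * s + 1)) := by
          rw [div_mul_eq_mul_div, le_div_iff₀ hNpos]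
          linarith
        nlinarith
      have h2 := sum_returnWeight_le (y := y) hd h0 h1 (card_insert_trace_le hl y)
        (by linarith) (by linarith) (by positivity) hq
      refine h2.trans (add_le_add le_rfl ?_)
      rw [← mul_assoc]
      refine mul_le_mul_of_nonneg_right ?_ hm0
      refine mul_le_mul_of_nonneg_right ?_ (by positivity)
      linarith
    refine (pathSum_mono key x).trans ?_
    rw [pathSum_add, pathSum_const_mul]
    have a := sum_followProb_le (α := α) hd h0 h1 s x
    have b := mul_le_mul_of_nonneg_left a
      (by positivity : 0 ≤ (4 * (T : ℝ) + 1) * (2 / N))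
    push_cast
    linarith

open Classical in
/-- The total weight of the trajectories whose endpoint is fresh, but initially paired with a
half-edge that has been seen. -/
lemma pathSum_partner_le (hd : ∀ v, 2 ≤ d v) (h0 : 0 ≤ α) (h1 : α ≤ 1) {T : ℕ}
    (hT : 4 * T + 4 ≤ Fintype.card (HalfEdge d)) {s : ℕ} (hs : s ≤ T) (x : HalfEdge d) :
    pathSum s (fun l y => if y ∈ trace l then 0 else
      ∑ ξ : Config d, if ξ.1 y ∈ trace l then followProb α ξ l else 0) x
      ≤ 2 * T * (2 / Fintype.card (HalfEdge d)) * Fintype.card (Config d) := by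
  set N : ℝ := (Fintype.card (HalfEdge d) : ℝ) with hN
  have hTN : 4 * (T : ℝ) + 4 ≤ N := by rw [hN]; exact_mod_cast hT
  have hT0 : (0 : ℝ) ≤ T := by positivity
  have hNpos : 0 < N := by linarith
  have hsT : (s : ℝ) ≤ T := by exact_mod_cast hs
  have key : ∀ (l : List (HalfEdge d × HalfEdge d)) (y : HalfEdge d), l.length = s →
      (if y ∈ trace l then 0 else
      ∑ ξ : Config d, if ξ.1 y ∈ trace l then followProb α ξ l else 0)
      ≤ (2 * T * (2 / N)) * ∑ ξ, followProb α ξ l := by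
    intro l y hl
    set m := ∑ ξ, followProb α ξ l with hm
    have hm0 : 0 ≤ m := sum_followProb_nonneg h0 h1 l
    have hcard : ((trace l).card : ℝ) ≤ 2 * s := by
      have := card_trace_le l
      rw [hl] at this
      exact_mod_cast this
    split_ifs with hy
    · positivity
    have e : ∀ ξ : Config d, (if ξ.1 y ∈ trace l then followProb α ξ l else 0)
        = ∑ a ∈ trace l, if ξ.1 a = y then followProb α ξ l else 0 := by
      intro ξ
      have : ∀ a, (if ξ.1 a = y then followProb α ξ l else 0)
          = if ξ.1 y = a then followProb α ξ l else 0 := by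
        intro a
        refine if_congr ?_ rfl rfl
        constructor <;> rintro rfl <;> exact config_invol _ _
      simp [this]
    rw [Finset.sum_congr rfl fun ξ _ => e ξ, Finset.sum_comm]
    have hq : m / (N - 2 * s) ≤ 2 / N * m := by
      rw [div_le_iff₀ (by linarith)]
      have : 1 ≤ 2 / N * (N - 2 * s) := by
        rw [div_mul_eq_mul_div, le_div_iff₀ hNpos]
        linarith
      nlinarith
    refine (Finset.sum_le_card_nsmul _ _ (2 / N * m) fun a ha =>
      (sum_val_partner_le h0 h1 hcard (by rw [← hN]; linarith) ha hy).trans hq).trans ?_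
    rw [nsmul_eq_mul, mul_assoc (2 * (T : ℝ))]
    exact mul_le_mul_of_nonneg_right (by linarith) (by positivity)
  refine (pathSum_mono key x).trans ?_
  rw [pathSum_const_mul]
  exact mul_le_mul_of_nonneg_left (sum_followProb_le hd h0 h1 s x) (by positivity)

open Classical in
/-- One step of the approximate product formula, for a given initial state. -/
lemma abs_tailVal_succ_sub_le (hd : ∀ v, 2 ≤ d v) (h0 : 0 ≤ α) (h1 : α ≤ 1) (s : ℕ)
    (x : HalfEdge d) (ξ : Config d) (hN : 0 < Fintype.card (HalfEdge d)) :
    |tailVal α globalRule (s + 1) x ξ Finset.univ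
        - (1 - α) ^ (s + 1) * tailVal α globalRule s x ξ Finset.univ| ≤
      4 * s / Fintype.card (HalfEdge d) + (1 / 2 + s) / √(Fintype.card (HalfEdge d))
      + pathSum s (fun l y => if y ∈ trace l ∨ ξ.1 y ∈ trace l then followProb α ξ l else 0) x := by
  set N : ℝ := (Fintype.card (HalfEdge d) : ℝ) with hNdef
  have hN0 : 0 < N := by rw [hNdef]; exact_mod_cast hN
  set w : ℝ := (1 - α) ^ s * N with hw
  have hp1 : (1 - α) ^ s ≤ 1 := pow_le_one₀ (by linarith) (by linarith)
  have hp0 : 0 ≤ (1 - α) ^ s := pow_nonneg (by linarith) _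
  -- the edge ahead of the walk is selected in the last step with probability `α`, independently of
  -- the past
  have e1 : tailVal α globalRule (s + 1) x ξ Finset.univ = (1 - α) * pathSum s (fun l y =>
      val α globalRule l ξ Finset.univ (fun _ Y => if y ∈ Y then 1 else 0)) x := by
    rw [tailVal_eq_pathSum, pathSum_snoc, ← pathSum_const_mul]
    refine pathSum_congr (fun l y _ => ?_) x
    have e2 : ∀ z, ∑ y', sibKer z y' * val α globalRule (l ++ [(y, z)]) ξ Finset.univ
        (fun _ _ => 1) = val α globalRule (l ++ [(y, z)]) ξ Finset.univ (fun _ _ => 1) := by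
      intro z
      rw [← Finset.sum_mul, sum_sibKer_right hd, one_mul]
    rw [Finset.sum_congr rfl fun z _ => e2 z]
    simp only [val_append]
    rw [← val_sum, ← val_const_mul]
    congr 1
    funext C Y
    simp only [val]
    rw [← envStep_sum]
    have e3 : ∀ (R : Finset (Edge d)) (η : Config d), R ⊆ globalRule C y →
        (∑ z, if y ∈ Y \ halfEdges R ∧ η.1 y = z then (1 : ℝ) else 0) =
        (if y ∈ Y then 1 else 0) * (if edgeAt C y ∈ R then 0 else 1) := by
      intro R η hR
      have := mem_halfEdges_iff (h := y) hR
      by_cases a : y ∈ Y <;> by_cases b : edgeAt C y ∈ R <;> simp [a, b, this]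
    rw [envStep_congr e3, envStep_const_mul, mul_comm,
      envStep_select (S := globalRule C y) (le_refl (edges C))
        (fun R => if edgeAt C y ∈ R then 0 else 1)]
    simp only [mul_ite, mul_zero, mul_one]
    rw [sum_selectProb_notMem]
    exact edgeAt_mem_edges C y
  have e2 : tailVal α globalRule s x ξ Finset.univ = pathSum s (fun l _ => followProb α ξ l) x :=
    tailVal_eq_pathSum s x ξ Finset.univ
  have e3 : tailVal α globalRule (s + 1) x ξ Finset.univ
        - (1 - α) ^ (s + 1) * tailVal α globalRule s x ξ Finset.univ
      = (1 - α) * pathSum s (fun l y =>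
          val α globalRule l ξ Finset.univ (fun _ Y => if y ∈ Y then 1 else 0)
            + (-(1 - α) ^ s) * followProb α ξ l) x := by
    rw [e1, e2, pathSum_add, pathSum_const_mul]
    ring
  rw [e3, abs_mul, abs_of_nonneg (by linarith : 0 ≤ 1 - α)]
  refine (mul_le_of_le_one_left (abs_nonneg _) (by linarith)).trans ?_
  refine (pathSum_abs_le _ _ _).trans ?_
  have key : ∀ (l : List (HalfEdge d × HalfEdge d)) (y : HalfEdge d), l.length = s →
      |val α globalRule l ξ Finset.univ (fun _ Y => if y ∈ Y then 1 else 0)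
            + (-(1 - α) ^ s) * followProb α ξ l| ≤
        (4 * s / N) * followProb α ξ l
        + (1 / N) * val α globalRule l ξ Finset.univ (fun _ Y => |(Y.card : ℝ) - w|)
        + (if y ∈ trace l ∨ ξ.1 y ∈ trace l then followProb α ξ l else 0) := by
    intro l y hl
    have := abs_val_mem_sub_le h0 h1 ξ l y (w := w) (by positivity)
      (by rw [← hNdef, hw]; nlinarith)
    rw [← hNdef, hl] at this
    have e4 : val α globalRule l ξ Finset.univ (fun _ Y => if y ∈ Y then 1 else 0)
            + (-(1 - α) ^ s) * followProb α ξ l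
        = (1 / N) * (N * val α globalRule l ξ Finset.univ (fun _ Y => if y ∈ Y then 1 else 0)
            - w * followProb α ξ l) := by
      rw [hw]
      field_simp
      ring
    rw [e4, abs_mul, abs_of_pos (by positivity : 0 < 1 / N)]
    refine (mul_le_mul_of_nonneg_left this (by positivity)).trans (le_of_eq ?_)
    split_ifs
    · field_simp
    · field_simp
      ring
  refine (pathSum_mono key x).trans ?_
  rw [pathSum_add, pathSum_add, pathSum_const_mul, pathSum_const_mul, ← e2]
  -- the total weight of the trajectories is at most one, and the number of half-edges that have not
  -- been rewired is compared to its mean without regard to the walk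
  have b1 := tailVal_le_one (K := globalRule) hd (fun C x => le_refl (edges C)) h0 h1 s x ξ
    Finset.univ
  have b2 := (pathSum_val_le_envVal (α := α) hd h0 h1 s x ξ Finset.univ
    (Φ := fun _ Y => |(Y.card : ℝ) - w|) (fun _ _ => abs_nonneg _)).trans
    (envVal_abs_card_sub_le h0 h1 s ξ hN)
  rw [← hNdef] at b2
  have b3 := mul_le_mul_of_nonneg_left b2 (by positivity : 0 ≤ 1 / N)
  have b4 : 1 / N * (√N * (1 / 2 + s)) = (1 / 2 + s) / √N := by
    have : √N ^ 2 = N := Real.sq_sqrt hN0.le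
    have h2 : 0 < √N := Real.sqrt_pos.2 hN0
    rw [div_mul_eq_mul_div, div_eq_div_iff hN0.ne' h2.ne']
    rw [← this]
    rw [Real.sqrt_sq h2.le]
    ring
  rw [b4] at b3
  have b5 : 4 * (s : ℝ) / N * tailVal α globalRule s x ξ Finset.univ ≤ 4 * s / N :=
    mul_le_of_le_one_right (by positivity) b1
  linarith

/-- Global rewiring, in averaged form and with an explicit error. -/
theorem sum_abs_tailProb_global_sub_le (hd : ∀ v, 2 ≤ d v) (h0 : 0 ≤ α) (h1 : α ≤ 1) (T : ℕ)
    (hT : 4 * T + 4 ≤ Fintype.card (HalfEdge d)) (x : HalfEdge d) :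
    ∑ ξ, |tailProb α globalRule x ξ T - ∏ s ∈ Finset.range T, (1 - α) ^ (s + 1)|
      ≤ Fintype.card (Config d) * (T * ((4 * T + (8 * T ^ 2 + 6 * T)) / Fintype.card (HalfEdge d)
          + (1 / 2 + T) / √(Fintype.card (HalfEdge d)))) := by
  classical
  set N : ℝ := (Fintype.card (HalfEdge d) : ℝ) with hNdef
  set M : ℝ := (Fintype.card (Config d) : ℝ) with hM
  have hN : 0 < Fintype.card (HalfEdge d) := by omega
  have hN0 : 0 < N := by rw [hNdef]; exact_mod_cast hN
  set c : ℝ := (4 * T + (8 * T ^ 2 + 6 * T)) / N + (1 / 2 + T) / √N with hc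
  have hM0 : 0 ≤ M := by positivity
  have hc0 : 0 ≤ c := by positivity
  suffices h : ∀ t ≤ T, ∑ ξ, |tailVal α globalRule t x ξ Finset.univ
      - ∏ s ∈ Finset.range t, (1 - α) ^ (s + 1)| ≤ M * (t * c) by
    simp only [tailProb_eq]
    exact h T le_rfl
  intro t
  induction t with
  | zero => simp [tailVal]
  | succ t ih =>
    intro ht
    have ih := ih (by omega)
    have htT : (t : ℝ) ≤ T := by exact_mod_cast (by omega : t ≤ T)
    have hp1 : (1 - α) ^ (t + 1) ≤ 1 := pow_le_one₀ (by linarith) (by linarith)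
    have hp0 : 0 ≤ (1 - α) ^ (t + 1) := pow_nonneg (by linarith) _
    have step : ∀ ξ : Config d, |tailVal α globalRule (t + 1) x ξ Finset.univ
        - ∏ s ∈ Finset.range (t + 1), (1 - α) ^ (s + 1)|
        ≤ |tailVal α globalRule t x ξ Finset.univ - ∏ s ∈ Finset.range t, (1 - α) ^ (s + 1)|
          + ((4 * t / N + (1 / 2 + t) / √N) + pathSum t (fun l y =>
            if y ∈ trace l ∨ ξ.1 y ∈ trace l then followProb α ξ l else 0) x) := by
      intro ξ
      have a := abs_tailVal_succ_sub_le hd h0 h1 t x ξ hN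
      rw [Finset.prod_range_succ]
      have e : tailVal α globalRule (t + 1) x ξ Finset.univ
          - (∏ s ∈ Finset.range t, (1 - α) ^ (s + 1)) * (1 - α) ^ (t + 1)
          = (1 - α) ^ (t + 1) * (tailVal α globalRule t x ξ Finset.univ
              - ∏ s ∈ Finset.range t, (1 - α) ^ (s + 1))
            + (tailVal α globalRule (t + 1) x ξ Finset.univ
              - (1 - α) ^ (t + 1) * tailVal α globalRule t x ξ Finset.univ) := by ring
      rw [e]
      refine (abs_add_le _ _).trans (add_le_add ?_ a)
      rw [abs_mul, abs_of_nonneg hp0]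
      exact mul_le_of_le_one_left (abs_nonneg _) hp1
    refine (Finset.sum_le_sum fun ξ _ => step ξ).trans ?_
    rw [Finset.sum_add_distrib, Finset.sum_add_distrib, Finset.sum_const, Finset.card_univ,
      nsmul_eq_mul, ← hM, ← pathSum_sum]
    have hb : pathSum t (fun l y => ∑ ξ : Config d,
        if y ∈ trace l ∨ ξ.1 y ∈ trace l then followProb α ξ l else 0) x
        ≤ t * ((4 * T + 1) * (2 / N) * M) + 2 * T * (2 / N) * M := by
      refine le_trans (le_of_eq ?_) (add_le_add
        (pathSum_return_le (s := t) hd h0 h1 hT (by omega) x)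
        (pathSum_partner_le (s := t) hd h0 h1 hT (by omega) x))
      rw [← pathSum_add]
      refine pathSum_congr (fun l y _ => ?_) x
      by_cases hy : y ∈ trace l <;> simp [hy]
    have hM1 : M * (4 * t / N + (1 / 2 + t) / √N) ≤ M * (4 * T / N + (1 / 2 + T) / √N) := by
      gcongr
    have hM2 : t * ((4 * T + 1) * (2 / N) * M) + 2 * T * (2 / N) * M
        ≤ M * ((8 * T ^ 2 + 6 * T) / N) := by
      have : t * ((4 * T + 1) * (2 / N) * M) ≤ T * ((4 * T + 1) * (2 / N) * M) := by gcongr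
      refine (add_le_add_left this _).trans (le_of_eq ?_)
      field_simp
      ring
    have hM3 : M * (4 * T / N + (1 / 2 + T) / √N) + M * ((8 * T ^ 2 + 6 * T) / N) = M * c := by
      rw [hc]
      ring
    push_cast
    nlinarith

end DynCM

/-! ### From averaged estimates to convergence in probability -/

namespace DynCM

/-- Markov's inequality for the uniform distribution. -/
lemma one_sub_le_uniformProb {Ω : Type*} [Fintype Ω] [Nonempty Ω] {E : Ω → Prop} {f : Ω → ℝ}
    {ε δ : ℝ} (hε : 0 < ε) (hf : ∀ ω, 0 ≤ f ω) (hE : ∀ ω, ¬ E ω → ε ≤ f ω)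
    (hsum : ∑ ω, f ω ≤ δ * Fintype.card Ω) : 1 - δ / ε ≤ uniformProb E := by
  classical
  have hc : (0 : ℝ) < Fintype.card Ω := by exact_mod_cast Fintype.card_pos
  have h1 : ((Finset.univ.filter fun ω => ¬ E ω).card : ℝ) * ε ≤ δ * Fintype.card Ω := by
    refine le_trans ?_ hsum
    rw [← nsmul_eq_mul]
    refine (Finset.card_nsmul_le_sum _ f ε fun ω hω => hE ω (Finset.mem_filter.1 hω).2).trans ?_
    exact Finset.sum_le_sum_of_subset_of_nonneg (Finset.subset_univ _) fun ω _ _ => hf ω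
  have h2 : ((Finset.univ.filter E).card : ℝ) + ((Finset.univ.filter fun ω => ¬ E ω).card : ℝ)
      = Fintype.card Ω := by
    have := Finset.card_filter_add_card_filter_not (s := (Finset.univ : Finset Ω)) E
    rw [Finset.card_univ] at this
    exact_mod_cast this
  have h3 : uniformProb E = ((Finset.univ.filter E).card : ℝ) / Fintype.card Ω := by
    unfold uniformProb
    congr!
  rw [h3, le_div_iff₀ hc]
  have h4 : (1 - δ / ε) * Fintype.card Ω = Fintype.card Ω - δ * Fintype.card Ω / ε := by
    field_simp
  rw [h4, sub_le_iff_le_add]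
  have h5 := (le_div_iff₀ hε).2 h1
  linarith

lemma uniformProb_le_one {Ω : Type*} [Fintype Ω] (E : Ω → Prop) : uniformProb E ≤ 1 := by
  classical
  unfold uniformProb
  refine div_le_one_of_le₀ ?_ (by positivity)
  exact_mod_cast Finset.card_le_univ _

lemma card_halfEdge {n : ℕ} (d : Fin n → ℕ) : Fintype.card (HalfEdge d) = ∑ v, d v := by
  simp [Fintype.card_sigma]

lemma nonempty_config {n : ℕ} {d : Fin n → ℕ} (h : Even (∑ v, d v)) : Nonempty (Config d) := by
  obtain ⟨k, hk⟩ := h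
  have e : Nonempty (HalfEdge d ≃ Fin k × Bool) := by
    refine ⟨Fintype.equivOfCardEq ?_⟩
    rw [card_halfEdge, hk, Fintype.card_prod, Fintype.card_fin, Fintype.card_bool]
    omega
  obtain ⟨e⟩ := e
  refine ⟨⟨fun h => e.symm ((e h).1, !(e h).2), fun h => ⟨fun hh => ?_, by simp⟩⟩⟩
  have := congrArg (fun g => (e g).2) hh
  simp at this

lemma two_mul_le_card {n : ℕ} {d : Fin n → ℕ} (hd : ∀ v, 2 ≤ d v) :
    2 * n ≤ Fintype.card (HalfEdge d) := by
  rw [card_halfEdge]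
  calc 2 * n = ∑ _v : Fin n, 2 := by simp [mul_comm]
    _ ≤ _ := Finset.sum_le_sum fun v _ => hd v

lemma evenAtTop_le (d : (n : ℕ) → Fin n → ℕ) : evenAtTop d ≤ atTop := inf_le_left

lemma eventually_even (d : (n : ℕ) → Fin n → ℕ) : ∀ᶠ n in evenAtTop d, Even (∑ v, d n v) :=
  mem_inf_of_right (mem_principal_self _)

/-- Convergence in probability follows from an averaged estimate. -/
lemma tailTendsto_of_sum_le {d : (n : ℕ) → Fin n → ℕ} (hd : ∀ n v, 2 ≤ d n v) {α : ℕ → ℝ}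
    {K : (n : ℕ) → Rule (d n)} {t : ℕ → ℕ} {ℓ : ℝ} {ℓ' δ : ℕ → ℝ}
    (hℓ : Tendsto ℓ' (evenAtTop d) (𝓝 ℓ)) (hδ : Tendsto δ (evenAtTop d) (𝓝 0))
    (h : ∀ᶠ n in evenAtTop d, ∑ x, ∑ ξ, |tailProb (α n) (K n) x ξ (t n) - ℓ' n|
      ≤ δ n * (Fintype.card (HalfEdge (d n)) * Fintype.card (Config (d n)))) :
    TailTendsto d α K t ℓ := by
  intro ε hε
  have hl : Tendsto (fun n => 1 - δ n / (ε / 2)) (evenAtTop d) (𝓝 1) := by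
    simpa using (hδ.div_const (ε / 2)).const_sub 1
  refine tendsto_of_tendsto_of_tendsto_of_le_of_le' hl tendsto_const_nhds ?_
    (Eventually.of_forall fun n => uniformProb_le_one _)
  have hℓ2 : ∀ᶠ n in evenAtTop d, |ℓ' n - ℓ| < ε / 2 := by
    have := (Metric.tendsto_nhds.1 hℓ) (ε / 2) (by linarith)
    simpa [Real.dist_eq] using this
  have hn : ∀ᶠ n in evenAtTop d, 1 ≤ n := evenAtTop_le d (eventually_ge_atTop 1)
  filter_upwards [h, hℓ2, hn, eventually_even d] with n h1 h2 h3 h4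
  have hne : Nonempty (HalfEdge (d n)) := by
    rw [← Fintype.card_pos_iff]
    have := two_mul_le_card (hd n)
    omega
  have := nonempty_config h4
  refine one_sub_le_uniformProb (f := fun p => |tailProb (α n) (K n) p.1 p.2 (t n) - ℓ' n|)
    (by linarith) (fun _ => abs_nonneg _) ?_ ?_
  · intro p hp
    have := abs_sub_le (tailProb (α n) (K n) p.1 p.2 (t n)) (ℓ' n) ℓ
    rw [not_lt] at hp
    linarith
  · rw [Fintype.sum_prod_type, Fintype.card_prod]
    push_cast
    exact h1

/-! ### Elementary limits -/

lemma tendsto_one_sub_pow {l : Filter ℕ} {α : ℕ → ℝ} {m : ℕ → ℕ} {c : ℝ}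
    (hα : ∀ n, 0 < α n) (hα0 : Tendsto α l (𝓝 0))
    (h : Tendsto (fun n => α n * m n) l (𝓝 c)) :
    Tendsto (fun n => (1 - α n) ^ m n) l (𝓝 (Real.exp (-c))) := by
  have hder : HasDerivAt (fun x : ℝ => Real.log (1 - x)) (-1) 0 := by
    have h1 : HasDerivAt (fun x : ℝ => 1 - x) (-1) 0 := by
      simpa using (hasDerivAt_id (0 : ℝ)).const_sub 1
    simpa using h1.log (by norm_num)
  have hslope := (hasDerivAt_iff_tendsto_slope.1 hder)
  have hα' : Tendsto α l (𝓝[≠] 0) :=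
    tendsto_nhdsWithin_iff.2 ⟨hα0, Eventually.of_forall fun n => (hα n).ne'⟩
  have h2 : Tendsto (fun n => Real.log (1 - α n) / α n) l (𝓝 (-1)) := by
    refine (hslope.comp hα').congr fun n => ?_
    simp [slope_def_field]
  have h3 : Tendsto (fun n => (α n * m n) * (Real.log (1 - α n) / α n)) l (𝓝 (-c)) := by
    simpa using h.mul h2
  refine ((Real.continuous_exp.tendsto _).comp h3).congr' ?_
  filter_upwards [hα0.eventually (gt_mem_nhds (show (0 : ℝ) < 1 by norm_num))] with n hn
  have hpos : 0 < 1 - α n := by linarith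
  have e : (α n * m n) * (Real.log (1 - α n) / α n) = m n * Real.log (1 - α n) := by
    field_simp [(hα n).ne']
  simp only [Function.comp_apply]
  rw [e, mul_comm, Real.exp_mul, Real.exp_log hpos, Real.rpow_natCast]

lemma tendsto_mul_floor_div {l : Filter ℕ} {a : ℕ → ℝ} (ha : ∀ n, 0 < a n)
    (ha0 : Tendsto a l (𝓝 0)) {c : ℝ} (hc : 0 < c) :
    Tendsto (fun n => a n * (⌊c / a n⌋₊ : ℝ)) l (𝓝 c) := by
  have h1 : Tendsto (fun n => c - a n) l (𝓝 c) := by simpa using ha0.const_sub c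
  refine tendsto_of_tendsto_of_tendsto_of_le_of_le h1 tendsto_const_nhds (fun n => ?_) fun n => ?_
  · have h2 := Nat.lt_floor_add_one (c / a n)
    rw [div_lt_iff₀ (ha n)] at h2
    show c - a n ≤ a n * (⌊c / a n⌋₊ : ℝ)
    linarith
  · have h2 := Nat.floor_le (div_pos hc (ha n)).le
    rw [le_div_iff₀ (ha n)] at h2
    show a n * (⌊c / a n⌋₊ : ℝ) ≤ c
    linarith

/-- A power of a sequence of logarithmic order is negligible against any power of `n`. -/
lemma tendsto_pow_div_rpow {l : Filter ℕ} (hl : l ≤ atTop) {U : ℕ → ℝ}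
    (hU : U =O[l] fun n => Real.log n) (k : ℕ) {δ : ℝ} (hδ : 0 < δ) :
    Tendsto (fun n => U n ^ k / (n : ℝ) ^ δ) l (𝓝 0) := by
  have h1 : (fun n => U n ^ k) =O[l] fun n => Real.log n ^ k := hU.pow k
  have h2 : (fun n : ℕ => Real.log n ^ k) =o[l] fun n : ℕ => (n : ℝ) ^ δ := by
    have h3 := (isLittleO_log_rpow_rpow_atTop (k : ℝ) hδ).comp_tendsto
      ((tendsto_natCast_atTop_atTop (R := ℝ)).mono_left hl)
    refine h3.congr_left fun n => ?_
    simp [Function.comp_apply, Real.rpow_natCast]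
  exact (h1.trans_isLittleO h2).tendsto_div_nhds_zero

lemma isBigO_add_one {l : Filter ℕ} (hl : l ≤ atTop) {U : ℕ → ℝ}
    (hU : U =O[l] fun n => Real.log n) : (fun n => U n + 1) =O[l] fun n => Real.log n := by
  refine hU.add ?_
  have : Tendsto (fun n : ℕ => ‖Real.log n‖) l atTop :=
    tendsto_norm_atTop_atTop.comp
      ((Real.tendsto_log_atTop.comp tendsto_natCast_atTop_atTop).mono_left hl)
  exact ((isLittleO_const_left (c := (1 : ℝ))).2 (Or.inr this)).isBigO

/-! ### Local and global rewiring -/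

theorem tailTendsto_local {d : (n : ℕ) → Fin n → ℕ} (hd : ∀ n v, 2 ≤ d n v) {α : ℕ → ℝ}
    (hα : ∀ n, 0 < α n ∧ α n ≤ 1) (hα0 : Tendsto α (evenAtTop d) (𝓝 0)) {c : ℝ} (hc : 0 < c) :
    TailTendsto d α (fun _ => localRule) (fun n => ⌊c / α n⌋₊) (Real.exp (-c)) := by
  refine tailTendsto_of_sum_le hd (δ := fun _ => 0)
    (tendsto_one_sub_pow (fun n => (hα n).1) hα0
      (tendsto_mul_floor_div (fun n => (hα n).1) hα0 hc)) tendsto_const_nhds ?_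
  refine Eventually.of_forall fun n => ?_
  simp [tailProb_local (hd n)]

theorem tailTendsto_global {d : (n : ℕ) → Fin n → ℕ} (hd : ∀ n v, 2 ≤ d n v) {α : ℕ → ℝ}
    (hα : ∀ n, 0 < α n ∧ α n ≤ 1) (hα0 : Tendsto α (evenAtTop d) (𝓝 0)) {c : ℝ} (hc : 0 < c)
    (hlog : (fun n => (⌊c / √(α n)⌋₊ : ℝ)) =O[evenAtTop d] (fun n => Real.log n)) :
    TailTendsto d α (fun _ => globalRule) (fun n => ⌊c / √(α n)⌋₊) (Real.exp (-c ^ 2 / 2)) := by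
  set T : ℕ → ℕ := fun n => ⌊c / √(α n)⌋₊ with hT
  have hs : ∀ n, 0 < √(α n) := fun n => Real.sqrt_pos.2 (hα n).1
  have hs0 : Tendsto (fun n => √(α n)) (evenAtTop d) (𝓝 0) := by
    have h := (Real.continuous_sqrt.tendsto 0).comp hα0
    rw [Real.sqrt_zero] at h
    exact h
  have hsT := tendsto_mul_floor_div hs hs0 hc
  have hprod : ∀ (a : ℝ) (t : ℕ), ∏ s ∈ Finset.range t, (1 - a) ^ (s + 1)
      = (1 - a) ^ (∑ s ∈ Finset.range t, (s + 1)) := fun a t => Finset.prod_pow_eq_pow_sum _ _ _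
  have hsum : ∀ t : ℕ, ((∑ s ∈ Finset.range t, (s + 1) : ℕ) : ℝ) = t * (t + 1) / 2 := by
    intro t
    induction t with
    | zero => simp
    | succ t ih =>
      rw [Finset.sum_range_succ]
      push_cast at ih ⊢
      rw [ih]
      ring
  have hlim : Tendsto (fun n => ∏ s ∈ Finset.range (T n), (1 - α n) ^ (s + 1)) (evenAtTop d)
      (𝓝 (Real.exp (-c ^ 2 / 2))) := by
    simp only [hprod]
    have h1 : -c ^ 2 / 2 = -((c * c + 0 * c) / 2) := by ring
    rw [h1]
    refine tendsto_one_sub_pow (fun n => (hα n).1) hα0 ?_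
    refine (((hsT.mul hsT).add (hs0.mul hsT)).div_const 2).congr fun n => ?_
    rw [hsum]
    have := Real.mul_self_sqrt (hα n).1.le
    simp only [hT]
    linear_combination (⌊c / √(α n)⌋₊ * (⌊c / √(α n)⌋₊ + 1) / 2 : ℝ) * this
  have hU := isBigO_add_one (evenAtTop_le d) hlog
  have hδ : Tendsto (fun n => 20 * (((T n : ℝ) + 1) ^ 3 / (n : ℝ) ^ (1 / 2 : ℝ)))
      (evenAtTop d) (𝓝 0) := by
    simpa using (tendsto_pow_div_rpow (evenAtTop_le d) hU 3
      (by norm_num : (0 : ℝ) < 1 / 2)).const_mul 20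
  refine tailTendsto_of_sum_le hd hlim hδ ?_
  have h1 := tendsto_pow_div_rpow (evenAtTop_le d) hU 1 (by norm_num : (0 : ℝ) < 1)
  have h2 := h1.eventually (gt_mem_nhds (show (0 : ℝ) < 1 / 4 by norm_num))
  have hn : ∀ᶠ n in evenAtTop d, 1 ≤ n := evenAtTop_le d (eventually_ge_atTop 1)
  filter_upwards [h2, hn] with n h3 h4
  have h5 : (1 : ℝ) ≤ n := by exact_mod_cast h4
  rw [Real.rpow_one, pow_one, div_lt_iff₀ (by linarith)] at h3
  have h6 : 2 * (n : ℝ) ≤ Fintype.card (HalfEdge (d n)) := by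
    exact_mod_cast two_mul_le_card (hd n)
  have h7 : 4 * T n + 4 ≤ Fintype.card (HalfEdge (d n)) := by
    have : 4 * (T n : ℝ) + 4 ≤ Fintype.card (HalfEdge (d n)) := by
      simp only [hT]
      linarith
    exact_mod_cast this
  refine (Finset.sum_le_sum fun x _ =>
    sum_abs_tailProb_global_sub_le (hd n) (hα n).1.le (hα n).2 (T n) h7 x).trans ?_
  rw [Finset.sum_const, Finset.card_univ, nsmul_eq_mul]
  set N : ℝ := (Fintype.card (HalfEdge (d n)) : ℝ) with hN
  set M : ℝ := (Fintype.card (Config (d n)) : ℝ) with hM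
  have hM0 : 0 ≤ M := by positivity
  set t : ℝ := (T n : ℝ) with ht
  have ht0 : 0 ≤ t := by positivity
  have hN1 : 1 ≤ √n := Real.one_le_sqrt.2 h5
  have hN2 : √n ≤ √N := Real.sqrt_le_sqrt (by linarith)
  have hN3 : √n ≤ N := by
    have := Real.sq_sqrt (by linarith : (0 : ℝ) ≤ n)
    nlinarith
  have e1 : (4 * t + (8 * t ^ 2 + 6 * t)) / N ≤ (4 * t + (8 * t ^ 2 + 6 * t)) / √n := by gcongr
  have e2 : (1 / 2 + t) / √N ≤ (1 / 2 + t) / √n := by gcongr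
  have e3 : t * ((4 * t + (8 * t ^ 2 + 6 * t)) / N + (1 / 2 + t) / √N)
      ≤ 20 * ((t + 1) ^ 3 / √n) := by
    refine (mul_le_mul_of_nonneg_left (add_le_add e1 e2) ht0).trans ?_
    rw [← add_div, ← mul_div_assoc, ← mul_div_assoc]
    refine div_le_div_of_nonneg_right ?_ (by positivity)
    nlinarith [pow_nonneg ht0 2, pow_nonneg ht0 3]
  rw [← Real.sqrt_eq_rpow]
  calc N * (M * (t * ((4 * t + (8 * t ^ 2 + 6 * t)) / N + (1 / 2 + t) / √N)))
      ≤ N * (M * (20 * ((t + 1) ^ 3 / √n))) := by gcongr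
    _ = 20 * ((t + 1) ^ 3 / √n) * (N * M) := by ring

end DynCM

/-! ### The law of a single rewiring -/

namespace DynCM

variable {n : ℕ} {d : Fin n → ℕ} {α : ℝ}

/-- The configuration `C` contains all the pairs in the list `M`. -/
def Joins (C : Config d) (M : List (HalfEdge d × HalfEdge d)) : Prop := ∀ p ∈ M, C.1 p.1 = p.2

lemma joins_nil (C : Config d) : Joins C [] := fun _ h => absurd h List.not_mem_nil

lemma joins_cons {C : Config d} {h g : HalfEdge d} {M : List (HalfEdge d × HalfEdge d)} :
    Joins C ((h, g) :: M) ↔ C.1 h = g ∧ Joins C M := by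
  simp [Joins]

lemma joins_append {C : Config d} {M M' : List (HalfEdge d × HalfEdge d)} :
    Joins C (M ++ M') ↔ Joins C M ∧ Joins C M' := by
  simp only [Joins, List.mem_append]
  exact ⟨fun h => ⟨fun p hp => h p (Or.inl hp), fun p hp => h p (Or.inr hp)⟩,
    fun h p hp => hp.elim (h.1 p) (h.2 p)⟩

lemma joins_conj {C : Config d} {π : Equiv.Perm (HalfEdge d)}
    {M : List (HalfEdge d × HalfEdge d)} (h : ∀ p ∈ M, π p.1 = p.1 ∧ π p.2 = p.2) :
    Joins (conj π C) M ↔ Joins C M := by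
  refine forall₂_congr fun p hp => ?_
  have := conj_apply π C p.1
  rw [(h p hp).1] at this
  rw [this]
  nth_rewrite 1 [← (h p hp).2]
  exact π.injective.eq_iff

lemma mapEdges_eq_self {π : Equiv.Perm (HalfEdge d)} {R : Finset (Edge d)}
    (h : ∀ a ∈ halfEdges R, π a = a) : mapEdges π R = R := by
  classical
  unfold mapEdges
  rw [Finset.map_eq_image]
  refine (Finset.image_congr fun e he => ?_).trans Finset.image_id
  induction e using Sym2.inductionOn with
  | hf a b =>
    have ha := h a (mem_halfEdges.2 ⟨_, he, Sym2.mem_mk_left a b⟩)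
    have hb := h b (mem_halfEdges.2 ⟨_, he, Sym2.mem_mk_right a b⟩)
    change edgePerm π s(a, b) = s(a, b)
    rw [edgePerm_mk, ha, hb]

/-- The outcome of a rewiring that does not break up everything. -/
lemma exists_rewire_eq {C η : Config d} {R : Finset (Edge d)} (hR : R ⊆ edges C)
    (hlt : R.card < (edges C \ R).card) (h : repairProb C R η ≠ 0) :
    ∃ R' ⊆ edges C \ R, ∃ f : halfEdges R ≃ halfEdges R', rewire C R R' f = η := by
  classical
  unfold repairProb at h
  rw [if_neg (not_le.2 hlt)] at h
  obtain ⟨h, -⟩ := div_ne_zero_iff.1 h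
  obtain ⟨R', hR', hne⟩ := Finset.exists_ne_zero_of_sum_ne_zero h
  rw [Finset.mem_powersetCard] at hR'
  refine ⟨R', hR'.1, ?_⟩
  unfold uniformProb at hne
  obtain ⟨hne, -⟩ := div_ne_zero_iff.1 hne
  have hne : (Finset.univ.filter fun f : halfEdges R ≃ halfEdges R' =>
        (∀ h : halfEdges R, η.1 h = f h) ∧
          ∀ h : HalfEdge d, h ∉ halfEdges R → h ∉ halfEdges R' → η.1 h = C.1 h).card ≠ 0 := by
    intro e
    refine hne ?_
    rw [← Nat.cast_zero, ← e]
    congr!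
  obtain ⟨f, hf⟩ := Finset.card_ne_zero.1 hne
  exact ⟨f, (eq_rewire_iff hR hR'.1 f η).1 (Finset.mem_filter.1 hf).2⟩

lemma apply_notMem_of_repairProb {C η : Config d} {R : Finset (Edge d)} (hR : R ⊆ edges C)
    (hlt : R.card < (edges C \ R).card) (h : repairProb C R η ≠ 0) {a : HalfEdge d}
    (ha : a ∈ halfEdges R) : η.1 a ∉ halfEdges R := by
  obtain ⟨R', hR', f, rfl⟩ := exists_rewire_eq hR hlt h
  rw [rewire_apply hR hR', rewireFun, dif_pos ha]
  exact notMem_halfEdges_of_mem hR hR' (f ⟨a, ha⟩).2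

lemma apply_eq_of_repairProb {C η : Config d} {R : Finset (Edge d)} (hR : R ⊆ edges C)
    (hlt : R.card < (edges C \ R).card) (h : repairProb C R η ≠ 0) {a : HalfEdge d}
    (ha : a ∉ halfEdges R) (ha' : η.1 a ∉ halfEdges R) : η.1 a = C.1 a := by
  obtain ⟨R', hR', f, rfl⟩ := exists_rewire_eq hR hlt h
  rw [rewire_apply hR hR', rewireFun, dif_neg ha] at ha' ⊢
  split_ifs at ha' ⊢ with h2
  · exact absurd (f.symm ⟨a, h2⟩).2 ha'
  · rfl

lemma repairProb_conj_self {C : Config d} {π : Equiv.Perm (HalfEdge d)} {R : Finset (Edge d)}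
    (hC : ∀ h, π (C.1 h) = C.1 (π h)) (h : ∀ a ∈ halfEdges R, π a = a) (η : Config d) :
    repairProb C R (conj π η) = repairProb C R η := by
  have := repairProb_conj π C R η
  rwa [conj_eq_self hC, mapEdges_eq_self h] at this

/-- The half-edges that are rewired are exchangeable. -/
lemma repairProb_conj_swap {C : Config d} {R : Finset (Edge d)} (hR : R ⊆ edges C)
    (hlt : R.card < (edges C \ R).card) {x x' : HalfEdge d} (hx : x ∈ halfEdges R)
    (hx' : x' ∈ halfEdges R) (η : Config d) :
    repairProb C R (conj (Equiv.swap x x') η) = repairProb C R η := by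
  classical
  unfold repairProb
  rw [if_neg (not_le.2 hlt), if_neg (not_le.2 hlt)]
  congr 1
  refine Finset.sum_congr rfl fun R' hR' => ?_
  rw [Finset.mem_powersetCard] at hR'
  set τ : Equiv.Perm (halfEdges R) := Equiv.swap ⟨x, hx⟩ ⟨x', hx'⟩ with hτ
  have hτv : ∀ a : halfEdges R, ((τ a : halfEdges R) : HalfEdge d) = Equiv.swap x x' a := by
    intro a
    rw [hτ, Equiv.swap_apply_def, Equiv.swap_apply_def]
    split_ifs <;> simp_all [Subtype.ext_iff]
  have hfix : ∀ a, a ∉ halfEdges R → Equiv.swap x x' a = a := fun a ha =>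
    Equiv.swap_apply_of_ne_of_ne (fun e => ha (e ▸ hx)) (fun e => ha (e ▸ hx'))
  have hτ2 : ∀ a, Equiv.swap x x' (Equiv.swap x x' a) = a := fun a => by
    rw [← Equiv.trans_apply, Equiv.swap_swap, Equiv.refl_apply]
  have hconj : ∀ a, (conj (Equiv.swap x x') η).1 (Equiv.swap x x' a)
      = Equiv.swap x x' (η.1 a) := fun a => conj_apply _ _ _
  have hf : ∀ (f : halfEdges R ≃ halfEdges R') a, Equiv.swap x x' (f a) = f a := fun f a =>
    hfix _ (notMem_halfEdges_of_mem hR hR'.1 (f a).2)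
  refine uniformProb_congr (τ.equivCongr (Equiv.refl _)) fun f => ?_
  have e1 : ∀ a, (τ.equivCongr (Equiv.refl (halfEdges R'))) f a = f (τ a) := by
    intro a
    simp [Equiv.equivCongr, hτ]
  refine and_congr ⟨fun h a => ?_, fun h a => ?_⟩ ⟨fun h a h1 h2 => ?_, fun h a h1 h2 => ?_⟩
  · have h3 := h (τ a)
    rw [e1, hτv, hconj] at h3
    have h4 : τ (τ a) = a := by
      rw [hτ, ← Equiv.trans_apply, Equiv.swap_swap, Equiv.refl_apply]
    rw [h4, ← hf f a] at h3
    exact (Equiv.injective _) h3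
  · have h3 := h (τ a)
    rw [e1]
    have h5 := hconj (τ a)
    rw [hτv, hτ2] at h5
    rw [h5, ← hf f, ← h3, hτv]
  · have h3 := h a h1 h2
    have h4 := hconj a
    rw [hfix a h1, h3] at h4
    have hCa : C.1 a ∉ halfEdges R := fun e => h1 ((partner_mem_halfEdges hR).1 e)
    rw [← hfix _ hCa] at h4
    exact ((Equiv.injective _) h4).symm
  · have h3 := h a h1 h2
    have h4 := hconj a
    have hCa : C.1 a ∉ halfEdges R := fun e => h1 ((partner_mem_halfEdges hR).1 e)
    rw [hfix a h1, h3, hfix _ hCa] at h4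
    exact h4

open Classical in
/-- Probability that a rewiring of the edges in `R` creates all the pairs in `N`. -/
noncomputable def joinProb (C : Config d) (R : Finset (Edge d))
    (N : List (HalfEdge d × HalfEdge d)) : ℝ :=
  ∑ η, repairProb C R η * if Joins η N then 1 else 0

lemma joinProb_nonneg (C : Config d) (R : Finset (Edge d))
    (N : List (HalfEdge d × HalfEdge d)) : 0 ≤ joinProb C R N :=
  Finset.sum_nonneg fun η _ => mul_nonneg (repairProb_nonneg _ _ _) (by split_ifs <;> norm_num)

lemma joinProb_eq_zero {C : Config d} {R : Finset (Edge d)} (hR : R ⊆ edges C)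
    (hlt : R.card < (edges C \ R).card) {N : List (HalfEdge d × HalfEdge d)}
    {p : HalfEdge d × HalfEdge d} (hp : p ∈ N) (h1 : p.1 ∈ halfEdges R)
    (h2 : p.2 ∈ halfEdges R) : joinProb C R N = 0 := by
  refine Finset.sum_eq_zero fun η _ => ?_
  by_contra hne
  obtain ⟨ha, hb⟩ := mul_ne_zero_iff.1 hne
  have hj : Joins η N := by
    by_contra h
    exact hb (if_neg h)
  exact apply_notMem_of_repairProb hR hlt ha h1 (hj p hp ▸ h2)

lemma joinProb_cons_eq {C : Config d} {R : Finset (Edge d)} {N : List (HalfEdge d × HalfEdge d)}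
    {π : Equiv.Perm (HalfEdge d)} (hπ : ∀ η, repairProb C R (conj π η) = repairProb C R η)
    (hN : ∀ p ∈ N, π p.1 = p.1 ∧ π p.2 = p.2) (h g : HalfEdge d) :
    joinProb C R ((π h, π g) :: N) = joinProb C R ((h, g) :: N) := by
  classical
  unfold joinProb
  rw [← (conjEquiv π).sum_comp]
  refine Finset.sum_congr rfl fun η _ => ?_
  change repairProb C R (conj π η) * (if Joins (conj π η) ((π h, π g) :: N) then 1 else 0) = _
  rw [hπ]
  congr 1
  refine if_congr ?_ rfl rfl
  rw [joins_cons, joins_cons, joins_conj hN, conj_apply, π.injective.eq_iff]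

lemma sum_joinProb_cons_right (C : Config d) (R : Finset (Edge d))
    (N : List (HalfEdge d × HalfEdge d)) (h : HalfEdge d) :
    ∑ g, joinProb C R ((h, g) :: N) = joinProb C R N := by
  classical
  unfold joinProb
  rw [Finset.sum_comm]
  refine Finset.sum_congr rfl fun η _ => ?_
  rw [← Finset.mul_sum]
  congr 1
  simp only [joins_cons, ite_and]
  simp

lemma sum_joinProb_cons_left (C : Config d) (R : Finset (Edge d))
    (N : List (HalfEdge d × HalfEdge d)) (g : HalfEdge d) :
    ∑ h, joinProb C R ((h, g) :: N) = joinProb C R N := by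
  classical
  rw [← sum_joinProb_cons_right C R N g]
  refine Finset.sum_congr rfl fun h _ => ?_
  unfold joinProb
  refine Finset.sum_congr rfl fun η _ => ?_
  congr 1
  refine if_congr ?_ rfl rfl
  rw [joins_cons, joins_cons]
  refine and_congr_left fun _ => ?_
  constructor <;> rintro rfl <;> exact config_invol _ _

lemma card_halfEdges_sdiff_lt {C : Config d} {R : Finset (Edge d)} (hR : R ⊆ edges C)
    (hlt : R.card < (edges C \ R).card) :
    2 * (2 * R.card) < Fintype.card (HalfEdge d) := by
  rw [Finset.card_sdiff_of_subset hR] at hlt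
  rw [card_halfEdge_eq C]
  omega

/-- A new partner `g` is unlikely to be hit when its edge is not yet known to take part in the
rewiring. -/
lemma joinProb_cons_le_of_fresh {C : Config d} {R : Finset (Edge d)} (hR : R ⊆ edges C)
    {N : List (HalfEdge d × HalfEdge d)} {k : ℝ}
    (hN : ∀ p ∈ N, p.1 ∈ halfEdges R) (hk : 2 * (R.card : ℝ) + 2 * N.length ≤ k)
    (hkN : k < Fintype.card (HalfEdge d)) {h g : HalfEdge d} (hh : h ∈ halfEdges R)
    (hg : g ∉ halfEdges R) (h1 : g ∉ N.map Prod.snd) (h2 : C.1 g ∉ N.map Prod.snd) :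
    joinProb C R ((h, g) :: N) ≤ joinProb C R N / (Fintype.card (HalfEdge d) - k) := by
  classical
  set A : Finset (HalfEdge d) := (N.map Prod.snd).toFinset with hA
  set F : Finset (HalfEdge d) := halfEdges R ∪ (A ∪ A.image C.1) with hF
  have hmem : ∀ a, a ∉ F → a ∉ halfEdges R ∪ A ∧ C.1 a ∉ halfEdges R ∪ A := by
    intro a ha
    simp only [hF, Finset.mem_union, not_or] at ha ⊢
    refine ⟨⟨ha.1, ha.2.1⟩, fun e => ha.1 ((partner_mem_halfEdges hR).1 e), fun e => ha.2.2 ?_⟩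
    exact Finset.mem_image.2 ⟨_, e, config_invol C a⟩
  refine le_div_of_eq_off (F := F) (G := fun g => joinProb C R ((h, g) :: N))
    (fun g => joinProb_nonneg _ _ _) ?_ (sum_joinProb_cons_right C R N h).le ?_ hkN ?_
  · intro y y' hy hy'
    obtain ⟨π, hfix, hcomm, hπ⟩ := exists_perm_comm C (hmem y hy).1 (hmem y hy).2
      (hmem y' hy').1 (hmem y' hy').2
    have hfixR : ∀ a ∈ halfEdges R, π a = a := fun a ha =>
      hfix a (Finset.mem_union_left _ ha)
    have := joinProb_cons_eq (repairProb_conj_self hcomm hfixR) (N := N) (fun p hp =>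
      ⟨hfixR _ (hN p hp), hfix _ (Finset.mem_union_right _ (by
        rw [hA, List.mem_toFinset]
        exact List.mem_map_of_mem hp))⟩) h y
    rw [hfixR h hh, hπ] at this
    exact this.symm
  · refine le_trans ?_ hk
    have c1 := Finset.card_union_le (halfEdges R) (A ∪ A.image C.1)
    have c2 := Finset.card_union_le A (A.image C.1)
    have c3 := Finset.card_image_le (s := A) (f := C.1)
    have c4 : A.card ≤ N.length := by
      have := (N.map Prod.snd).toFinset_card_le
      rwa [List.length_map] at this
    have c5 := card_halfEdges hR
    have : F.card ≤ 2 * R.card + 2 * N.length := by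
      rw [hF]
      omega
    exact_mod_cast this
  · simp only [hF, Finset.mem_union, not_or]
    refine ⟨hg, by rwa [hA, List.mem_toFinset], fun e => h2 ?_⟩
    obtain ⟨a, ha, rfl⟩ := Finset.mem_image.1 e
    rw [config_invol]
    rwa [hA, List.mem_toFinset] at ha

/-- A given new partner is matched with each of the remaining rewired half-edges with the same
probability. -/
lemma joinProb_cons_le {C : Config d} {R : Finset (Edge d)} (hR : R ⊆ edges C)
    (hlt : R.card < (edges C \ R).card) {N : List (HalfEdge d × HalfEdge d)}
    (hN2 : ∀ p ∈ N, p.2 ∉ halfEdges R)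
    (hc : N.length < 2 * R.card) {h g : HalfEdge d} (hh : h ∈ halfEdges R)
    (hg : g ∉ halfEdges R) (h1 : h ∉ N.map Prod.fst) :
    joinProb C R ((h, g) :: N) ≤ joinProb C R N / (2 * R.card - N.length) := by
  classical
  set A : Finset (HalfEdge d) := (N.map Prod.fst).toFinset with hA
  have c4 : A.card ≤ N.length := by
    have := (N.map Prod.fst).toFinset_card_le
    rwa [List.length_map] at this
  have c5 := card_halfEdges hR
  have c6 := card_halfEdges_sdiff_lt hR hlt
  have c7 : (halfEdges R)ᶜ.card = Fintype.card (HalfEdge d) - 2 * R.card := by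
    rw [Finset.card_compl, c5]
  have hc' : (N.length : ℝ) < 2 * R.card := by exact_mod_cast hc
  have key := le_div_of_eq_off (F := (halfEdges R)ᶜ ∪ A)
    (G := fun h => joinProb C R ((h, g) :: N)) (M := joinProb C R N)
    (k := Fintype.card (HalfEdge d) - (2 * R.card - N.length)) (y := h)
    (fun g => joinProb_nonneg _ _ _) ?_ (sum_joinProb_cons_left C R N g).le ?_ (by linarith) ?_
  · rwa [sub_sub_cancel] at key
  · intro y y' hy hy'
    simp only [Finset.mem_union, Finset.mem_compl, not_or, not_not] at hy hy'
    have hfix : ∀ a, a ∉ halfEdges R → Equiv.swap y y' a = a := fun a ha =>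
      Equiv.swap_apply_of_ne_of_ne (fun e => ha (e ▸ hy.1)) (fun e => ha (e ▸ hy'.1))
    have := joinProb_cons_eq (repairProb_conj_swap hR hlt hy.1 hy'.1) (N := N) (fun p hp =>
      ⟨Equiv.swap_apply_of_ne_of_ne
        (fun e => hy.2 (e ▸ List.mem_toFinset.2 (List.mem_map_of_mem hp)))
        (fun e => hy'.2 (e ▸ List.mem_toFinset.2 (List.mem_map_of_mem hp))),
        hfix _ (hN2 p hp)⟩) y g
    rw [Equiv.swap_apply_left, hfix g hg] at this
    exact this.symm
  · have c8 := Finset.card_union_le (halfEdges R)ᶜ A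
    have : ((((halfEdges R)ᶜ ∪ A).card : ℕ) : ℝ) + 2 * R.card
        ≤ Fintype.card (HalfEdge d) + N.length := by
      exact_mod_cast (by omega : ((halfEdges R)ᶜ ∪ A).card + 2 * R.card
        ≤ Fintype.card (HalfEdge d) + N.length)
    linarith
  · simp only [Finset.mem_union, Finset.mem_compl, not_or, not_not]
    exact ⟨hh, by rwa [hA, List.mem_toFinset]⟩

end DynCM

/-! ### Weights for the joint appearance of several pairs -/

namespace DynCM

variable {n : ℕ} {d : Fin n → ℕ} {α : ℝ}

open Classical in
/-- A product over the half-edges `h` in a list: the factor is `a`, increased by `b j` if the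
partner of `h` is one of the `j` later members of the list. -/
noncomputable def weight (C : Config d) (a : ℝ) (b : ℕ → ℝ) : List (HalfEdge d) → ℝ
  | [] => 1
  | h :: L => (a + if C.1 h ∈ L then b L.length else 0) * weight C a b L

lemma weight_nonneg {a : ℝ} {b : ℕ → ℝ} (ha : 0 ≤ a) :
    ∀ (C : Config d) (L : List (HalfEdge d)), (∀ j < L.length, 0 ≤ b j) → 0 ≤ weight C a b L
  | _, [], _ => zero_le_one
  | C, h :: L, hb => by
    have hL := weight_nonneg ha C L fun j hj => hb j (hj.trans (by simp))
    have := hb L.length (by simp)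
    rw [weight]
    refine mul_nonneg (add_nonneg ha ?_) hL
    split_ifs
    exacts [this, le_rfl]

/-- A rewiring creates all the pairs in `N` with a probability that is at most a product. -/
lemma joinProb_le_weight {C : Config d} {R : Finset (Edge d)} (hR : R ⊆ edges C)
    (hlt : R.card < (edges C \ R).card) {B : ℕ} (hB : B ≤ 2 * R.card) {k γ : ℝ}
    (hk : 2 * (R.card : ℝ) + 2 * B ≤ k) (hkN : k < Fintype.card (HalfEdge d))
    (hγ : 1 / (Fintype.card (HalfEdge d) - k) ≤ γ) (N : List (HalfEdge d × HalfEdge d))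
    (hN : ∀ p ∈ N, p.1 ∈ halfEdges R) (h1 : (N.map Prod.fst).Nodup)
    (h2 : (N.map Prod.snd).Nodup) (hNB : N.length ≤ B) :
    joinProb C R N ≤ weight C γ (fun j => 1 / ((B : ℝ) - j)) (N.map Prod.snd) := by
  classical
  have hγ0 : 0 ≤ γ := le_trans (one_div_nonneg.2 (by linarith)) hγ
  induction N with
  | nil =>
    have h := sum_repairProb hR
    simp [joinProb, weight, joins_nil, h]
  | cons p N ih =>
    obtain ⟨h, g⟩ := p
    rw [List.map_cons, List.nodup_cons] at h1 h2
    rw [List.length_cons] at hNB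
    have hN' : ∀ p ∈ N, p.1 ∈ halfEdges R := fun p hp => hN p (List.mem_cons_of_mem _ hp)
    have ih := ih hN' h1.2 h2.2 (by omega)
    have hb : ∀ j < N.length + 1, 0 ≤ 1 / ((B : ℝ) - j) := by
      intro j hj
      have : (j : ℝ) < B := by exact_mod_cast (by omega : j < B)
      exact one_div_nonneg.2 (by linarith)
    have hw : 0 ≤ weight C γ (fun j => 1 / ((B : ℝ) - j)) (N.map Prod.snd) :=
      weight_nonneg hγ0 C _ fun j hj => hb j (by rw [List.length_map] at hj; omega)
    have hwc : 0 ≤ weight C γ (fun j => 1 / ((B : ℝ) - j)) (((h, g) :: N).map Prod.snd) :=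
      weight_nonneg hγ0 C _ fun j hj => hb j (by simpa using hj)
    have hh : h ∈ halfEdges R := hN (h, g) List.mem_cons_self
    by_cases hz : ∃ p ∈ ((h, g) :: N), p.2 ∈ halfEdges R
    · obtain ⟨p, hp, hp2⟩ := hz
      rw [joinProb_eq_zero hR hlt hp (hN p hp) hp2]
      exact hwc
    push Not at hz
    have hg : g ∉ halfEdges R := hz (h, g) List.mem_cons_self
    have hz' : ∀ p ∈ N, p.2 ∉ halfEdges R := fun p hp => hz p (List.mem_cons_of_mem _ hp)
    have hjn := joinProb_nonneg C R N
    rw [List.map_cons, weight, List.length_map]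
    have hnl : (N.length : ℝ) + 1 ≤ B := by exact_mod_cast hNB
    have hB' : (B : ℝ) ≤ 2 * R.card := by exact_mod_cast hB
    by_cases hc : C.1 g ∈ N.map Prod.snd
    · rw [if_pos hc]
      have key := joinProb_cons_le hR hlt hz' (by omega) hh hg h1.1
      have e : joinProb C R N / (2 * R.card - N.length)
          ≤ 1 / ((B : ℝ) - N.length) * joinProb C R N := by
        rw [div_eq_mul_one_div, mul_comm]
        refine mul_le_mul_of_nonneg_right ?_ hjn
        exact one_div_le_one_div_of_le (by linarith) (by linarith)
      have hb' := hb N.length (by omega)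
      refine (key.trans e).trans (mul_le_mul ?_ ih hjn (by positivity))
      linarith
    · rw [if_neg hc, add_zero]
      have key := joinProb_cons_le_of_fresh hR hN' (k := k) (by linarith) hkN hh hg h2.1 hc
      refine key.trans ?_
      rw [div_eq_mul_one_div, mul_comm]
      exact mul_le_mul hγ ih hjn hγ0

open Classical in
/-- The selected edges contain all the half-edges of a list with a probability that is at most a
product. -/
lemma sum_selectProb_halfEdges_le (h0 : 0 ≤ α) {C : Config d}
    {S : Finset (Edge d)} (hS : S ⊆ edges C) {L : List (HalfEdge d)} (hL : L.Nodup) :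
    ∑ R, (if ∀ a ∈ L, a ∈ halfEdges R then selectProb α S R else 0)
      ≤ weight C α (fun _ => 1) L := by
  have hpow : α ^ (L.toFinset.image (edgeAt C)).card ≤ weight C α (fun _ => 1) L := by
    induction L with
    | nil => simp [weight]
    | cons h L ih =>
      rw [List.nodup_cons] at hL
      have ih := ih hL.2
      have hp : 0 ≤ α ^ (L.toFinset.image (edgeAt C)).card := pow_nonneg h0 _
      rw [weight, List.toFinset_cons, Finset.image_insert]
      by_cases hc : C.1 h ∈ L
      · have : edgeAt C h ∈ L.toFinset.image (edgeAt C) :=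
          Finset.mem_image.2 ⟨C.1 h, List.mem_toFinset.2 hc, edgeAt_partner C h⟩
        rw [Finset.insert_eq_of_mem this, if_pos hc]
        nlinarith
      · have : edgeAt C h ∉ L.toFinset.image (edgeAt C) := by
          intro e
          obtain ⟨g, hg, e⟩ := Finset.mem_image.1 e
          rw [List.mem_toFinset] at hg
          rcases edgeAt_eq_iff.1 e with rfl | rfl
          exacts [hL.1 hg, hc hg]
        rw [Finset.card_insert_of_notMem this, if_neg hc, add_zero, pow_succ']
        exact mul_le_mul_of_nonneg_left ih h0
  have hw := le_trans (pow_nonneg h0 _) hpow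
  by_cases hT : L.toFinset.image (edgeAt C) ⊆ S
  · refine le_trans (le_of_eq ?_) hpow
    rw [← sum_selectProb_superset hT]
    refine Finset.sum_congr rfl fun R _ => ?_
    by_cases hR : R ⊆ S
    · refine if_congr ?_ rfl rfl
      simp only [mem_halfEdges_iff (hR.trans hS), Finset.image_subset_iff, List.mem_toFinset]
    · simp [selectProb_eq_zero hR]
  · refine le_trans (le_of_eq (Finset.sum_eq_zero fun R _ => ?_)) hw
    by_cases hR : R ⊆ S
    · rw [if_neg]
      intro h
      refine hT (Finset.image_subset_iff.2 fun a ha => hR ?_)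
      rw [List.mem_toFinset] at ha
      exact (mem_halfEdges_iff (hR.trans hS)).1 (h a ha)
    · rw [selectProb_eq_zero hR, ite_self]

/-! ### Measures under which several pairs are rarely present together -/

/-- The half-edges of a list of pairs. -/
def ends (M : List (HalfEdge d × HalfEdge d)) : List (HalfEdge d) :=
  M.flatMap fun p => [p.1, p.2]

lemma ends_cons (p : HalfEdge d × HalfEdge d) (M : List (HalfEdge d × HalfEdge d)) :
    ends (p :: M) = p.1 :: p.2 :: ends M := by simp [ends]

lemma mem_ends {M : List (HalfEdge d × HalfEdge d)} {a : HalfEdge d} :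
    a ∈ ends M ↔ ∃ p ∈ M, a = p.1 ∨ a = p.2 := by simp [ends]

lemma length_ends (M : List (HalfEdge d × HalfEdge d)) : (ends M).length = 2 * M.length := by
  induction M with
  | nil => simp [ends]
  | cons p M ih => simp [ends_cons, ih]; ring

open Classical in
/-- The mass that `μ` gives to the configurations that contain all the pairs in `M`, in the sense
of a weighted sum with a further weight `Ψ`. -/
noncomputable def joinMass (μ Ψ : Config d → ℝ) (M : List (HalfEdge d × HalfEdge d)) : ℝ :=
  ∑ C, μ C * Ψ C * if Joins C M then 1 else 0

/-- Under `μ`, each of any number of disjoint pairs from `U` costs a factor `κ`. -/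
def PairBound (μ : Config d → ℝ) (U : Finset (HalfEdge d)) (c κ : ℝ) : Prop :=
  ∀ M : List (HalfEdge d × HalfEdge d), (ends M).Nodup → (∀ a ∈ ends M, a ∈ U) →
    joinMass μ (fun _ => 1) M ≤ c * κ ^ M.length

/-- The product of the factors of `weight`, averaged over a measure with a pair bound. -/
noncomputable def weightBound (a : ℝ) (b : ℕ → ℝ) (κ : ℝ) (m : ℕ) : ℝ :=
  ∏ j ∈ Finset.range m, (a + j * b j * κ)

/-- Inserting the weight of a list into an average costs the product of the averaged factors:
every coincidence in the weight amounts to a further pair of the configuration. -/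
lemma joinMass_weight_le {μ Ψ : Config d → ℝ} {U : Finset (HalfEdge d)} {c κ a : ℝ} {b : ℕ → ℝ}
    (hc : 0 ≤ c) (hκ : 0 ≤ κ) (ha : 0 ≤ a) (G : List (HalfEdge d))
    (hG : ∀ M : List (HalfEdge d × HalfEdge d), (ends M).Nodup → (∀ a ∈ ends M, a ∈ U) →
      (∀ p ∈ M, ¬ (p.1 ∈ G ∧ p.2 ∈ G)) → joinMass μ Ψ M ≤ c * κ ^ M.length) :
    ∀ L : List (HalfEdge d), (L ++ G).Nodup → (∀ a ∈ L ++ G, a ∈ U) →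
      (∀ j < L.length, 0 ≤ b j) →
      ∀ M : List (HalfEdge d × HalfEdge d), (ends M).Nodup → (∀ a ∈ ends M, a ∈ U) →
      (∀ p ∈ M, ¬ (p.1 ∈ L ++ G ∧ p.2 ∈ L ++ G)) →
      joinMass μ (fun C => weight C a b L * Ψ C) M
        ≤ c * κ ^ M.length * weightBound a b κ L.length := by
  classical
  intro L
  induction L with
  | nil =>
    intro _ _ _ M h1 h2 h3
    simpa [weight, weightBound] using hG M h1 h2 h3
  | cons h L ih =>
    intro hnd hU hb M h1 h2 h3
    rw [List.cons_append, List.nodup_cons] at hnd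
    have hb' : ∀ j < L.length, 0 ≤ b j := fun j hj => hb j (hj.trans (by simp))
    have hbL : 0 ≤ b L.length := hb _ (by simp)
    have hU' : ∀ a ∈ L ++ G, a ∈ U := fun a ha => hU a (List.mem_cons_of_mem _ ha)
    have ih := ih hnd.2 hU' hb'
    have h3' : ∀ p ∈ M, ¬ (p.1 ∈ L ++ G ∧ p.2 ∈ L ++ G) := fun p hp e =>
      h3 p hp ⟨List.mem_cons_of_mem _ e.1, List.mem_cons_of_mem _ e.2⟩
    have hwb : 0 ≤ weightBound a b κ L.length := Finset.prod_nonneg fun j hj => by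
      have := hb' j (Finset.mem_range.1 hj)
      positivity
    have e1 : joinMass μ (fun C => weight C a b (h :: L) * Ψ C) M
        = a * joinMass μ (fun C => weight C a b L * Ψ C) M
          + b L.length * ∑ h' ∈ L.toFinset,
            joinMass μ (fun C => weight C a b L * Ψ C) ((h, h') :: M) := by
      unfold joinMass
      rw [Finset.sum_comm, Finset.mul_sum, Finset.mul_sum, ← Finset.sum_add_distrib]
      refine Finset.sum_congr rfl fun C _ => ?_
      beta_reduce
      rw [show weight C a b (h :: L)
        = (a + if C.1 h ∈ L then b L.length else 0) * weight C a b L from rfl]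
      have e2 : ∑ h' ∈ L.toFinset, μ C * (weight C a b L * Ψ C) *
          (if Joins C ((h, h') :: M) then 1 else 0)
          = μ C * (weight C a b L * Ψ C) *
            ((if Joins C M then 1 else 0) * if C.1 h ∈ L then 1 else 0) := by
        rw [← Finset.mul_sum]
        congr 1
        simp only [joins_cons, ite_and, Finset.sum_ite_eq, List.mem_toFinset]
        split_ifs <;> simp
      rw [e2]
      split_ifs <;> ring
    have hterm : ∀ h' ∈ L.toFinset,
        joinMass μ (fun C => weight C a b L * Ψ C) ((h, h') :: M)
          ≤ c * κ ^ M.length * κ * weightBound a b κ L.length := by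
      intro h' hh'
      rw [List.mem_toFinset] at hh'
      by_cases hfr : h ∈ ends M ∨ h' ∈ ends M
      · refine le_trans (le_of_eq (Finset.sum_eq_zero fun C _ => ?_)) (by positivity)
        rw [if_neg, mul_zero]
        rintro hj
        rw [joins_cons] at hj
        obtain ⟨hj1, hj2⟩ := hj
        have hj1' : C.1 h' = h := by rw [← hj1, config_invol]
        have m1 : h ∈ (h :: L) ++ G := List.mem_cons_self
        have m2 : h' ∈ (h :: L) ++ G := by simp [hh']
        rcases hfr with hfr | hfr
        · obtain ⟨p, hp, e | e⟩ := mem_ends.1 hfr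
          · have := hj2 p hp
            refine h3 p hp ⟨e ▸ m1, ?_⟩
            rw [← this, ← e, hj1]
            exact m2
          · have := hj2 p hp
            refine h3 p hp ⟨?_, e ▸ m1⟩
            have e3 : p.1 = C.1 p.2 := by rw [← this, config_invol]
            rw [e3, ← e, hj1]
            exact m2
        · obtain ⟨p, hp, e | e⟩ := mem_ends.1 hfr
          · have := hj2 p hp
            refine h3 p hp ⟨e ▸ m2, ?_⟩
            rw [← this, ← e, hj1']
            exact m1
          · have := hj2 p hp
            refine h3 p hp ⟨?_, e ▸ m2⟩
            have e3 : p.1 = C.1 p.2 := by rw [← this, config_invol]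
            rw [e3, ← e, hj1']
            exact m1
      · rw [not_or] at hfr
        have hne : h ≠ h' := fun e => hnd.1 (List.mem_append_left _ (e ▸ hh'))
        refine (ih ((h, h') :: M) ?_ ?_ ?_).trans (le_of_eq ?_)
        · rw [ends_cons, List.nodup_cons, List.nodup_cons, List.mem_cons, not_or]
          exact ⟨⟨hne, hfr.1⟩, hfr.2, h1⟩
        · intro x hx
          rw [ends_cons, List.mem_cons, List.mem_cons] at hx
          rcases hx with rfl | rfl | hx
          · exact hU _ List.mem_cons_self
          · exact hU' _ (List.mem_append_left _ hh')
          · exact h2 x hx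
        · intro p hp
          rcases List.mem_cons.1 hp with rfl | hp
          · exact fun e => hnd.1 e.1
          · exact h3' p hp
        · rw [List.length_cons, pow_succ]
          ring
    rw [e1]
    have hsum := Finset.sum_le_card_nsmul _ _ _ hterm
    rw [nsmul_eq_mul] at hsum
    have hcard : (L.toFinset.card : ℝ) ≤ L.length := by exact_mod_cast L.toFinset_card_le
    have hX : 0 ≤ c * κ ^ M.length * κ * weightBound a b κ L.length := by positivity
    have hA := mul_le_mul_of_nonneg_left (ih M h1 h2 h3') ha
    have hB := mul_le_mul_of_nonneg_left
      (hsum.trans (mul_le_mul_of_nonneg_right hcard hX)) hbL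
    refine (add_le_add hA hB).trans (le_of_eq ?_)
    have e3 : weightBound a b κ (L.length + 1)
        = weightBound a b κ L.length * (a + L.length * b L.length * κ) :=
      Finset.prod_range_succ _ _
    rw [List.length_cons, e3]
    ring

end DynCM

/-! ### Rewiring preserves pair bounds -/

namespace DynCM

variable {n : ℕ} {d : Fin n → ℕ} {α : ℝ}

open Classical in
/-- Mass, after one rewiring without complete reshuffling, of the following event: the pairs in `K`
were present before, the pairs in `N` are created by the rewiring, and the pairs in `M` are present
afterwards. -/
noncomputable def stepMass (α : ℝ) (μ : Config d → ℝ) (S : Config d → Finset (Edge d))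
    (K N M : List (HalfEdge d × HalfEdge d)) : ℝ :=
  ∑ C, μ C * ((if Joins C K then 1 else 0) * envStep α (S C) C fun R η =>
    if R.card < (edges C \ R).card ∧ (∀ p ∈ N, p.1 ∈ halfEdges R) ∧ Joins η N ∧ Joins η M
    then 1 else 0)

lemma envStep_mono_of_repair (h0 : 0 ≤ α) (h1 : α ≤ 1) {S : Finset (Edge d)} {C : Config d}
    {F G : Finset (Edge d) → Config d → ℝ}
    (h : ∀ R η, R ⊆ S → repairProb C R η ≠ 0 → F R η ≤ G R η) :
    envStep α S C F ≤ envStep α S C G := by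
  refine Finset.sum_le_sum fun R _ => Finset.sum_le_sum fun η _ => ?_
  by_cases hR : R ⊆ S
  · by_cases hη : repairProb C R η = 0
    · simp [hη]
    · exact mul_le_mul_of_nonneg_left (h R η hR hη)
        (mul_nonneg (selectProb_nonneg h0 h1 _ _) (repairProb_nonneg _ _ _))
  · simp [selectProb_eq_zero hR]

open Classical in
/-- A pair present after the rewiring either was present before, or was created, and then one of its
two half-edges belongs to a selected edge. -/
lemma stepMass_cons_le (h0 : 0 ≤ α) (h1 : α ≤ 1) {μ : Config d → ℝ} (hμ : ∀ C, 0 ≤ μ C)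
    {S : Config d → Finset (Edge d)} (hS : ∀ C, S C ⊆ edges C)
    (K N M : List (HalfEdge d × HalfEdge d)) (h g : HalfEdge d) :
    stepMass α μ S K N ((h, g) :: M) ≤ stepMass α μ S ((h, g) :: K) N M
      + (stepMass α μ S K ((h, g) :: N) M + stepMass α μ S K ((g, h) :: N) M) := by
  unfold stepMass
  rw [← Finset.sum_add_distrib, ← Finset.sum_add_distrib]
  refine Finset.sum_le_sum fun C _ => ?_
  rw [← mul_add, ← mul_add]
  refine mul_le_mul_of_nonneg_left ?_ (hμ C)
  by_cases hK : Joins C K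
  swap
  · simp [hK, joins_cons]
  simp only [joins_cons, and_true, hK, if_true, one_mul]
  rw [← envStep_add, ← envStep_const_mul, ← envStep_add]
  refine envStep_mono_of_repair h0 h1 fun R η hR hη => ?_
  by_cases hev : R.card < (edges C \ R).card ∧ (∀ p ∈ N, p.1 ∈ halfEdges R) ∧ Joins η N ∧
      (η.1 h = g ∧ Joins η M)
  swap
  · rw [if_neg hev]
    refine add_nonneg (mul_nonneg ?_ ?_) (add_nonneg ?_ ?_) <;> split_ifs <;> norm_num
  obtain ⟨hlt, hN, hjN, hg, hM⟩ := hev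
  have hRC := hR.trans (hS C)
  have hg' : η.1 g = h := by rw [← hg, config_invol]
  rw [if_pos ⟨hlt, hN, hjN, hg, hM⟩]
  have n1 : ∀ (P : Prop) [Decidable P], (0 : ℝ) ≤ if P then 1 else 0 := fun P _ => by
    split_ifs <;> norm_num
  by_cases ha : h ∈ halfEdges R
  · have e : (if R.card < (edges C \ R).card ∧ (∀ p ∈ (h, g) :: N, p.1 ∈ halfEdges R) ∧
        (η.1 h = g ∧ Joins η N) ∧ Joins η M then (1 : ℝ) else 0) = 1 := by
      refine if_pos ⟨hlt, ?_, ⟨hg, hjN⟩, hM⟩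
      rintro p hp
      rcases List.mem_cons.1 hp with rfl | hp
      exacts [ha, hN p hp]
    rw [e]
    have := mul_nonneg (n1 (C.1 h = g)) (n1 (R.card < (edges C \ R).card ∧
      (∀ p ∈ N, p.1 ∈ halfEdges R) ∧ Joins η N ∧ Joins η M))
    have := n1 (R.card < (edges C \ R).card ∧ (∀ p ∈ (g, h) :: N, p.1 ∈ halfEdges R) ∧
      (η.1 g = h ∧ Joins η N) ∧ Joins η M)
    linarith
  by_cases hb : g ∈ halfEdges R
  · have e : (if R.card < (edges C \ R).card ∧ (∀ p ∈ (g, h) :: N, p.1 ∈ halfEdges R) ∧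
        (η.1 g = h ∧ Joins η N) ∧ Joins η M then (1 : ℝ) else 0) = 1 := by
      refine if_pos ⟨hlt, ?_, ⟨hg', hjN⟩, hM⟩
      rintro p hp
      rcases List.mem_cons.1 hp with rfl | hp
      exacts [hb, hN p hp]
    rw [e]
    have := mul_nonneg (n1 (C.1 h = g)) (n1 (R.card < (edges C \ R).card ∧
      (∀ p ∈ N, p.1 ∈ halfEdges R) ∧ Joins η N ∧ Joins η M))
    have := n1 (R.card < (edges C \ R).card ∧ (∀ p ∈ (h, g) :: N, p.1 ∈ halfEdges R) ∧
      (η.1 h = g ∧ Joins η N) ∧ Joins η M)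
    linarith
  have hC : C.1 h = g := by
    rw [← hg]
    exact (apply_eq_of_repairProb hRC hlt hη ha (hg ▸ hb)).symm
  rw [if_pos hC, if_pos ⟨hlt, hN, hjN, hM⟩]
  have := n1 (R.card < (edges C \ R).card ∧ (∀ p ∈ (h, g) :: N, p.1 ∈ halfEdges R) ∧
      (η.1 h = g ∧ Joins η N) ∧ Joins η M)
  have := n1 (R.card < (edges C \ R).card ∧ (∀ p ∈ (g, h) :: N, p.1 ∈ halfEdges R) ∧
      (η.1 g = h ∧ Joins η N) ∧ Joins η M)
  linarith

open Classical in
/-- The probability that one rewiring creates all the pairs in `N`. -/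
lemma envStep_create_le (h0 : 0 ≤ α) (h1 : α ≤ 1) {C : Config d} {S : Finset (Edge d)}
    (hS : S ⊆ edges C) {N : List (HalfEdge d × HalfEdge d)} (hN1 : (N.map Prod.fst).Nodup)
    (hN2 : (N.map Prod.snd).Nodup) {γ : ℝ}
    (hlen : 2 * (N.length : ℝ) < Fintype.card (HalfEdge d) / 2)
    (hγ : 1 / (Fintype.card (HalfEdge d) / 2 - 2 * (N.length : ℝ)) ≤ γ) :
    (envStep α S C fun R η => if R.card < (edges C \ R).card ∧
      (∀ p ∈ N, p.1 ∈ halfEdges R) ∧ Joins η N ∧ Joins η [] then 1 else 0)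
      ≤ weight C α (fun _ => 1) (N.map Prod.fst)
        * weight C γ (fun j => 1 / ((N.length : ℝ) - j)) (N.map Prod.snd) := by
  have hγ0 : 0 ≤ γ := le_trans (one_div_nonneg.2 (by linarith)) hγ
  set w := weight C γ (fun j => 1 / ((N.length : ℝ) - j)) (N.map Prod.snd) with hw
  have hw0 : 0 ≤ w := weight_nonneg hγ0 C _ fun j hj => by
    have : (j : ℝ) < N.length := by exact_mod_cast (by simpa using hj)
    exact one_div_nonneg.2 (by linarith)
  refine le_trans ?_ (mul_le_mul_of_nonneg_right
    (sum_selectProb_halfEdges_le h0 hS hN1) hw0)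
  rw [Finset.sum_mul]
  refine Finset.sum_le_sum fun R _ => ?_
  by_cases hR : R ⊆ S
  swap
  · simp [selectProb_eq_zero hR]
  have hRC := hR.trans hS
  have hsel := selectProb_nonneg h0 h1 S R
  by_cases hin : ∀ a ∈ N.map Prod.fst, a ∈ halfEdges R
  swap
  · rw [if_neg hin, zero_mul]
    refine (Finset.sum_eq_zero fun η _ => ?_).le
    beta_reduce
    rw [if_neg, mul_zero]
    rintro ⟨-, h, -⟩
    refine hin fun a ha => ?_
    obtain ⟨p, hp, rfl⟩ := List.mem_map.1 ha
    exact h p hp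
  rw [if_pos hin]
  have hin' : ∀ p ∈ N, p.1 ∈ halfEdges R := fun p hp => hin _ (List.mem_map_of_mem hp)
  by_cases hlt : R.card < (edges C \ R).card
  swap
  · refine (Finset.sum_eq_zero fun η _ => ?_).le.trans (mul_nonneg hsel hw0)
    beta_reduce
    rw [if_neg, mul_zero]
    rintro ⟨h, -⟩
    exact hlt h
  have hB : N.length ≤ 2 * R.card := by
    rw [← card_halfEdges hRC, ← List.length_map Prod.fst, ← List.toFinset_card_of_nodup hN1]
    exact Finset.card_le_card fun a ha => hin a (List.mem_toFinset.1 ha)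
  have hlt2 : 2 * (2 * (R.card : ℝ)) < Fintype.card (HalfEdge d) := by
    exact_mod_cast card_halfEdges_sdiff_lt hRC hlt
  have key := joinProb_le_weight hRC hlt hB
    (k := Fintype.card (HalfEdge d) / 2 + 2 * N.length) (by linarith) (by linarith)
    (γ := γ) (by
      refine le_trans (le_of_eq ?_) hγ
      congr 1
      ring) N hin' hN1 hN2 le_rfl
  refine le_trans (le_of_eq ?_) (mul_le_mul_of_nonneg_left key hsel)
  unfold joinProb
  rw [Finset.mul_sum]
  refine Finset.sum_congr rfl fun η _ => ?_
  rw [mul_assoc]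
  congr 2
  exact if_congr ⟨fun h => h.2.2.1, fun h => ⟨hlt, hin', h, joins_nil _⟩⟩ rfl rfl

lemma weightBound_select_le {κ : ℝ} (h0 : 0 ≤ α) (hκ : 0 ≤ κ) {m : ℕ} (h : m * κ ≤ α) :
    weightBound α (fun _ => 1) κ m ≤ (2 * α) ^ m := by
  unfold weightBound
  rw [← Finset.card_range m, ← Finset.prod_const, Finset.card_range]
  refine Finset.prod_le_prod (fun j _ => by positivity) fun j hj => ?_
  have : (j : ℝ) ≤ m := by exact_mod_cast (Finset.mem_range.1 hj).le
  have := mul_le_mul_of_nonneg_right this hκ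
  linarith

/-- The product of the factors `m / (m - j)` is `m ^ m / m !`, and hence at most `exp m`. -/
lemma weightBound_match_le {γ κ : ℝ} (hκ : 0 ≤ κ) (hγ : 0 ≤ γ) (hγκ : γ ≤ 4 * κ) (m : ℕ) :
    weightBound γ (fun j => 1 / ((m : ℝ) - j)) κ m ≤ (4 * Real.exp 1 * κ) ^ m := by
  have hpos : ∀ j ∈ Finset.range m, 0 < (m : ℝ) - j := fun j hj => by
    have : (j : ℝ) < m := by exact_mod_cast Finset.mem_range.1 hj
    linarith
  have h1 : weightBound γ (fun j => 1 / ((m : ℝ) - j)) κ m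
      ≤ ∏ j ∈ Finset.range m, (4 * κ * (m / ((m : ℝ) - j))) := by
    refine Finset.prod_le_prod (fun j hj => ?_) fun j hj => ?_
    · have := hpos j hj
      positivity
    · have h2 := hpos j hj
      have e : 4 * κ * (m / ((m : ℝ) - j)) = 4 * κ + 4 * (j * (1 / ((m : ℝ) - j)) * κ) := by
        field_simp
        ring
      rw [e]
      have : 0 ≤ (j : ℝ) * (1 / ((m : ℝ) - j)) * κ := by positivity
      linarith
  refine h1.trans ?_
  have h3 : ∏ j ∈ Finset.range m, ((m : ℝ) - j) = (m.factorial : ℝ) := by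
    rw [← Finset.prod_range_add_one_eq_factorial, Nat.cast_prod, ← Finset.prod_range_reflect]
    refine Finset.prod_congr rfl fun j hj => ?_
    have := Finset.mem_range.1 hj
    rw [Nat.sub_sub, Nat.cast_sub (by omega)]
    push_cast [Nat.cast_sub (show 1 + j ≤ m by omega)]
    ring
  rw [Finset.prod_mul_distrib, Finset.prod_const, Finset.card_range, Finset.prod_div_distrib, h3,
    Finset.prod_const, Finset.card_range]
  have h4 := Real.pow_div_factorial_le_exp (m : ℝ) (by positivity) m
  calc (4 * κ) ^ m * ((m : ℝ) ^ m / m.factorial) ≤ (4 * κ) ^ m * Real.exp m := by gcongr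
    _ = (4 * Real.exp 1 * κ) ^ m := by
      rw [← mul_one (m : ℝ), Real.exp_nat_mul, ← mul_pow]
      ring

lemma perm_ends (N : List (HalfEdge d × HalfEdge d)) :
    (N.map Prod.fst ++ N.map Prod.snd).Perm (ends N) := by
  induction N with
  | nil => simp [ends]
  | cons p N ih =>
    rw [ends_cons, List.map_cons, List.map_cons, List.cons_append]
    refine List.Perm.cons _ ?_
    exact List.perm_middle.trans (List.Perm.cons _ ih)

section PairBound

variable {μ : Config d → ℝ} {S : Config d → Finset (Edge d)} {U : Finset (HalfEdge d)} {c κ : ℝ}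

/-- Each created pair costs a factor `2 * α` for the selection of its first half-edge, and a factor
`4 * exp 1 * κ` for the match with the second. -/
lemma stepMass_nil_le (h0 : 0 ≤ α) (h1 : α ≤ 1) (hμ : ∀ C, 0 ≤ μ C)
    (hS : ∀ C, S C ⊆ edges C) (hc : 0 ≤ c)
    (hN : 0 < Fintype.card (HalfEdge d)) (hU : 4 * (U.card : ℝ) ≤ Fintype.card (HalfEdge d))
    (hκ : 1 / (Fintype.card (HalfEdge d) : ℝ) ≤ κ) (hUκ : U.card * κ ≤ α)
    (hb : PairBound μ U c κ) {K N : List (HalfEdge d × HalfEdge d)}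
    (hnd : (ends K ++ ends N).Nodup) (hKN : ∀ a ∈ ends K ++ ends N, a ∈ U) :
    stepMass α μ S K N [] ≤ c * κ ^ K.length * (22 * α * κ) ^ N.length := by
  classical
  have hN0 : (0 : ℝ) < Fintype.card (HalfEdge d) := by exact_mod_cast hN
  have hκ0 : 0 < κ := lt_of_lt_of_le (by positivity) hκ
  have hlen : 2 * N.length ≤ U.card := by
    rw [← length_ends, ← List.toFinset_card_of_nodup (List.Nodup.of_append_right hnd)]
    exact Finset.card_le_card fun a ha =>
      hKN a (List.mem_append_right _ (List.mem_toFinset.1 ha))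
  have hlen' : 2 * (N.length : ℝ) ≤ U.card := by exact_mod_cast hlen
  have hperm := perm_ends N
  have hnd' : (N.map Prod.fst ++ N.map Prod.snd).Nodup :=
    hperm.nodup_iff.2 (List.Nodup.of_append_right hnd)
  have hmemU : ∀ a ∈ N.map Prod.fst ++ N.map Prod.snd, a ∈ U := fun a ha =>
    hKN a (List.mem_append_right _ (hperm.mem_iff.1 ha))
  set γ : ℝ := 4 / Fintype.card (HalfEdge d) with hγ
  have hγ0 : 0 ≤ γ := by positivity
  have hγκ : γ ≤ 4 * κ := by
    rw [hγ, div_eq_mul_one_div]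
    linarith
  set w : Config d → ℝ := fun C =>
    weight C γ (fun j => 1 / ((N.length : ℝ) - j)) (N.map Prod.snd) with hw
  have hbpos : ∀ j < N.length, 0 ≤ 1 / ((N.length : ℝ) - j) := fun j hj => by
    have : (j : ℝ) < N.length := by exact_mod_cast hj
    exact one_div_nonneg.2 (by linarith)
  have hKdisj : ∀ p ∈ K, p.1 ∉ ends N := fun p hp hn =>
    List.disjoint_of_nodup_append hnd (mem_ends.2 ⟨p, hp, Or.inl rfl⟩) hn
  have step1 : stepMass α μ S K N [] ≤ joinMass μ
      (fun C => weight C α (fun _ => 1) (N.map Prod.fst) * (w C * 1)) K := by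
    refine Finset.sum_le_sum fun C _ => ?_
    beta_reduce
    rw [mul_assoc]
    refine mul_le_mul_of_nonneg_left ?_ (hμ C)
    rw [mul_comm]
    refine mul_le_mul_of_nonneg_right ?_ (by split_ifs <;> norm_num)
    rw [mul_one]
    refine envStep_create_le h0 h1 (hS C) (List.Nodup.of_append_left hnd')
      (List.Nodup.of_append_right hnd') (by linarith) ?_
    rw [hγ, div_le_div_iff₀ (by linarith) hN0]
    linarith
  have step2 : ∀ M : List (HalfEdge d × HalfEdge d), (ends M).Nodup → (∀ a ∈ ends M, a ∈ U) →
      (∀ p ∈ M, ¬ (p.1 ∈ N.map Prod.snd ∧ p.2 ∈ N.map Prod.snd)) →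
      joinMass μ (fun C => w C * 1) M ≤ c * weightBound γ (fun j => 1 / ((N.length : ℝ) - j)) κ
        N.length * κ ^ M.length := by
    intro M m1 m2 m3
    have := joinMass_weight_le (Ψ := fun _ => 1) (b := fun j => 1 / ((N.length : ℝ) - j)) hc
      hκ0.le hγ0 []
      (fun M a b _ => hb M a b) (N.map Prod.snd)
      (by rw [List.append_nil]; exact List.Nodup.of_append_right hnd')
      (fun a ha => hmemU a (List.mem_append_right _ (by rwa [List.append_nil] at ha)))
      (fun j hj => hbpos j (by simpa using hj)) M m1 m2 (by simpa using m3)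
    rw [List.length_map] at this
    refine this.trans (le_of_eq (by ring))
  have hWg : 0 ≤ weightBound γ (fun j => 1 / ((N.length : ℝ) - j)) κ N.length :=
    Finset.prod_nonneg fun j hj => by
      have := hbpos j (Finset.mem_range.1 hj)
      positivity
  have step3 := joinMass_weight_le (b := fun _ => (1 : ℝ)) (mul_nonneg hc hWg) hκ0.le h0
    (N.map Prod.snd) step2 (N.map Prod.fst) hnd' hmemU (fun _ _ => zero_le_one) K
    (List.Nodup.of_append_left hnd) (fun a ha => hKN a (List.mem_append_left _ ha))
    (fun p hp e => hKdisj p hp (hperm.mem_iff.1 e.1))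
  rw [List.length_map] at step3
  refine (step1.trans step3).trans ?_
  have b1 : weightBound α (fun _ => 1) κ N.length ≤ (2 * α) ^ N.length := by
    refine weightBound_select_le h0 hκ0.le (le_trans ?_ hUκ)
    refine mul_le_mul_of_nonneg_right ?_ hκ0.le
    have : (0 : ℝ) ≤ N.length := by positivity
    linarith
  have b2 := weightBound_match_le hκ0.le hγ0 hγκ N.length
  have hWh : 0 ≤ weightBound α (fun _ => 1) κ N.length :=
    Finset.prod_nonneg fun j _ => by positivity
  calc c * weightBound γ (fun j => 1 / ((N.length : ℝ) - j)) κ N.length * κ ^ K.length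
        * weightBound α (fun _ => 1) κ N.length
      ≤ c * (4 * Real.exp 1 * κ) ^ N.length * κ ^ K.length * (2 * α) ^ N.length := by gcongr
    _ = c * κ ^ K.length * ((8 * Real.exp 1) * α * κ) ^ N.length := by
      have : (8 * Real.exp 1) * α * κ = (4 * Real.exp 1 * κ) * (2 * α) := by ring
      rw [this, mul_pow (4 * Real.exp 1 * κ)]
      ring
    _ ≤ c * κ ^ K.length * (22 * α * κ) ^ N.length := by
      have := Real.exp_one_lt_d9
      gcongr
      linarith

/-- The pairs in `M` are assigned one after the other to the old pairs or to the created ones. The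
constant `44 = 2 * 22` accounts for the two half-edges that may be the selected one. -/
lemma stepMass_le (h0 : 0 ≤ α) (h1 : α ≤ 1) (hμ : ∀ C, 0 ≤ μ C)
    (hS : ∀ C, S C ⊆ edges C) (hc : 0 ≤ c)
    (hN : 0 < Fintype.card (HalfEdge d)) (hU : 4 * (U.card : ℝ) ≤ Fintype.card (HalfEdge d))
    (hκ : 1 / (Fintype.card (HalfEdge d) : ℝ) ≤ κ) (hUκ : U.card * κ ≤ α)
    (hb : PairBound μ U c κ) (M : List (HalfEdge d × HalfEdge d)) :
    ∀ K N : List (HalfEdge d × HalfEdge d), (ends K ++ (ends N ++ ends M)).Nodup →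
      (∀ a ∈ ends K ++ (ends N ++ ends M), a ∈ U) →
      stepMass α μ S K N M
        ≤ c * κ ^ K.length * (22 * α * κ) ^ N.length * (κ * (1 + 44 * α)) ^ M.length := by
  classical
  induction M with
  | nil =>
    intro K N hnd hK
    have e : ends ([] : List (HalfEdge d × HalfEdge d)) = [] := rfl
    rw [e, List.append_nil] at hnd hK
    simpa using stepMass_nil_le h0 h1 hμ hS hc hN hU hκ hUκ hb hnd hK
  | cons p M ih =>
    intro K N hnd hK
    obtain ⟨h, g⟩ := p
    have p1 : (ends ((h, g) :: K) ++ (ends N ++ ends M)).Perm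
        (ends K ++ (ends N ++ ends ((h, g) :: M))) := by
      rw [List.perm_iff_count]
      intro a
      simp only [ends_cons, List.count_append, List.count_cons]
      omega
    have p2 : (ends K ++ (ends ((h, g) :: N) ++ ends M)).Perm
        (ends K ++ (ends N ++ ends ((h, g) :: M))) := by
      rw [List.perm_iff_count]
      intro a
      simp only [ends_cons, List.count_append, List.count_cons]
      omega
    have p3 : (ends K ++ (ends ((g, h) :: N) ++ ends M)).Perm
        (ends K ++ (ends N ++ ends ((h, g) :: M))) := by
      rw [List.perm_iff_count]
      intro a
      simp only [ends_cons, List.count_append, List.count_cons]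
      omega
    have a1 := ih ((h, g) :: K) N (p1.nodup_iff.2 hnd) fun a ha => hK a (p1.mem_iff.1 ha)
    have a2 := ih K ((h, g) :: N) (p2.nodup_iff.2 hnd) fun a ha => hK a (p2.mem_iff.1 ha)
    have a3 := ih K ((g, h) :: N) (p3.nodup_iff.2 hnd) fun a ha => hK a (p3.mem_iff.1 ha)
    refine (stepMass_cons_le h0 h1 hμ hS K N M h g).trans
      ((add_le_add a1 (add_le_add a2 a3)).trans (le_of_eq ?_))
    simp only [List.length_cons, pow_succ]
    ring

open Classical in
/-- One rewiring, of any set of candidate edges that may depend on the configuration, changes the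
constant of a pair bound by a factor close to one only. -/
lemma sum_envStep_joins_le (h0 : 0 ≤ α) (h1 : α ≤ 1) (hμ : ∀ C, 0 ≤ μ C)
    (hS : ∀ C, S C ⊆ edges C) (hc : 0 ≤ c)
    (hN : 0 < Fintype.card (HalfEdge d)) (hU : 4 * (U.card : ℝ) ≤ Fintype.card (HalfEdge d))
    (hκ : 1 / (Fintype.card (HalfEdge d) : ℝ) ≤ κ) (hUκ : U.card * κ ≤ α)
    (hb : PairBound μ U c κ) {M : List (HalfEdge d × HalfEdge d)} (hM : (ends M).Nodup)
    (hMU : ∀ a ∈ ends M, a ∈ U) :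
    ∑ C, μ C * envStep α (S C) C (fun R η =>
      if R.card < (edges C \ R).card ∧ Joins η M then 1 else 0)
      ≤ c * (κ * (1 + 44 * α)) ^ M.length := by
  have e : ends ([] : List (HalfEdge d × HalfEdge d)) = [] := rfl
  have := stepMass_le h0 h1 hμ hS hc hN hU hκ hUκ hb M [] []
    (by simpa [e] using hM) (by simpa [e] using hMU)
  simpa [stepMass, joins_nil] using this

end PairBound

end DynCM

/-! ### Uniform configurations with prescribed pairs -/

namespace DynCM

variable {n : ℕ} {d : Fin n → ℕ} {α : ℝ}

open Classical in
/-- Number of configurations that contain all the pairs in `M`. -/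
noncomputable def numJoins (M : List (HalfEdge d × HalfEdge d)) : ℝ :=
  ∑ ξ : Config d, if Joins ξ M then 1 else 0

open Classical in
lemma numJoins_nonneg (M : List (HalfEdge d × HalfEdge d)) : 0 ≤ numJoins M :=
  Finset.sum_nonneg fun ξ _ => by split_ifs <;> norm_num

open Classical in
lemma numJoins_congr {M M' : List (HalfEdge d × HalfEdge d)}
    (h : ∀ ξ : Config d, Joins ξ M ↔ Joins ξ M') : numJoins M = numJoins M' :=
  Finset.sum_congr rfl fun ξ _ => if_congr (h ξ) rfl rfl

lemma joins_cons_swap {C : Config d} {h g : HalfEdge d} {M : List (HalfEdge d × HalfEdge d)} :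
    Joins C ((h, g) :: M) ↔ Joins C ((g, h) :: M) := by
  rw [joins_cons, joins_cons]
  refine and_congr_left fun _ => ?_
  constructor <;> rintro rfl <;> exact config_invol _ _

lemma sum_numJoins_cons (M : List (HalfEdge d × HalfEdge d)) (h : HalfEdge d) :
    ∑ g, numJoins ((h, g) :: M) = numJoins M := by
  classical
  unfold numJoins
  rw [Finset.sum_comm]
  refine Finset.sum_congr rfl fun ξ _ => ?_
  simp only [joins_cons, ite_and]
  simp

/-- Each further pair costs a factor of about one over the number of half-edges. -/
lemma numJoins_cons_le {M : List (HalfEdge d × HalfEdge d)} {k : ℝ}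
    (hk : 2 * (M.length : ℝ) + 1 ≤ k) (hkN : k < Fintype.card (HalfEdge d)) (h : HalfEdge d)
    {g : HalfEdge d} (hg : g ∉ ends M) :
    numJoins ((h, g) :: M) ≤ numJoins M / (Fintype.card (HalfEdge d) - k) := by
  classical
  by_cases hhg : g = h
  · refine le_trans (le_of_eq ?_) (div_nonneg (numJoins_nonneg M) (by linarith))
    refine Finset.sum_eq_zero fun ξ _ => if_neg ?_
    rw [joins_cons, hhg]
    exact fun e => config_ne ξ h e.1
  refine le_div_of_eq_off (F := insert h (ends M).toFinset)
    (G := fun g => numJoins ((h, g) :: M)) (fun g => numJoins_nonneg _) ?_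
    (sum_numJoins_cons M h).le ?_ hkN ?_
  · intro y y' hy hy'
    rw [Finset.mem_insert, not_or, List.mem_toFinset] at hy hy'
    have hfix : ∀ a, a = h ∨ a ∈ ends M → Equiv.swap y y' a = a := by
      rintro a (rfl | ha)
      · exact Equiv.swap_apply_of_ne_of_ne (Ne.symm hy.1) (Ne.symm hy'.1)
      · exact Equiv.swap_apply_of_ne_of_ne (fun e => hy.2 (e ▸ ha)) (fun e => hy'.2 (e ▸ ha))
    unfold numJoins
    rw [← (conjEquiv (Equiv.swap y y')).sum_comp
      (fun ξ => if Joins ξ ((h, y') :: M) then (1 : ℝ) else 0)]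
    refine Finset.sum_congr rfl fun ξ _ => if_congr ?_ rfl rfl
    change _ ↔ Joins (conj (Equiv.swap y y') ξ) ((h, y') :: M)
    rw [joins_cons, joins_cons, joins_conj fun p hp =>
      ⟨hfix _ (Or.inr (mem_ends.2 ⟨p, hp, Or.inl rfl⟩)),
        hfix _ (Or.inr (mem_ends.2 ⟨p, hp, Or.inr rfl⟩))⟩]
    refine and_congr_left fun _ => ?_
    have := conj_apply (Equiv.swap y y') ξ h
    rw [hfix h (Or.inl rfl)] at this
    rw [this, Equiv.swap_apply_eq_iff, Equiv.swap_apply_right]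
  · refine le_trans ?_ hk
    have c1 := Finset.card_insert_le h (ends M).toFinset
    have c2 := (ends M).toFinset_card_le
    rw [length_ends] at c2
    exact_mod_cast c1.trans (Nat.succ_le_succ c2)
  · rw [Finset.mem_insert, not_or, List.mem_toFinset]
    exact ⟨hhg, hg⟩

open Classical in
/-- The uniform distribution on the configurations containing `l` satisfies a pair bound for sets
of half-edges that meet `l` in at most one point. -/
lemma pairBound_uniform (l : List (HalfEdge d × HalfEdge d)) {U : Finset (HalfEdge d)}
    {h₀ : HalfEdge d} (hU : ∀ a ∈ U, a ∈ ends l → a = h₀) {k : ℝ}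
    (hk : 2 * (l.length : ℝ) + U.card + 1 ≤ k) (hkN : k < Fintype.card (HalfEdge d)) :
    PairBound (fun ξ : Config d => if Joins ξ l then 1 else 0) U (numJoins l)
      (1 / (Fintype.card (HalfEdge d) - k)) := by
  intro M hnd hMU
  have e : ∀ M : List (HalfEdge d × HalfEdge d),
      joinMass (fun ξ : Config d => if Joins ξ l then 1 else 0) (fun _ => 1) M
        = numJoins (M ++ l) := by
    intro M
    refine Finset.sum_congr rfl fun ξ _ => ?_
    have := joins_append (C := ξ) (M := M) (M' := l)
    by_cases a : Joins ξ l <;> by_cases b : Joins ξ M <;> simp [a, b, this]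
  rw [e]
  have hq : 0 ≤ 1 / ((Fintype.card (HalfEdge d) : ℝ) - k) := one_div_nonneg.2 (by linarith)
  induction M with
  | nil => simp
  | cons p M ih =>
    obtain ⟨h, g⟩ := p
    have hlen : 2 * ((h, g) :: M).length ≤ U.card := by
      rw [← length_ends, ← List.toFinset_card_of_nodup hnd]
      exact Finset.card_le_card fun a ha => hMU a (List.mem_toFinset.1 ha)
    rw [List.length_cons] at hlen
    rw [ends_cons, List.nodup_cons, List.nodup_cons, List.mem_cons, not_or] at hnd
    simp only [ends_cons, List.mem_cons] at hMU
    have ih := ih hnd.2.2 fun a ha => hMU a (Or.inr (Or.inr ha))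
    have hk' : 2 * ((M ++ l).length : ℝ) + 1 ≤ k := by
      have : 2 * ((M.length : ℝ) + 1) ≤ U.card := by exact_mod_cast hlen
      rw [List.length_append]
      push_cast
      linarith
    have hmem : ∀ a, a ∉ ends M → a ∉ ends l → a ∉ ends (M ++ l) := by
      intro a h1 h2 h3
      obtain ⟨p, hp, h3⟩ := mem_ends.1 h3
      rcases List.mem_append.1 hp with hp | hp
      exacts [h1 (mem_ends.2 ⟨p, hp, h3⟩), h2 (mem_ends.2 ⟨p, hp, h3⟩)]
    have key : numJoins ((h, g) :: (M ++ l))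
        ≤ numJoins (M ++ l) / (Fintype.card (HalfEdge d) - k) := by
      by_cases hg : g ∈ ends l
      · have hh : h ∉ ends l := fun hh => hnd.1.1
          ((hU h (hMU h (Or.inl rfl)) hh).trans (hU g (hMU g (Or.inr (Or.inl rfl))) hg).symm)
        rw [numJoins_congr fun ξ => joins_cons_swap]
        exact numJoins_cons_le hk' hkN g (hmem h hnd.1.2 hh)
      · exact numJoins_cons_le hk' hkN h (hmem g hnd.2.1 hg)
    rw [List.cons_append]
    refine key.trans ?_
    rw [div_eq_mul_one_div, List.length_cons, pow_succ, ← mul_assoc]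
    exact mul_le_mul_of_nonneg_right ih hq

end DynCM

/-! ### Following a path of the initial configuration -/

namespace DynCM

variable {n : ℕ} {d : Fin n → ℕ} {α : ℝ} {K : Rule d}

lemma val_le_one (hK : ∀ C x, K C x ⊆ edges C) (h0 : 0 ≤ α) (h1 : α ≤ 1)
    (l : List (HalfEdge d × HalfEdge d)) (C : Config d) (Y : Finset (HalfEdge d)) :
    val α K l C Y (fun _ _ => 1) ≤ 1 := by
  induction l generalizing C Y with
  | nil => exact le_rfl
  | cons e l ih =>
    rw [val]
    refine (envStep_mono h0 h1 fun R η _ => ?_).trans (envStep_const (hK C e.1) 1).le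
    split_ifs
    exacts [ih _ _, zero_le_one]

lemma envStep_zero (S : Finset (Edge d)) (C : Config d) :
    envStep α S C (fun _ _ => 0) = 0 := by simp [envStep]

/-- A path cannot be followed once one of its starting half-edges has been rewired. -/
lemma val_eq_zero {l : List (HalfEdge d × HalfEdge d)} {C : Config d} {Y : Finset (HalfEdge d)}
    {p : HalfEdge d × HalfEdge d} (hp : p ∈ l) (hY : p.1 ∉ Y)
    (Φ : Config d → Finset (HalfEdge d) → ℝ) : val α K l C Y Φ = 0 := by
  induction l generalizing C Y with
  | nil => exact absurd hp List.not_mem_nil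
  | cons e l ih =>
    rw [val]
    refine (envStep_congr fun R η _ => ?_).trans (envStep_zero _ _)
    split_ifs with h
    · rcases List.mem_cons.1 hp with rfl | hp
      · exact absurd (Finset.mem_sdiff.1 h.1).1 hY
      · exact ih hp fun e => hY (Finset.mem_sdiff.1 e).1
    · rfl

lemma sum_val_snoc_le (hK : ∀ C x, K C x ⊆ edges C) (h0 : 0 ≤ α) (h1 : α ≤ 1)
    (l : List (HalfEdge d × HalfEdge d)) (y : HalfEdge d) (C : Config d)
    (Y : Finset (HalfEdge d)) :
    ∑ z, val α K (l ++ [(y, z)]) C Y (fun _ _ => 1) ≤ val α K l C Y fun _ _ => 1 := by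
  simp only [val_append]
  rw [← val_sum]
  refine val_mono h0 h1 fun C Y => ?_
  simp only [val]
  rw [← envStep_sum]
  refine (envStep_mono h0 h1 fun R η _ => ?_).trans (envStep_const (hK C y) 1).le
  by_cases h : y ∈ Y \ halfEdges R
  · simp [h]
  · simp [h]

open Classical in
/-- The probability to leave the path `l` in its last step, along an edge that is not the one
prescribed by `l ++ [(y, z)]`. -/
noncomputable def deviation (α : ℝ) (K : Rule d) (l : List (HalfEdge d × HalfEdge d))
    (y z : HalfEdge d) (C : Config d) (Y : Finset (HalfEdge d)) : ℝ :=
  ∑ z' ∈ Finset.univ.erase z, val α K (l ++ [(y, z')]) C Y fun _ _ => 1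

lemma deviation_le_one (hK : ∀ C x, K C x ⊆ edges C) (h0 : 0 ≤ α) (h1 : α ≤ 1)
    (l : List (HalfEdge d × HalfEdge d)) (y z : HalfEdge d) (C : Config d)
    (Y : Finset (HalfEdge d)) : deviation α K l y z C Y ≤ 1 := by
  refine (Finset.sum_le_sum_of_subset_of_nonneg (Finset.subset_univ _) fun _ _ _ =>
    val_nonneg h0 h1 fun _ _ => zero_le_one).trans ?_
  exact (sum_val_snoc_le hK h0 h1 l y C Y).trans (val_le_one hK h0 h1 l C Y)

/-- The rewiring of `R`, with outcome `η`, leaves the path `l` intact. -/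
def KeepsPath (C : Config d) (l : List (HalfEdge d × HalfEdge d)) (R : Finset (Edge d))
    (η : Config d) : Prop :=
  R.card < (edges C \ R).card ∧ Joins η l

/-- The edges in `R` do not belong to the path `l`. -/
def Misses (R : Finset (Edge d)) (l : List (HalfEdge d × HalfEdge d)) : Prop :=
  ∀ p ∈ l, p.1 ∉ halfEdges R

open Classical in
/-- The probability that no edge of the path `l` is selected in one step. -/
noncomputable def missProb (α : ℝ) (S : Finset (Edge d)) (l : List (HalfEdge d × HalfEdge d)) :
    ℝ := ∑ R, selectProb α S R * if Misses R l then 1 else 0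

open Classical in
/-- The probability that no edge of the path `l` is selected, but that the path is destroyed by
the rewiring of other edges. -/
noncomputable def lossProb (α : ℝ) (S : Finset (Edge d)) (C : Config d)
    (l : List (HalfEdge d × HalfEdge d)) : ℝ :=
  envStep α S C fun R η => if Misses R l ∧ ¬ KeepsPath C l R η then 1 else 0

lemma lossProb_nonneg (h0 : 0 ≤ α) (h1 : α ≤ 1) (S : Finset (Edge d)) (C : Config d)
    (l : List (HalfEdge d × HalfEdge d)) : 0 ≤ lossProb α S C l :=
  envStep_nonneg h0 h1 fun R η _ => by split_ifs <;> norm_num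

/-- The error of one step: the deviation of the probability to miss the path `l` from `ρ`, and the
probability to destroy the path otherwise. -/
noncomputable def stepErr (α : ℝ) (K : Rule d) (ρ : ℕ → ℝ) (l : List (HalfEdge d × HalfEdge d))
    (x : HalfEdge d) (C : Config d) : ℝ :=
  |missProb α (K C x) l - ρ l.length| + 2 * lossProb α (K C x) C l

lemma stepErr_nonneg (h0 : 0 ≤ α) (h1 : α ≤ 1) (ρ : ℕ → ℝ)
    (l : List (HalfEdge d × HalfEdge d)) (x : HalfEdge d) (C : Config d) :
    0 ≤ stepErr α K ρ l x C :=
  add_nonneg (abs_nonneg _) (mul_nonneg zero_le_two (lossProb_nonneg h0 h1 _ _ _))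

open Classical in
/-- The accumulated error when the path `l` is followed as long as it stays intact. -/
noncomputable def pathErr (α : ℝ) (K : Rule d) (ρ : ℕ → ℝ) :
    List (HalfEdge d × HalfEdge d) → Config d → ℝ
  | [], _ => 0
  | e :: l, C => stepErr α K ρ (e :: l) e.1 C + envStep α (K C e.1) C fun R η =>
      if Misses R (e :: l) ∧ KeepsPath C (e :: l) R η then pathErr α K ρ l η else 0

lemma pathErr_nonneg (h0 : 0 ≤ α) (h1 : α ≤ 1) (ρ : ℕ → ℝ) :
    ∀ (l : List (HalfEdge d × HalfEdge d)) (C : Config d), 0 ≤ pathErr α K ρ l C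
  | [], _ => le_rfl
  | e :: l, C => by
    rw [pathErr]
    refine add_nonneg (stepErr_nonneg h0 h1 ρ _ _ C) (envStep_nonneg h0 h1 fun R η _ => ?_)
    split_ifs
    exacts [pathErr_nonneg h0 h1 ρ l η, le_rfl]

lemma joins_of_keepsPath_cons {C η : Config d} {e : HalfEdge d × HalfEdge d}
    {l : List (HalfEdge d × HalfEdge d)} {R : Finset (Edge d)} (h : KeepsPath C (e :: l) R η) :
    η.1 e.1 = e.2 ∧ Joins η l :=
  ⟨h.2 e List.mem_cons_self, fun p hp => h.2 p (List.mem_cons_of_mem _ hp)⟩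

lemma mem_sdiff_of_misses {e : HalfEdge d × HalfEdge d}
    {l : List (HalfEdge d × HalfEdge d)} {R : Finset (Edge d)} {Y : Finset (HalfEdge d)}
    (hY : ∀ p ∈ e :: l, p.1 ∈ Y) (h : Misses R (e :: l)) :
    e.1 ∈ Y \ halfEdges R ∧ ∀ p ∈ l, p.1 ∈ Y \ halfEdges R :=
  ⟨Finset.mem_sdiff.2 ⟨hY e List.mem_cons_self, h e List.mem_cons_self⟩, fun p hp =>
    Finset.mem_sdiff.2 ⟨hY p (List.mem_cons_of_mem _ hp), h p (List.mem_cons_of_mem _ hp)⟩⟩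

open Classical in
/-- The probability to follow a path of the initial configuration is close to the product of the
numbers `ρ`. -/
lemma abs_val_sub_prod_le (hK : ∀ C x, K C x ⊆ edges C) (h0 : 0 ≤ α) (h1 : α ≤ 1) {ρ : ℕ → ℝ}
    (hρ0 : ∀ i, 0 ≤ ρ i) (hρ1 : ∀ i, ρ i ≤ 1) (l : List (HalfEdge d × HalfEdge d))
    {C : Config d} {Y : Finset (HalfEdge d)} (hY : ∀ p ∈ l, p.1 ∈ Y) (hC : Joins C l) :
    |val α K l C Y (fun _ _ => 1) - ∏ i ∈ Finset.range l.length, ρ (i + 1)|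
      ≤ pathErr α K ρ l C := by
  induction l generalizing C Y with
  | nil => simp [val, pathErr]
  | cons e l ih =>
    set π := ∏ i ∈ Finset.range l.length, ρ (i + 1) with hπ
    have hπ0 : 0 ≤ π := Finset.prod_nonneg fun i _ => hρ0 _
    have hπ1 : π ≤ 1 := Finset.prod_le_one (fun i _ => hρ0 _) fun i _ => hρ1 _
    rw [List.length_cons, Finset.prod_range_succ, ← hπ, val, pathErr, stepErr]
    set S := K C e.1 with hS
    have hSe : S ⊆ edges C := hK C e.1
    -- on the event that the path ahead is neither selected nor destroyed the walk takes the step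
    -- along the path, and the induction hypothesis replaces what follows by `π`
    set G : Finset (Edge d) → Config d → ℝ := fun R η =>
      if Misses R (e :: l) ∧ KeepsPath C (e :: l) R η then π else 0 with hG
    have e1 : envStep α S C G = π * (missProb α S (e :: l) - lossProb α S C (e :: l)) := by
      have h2 : missProb α S (e :: l)
          = envStep α S C fun R _ => if Misses R (e :: l) then 1 else 0 :=
        (envStep_select hSe fun R => if Misses R (e :: l) then 1 else 0).symm
      rw [h2, lossProb, ← envStep_sub, ← envStep_const_mul]
      refine envStep_congr fun R η _ => ?_
      rw [hG]
      by_cases a : Misses R (e :: l) <;> by_cases b : KeepsPath C (e :: l) R η <;> simp [a, b]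
    have e2 : |envStep α S C (fun R η => if e.1 ∈ Y \ halfEdges R ∧ η.1 e.1 = e.2 then
        val α K l η (Y \ halfEdges R) (fun _ _ => 1) else 0) - envStep α S C G|
        ≤ (envStep α S C fun R η => if Misses R (e :: l) ∧ KeepsPath C (e :: l) R η then
            pathErr α K ρ l η else 0) + lossProb α S C (e :: l) := by
      rw [← envStep_sub, lossProb, ← envStep_add]
      refine (Finset.abs_sum_le_sum_abs _ _).trans (Finset.sum_le_sum fun R _ => ?_)
      refine (Finset.abs_sum_le_sum_abs _ _).trans (Finset.sum_le_sum fun η _ => ?_)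
      have hw := mul_nonneg (selectProb_nonneg h0 h1 S R) (repairProb_nonneg C R η)
      rw [abs_mul, abs_of_nonneg hw]
      refine mul_le_mul_of_nonneg_left ?_ hw
      rw [hG]
      by_cases a : Misses R (e :: l)
      · obtain ⟨m1, m2⟩ := mem_sdiff_of_misses hY a
        by_cases b : KeepsPath C (e :: l) R η
        · obtain ⟨j1, j2⟩ := joins_of_keepsPath_cons b
          simpa [a, b, m1, j1] using ih m2 j2
        · simp only [a, b, and_false, if_false, not_false_eq_true, and_true, if_true, sub_zero,
            zero_add]
          split_ifs
          · rw [abs_of_nonneg (val_nonneg h0 h1 fun _ _ => zero_le_one)]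
            exact val_le_one hK h0 h1 _ _ _
          · simp
      · simp only [a, false_and, if_false, sub_zero, add_zero]
        refine (abs_eq_zero.2 ?_).le
        split_ifs with c
        · unfold Misses at a
          push Not at a
          obtain ⟨p, hp, hpR⟩ := a
          rcases List.mem_cons.1 hp with rfl | hp
          · exact absurd hpR (Finset.mem_sdiff.1 c.1).2
          · exact val_eq_zero hp (fun h => (Finset.mem_sdiff.1 h).2 hpR) _
        · rfl
    have e3 : |envStep α S C G - π * ρ (l.length + 1)|
        ≤ |missProb α S (e :: l) - ρ (l.length + 1)| + lossProb α S C (e :: l) := by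
      have hl := lossProb_nonneg h0 h1 S C (e :: l)
      rw [e1, ← mul_sub, abs_mul, abs_of_nonneg hπ0]
      refine (mul_le_of_le_one_left (abs_nonneg _) hπ1).trans ?_
      have : missProb α S (e :: l) - lossProb α S C (e :: l) - ρ (l.length + 1)
          = (missProb α S (e :: l) - ρ (l.length + 1)) + -lossProb α S C (e :: l) := by ring
      rw [this]
      refine (abs_add_le _ _).trans ?_
      rw [abs_neg, abs_of_nonneg hl]
    refine (abs_sub_le _ _ _).trans ((add_le_add e2 e3).trans (le_of_eq ?_))
    rw [List.length_cons]
    ring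

open Classical in
/-- The probability to leave a path of the initial configuration in its last step is small as
well. -/
lemma deviation_le (hK : ∀ C x, K C x ⊆ edges C) (h0 : 0 ≤ α) (h1 : α ≤ 1) (ρ : ℕ → ℝ)
    (l : List (HalfEdge d × HalfEdge d)) (y z : HalfEdge d)
    {C : Config d} {Y : Finset (HalfEdge d)} (hY : ∀ p ∈ l ++ [(y, z)], p.1 ∈ Y)
    (hC : Joins C (l ++ [(y, z)])) :
    deviation α K l y z C Y ≤ pathErr α K ρ (l ++ [(y, z)]) C := by
  induction l generalizing C Y with
  | nil =>
    rw [List.nil_append, pathErr]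
    have a1 : deviation α K [] y z C Y ≤ lossProb α (K C y) C [(y, z)] := by
      unfold deviation lossProb
      simp only [List.nil_append, val]
      rw [← envStep_sum]
      refine envStep_mono h0 h1 fun R η _ => ?_
      by_cases a : y ∈ Y \ halfEdges R
      · have hm : Misses R [(y, z)] := by
          intro p hp
          rw [List.mem_singleton.1 hp]
          exact (Finset.mem_sdiff.1 a).2
        by_cases b : η.1 y = z
        · refine le_trans (le_of_eq (Finset.sum_eq_zero fun z' hz' => if_neg ?_)) ?_
          · exact fun e => (Finset.mem_erase.1 hz').1 (e.2.symm.trans b)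
          · split_ifs <;> norm_num
        · have hn : ¬ KeepsPath C [(y, z)] R η := fun h => b (h.2 _ List.mem_cons_self)
          rw [if_pos ⟨hm, hn⟩]
          simp only [a, true_and, Finset.sum_ite_eq]
          split_ifs <;> norm_num
      · simp only [a, false_and, if_false, Finset.sum_const_zero]
        split_ifs <;> norm_num
    have a2 := lossProb_nonneg h0 h1 (K C y) C [(y, z)]
    have a3 : 0 ≤ envStep α (K C y) C fun R η =>
        if Misses R [(y, z)] ∧ KeepsPath C [(y, z)] R η then pathErr α K ρ [] η else 0 :=
      envStep_nonneg h0 h1 fun R η _ => by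
        split_ifs
        exacts [pathErr_nonneg h0 h1 ρ _ _, le_rfl]
    have a4 := abs_nonneg (missProb α (K C y) [(y, z)] - ρ [(y, z)].length)
    unfold stepErr
    linarith
  | cons e l ih =>
    rw [List.cons_append] at hY hC ⊢
    rw [pathErr]
    have a1 : deviation α K (e :: l) y z C Y ≤ lossProb α (K C e.1) C (e :: (l ++ [(y, z)]))
        + envStep α (K C e.1) C fun R η => if Misses R (e :: (l ++ [(y, z)])) ∧
          KeepsPath C (e :: (l ++ [(y, z)])) R η then pathErr α K ρ (l ++ [(y, z)]) η else 0 := by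
      unfold lossProb
      rw [← envStep_add]
      have e1 : deviation α K (e :: l) y z C Y = envStep α (K C e.1) C fun R η =>
          if e.1 ∈ Y \ halfEdges R ∧ η.1 e.1 = e.2 then
            deviation α K l y z η (Y \ halfEdges R) else 0 := by
        unfold deviation
        simp only [List.cons_append, val]
        rw [← envStep_sum]
        refine envStep_congr fun R η _ => ?_
        split_ifs <;> simp
      rw [e1]
      refine envStep_mono h0 h1 fun R η _ => ?_
      by_cases a : Misses R (e :: (l ++ [(y, z)]))
      · obtain ⟨m1, m2⟩ := mem_sdiff_of_misses hY a
        by_cases b : KeepsPath C (e :: (l ++ [(y, z)])) R η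
        · obtain ⟨j1, j2⟩ := joins_of_keepsPath_cons b
          simpa [a, b, m1, j1] using ih m2 j2
        · simp only [a, b, and_false, if_false, not_false_eq_true, and_true, if_true, add_zero]
          split_ifs
          · exact deviation_le_one hK h0 h1 _ _ _ _ _
          · exact zero_le_one
      · simp only [a, false_and, if_false, add_zero]
        refine le_of_eq ?_
        split_ifs with c
        · unfold Misses at a
          push Not at a
          obtain ⟨p, hp, hpR⟩ := a
          rcases List.mem_cons.1 hp with rfl | hp
          · exact absurd hpR (Finset.mem_sdiff.1 c.1).2
          · refine Finset.sum_eq_zero fun z' _ => ?_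
            rcases List.mem_append.1 hp with hp | hp
            · exact val_eq_zero (List.mem_append_left _ hp)
                (fun h => (Finset.mem_sdiff.1 h).2 hpR) _
            · rw [List.mem_singleton.1 hp] at hpR
              exact val_eq_zero (p := (y, z')) (List.mem_append_right _ (List.mem_singleton.2 rfl))
                (fun h => (Finset.mem_sdiff.1 h).2 hpR) _
        · rfl
    have a2 := lossProb_nonneg h0 h1 (K C e.1) C (e :: (l ++ [(y, z)]))
    have a4 := abs_nonneg (missProb α (K C e.1) (e :: (l ++ [(y, z)]))
      - ρ (e :: (l ++ [(y, z)])).length)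
    unfold stepErr
    linarith

end DynCM

/-! ### Averaging the errors along a path -/

namespace DynCM

variable {n : ℕ} {d : Fin n → ℕ} {α : ℝ} {K : Rule d}

lemma envStep_le_of_forall (h0 : 0 ≤ α) (h1 : α ≤ 1) {S : Finset (Edge d)} {C : Config d}
    {F : Finset (Edge d) → Config d → ℝ} {B : ℝ}
    (h : ∀ R ⊆ S, ∑ η, repairProb C R η * F R η ≤ B) : envStep α S C F ≤ B := by
  rw [← one_mul B, ← sum_selectProb α S, Finset.sum_mul]
  refine Finset.sum_le_sum fun R _ => ?_
  by_cases hR : R ⊆ S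
  · simp only [mul_assoc]
    rw [← Finset.mul_sum]
    exact mul_le_mul_of_nonneg_left (h R hR) (selectProb_nonneg h0 h1 S R)
  · simp [selectProb_eq_zero hR]

lemma joinProb_nil {C : Config d} {R : Finset (Edge d)} (hR : R ⊆ edges C) :
    joinProb C R [] = 1 := by
  simp [joinProb, joins_nil, sum_repairProb hR]

/-- An intact path is destroyed by the rewiring of other edges with a probability that is
proportional to the number of rewired edges. -/
lemma lossProb_le (h0 : 0 ≤ α) (h1 : α ≤ 1) {S : Finset (Edge d)} {C : Config d}
    (hS : S ⊆ edges C) {l : List (HalfEdge d × HalfEdge d)} (hl : l ≠ []) (hC : Joins C l)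
    (hN : 0 < Fintype.card (HalfEdge d)) :
    lossProb α S C l ≤ 4 * l.length * S.card / Fintype.card (HalfEdge d) := by
  classical
  have hN0 : (0 : ℝ) < Fintype.card (HalfEdge d) := by exact_mod_cast hN
  have hl1 : (1 : ℝ) ≤ l.length := by exact_mod_cast List.length_pos_of_ne_nil hl
  refine envStep_le_of_forall h0 h1 fun R hR => ?_
  have hRC := hR.trans hS
  have hRS : (R.card : ℝ) ≤ S.card := by exact_mod_cast Finset.card_le_card hR
  have hB : 4 * (l.length : ℝ) * R.card / Fintype.card (HalfEdge d)
      ≤ 4 * l.length * S.card / Fintype.card (HalfEdge d) := by gcongr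
  refine le_trans ?_ hB
  -- a complete reshuffling requires that half of the edges are selected, and then the bound is
  -- trivial
  by_cases hlt : R.card < (edges C \ R).card
  swap
  · have e1 : (1 : ℝ) ≤ 4 * l.length * R.card / Fintype.card (HalfEdge d) := by
      rw [le_div_iff₀ hN0, one_mul]
      have : Fintype.card (HalfEdge d) ≤ 4 * R.card := by
        rw [card_halfEdge_eq C]
        rw [Finset.card_sdiff_of_subset hRC] at hlt
        omega
      have : (Fintype.card (HalfEdge d) : ℝ) ≤ 4 * R.card := by exact_mod_cast this
      have : (0 : ℝ) ≤ R.card := by positivity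
      nlinarith
    refine le_trans (le_trans (Finset.sum_le_sum fun η _ => ?_) (sum_repairProb hRC).le) e1
    refine mul_le_of_le_one_right (repairProb_nonneg _ _ _) ?_
    split_ifs <;> norm_num
  have hlt2 : 2 * (2 * (R.card : ℝ)) < Fintype.card (HalfEdge d) := by
    exact_mod_cast card_halfEdges_sdiff_lt hRC hlt
  by_cases hm : Misses R l
  swap
  · simp only [hm, false_and, if_false, mul_zero, Finset.sum_const_zero]
    positivity
  -- an edge of the path that is lost has its first half-edge matched with a half-edge of a selected
  -- edge
  have key : ∀ η, repairProb C R η * (if Misses R l ∧ ¬ KeepsPath C l R η then (1 : ℝ) else 0)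
      ≤ ∑ p ∈ l.toFinset, ∑ h ∈ halfEdges R,
        repairProb C R η * (if Joins η [(h, p.1)] then 1 else 0) := by
    intro η
    have hr := repairProb_nonneg C R η
    have hterm : ∀ (p : HalfEdge d × HalfEdge d) (h : HalfEdge d),
        0 ≤ repairProb C R η * (if Joins η [(h, p.1)] then (1 : ℝ) else 0) := fun p h =>
      mul_nonneg hr (by split_ifs <;> norm_num)
    have hsum := Finset.sum_nonneg fun p (_ : p ∈ l.toFinset) =>
      Finset.sum_nonneg fun h (_ : h ∈ halfEdges R) => hterm p h
    by_cases hη : repairProb C R η = 0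
    · simp [hη]
    by_cases hk : Joins η l
    · have : ¬ (Misses R l ∧ ¬ KeepsPath C l R η) := fun e => e.2 ⟨hlt, hk⟩
      rw [if_neg this, mul_zero]
      exact hsum
    have hk' := hk
    unfold Joins at hk
    push Not at hk
    obtain ⟨p, hp, hne⟩ := hk
    have hmem : η.1 p.1 ∈ halfEdges R := by
      by_contra h
      exact hne ((apply_eq_of_repairProb hRC hlt hη (hm p hp) h).trans (hC p hp))
    have a1 := Finset.single_le_sum (fun h _ => hterm p h) hmem
    have a2 := Finset.single_le_sum (f := fun p : HalfEdge d × HalfEdge d => ∑ h ∈ halfEdges R,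
        repairProb C R η * (if Joins η [(h, p.1)] then (1 : ℝ) else 0))
      (fun p _ => Finset.sum_nonneg fun h _ => hterm p h) (List.mem_toFinset.2 hp)
    refine le_trans ?_ (a1.trans a2)
    have : Joins η [(η.1 p.1, p.1)] := by
      rw [joins_cons]
      exact ⟨config_invol _ _, joins_nil _⟩
    rw [if_pos this]
    refine mul_le_mul_of_nonneg_left ?_ hr
    split_ifs <;> norm_num
  refine (Finset.sum_le_sum fun η _ => key η).trans ?_
  rw [Finset.sum_comm]
  have hone : ∀ p ∈ l.toFinset, ∑ η, ∑ h ∈ halfEdges R,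
      repairProb C R η * (if Joins η [(h, p.1)] then (1 : ℝ) else 0)
      ≤ 4 * R.card / Fintype.card (HalfEdge d) := by
    intro p hp
    rw [Finset.sum_comm]
    have hj : ∀ h ∈ halfEdges R, ∑ η, repairProb C R η *
        (if Joins η [(h, p.1)] then (1 : ℝ) else 0) ≤ 2 / Fintype.card (HalfEdge d) := by
      intro h hh
      refine (joinProb_cons_le_of_fresh hRC (N := []) (k := 2 * R.card)
        (fun _ h => absurd h List.not_mem_nil) (by simp) (by linarith) hh
        (hm p (List.mem_toFinset.1 hp)) (by simp) (by simp)).trans ?_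
      rw [joinProb_nil hRC, div_le_div_iff₀ (by linarith) hN0]
      linarith
    refine (Finset.sum_le_card_nsmul _ _ _ hj).trans (le_of_eq ?_)
    rw [nsmul_eq_mul, card_halfEdges hRC]
    push_cast
    ring
  refine (Finset.sum_le_card_nsmul _ _ _ hone).trans ?_
  rw [nsmul_eq_mul]
  have : (l.toFinset.card : ℝ) ≤ l.length := by exact_mod_cast l.toFinset_card_le
  calc (l.toFinset.card : ℝ) * (4 * R.card / Fintype.card (HalfEdge d))
      ≤ l.length * (4 * R.card / Fintype.card (HalfEdge d)) := by gcongr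
    _ = _ := by ring

open Classical in
/-- The measure `μ` after one step in which no edge of the path `l` is rewired. -/
noncomputable def pushMass (α : ℝ) (S : Config d → Finset (Edge d)) (μ : Config d → ℝ)
    (l : List (HalfEdge d × HalfEdge d)) (η : Config d) : ℝ :=
  ∑ C, μ C * ∑ R, selectProb α (S C) R * repairProb C R η *
    if Misses R l ∧ KeepsPath C l R η then 1 else 0

open Classical in
lemma sum_pushMass_mul (S : Config d → Finset (Edge d)) (μ : Config d → ℝ)
    (l : List (HalfEdge d × HalfEdge d)) (Φ : Config d → ℝ) :
    ∑ η, pushMass α S μ l η * Φ η = ∑ C, μ C * envStep α (S C) C fun R η =>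
      if Misses R l ∧ KeepsPath C l R η then Φ η else 0 := by
  unfold pushMass envStep
  simp only [Finset.sum_mul]
  rw [Finset.sum_comm]
  refine Finset.sum_congr rfl fun C _ => ?_
  simp only [mul_assoc, Finset.sum_mul]
  rw [← Finset.mul_sum, Finset.sum_comm]
  congr 1
  refine Finset.sum_congr rfl fun R _ => Finset.sum_congr rfl fun η _ => ?_
  split_ifs <;> ring

section Average

variable {μ : Config d → ℝ} {S : Config d → Finset (Edge d)}

lemma pushMass_nonneg (h0 : 0 ≤ α) (h1 : α ≤ 1) (hμ : ∀ C, 0 ≤ μ C)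
    (l : List (HalfEdge d × HalfEdge d)) (η : Config d) : 0 ≤ pushMass α S μ l η :=
  Finset.sum_nonneg fun C _ => mul_nonneg (hμ C) <| Finset.sum_nonneg fun R _ =>
    mul_nonneg (mul_nonneg (selectProb_nonneg h0 h1 _ _) (repairProb_nonneg _ _ _))
      (by split_ifs <;> norm_num)

lemma joins_of_pushMass {l : List (HalfEdge d × HalfEdge d)} {η : Config d}
    (h : pushMass α S μ l η ≠ 0) : Joins η l := by
  classical
  by_contra hn
  refine h (Finset.sum_eq_zero fun C _ => ?_)
  rw [Finset.sum_eq_zero fun R _ => ?_, mul_zero]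
  rw [if_neg fun e => hn e.2.2, mul_zero]

lemma PairBound.mono {U : Finset (HalfEdge d)} {c κ κ' : ℝ} (h : PairBound μ U c κ)
    (hc : 0 ≤ c) (hκ : 0 ≤ κ) (hκκ' : κ ≤ κ') : PairBound μ U c κ' := fun M h1 h2 =>
  (h M h1 h2).trans (mul_le_mul_of_nonneg_left (pow_le_pow_left₀ hκ hκκ' _) hc)

/-- One step of the dynamics, restricted to the event that the path stays intact, preserves pair
bounds up to a factor close to one. -/
lemma pairBound_pushMass (h0 : 0 ≤ α) (h1 : α ≤ 1) (hμ : ∀ C, 0 ≤ μ C)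
    (hS : ∀ C, S C ⊆ edges C) {U : Finset (HalfEdge d)} {c κ : ℝ} (hc : 0 ≤ c)
    (hN : 0 < Fintype.card (HalfEdge d)) (hU : 4 * (U.card : ℝ) ≤ Fintype.card (HalfEdge d))
    (hκ : 1 / (Fintype.card (HalfEdge d) : ℝ) ≤ κ) (hUκ : U.card * κ ≤ α)
    (hb : PairBound μ U c κ) (l : List (HalfEdge d × HalfEdge d)) :
    PairBound (pushMass α S μ l) U c (κ * (1 + 44 * α)) := by
  classical
  intro M hM hMU
  refine le_trans ?_ (sum_envStep_joins_le h0 h1 hμ hS hc hN hU hκ hUκ hb hM hMU)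
  unfold joinMass
  simp only [mul_one]
  rw [sum_pushMass_mul]
  refine Finset.sum_le_sum fun C _ => mul_le_mul_of_nonneg_left ?_ (hμ C)
  refine envStep_mono h0 h1 fun R η _ => ?_
  by_cases a : Misses R l ∧ KeepsPath C l R η
  · rw [if_pos a]
    by_cases b : Joins η M
    · rw [if_pos b, if_pos ⟨a.2.1, b⟩]
    · rw [if_neg b, if_neg fun e => b e.2]
  · rw [if_neg a]
    split_ifs <;> norm_num

/-- The accumulated error along a path, averaged over the initial configuration, is controlled by
the error of a single step under measures that satisfy pair bounds. -/
lemma sum_pathErr_le (hK : ∀ C x, K C x ⊆ edges C) (h0 : 0 ≤ α) (h1 : α ≤ 1) (ρ : ℕ → ℝ)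
    {𝒰 : Finset (HalfEdge d) → Prop} {u c κ ε : ℝ} (hc : 0 ≤ c)
    (hN : 0 < Fintype.card (HalfEdge d)) (h𝒰 : ∀ U, 𝒰 U → (U.card : ℝ) ≤ u)
    (hu : 4 * u ≤ Fintype.card (HalfEdge d))
    (hκ : 1 / (Fintype.card (HalfEdge d) : ℝ) ≤ κ) {T : ℕ}
    (hκu : u * (κ * (1 + 44 * α) ^ T) ≤ α) (l₀ : List (HalfEdge d × HalfEdge d))
    (hl₀ : l₀.length ≤ T)
    (hstep : ∀ (done : List (HalfEdge d × HalfEdge d)) (e : HalfEdge d × HalfEdge d)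
      (l : List (HalfEdge d × HalfEdge d)) (μ : Config d → ℝ), done ++ e :: l = l₀ →
      (∀ C, 0 ≤ μ C) → (∀ C, μ C ≠ 0 → Joins C (e :: l)) →
      (∀ U, 𝒰 U → PairBound μ U c (κ * (1 + 44 * α) ^ T)) →
      ∑ C, μ C * stepErr α K ρ (e :: l) e.1 C ≤ ε * c)
    (l : List (HalfEdge d × HalfEdge d)) :
    ∀ (done : List (HalfEdge d × HalfEdge d)) (μ : Config d → ℝ), done ++ l = l₀ →
      (∀ C, 0 ≤ μ C) → (∀ C, μ C ≠ 0 → Joins C l) →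
      (∀ U, 𝒰 U → PairBound μ U c (κ * (1 + 44 * α) ^ done.length)) →
      ∑ C, μ C * pathErr α K ρ l C ≤ l.length * (ε * c) := by
  classical
  have hN0 : (0 : ℝ) < Fintype.card (HalfEdge d) := by exact_mod_cast hN
  have hκ0 : 0 < κ := lt_of_lt_of_le (by positivity) hκ
  have hA : 1 ≤ 1 + 44 * α := by linarith
  induction l with
  | nil =>
    intro done μ _ _ _ _
    simp [pathErr]
  | cons e l ih =>
    intro done μ hdone hμ hsupp hb
    have hdT : done.length < T := by
      have := congrArg List.length hdone
      rw [List.length_append, List.length_cons] at this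
      omega
    have hpow : (1 + 44 * α) ^ done.length ≤ (1 + 44 * α) ^ T :=
      pow_le_pow_right₀ hA hdT.le
    have hκd : κ ≤ κ * (1 + 44 * α) ^ done.length :=
      le_mul_of_one_le_right hκ0.le (one_le_pow₀ hA)
    have hκd0 : 0 ≤ κ * (1 + 44 * α) ^ done.length := hκ0.le.trans hκd
    have hκT : κ * (1 + 44 * α) ^ done.length ≤ κ * (1 + 44 * α) ^ T :=
      mul_le_mul_of_nonneg_left hpow hκ0.le
    have s1 := hstep done e l μ hdone hμ hsupp fun U hU => (hb U hU).mono hc hκd0 hκT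
    have s2 := ih (done ++ [e]) (pushMass α (fun C => K C e.1) μ (e :: l))
      (by rw [List.append_assoc]; exact hdone) (pushMass_nonneg h0 h1 hμ _)
      (fun C hC => fun p hp => joins_of_pushMass hC p (List.mem_cons_of_mem _ hp))
      fun U hU => by
        have hUu := h𝒰 U hU
        have hU0 : (0 : ℝ) ≤ U.card := by positivity
        have := pairBound_pushMass h0 h1 hμ (S := fun C => K C e.1) (fun C => hK C e.1) hc hN
          (by linarith) (hκ.trans hκd)
          ((mul_le_mul hUu hκT hκd0 (hU0.trans hUu)).trans hκu) (hb U hU) (e :: l)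
        rw [mul_assoc, ← pow_succ] at this
        rwa [List.length_append, List.length_singleton]
    rw [sum_pushMass_mul] at s2
    have e1 : ∑ C, μ C * pathErr α K ρ (e :: l) C
        = ∑ C, μ C * stepErr α K ρ (e :: l) e.1 C
          + ∑ C, μ C * envStep α (K C e.1) C fun R η =>
            if Misses R (e :: l) ∧ KeepsPath C (e :: l) R η then pathErr α K ρ l η else 0 := by
      rw [← Finset.sum_add_distrib]
      refine Finset.sum_congr rfl fun C _ => ?_
      rw [← mul_add, pathErr]
    rw [e1, List.length_cons]
    push_cast
    linarith

end Average

end DynCM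

/-! ### Excursions from a set of vertices -/

namespace DynCM

variable {n : ℕ} {d : Fin n → ℕ}

/-- The vertices that can be reached from `S` in `m` steps along edges of `C`, where all vertices
after the first one lie outside of `P`. -/
def Layer (C : Config d) (P S : Finset (Fin n)) : ℕ → Fin n → Prop
  | 0, v => v ∈ S
  | m + 1, v => v ∉ P ∧ ∃ h : HalfEdge d, Layer C P S m h.1 ∧ (C.1 h).1 = v

lemma Layer.mono {C : Config d} {P S S' : Finset (Fin n)} (hS : S ⊆ S') :
    ∀ {m : ℕ} {v : Fin n}, Layer C P S m v → Layer C P S' m v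
  | 0, _, h => hS h
  | _ + 1, _, ⟨h1, h, h2, h3⟩ => ⟨h1, h, h2.mono hS, h3⟩

lemma Layer.eq_zero {C : Config d} {P S : Finset (Fin n)} {m : ℕ} {v : Fin n} (hv : v ∈ P)
    (h : Layer C P S m v) : m = 0 ∧ v ∈ S := by
  cases m with
  | zero => exact ⟨rfl, h⟩
  | succ m => exact absurd hv h.1

/-- The pairs along a chain of half-edges, which starts at `h`, ends at `g`, and traverses the
vertices of the pairs in `w`. -/
def chainPairs : HalfEdge d → List (HalfEdge d × HalfEdge d) → HalfEdge d →
    List (HalfEdge d × HalfEdge d)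
  | h, [], g => [(h, g)]
  | h, p :: w, g => (h, p.1) :: chainPairs p.2 w g

lemma chainPairs_snoc (h a b g : HalfEdge d) (w : List (HalfEdge d × HalfEdge d)) :
    chainPairs h (w ++ [(a, b)]) g = chainPairs h w a ++ [(b, g)] := by
  induction w generalizing h with
  | nil => rfl
  | cons p w ih => simp [chainPairs, ih]

lemma length_chainPairs (h g : HalfEdge d) (w : List (HalfEdge d × HalfEdge d)) :
    (chainPairs h w g).length = w.length + 1 := by
  induction w generalizing h with
  | nil => rfl
  | cons p w ih => simp [chainPairs, ih]

lemma ends_chainPairs (h g : HalfEdge d) (w : List (HalfEdge d × HalfEdge d)) :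
    ends (chainPairs h w g) = h :: (ends w ++ [g]) := by
  induction w generalizing h with
  | nil => rfl
  | cons p w ih => simp [chainPairs, ends_cons, ih]

lemma ends_append (M M' : List (HalfEdge d × HalfEdge d)) :
    ends (M ++ M') = ends M ++ ends M' := by simp [ends]

/-- A shortest excursion visits distinct vertices, and so traverses distinct half-edges. -/
lemma exists_chain {C : Config d} {P S : Finset (Fin n)} (m : ℕ) :
    ∀ b : HalfEdge d, Layer C P S m b.1 → (∀ j < m, ¬ Layer C P S j b.1) →
      (∀ j ≤ m, ¬ Layer C P S j (C.1 b).1) →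
      ∃ (h : HalfEdge d) (w : List (HalfEdge d × HalfEdge d)), h.1 ∈ S ∧ w.length = m ∧
        (∀ p ∈ w, Sibling p.1 p.2 ∧ p.1.1 ∉ P) ∧ Joins C (chainPairs h w (C.1 b)) ∧
        (ends (chainPairs h w (C.1 b))).Nodup ∧
        ∀ x ∈ h :: ends w, ∃ j ≤ m, Layer C P S j x.1 := by
  induction m with
  | zero =>
    intro b hb _ _
    refine ⟨b, [], hb, rfl, by simp, ?_, ?_, ?_⟩
    · simp [chainPairs, joins_cons, joins_nil]
    · rw [ends_chainPairs]
      simpa [ends] using (config_ne C b).symm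
    · intro x hx
      simp only [ends, List.flatMap_nil, List.mem_singleton] at hx
      subst hx
      exact ⟨0, le_rfl, hb⟩
  | succ m ih =>
    intro b hb hmin hv
    obtain ⟨hbP, b', hb', hbb'⟩ := hb
    have hmin' : ∀ j < m, ¬ Layer C P S j b'.1 := fun j hj hl =>
      hmin (j + 1) (by omega) ⟨hbP, b', hl, hbb'⟩
    obtain ⟨h, w, h1, h2, h3, h4, h5, h6⟩ := ih b' hb' hmin' fun j hj hl =>
      hmin j (by omega) (hbb' ▸ hl)
    set a := C.1 b' with ha
    have hab : a ≠ b := by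
      intro e
      have : C.1 b = b' := by rw [← e, ha, config_invol]
      exact hv m (by omega) (this ▸ hb')
    have hbl : Layer C P S (m + 1) b.1 := ⟨hbP, b', hb', hbb'⟩
    have hnb : ∀ x ∈ h :: ends w, x.1 ≠ b.1 := by
      intro x hx e
      obtain ⟨j, hj, hl⟩ := h6 x hx
      exact hmin j (by omega) (e ▸ hl)
    have hng : ∀ x ∈ h :: ends w, x.1 ≠ (C.1 b).1 := by
      intro x hx e
      obtain ⟨j, hj, hl⟩ := h6 x hx
      exact hv j (by omega) (e ▸ hl)
    have hgb : (C.1 b).1 ≠ b.1 := fun e => hv (m + 1) le_rfl (e ▸ hbl)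
    refine ⟨h, w ++ [(a, b)], h1, by simp [h2], ?_, ?_, ?_, ?_⟩
    · intro p hp
      rcases List.mem_append.1 hp with hp | hp
      · exact h3 p hp
      · rw [List.mem_singleton.1 hp]
        exact ⟨⟨hbb', hab⟩, hbb' ▸ hbP⟩
    · rw [chainPairs_snoc, joins_append]
      exact ⟨h4, by simp [joins_cons, joins_nil]⟩
    · rw [chainPairs_snoc, ends_append]
      refine List.Nodup.append h5 ?_ ?_
      · simpa [ends] using (config_ne C b).symm
      · intro x hx hx'
        rw [ends_chainPairs, ← List.cons_append, List.mem_append, List.mem_singleton] at hx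
        simp only [ends, List.flatMap_cons, List.flatMap_nil, List.append_nil, List.mem_cons,
          List.not_mem_nil, or_false] at hx'
        rcases hx with hx | e1 <;> rcases hx' with e2 | e2
        · exact hnb _ hx (by rw [e2])
        · exact hng _ hx (by rw [e2])
        · exact hab (e1.symm.trans e2)
        · exact hgb (by rw [← e2, e1, hbb'])
    · intro x hx
      rw [ends_append, ← List.cons_append, List.mem_append] at hx
      rcases hx with hx | hx
      · obtain ⟨j, hj, hl⟩ := h6 x hx
        exact ⟨j, by omega, hl⟩
      · simp only [ends, List.flatMap_cons, List.flatMap_nil, List.append_nil, List.mem_cons,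
          List.not_mem_nil, or_false] at hx
        rcases hx with rfl | rfl
        · exact ⟨m + 1, le_rfl, hbb'.symm ▸ hbl⟩
        · exact ⟨m + 1, le_rfl, hbl⟩

/-! ### Counting excursions -/

open Classical in
/-- The lists of length `m` with entries in `s`. -/
noncomputable def listsOf {ι : Type*} (s : Finset ι) : ℕ → Finset (List ι)
  | 0 => {[]}
  | m + 1 => (s ×ˢ listsOf s m).image fun p => p.1 :: p.2

lemma mem_listsOf {ι : Type*} {s : Finset ι} : ∀ {m : ℕ} {w : List ι},
    w ∈ listsOf s m ↔ w.length = m ∧ ∀ a ∈ w, a ∈ s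
  | 0, w => by
    rw [listsOf, Finset.mem_singleton]
    constructor
    · rintro rfl
      simp
    · exact fun h => List.length_eq_zero_iff.1 h.1
  | m + 1, w => by
    simp only [listsOf, Finset.mem_image, Finset.mem_product, Prod.exists]
    constructor
    · rintro ⟨a, w, ⟨ha, hw⟩, rfl⟩
      obtain ⟨h1, h2⟩ := mem_listsOf.1 hw
      refine ⟨by simp [h1], fun b hb => ?_⟩
      rcases List.mem_cons.1 hb with rfl | hb
      exacts [ha, h2 b hb]
    · rintro ⟨h1, h2⟩
      cases w with
      | nil => simp at h1
      | cons a w =>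
        exact ⟨a, w, ⟨h2 a List.mem_cons_self, mem_listsOf.2 ⟨by simpa using h1, fun b hb =>
          h2 b (List.mem_cons_of_mem _ hb)⟩⟩, rfl⟩

lemma card_listsOf_le {ι : Type*} (s : Finset ι) : ∀ m : ℕ, (listsOf s m).card ≤ s.card ^ m
  | 0 => by simp [listsOf]
  | m + 1 => by
    classical
    rw [listsOf, pow_succ']
    refine Finset.card_image_le.trans ?_
    rw [Finset.card_product]
    exact Nat.mul_le_mul_left _ (card_listsOf_le s m)

open Classical in
/-- The pairs of siblings. -/
noncomputable def sibPairs (d : Fin n → ℕ) : Finset (HalfEdge d × HalfEdge d) :=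
  Finset.univ.filter fun p => Sibling p.1 p.2

lemma card_sibPairs (d : Fin n → ℕ) : (sibPairs d).card = ∑ v, d v * (d v - 1) := by
  classical
  have h1 : (sibPairs d).card = ∑ h : HalfEdge d, degH h := by
    unfold sibPairs degH
    rw [Finset.card_filter, ← Finset.univ_product_univ, Finset.sum_product_right]
    refine Finset.sum_congr rfl fun h _ => ?_
    rw [Finset.card_filter]
  rw [h1, Fintype.sum_sigma]
  refine Finset.sum_congr rfl fun v _ => ?_
  have h2 : ∀ i : Fin (d v), degH (⟨v, i⟩ : HalfEdge d) = d v - 1 := fun i => by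
    have := degH_add_one (⟨v, i⟩ : HalfEdge d)
    have e : (⟨v, i⟩ : HalfEdge d).1 = v := rfl
    rw [e] at this
    omega
  simp [h2]

/-- The chain is admissible for a path `l`: its half-edges are distinct, and only the first one
may belong to the path. -/
def ChainOk (l : List (HalfEdge d × HalfEdge d)) (h : HalfEdge d)
    (w : List (HalfEdge d × HalfEdge d)) (g : HalfEdge d) : Prop :=
  (ends (chainPairs h w g)).Nodup ∧ ∀ a ∈ ends (chainPairs h w g), a ∈ ends l → a = h

/-- The sets of at most `u` half-edges that have at most one element in common with a path. -/
def FewCommon (l : List (HalfEdge d × HalfEdge d)) (u : ℝ) (U : Finset (HalfEdge d)) : Prop :=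
  (U.card : ℝ) ≤ u ∧ ∃ h, ∀ a ∈ U, a ∈ ends l → a = h

open Classical in
/-- A given chain is present with small mass. -/
lemma joinMass_chain_le {μ : Config d → ℝ} {l : List (HalfEdge d × HalfEdge d)} {u c κ : ℝ}
    (hb : ∀ U, FewCommon l u U → PairBound μ U c κ) {h g : HalfEdge d}
    {w : List (HalfEdge d × HalfEdge d)} (hok : ChainOk l h w g)
    (hu : 2 * ((w.length : ℝ) + 1) ≤ u) :
    joinMass μ (fun _ => 1) (chainPairs h w g) ≤ c * κ ^ (w.length + 1) := by
  rw [← length_chainPairs h g w]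
  refine hb (ends (chainPairs h w g)).toFinset ⟨?_, h, fun a ha => ?_⟩ _ hok.1
    fun a ha => List.mem_toFinset.2 ha
  · refine le_trans ?_ hu
    have := (ends (chainPairs h w g)).toFinset_card_le
    rw [length_ends, length_chainPairs] at this
    exact_mod_cast this
  · exact hok.2 a (List.mem_toFinset.1 ha)

open Classical in
/-- The weighted number of chains of `m + 1` edges in `C` that start in `A`. -/
noncomputable def chainCount (l : List (HalfEdge d × HalfEdge d)) (A : Finset (HalfEdge d))
    (f : HalfEdge d → ℝ) (m : ℕ) (C : Config d) : ℝ :=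
  ∑ h ∈ A, ∑ w ∈ listsOf (sibPairs d) m, ∑ g, f g *
    if ChainOk l h w g ∧ Joins C (chainPairs h w g) then 1 else 0

lemma le_chainCount {l : List (HalfEdge d × HalfEdge d)} {A : Finset (HalfEdge d)}
    {f : HalfEdge d → ℝ} (hf : ∀ g, 0 ≤ f g) {m : ℕ} {C : Config d} {h g : HalfEdge d}
    {w : List (HalfEdge d × HalfEdge d)} (hA : h ∈ A) (hw : w ∈ listsOf (sibPairs d) m)
    (h1 : ChainOk l h w g) (h2 : Joins C (chainPairs h w g)) : f g ≤ chainCount l A f m C := by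
  classical
  have hterm : ∀ h w g, 0 ≤ f g *
      if ChainOk l h w g ∧ Joins C (chainPairs h w g) then (1 : ℝ) else 0 := fun h w g =>
    mul_nonneg (hf g) (by split_ifs <;> norm_num)
  have a1 : f g ≤ ∑ g, f g *
      if ChainOk l h w g ∧ Joins C (chainPairs h w g) then (1 : ℝ) else 0 := by
    have := Finset.single_le_sum (fun g _ => hterm h w g) (Finset.mem_univ g)
    rwa [if_pos ⟨h1, h2⟩, mul_one] at this
  refine a1.trans ?_
  refine (Finset.single_le_sum (f := fun w => ∑ g, f g *
    if ChainOk l h w g ∧ Joins C (chainPairs h w g) then (1 : ℝ) else 0)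
    (fun w _ => Finset.sum_nonneg fun g _ => hterm h w g) hw).trans ?_
  exact Finset.single_le_sum (f := fun h => ∑ w ∈ listsOf (sibPairs d) m, ∑ g, f g *
    if ChainOk l h w g ∧ Joins C (chainPairs h w g) then (1 : ℝ) else 0)
    (fun h _ => Finset.sum_nonneg fun w _ => Finset.sum_nonneg fun g _ => hterm h w g) hA

/-- First moment bound for the number of chains. -/
lemma sum_chainCount_le {μ : Config d → ℝ} {l : List (HalfEdge d × HalfEdge d)}
    {u c κ : ℝ} (hc : 0 ≤ c) (hκ : 0 ≤ κ) (hb : ∀ U, FewCommon l u U → PairBound μ U c κ)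
    (A : Finset (HalfEdge d)) {f : HalfEdge d → ℝ} (hf : ∀ g, 0 ≤ f g) {m : ℕ}
    (hu : 2 * ((m : ℝ) + 1) ≤ u) :
    ∑ C, μ C * chainCount l A f m C
      ≤ A.card * (κ * ((sibPairs d).card : ℝ)) ^ m * κ * (∑ g, f g) * c := by
  classical
  have e1 : ∑ C, μ C * chainCount l A f m C = ∑ h ∈ A, ∑ w ∈ listsOf (sibPairs d) m, ∑ g,
      f g * ∑ C, μ C * if ChainOk l h w g ∧ Joins C (chainPairs h w g) then 1 else 0 := by
    unfold chainCount
    simp only [Finset.mul_sum]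
    rw [Finset.sum_comm]
    refine Finset.sum_congr rfl fun h _ => ?_
    rw [Finset.sum_comm]
    refine Finset.sum_congr rfl fun w _ => ?_
    rw [Finset.sum_comm]
    refine Finset.sum_congr rfl fun g _ => Finset.sum_congr rfl fun C _ => ?_
    ring
  have e2 : ∀ h, ∀ w ∈ listsOf (sibPairs d) m, ∀ g,
      ∑ C, μ C * (if ChainOk l h w g ∧ Joins C (chainPairs h w g) then (1 : ℝ) else 0)
        ≤ c * κ ^ (m + 1) := by
    intro h w hw g
    have hlen := (mem_listsOf.1 hw).1
    by_cases hok : ChainOk l h w g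
    · have := joinMass_chain_le hb hok (by rw [hlen]; exact hu)
      rw [hlen] at this
      simpa [joinMass, hok] using this
    · simp only [hok, false_and, if_false, mul_zero, Finset.sum_const_zero]
      positivity
  have hF : 0 ≤ ∑ g, f g := Finset.sum_nonneg fun g _ => hf g
  have e3 : ∀ h, ∑ w ∈ listsOf (sibPairs d) m, ∑ g,
      f g * ∑ C, μ C * (if ChainOk l h w g ∧ Joins C (chainPairs h w g) then (1 : ℝ) else 0)
      ≤ ((sibPairs d).card : ℝ) ^ m * ((∑ g, f g) * (c * κ ^ (m + 1))) := by
    intro h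
    refine (Finset.sum_le_sum fun w hw => Finset.sum_le_sum fun g _ =>
      mul_le_mul_of_nonneg_left (e2 h w hw g) (hf g)).trans ?_
    rw [← Finset.sum_mul, Finset.sum_const, nsmul_eq_mul]
    have : ((listsOf (sibPairs d) m).card : ℝ) ≤ ((sibPairs d).card : ℝ) ^ m := by
      exact_mod_cast card_listsOf_le (sibPairs d) m
    gcongr
  rw [e1]
  refine (Finset.sum_le_card_nsmul _ _ _ fun h _ => e3 h).trans (le_of_eq ?_)
  rw [nsmul_eq_mul, mul_pow, pow_succ]
  ring

end DynCM

/-! ### The vertices of a path -/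

namespace DynCM

variable {n : ℕ} {d : Fin n → ℕ} {α : ℝ}

/-- The half-edge `k` can be reached from `x` by `j` steps of the non-backtracking walk. -/
def Reach (C : Config d) (x : HalfEdge d) : ℕ → HalfEdge d → Prop
  | 0, k => k = x
  | j + 1, k => ∃ y, Reach C x j y ∧ Sibling (C.1 y) k

lemma nbMatrix_pow_nonneg (C : Config d) (j : ℕ) (x k : HalfEdge d) :
    0 ≤ (nbMatrix C ^ j) x k := by
  induction j generalizing k with
  | zero =>
    rw [pow_zero, Matrix.one_apply]
    split_ifs <;> norm_num
  | succ j ih =>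
    rw [pow_succ, Matrix.mul_apply]
    exact Finset.sum_nonneg fun y _ => mul_nonneg (ih y) (sibKer_nonneg _ _)

lemma nbMatrix_pow_pos_iff (hd : ∀ v, 2 ≤ d v) (C : Config d) (j : ℕ) (x k : HalfEdge d) :
    0 < (nbMatrix C ^ j) x k ↔ Reach C x j k := by
  induction j generalizing k with
  | zero =>
    rw [pow_zero, Matrix.one_apply]
    unfold Reach
    split_ifs with h
    · simp [h]
    · simpa using fun e : k = x => h e.symm
  | succ j ih =>
    have e : ∀ y, nbMatrix C y k = sibKer (C.1 y) k := fun _ => rfl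
    rw [pow_succ, Matrix.mul_apply]
    simp only [e]
    rw [Finset.sum_pos_iff_of_nonneg fun y _ =>
      mul_nonneg (nbMatrix_pow_nonneg C j x y) (sibKer_nonneg (C.1 y) k)]
    refine exists_congr fun y => ?_
    rw [← ih y]
    have hk := degH_pos hd k
    unfold sibKer
    by_cases h : Sibling (C.1 y) k
    · have : (0 : ℝ) < 1 / degH k := by positivity
      simp only [Finset.mem_univ, h, if_true, and_true, true_and]
      exact ⟨fun h' => pos_of_mul_pos_left h' this.le, fun h' => mul_pos h' this⟩
    · simp [h]

lemma mem_nearRule (hd : ∀ v, 2 ≤ d v) {r : ℕ} {C : Config d} {x : HalfEdge d} {e : Edge d} :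
    e ∈ nearRule r C x ↔ ∃ k, (∃ j < r, Reach C x j k) ∧ edgeAt C k = e := by
  simp only [nearRule, Finset.mem_image, Finset.mem_filter, Finset.mem_univ, true_and,
    nbMatrix_pow_pos_iff hd]

lemma nearRule_subset (r : ℕ) (C : Config d) (x : HalfEdge d) : nearRule r C x ⊆ edges C := by
  intro e he
  obtain ⟨k, -, rfl⟩ := Finset.mem_image.1 he
  exact edgeAt_mem_edges C k

/-- The first half-edge of a path with endpoint `y`. -/
def pathStart : List (HalfEdge d × HalfEdge d) → HalfEdge d → HalfEdge d
  | [], y => y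
  | e :: _, _ => e.1

/-- Consecutive pairs of `l` fit together, and the last one leads to `y`. -/
def Follows : List (HalfEdge d × HalfEdge d) → HalfEdge d → Prop
  | [], _ => True
  | e :: l, y => Sibling e.2 (pathStart l y) ∧ Follows l y

/-- The vertices visited by a path with endpoint `y`. -/
def verts (l : List (HalfEdge d × HalfEdge d)) (y : HalfEdge d) : List (Fin n) :=
  l.map (fun e => e.1.1) ++ [y.1]

lemma pathStart_append (l : List (HalfEdge d × HalfEdge d)) (e : HalfEdge d × HalfEdge d)
    (l' : List (HalfEdge d × HalfEdge d)) (y : HalfEdge d) :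
    pathStart (l ++ e :: l') y = pathStart l e.1 := by
  cases l <;> rfl

lemma follows_snoc {l : List (HalfEdge d × HalfEdge d)} {y z y' : HalfEdge d} :
    Follows (l ++ [(y, z)]) y' ↔ Follows l y ∧ Sibling z y' := by
  induction l with
  | nil => simp [Follows, pathStart]
  | cons e l ih => simp [Follows, ih, pathStart_append, and_assoc]

lemma length_verts (l : List (HalfEdge d × HalfEdge d)) (y : HalfEdge d) :
    (verts l y).length = l.length + 1 := by simp [verts]

/-- The position of a vertex on a path. -/
def pos (l : List (HalfEdge d × HalfEdge d)) (y : HalfEdge d) (v : Fin n) : ℕ :=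
  (verts l y).idxOf v

section Positions

variable {l : List (HalfEdge d × HalfEdge d)} {y : HalfEdge d}

lemma verts_getElem {i : ℕ} (hi : i < l.length) :
    (verts l y)[i]'(by rw [length_verts]; omega) = (l[i]).1.1 := by
  simp [verts, List.getElem_append_left, hi]

lemma Follows.sibling (h : Follows l y) {i : ℕ} (hi : i < l.length) (hi' : i + 1 < l.length) :
    Sibling (l[i]).2 (l[i + 1]).1 := by
  induction l generalizing i with
  | nil => simp at hi
  | cons e l ih =>
    cases i with
    | zero =>
      cases l with
      | nil => simp at hi'
      | cons e' l => exact h.1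
    | succ i => exact ih h.2 (by simpa using hi) (by simpa using hi')

lemma Follows.verts_succ (h : Follows l y) {i : ℕ} (hi : i < l.length) :
    (verts l y)[i + 1]'(by rw [length_verts]; omega) = (l[i]).2.1 := by
  induction l generalizing i with
  | nil => simp at hi
  | cons e l ih =>
    cases i with
    | zero =>
      cases l with
      | nil => exact h.1.1.symm
      | cons e' l => exact h.1.1.symm
    | succ i => exact ih h.2 (by simpa using hi)

lemma fst_mem_verts (hnd : (verts l y).Nodup) {i : ℕ} (hi : i < l.length) :
    (l[i]).1.1 ∈ verts l y ∧ pos l y (l[i]).1.1 = i := by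
  rw [← verts_getElem (y := y) hi]
  exact ⟨List.getElem_mem _, hnd.idxOf_getElem i _⟩

lemma Follows.snd_mem (h : Follows l y) (hnd : (verts l y).Nodup) {i : ℕ} (hi : i < l.length) :
    (l[i]).2.1 ∈ verts l y ∧ pos l y (l[i]).2.1 = i + 1 := by
  rw [← h.verts_succ hi]
  exact ⟨List.getElem_mem _, hnd.idxOf_getElem (i + 1) _⟩

lemma Follows.mem_of_mem_ends (h : Follows l y) (hnd : (verts l y).Nodup) {a : HalfEdge d}
    (ha : a ∈ ends l) : a.1 ∈ verts l y := by
  obtain ⟨p, hp, ha⟩ := mem_ends.1 ha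
  obtain ⟨i, hi, rfl⟩ := List.getElem_of_mem hp
  rcases ha with rfl | rfl
  exacts [(fst_mem_verts hnd hi).1, (h.snd_mem hnd hi).1]

lemma Follows.fst_ne_snd (h : Follows l y) (hnd : (verts l y).Nodup) {i j : ℕ}
    (hi : i < l.length) (hj : j < l.length) : (l[i]).1 ≠ (l[j]).2 := by
  intro e
  have h1 := (fst_mem_verts hnd hi).2
  rw [e, (h.snd_mem hnd hj).2] at h1
  subst h1
  exact (h.sibling hj hi).2 e.symm

lemma fst_injective (hnd : (verts l y).Nodup) {i j : ℕ}
    (hi : i < l.length) (hj : j < l.length) (e : (l[i]).1 = (l[j]).1) : i = j := by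
  have h1 := (fst_mem_verts hnd hi).2
  rw [e, (fst_mem_verts hnd hj).2] at h1
  exact h1.symm

end Positions

/-! ### Shortcuts -/

/-- No excursion of at most `r` steps from the path leads back to a vertex of the path beyond
position `u`, except along the path itself. -/
def NoShortcut (r u : ℕ) (l : List (HalfEdge d × HalfEdge d)) (y : HalfEdge d) (C : Config d) :
    Prop :=
  ∀ v ∈ verts l y, u < pos l y v → ∀ m < r, ∀ h : HalfEdge d,
    Layer C (verts l y).toFinset ((verts l y).toFinset.erase v) m h.1 → (C.1 h).1 = v →
      C.1 h ∈ ends l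

lemma Reach.exists_layer {C : Config d} {P : Finset (Fin n)} {x : HalfEdge d} (hx : x.1 ∈ P) :
    ∀ {j : ℕ} {k : HalfEdge d}, Reach C x j k → ∃ m ≤ j, Layer C P P m k.1
  | 0, k, h => ⟨0, le_rfl, by cases h; exact hx⟩
  | j + 1, k, ⟨y, hy, hk⟩ => by
    obtain ⟨m, hm, hl⟩ := hy.exists_layer hx
    rw [← hk.1]
    by_cases hP : (C.1 y).1 ∈ P
    · exact ⟨0, Nat.zero_le _, hP⟩
    · exact ⟨m + 1, by omega, hP, y, hl, rfl⟩

section Ahead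

variable {l : List (HalfEdge d × HalfEdge d)} {y : HalfEdge d} {C : Config d} {r u : ℕ}

/-- Without shortcuts, `j` steps of the walk lead at most `j` positions ahead. -/
lemma NoShortcut.exists_pos_le (hs : NoShortcut r u l y C) (hf : Follows l y)
    (hnd : (verts l y).Nodup) (hC : ∀ i (hi : i < l.length), u ≤ i → C.1 (l[i]).1 = (l[i]).2)
    (hu : u < l.length) :
    ∀ {j : ℕ} {k : HalfEdge d}, j < r → Reach C (l[u]).1 j k →
      ∃ a ∈ verts l y, pos l y a ≤ u + j ∧ ∃ m ≤ j, Layer C (verts l y).toFinset {a} m k.1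
  | 0, k, _, h => by
    refine ⟨(l[u]).1.1, (fst_mem_verts hnd hu).1, (fst_mem_verts hnd hu).2.le, 0, le_rfl, ?_⟩
    cases h
    exact Finset.mem_singleton_self _
  | j + 1, k', hj, ⟨k, hk, hkk'⟩ => by
    obtain ⟨a, ha, hpa, m, hm, hl⟩ := hs.exists_pos_le hf hnd hC hu (by omega) hk
    rw [← hkk'.1]
    by_cases hP : (C.1 k).1 ∈ verts l y
    swap
    · exact ⟨a, ha, by omega, m + 1, by omega, fun h => hP (List.mem_toFinset.1 h), k, hl, rfl⟩
    refine ⟨(C.1 k).1, hP, ?_, 0, Nat.zero_le _, Finset.mem_singleton_self _⟩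
    by_cases hua : a = (C.1 k).1
    · rw [← hua]
      omega
    by_contra hlt
    rw [not_le] at hlt
    have hmem := hs _ hP (by omega) m (by omega) k
      (hl.mono (Finset.singleton_subset_iff.2 (Finset.mem_erase.2
        ⟨hua, List.mem_toFinset.2 ha⟩))) rfl
    -- the walk can only enter the vertex along the path, and then it comes from a neighbour
    have hk1 : ∀ q, k.1 ∈ verts l y → pos l y k.1 = q → q ≤ u + j := by
      intro q h1 h2
      have := (hl.eq_zero (List.mem_toFinset.2 h1)).2
      rw [Finset.mem_singleton] at this
      rw [← h2, this]
      exact hpa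
    obtain ⟨p, hp, hp'⟩ := mem_ends.1 hmem
    obtain ⟨i, hi, rfl⟩ := List.getElem_of_mem hp
    rcases hp' with e | e
    · have e1 := (fst_mem_verts hnd hi).2
      rw [← e] at e1
      have e2 : k = (l[i]).2 := by rw [← hC i hi (by omega), ← e, config_invol]
      have := hk1 (i + 1) (e2 ▸ (hf.snd_mem hnd hi).1) (e2 ▸ (hf.snd_mem hnd hi).2)
      omega
    · have e1 := (hf.snd_mem hnd hi).2
      rw [← e] at e1
      have e2 : k = (l[i]).1 := by
        apply config_injective C
        rw [hC i hi (by omega), e]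
      have := hk1 i (e2 ▸ (fst_mem_verts hnd hi).1) (e2 ▸ (fst_mem_verts hnd hi).2)
      omega

lemma NoShortcut.pos_le (hs : NoShortcut r u l y C) (hf : Follows l y)
    (hnd : (verts l y).Nodup) (hC : ∀ i (hi : i < l.length), u ≤ i → C.1 (l[i]).1 = (l[i]).2)
    (hu : u < l.length) {j : ℕ} {k : HalfEdge d} (hj : j < r) (hk : Reach C (l[u]).1 j k)
    (hP : k.1 ∈ verts l y) : pos l y k.1 ≤ u + j := by
  obtain ⟨a, -, hpa, m, -, hl⟩ := hs.exists_pos_le hf hnd hC hu hj hk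
  have := (hl.eq_zero (List.mem_toFinset.2 hP)).2
  rw [Finset.mem_singleton] at this
  rw [this]
  exact hpa

lemma reach_path (hf : Follows l y)
    (hC : ∀ i (hi : i < l.length), u ≤ i → C.1 (l[i]).1 = (l[i]).2) (hu : u < l.length) :
    ∀ {j : ℕ} (hj : u + j < l.length), Reach C (l[u]).1 j (l[u + j]).1
  | 0, _ => rfl
  | j + 1, hj => ⟨_, reach_path hf hC hu (by omega), by
      rw [hC (u + j) (by omega) (by omega)]
      exact hf.sibling (i := u + j) (Nat.lt_of_succ_lt hj) hj⟩

open Classical in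
/-- Without shortcuts, the candidates for rewiring on the part of the path ahead are the next `r`
edges. -/
lemma NoShortcut.card_inter (hd : ∀ v, 2 ≤ d v) (hs : NoShortcut r u l y C) (hf : Follows l y)
    (hnd : (verts l y).Nodup) (hC : ∀ i (hi : i < l.length), u ≤ i → C.1 (l[i]).1 = (l[i]).2)
    (hu : u < l.length) :
    (nearRule r C (l[u]).1 ∩ ((l.drop u).toFinset.image Prod.fst).image
      (edgeAt C)).card = min r (l.length - u) := by
  have hinj : ∀ i j (hi : i < l.length) (hj : j < l.length), u ≤ j →
      edgeAt C (l[i]).1 = edgeAt C (l[j]).1 → i = j := by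
    intro i j hi hj huj e
    rcases edgeAt_eq_iff.1 e with e | e
    · exact fst_injective hnd hi hj e
    · rw [hC j hj huj] at e
      exact absurd e (hf.fst_ne_snd hnd hi hj)
  have e1 : nearRule r C (l[u]).1 ∩ ((l.drop u).toFinset.image Prod.fst).image
      (edgeAt C) = Finset.univ.image fun i : Fin (min r (l.length - u)) =>
        edgeAt C (l[u + i.1]'(by have := i.2; omega)).1 := by
    ext e
    rw [Finset.mem_inter]
    simp only [Finset.mem_image, Finset.mem_univ, true_and, List.mem_toFinset]
    constructor
    · rintro ⟨h1, a, ⟨p, hp, rfl⟩, rfl⟩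
      obtain ⟨k, ⟨j, hj, hk⟩, hk2⟩ := (mem_nearRule hd).1 h1
      obtain ⟨i, hi, rfl⟩ := List.getElem_of_mem hp
      rw [List.length_drop] at hi
      simp only [List.getElem_drop] at hk2 ⊢
      have hi' : u + i < l.length := by omega
      refine ⟨⟨i, ?_⟩, rfl⟩
      have hle : u + i ≤ u + j := by
        rcases edgeAt_eq_iff.1 hk2 with rfl | rfl
        · have := hs.pos_le hf hnd hC hu hj hk (fst_mem_verts hnd hi').1
          rwa [(fst_mem_verts hnd hi').2] at this
        · rw [hC (u + i) hi' (by omega)] at hk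
          have := hs.pos_le hf hnd hC hu hj hk (hf.snd_mem hnd hi').1
          rw [(hf.snd_mem hnd hi').2] at this
          omega
      omega
    · rintro ⟨⟨i, hi⟩, rfl⟩
      have hi' : u + i < l.length := by omega
      refine ⟨(mem_nearRule hd).2 ⟨_, ⟨i, by omega, reach_path hf hC hu hi'⟩, rfl⟩, _,
        ⟨(l[u + i]), ?_, rfl⟩, rfl⟩
      rw [List.mem_iff_getElem]
      exact ⟨i, by rw [List.length_drop]; omega, by simp⟩
  rw [e1, Finset.card_image_of_injective, Finset.card_univ, Fintype.card_fin]
  rintro ⟨i, hi⟩ ⟨j, hj⟩ e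
  have := hinj (u + i) (u + j) (by omega) (by omega) (by omega) e
  exact Fin.ext (by simp only; omega)

open Classical in
lemma NoShortcut.missProb_eq (hd : ∀ v, 2 ≤ d v) (hs : NoShortcut r u l y C) (hf : Follows l y)
    (hnd : (verts l y).Nodup) (hC : ∀ i (hi : i < l.length), u ≤ i → C.1 (l[i]).1 = (l[i]).2)
    (hu : u < l.length) :
    missProb α (nearRule r C (l[u]).1) (l.drop u) = (1 - α) ^ min r (l.length - u) := by
  rw [← hs.card_inter hd hf hnd hC hu, ← sum_selectProb_disjoint, missProb]
  refine Finset.sum_congr rfl fun R _ => ?_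
  by_cases hR : R ⊆ nearRule r C (l[u]).1
  swap
  · simp [selectProb_eq_zero hR]
  have : Misses R (l.drop u) ↔
      Disjoint R (((l.drop u).toFinset.image Prod.fst).image (edgeAt C)) := by
    rw [Finset.disjoint_right]
    simp only [Finset.forall_mem_image, List.mem_toFinset, Misses,
      mem_halfEdges_iff (hR.trans (nearRule_subset r C _))]
  by_cases h : Misses R (l.drop u)
  · rw [if_pos h, if_pos (this.1 h), mul_one]
  · rw [if_neg h, if_neg fun h' => h (this.2 h'), mul_zero]

end Ahead

end DynCM

/-! ### The error of a single step under near rewiring -/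

namespace DynCM

variable {n : ℕ} {d : Fin n → ℕ} {α : ℝ}

/-- The half-edges at the vertices in `P`. -/
def halfEdgesAt (d : Fin n → ℕ) (P : Finset (Fin n)) : Finset (HalfEdge d) :=
  Finset.univ.filter fun h => h.1 ∈ P

lemma card_halfEdgesAt (P : Finset (Fin n)) : (halfEdgesAt d P).card = ∑ v ∈ P, d v := by
  classical
  rw [Finset.card_eq_sum_card_fiberwise (f := fun h : HalfEdge d => h.1) (t := P)
    (s := halfEdgesAt d P) fun h hh => (Finset.mem_filter.1 hh).2]
  refine Finset.sum_congr rfl fun v hv => ?_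
  rw [← card_fiber_vertex (d := d) v]
  congr 1
  ext h
  simp only [halfEdgesAt, Finset.mem_filter, Finset.mem_univ, true_and]
  constructor
  · exact fun h => h.2
  · rintro rfl
    exact ⟨hv, rfl⟩

section

variable {l : List (HalfEdge d × HalfEdge d)} {P : Finset (Fin n)} {C : Config d}

/-- A shortest excursion from `P`, prolonged by one edge that does not belong to the path, is
counted by `chainCount`. -/
lemma le_chainCount_of_layer (hl : ∀ a ∈ ends l, a.1 ∈ P) {S : Finset (Fin n)} (hSP : S ⊆ P)
    {m : ℕ} {h : HalfEdge d} (hm : Layer C P S m h.1) (hmin : ∀ j < m, ¬ Layer C P S j h.1)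
    (hend : ∀ j ≤ m, ¬ Layer C P S j (C.1 h).1) (hCh : C.1 h ∉ ends l) {f : HalfEdge d → ℝ}
    (hf : ∀ g, 0 ≤ f g) : f (C.1 h) ≤ chainCount l (halfEdgesAt d P) f m C := by
  obtain ⟨h₀, w, h1, h2, h3, h4, h5, -⟩ := exists_chain m h hm hmin hend
  refine le_chainCount hf (h := h₀) (w := w)
    (Finset.mem_filter.2 ⟨Finset.mem_univ _, hSP h1⟩) ?_ ⟨h5, ?_⟩ h4
  · refine mem_listsOf.2 ⟨h2, fun p hp => ?_⟩
    classical exact Finset.mem_filter.2 ⟨Finset.mem_univ _, (h3 p hp).1⟩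
  · intro a ha hal
    rw [ends_chainPairs, List.mem_cons, List.mem_append, List.mem_singleton] at ha
    rcases ha with rfl | ha | rfl
    · rfl
    · obtain ⟨p, hp, ha⟩ := mem_ends.1 ha
      have hp3 := h3 p hp
      rcases ha with rfl | rfl
      · exact absurd (hl _ hal) hp3.2
      · exact absurd (hl _ hal) (hp3.1.1 ▸ hp3.2)
    · exact absurd hal hCh

lemma chainCount_nonneg {A : Finset (HalfEdge d)} {f : HalfEdge d → ℝ} (hf : ∀ g, 0 ≤ f g)
    (m : ℕ) (C : Config d) : 0 ≤ chainCount l A f m C :=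
  Finset.sum_nonneg fun h _ => Finset.sum_nonneg fun w _ => Finset.sum_nonneg fun g _ =>
    mul_nonneg (hf g) (by split_ifs <;> norm_num)

open Classical in
/-- The number of candidate edges is controlled by the number of excursions from the path. -/
lemma card_nearRule_le (hd : ∀ v, 2 ≤ d v) (hl : ∀ a ∈ ends l, a.1 ∈ P) {x : HalfEdge d}
    (hx : x.1 ∈ P) (r : ℕ) :
    ((nearRule r C x).card : ℝ) ≤ (halfEdgesAt d P).card + ∑ k : HalfEdge d,
      ∑ m ∈ Finset.range r, chainCount l (halfEdgesAt d P)
        (fun g => if g.1 = k.1 then 1 else 0) m C := by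
  have hf : ∀ k g : HalfEdge d, (0 : ℝ) ≤ if g.1 = k.1 then 1 else 0 := fun k g => by
    split_ifs <;> norm_num
  set B := Finset.univ.filter fun k : HalfEdge d => k.1 ∉ P ∧ ∃ j < r, Reach C x j k with hB
  have h1 : nearRule r C x ⊆ (halfEdgesAt d P ∪ B).image (edgeAt C) := by
    intro e he
    obtain ⟨k, hk, rfl⟩ := (mem_nearRule hd).1 he
    refine Finset.mem_image_of_mem _ (Finset.mem_union.2 ?_)
    by_cases hP : k.1 ∈ P
    · exact Or.inl (Finset.mem_filter.2 ⟨Finset.mem_univ _, hP⟩)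
    · exact Or.inr (Finset.mem_filter.2 ⟨Finset.mem_univ _, hP, hk⟩)
  have h2 : (nearRule r C x).card ≤ (halfEdgesAt d P).card + B.card :=
    (Finset.card_le_card h1).trans (Finset.card_image_le.trans (Finset.card_union_le _ _))
  have h3 : (B.card : ℝ) ≤ ∑ k : HalfEdge d, ∑ m ∈ Finset.range r,
      chainCount l (halfEdgesAt d P) (fun g => if g.1 = k.1 then 1 else 0) m C := by
    rw [← nsmul_one, ← Finset.sum_const]
    refine (Finset.sum_le_sum fun k hk => ?_).trans (Finset.sum_le_sum_of_subset_of_nonneg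
      (Finset.subset_univ B) fun k _ _ => Finset.sum_nonneg fun m _ =>
        chainCount_nonneg (hf k) m C)
    obtain ⟨-, hkP, j, hj, hk⟩ := Finset.mem_filter.1 hk
    have hex : ∃ m, Layer C P P m k.1 := by
      obtain ⟨m, -, hm⟩ := hk.exists_layer hx
      exact ⟨m, hm⟩
    have hle : Nat.find hex ≤ j := by
      obtain ⟨m, hm, hm'⟩ := hk.exists_layer hx
      exact (Nat.find_min' hex hm').trans hm
    have hfind := Nat.find_spec hex
    have hmin : ∀ i < Nat.find hex, ¬ Layer C P P i k.1 := fun i hi => Nat.find_min hex hi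
    obtain ⟨m, hm⟩ : ∃ m, Nat.find hex = m := ⟨_, rfl⟩
    rw [hm] at hle hfind hmin
    cases m with
    | zero => exact absurd hfind hkP
    | succ m =>
      obtain ⟨-, h, hh, hk2⟩ := hfind
      have key := le_chainCount_of_layer (f := fun g => if g.1 = k.1 then 1 else 0) hl
        (le_refl P) hh (fun i hi hl => hmin (i + 1) (by omega) ⟨hkP, h, hl, hk2⟩)
        (fun i hi hl => hmin i (by omega) (hk2 ▸ hl)) (fun hmem => hkP (hk2 ▸ hl _ hmem)) (hf k)
      simp only [hk2, if_true] at key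
      exact key.trans (Finset.single_le_sum (f := fun m => chainCount l (halfEdgesAt d P)
        (fun g => if g.1 = k.1 then 1 else 0) m C) (fun m _ => chainCount_nonneg (hf k) m C)
        (Finset.mem_range.2 (by omega)))
  have h4 : ((nearRule r C x).card : ℝ) ≤ (halfEdgesAt d P).card + B.card := by
    exact_mod_cast h2
  linarith

open Classical in
/-- A shortcut is an excursion of fewer than `r` steps that starts and ends on the path. -/
lemma one_le_sum_chainCount {y : HalfEdge d} (hf : Follows l y) (hnd : (verts l y).Nodup)
    {r u : ℕ} (hs : ¬ NoShortcut r u l y C) :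
    1 ≤ ∑ m ∈ Finset.range r, chainCount l (halfEdgesAt d (verts l y).toFinset)
      (fun g => if g.1 ∈ (verts l y).toFinset then 1 else 0) m C := by
  set P := (verts l y).toFinset with hP
  have hf0 : ∀ g : HalfEdge d, (0 : ℝ) ≤ if g.1 ∈ P then 1 else 0 := fun g => by
    split_ifs <;> norm_num
  unfold NoShortcut at hs
  push Not at hs
  obtain ⟨v, hv, -, m, hm, h, hlay, hhv, hmem⟩ := hs
  have hvP : v ∈ P := List.mem_toFinset.2 hv
  have hex : ∃ m, Layer C P (P.erase v) m h.1 := ⟨m, hlay⟩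
  have hle : Nat.find hex ≤ m := Nat.find_min' hex hlay
  have key := le_chainCount_of_layer (f := fun g => if g.1 ∈ P then 1 else 0)
    (fun a ha => List.mem_toFinset.2 (hf.mem_of_mem_ends hnd ha)) (P.erase_subset v)
    (Nat.find_spec hex) (fun i hi => Nat.find_min hex hi) (fun i _ hi => by
      rw [hhv] at hi
      exact (Finset.mem_erase.1 (hi.eq_zero hvP).2).1 rfl) hmem hf0
  rw [hhv, if_pos hvP] at key
  exact key.trans (Finset.single_le_sum (f := fun m => chainCount l (halfEdgesAt d P)
    (fun g => if g.1 ∈ P then 1 else 0) m C) (fun m _ => chainCount_nonneg hf0 m C)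
    (Finset.mem_range.2 (by omega)))

end

lemma pow_le_max_one_pow {q : ℝ} (hq : 0 ≤ q) {m r : ℕ} (h : m ≤ r) : q ^ m ≤ max 1 q ^ r :=
  (pow_le_pow_left₀ hq (le_max_right _ _) m).trans
    (pow_le_pow_right₀ (le_max_left _ _) h)

/-- The expected number of excursions of length at most `r`. -/
lemma sum_sum_chainCount_le {μ : Config d → ℝ} {l : List (HalfEdge d × HalfEdge d)}
    {c κ : ℝ} (hc : 0 ≤ c) (hκ : 0 ≤ κ) {r : ℕ}
    (hb : ∀ U, FewCommon l (2 * r) U → PairBound μ U c κ)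
    (A : Finset (HalfEdge d)) {f : HalfEdge d → ℝ} (hf : ∀ g, 0 ≤ f g) :
    ∑ C, μ C * ∑ m ∈ Finset.range r, chainCount l A f m C
      ≤ A.card * (r * max 1 (κ * ((sibPairs d).card : ℝ)) ^ r * κ) * (∑ g, f g) * c := by
  have hF : 0 ≤ ∑ g, f g := Finset.sum_nonneg fun g _ => hf g
  set G := max 1 (κ * ((sibPairs d).card : ℝ)) ^ r with hG
  have h1 : ∀ m ∈ Finset.range r, ∑ C, μ C * chainCount l A f m C
      ≤ A.card * (G * κ) * (∑ g, f g) * c := by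
    intro m hm
    have hm := Finset.mem_range.1 hm
    refine (sum_chainCount_le hc hκ hb A hf ?_).trans ?_
    · have : (m : ℝ) + 1 ≤ r := by exact_mod_cast hm
      linarith
    · have := pow_le_max_one_pow (q := κ * ((sibPairs d).card : ℝ)) (by positivity) hm.le
      rw [mul_assoc (A.card : ℝ)]
      gcongr
  have h2 : ∑ C, μ C * ∑ m ∈ Finset.range r, chainCount l A f m C
      = ∑ m ∈ Finset.range r, ∑ C, μ C * chainCount l A f m C := by
    rw [Finset.sum_comm]
    exact Finset.sum_congr rfl fun C _ => Finset.mul_sum _ _ _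
  rw [h2]
  refine (Finset.sum_le_card_nsmul _ _ _ h1).trans (le_of_eq ?_)
  rw [Finset.card_range, nsmul_eq_mul]
  ring

/-- The probability to keep the next `i` edges of a path in one step. -/
noncomputable def keepProb (α : ℝ) (r i : ℕ) : ℝ := (1 - α) ^ min r i

/-- Bound on the error of a single step, for a path of length at most `T` whose vertices carry at
most `a` half-edges. -/
noncomputable def stepBound (d : Fin n → ℕ) (T r : ℕ) (a κ : ℝ) : ℝ :=
  a * (r * max 1 (κ * ((sibPairs d).card : ℝ)) ^ r * κ) * a +
    8 * T / Fintype.card (HalfEdge d) * (a + a *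
      (r * max 1 (κ * ((sibPairs d).card : ℝ)) ^ r * κ) * ∑ v, (d v : ℝ) ^ 2)

open Classical in
/-- The expected error of a single step under a measure with a pair bound: the first summand of
`stepBound` accounts for shortcuts, the second for the loss of an edge of the path to a match with
one of the edges selected nearby. -/
lemma sum_stepErr_le (hd : ∀ v, 2 ≤ d v) (h0 : 0 ≤ α) (h1 : α ≤ 1)
    {l done rem : List (HalfEdge d × HalfEdge d)} {e : HalfEdge d × HalfEdge d} {y : HalfEdge d}
    (hf : Follows l y) (hnd : (verts l y).Nodup) (hl : done ++ e :: rem = l) {T r : ℕ}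
    (hT : l.length ≤ T) {a c κ : ℝ} (hc : 0 ≤ c) (hκ : 0 ≤ κ)
    (ha : ((halfEdgesAt d (verts l y).toFinset).card : ℝ) ≤ a)
    {μ : Config d → ℝ} (hμ : ∀ C, 0 ≤ μ C) (hsupp : ∀ C, μ C ≠ 0 → Joins C (e :: rem))
    (hb : ∀ U, FewCommon l (2 * r) U → PairBound μ U c κ) :
    ∑ C, μ C * stepErr α (nearRule r) (keepProb α r) (e :: rem) e.1 C
      ≤ stepBound d T r a κ * c := by
  set P := (verts l y).toFinset with hP
  set A := halfEdgesAt d P with hA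
  set N : ℝ := (Fintype.card (HalfEdge d) : ℝ) with hN
  set H := r * max 1 (κ * ((sibPairs d).card : ℝ)) ^ r * κ with hH
  have hH0 : 0 ≤ H := by positivity
  have ha0 : 0 ≤ a := le_trans (by positivity) ha
  have hNpos : 0 < Fintype.card (HalfEdge d) := Fintype.card_pos_iff.2 ⟨e.1⟩
  have hN0 : 0 < N := Nat.cast_pos.2 hNpos
  have hdrop : l.drop done.length = e :: rem := by rw [← hl, List.drop_left]
  have hlen : l.length = done.length + (rem.length + 1) := by
    rw [← hl, List.length_append, List.length_cons]
  have hu : done.length < l.length := by omega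
  have hget : l[done.length] = e := by
    subst hl
    simp
  have hends : ∀ b ∈ ends l, b.1 ∈ P := fun b hb =>
    List.mem_toFinset.2 (hf.mem_of_mem_ends hnd hb)
  have hxP : e.1.1 ∈ P := by
    have := (fst_mem_verts (y := y) hnd hu).1
    rw [hget] at this
    exact List.mem_toFinset.2 this
  have hmass : ∑ C, μ C ≤ c := by
    have := hb ∅ ⟨by simp, e.1, by simp⟩ [] (by simp [ends]) (by simp [ends])
    simpa [joinMass, joins_nil] using this
  set F : Config d → ℝ := fun C => ∑ m ∈ Finset.range r, chainCount l A
    (fun g => if g.1 ∈ P then 1 else 0) m C with hF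
  set B : HalfEdge d → Config d → ℝ := fun k C => ∑ m ∈ Finset.range r, chainCount l A
    (fun g => if g.1 = k.1 then 1 else 0) m C with hB
  have hpt : ∀ C, μ C * stepErr α (nearRule r) (keepProb α r) (e :: rem) e.1 C
      ≤ μ C * F C + 8 * T / N * (μ C * A.card + ∑ k, μ C * B k C) := by
    intro C
    by_cases hμC : μ C = 0
    · simp [hμC]
    have hJ := hsupp C hμC
    have hC : ∀ i (hi : i < l.length), done.length ≤ i → C.1 (l[i]).1 = (l[i]).2 := by
      intro i hi hui
      refine hJ _ ?_
      rw [← hdrop, List.mem_iff_getElem]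
      refine ⟨i - done.length, by rw [List.length_drop]; omega, ?_⟩
      simp only [List.getElem_drop, Nat.add_sub_cancel' hui]
    have b1 : |missProb α (nearRule r C e.1) (e :: rem) - keepProb α r (e :: rem).length|
        ≤ F C := by
      by_cases hs : NoShortcut r done.length l y C
      · have := hs.missProb_eq (α := α) hd hf hnd hC hu
        rw [hget, hdrop] at this
        have e2 : l.length - done.length = (e :: rem).length := by
          rw [List.length_cons]
          omega
        rw [this, e2, keepProb, sub_self, abs_zero]
        exact Finset.sum_nonneg fun m _ => chainCount_nonneg (fun g => by
          split_ifs <;> norm_num) m C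
      · refine le_trans ?_ (one_le_sum_chainCount hf hnd hs)
        have p1 : 0 ≤ missProb α (nearRule r C e.1) (e :: rem) := Finset.sum_nonneg fun R _ =>
          mul_nonneg (selectProb_nonneg h0 h1 _ _) (by split_ifs <;> norm_num)
        have p2 : missProb α (nearRule r C e.1) (e :: rem) ≤ 1 := by
          rw [← sum_selectProb α (nearRule r C e.1)]
          refine Finset.sum_le_sum fun R _ =>
            mul_le_of_le_one_right (selectProb_nonneg h0 h1 _ _) (by split_ifs <;> norm_num)
        have p3 : 0 ≤ keepProb α r (e :: rem).length := pow_nonneg (by linarith) _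
        have p4 : keepProb α r (e :: rem).length ≤ 1 := pow_le_one₀ (by linarith) (by linarith)
        rw [abs_le]
        constructor <;> linarith
    have b2 : lossProb α (nearRule r C e.1) C (e :: rem)
        ≤ 4 * T / N * (A.card + ∑ k, B k C) := by
      refine (lossProb_le h0 h1 (nearRule_subset r C e.1) (List.cons_ne_nil _ _) hJ hNpos).trans ?_
      have c1 := card_nearRule_le (C := C) hd hends hxP r
      have c2 : (((e :: rem).length : ℕ) : ℝ) ≤ T := by
        rw [List.length_cons]
        exact_mod_cast (by omega : rem.length + 1 ≤ T)
      rw [← hN, mul_div_right_comm]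
      gcongr
    have hμ0 := hμ C
    calc μ C * stepErr α (nearRule r) (keepProb α r) (e :: rem) e.1 C
        ≤ μ C * (F C + 2 * (4 * T / N * (A.card + ∑ k, B k C))) := by
          unfold stepErr
          gcongr
      _ = _ := by
          rw [← Finset.mul_sum]
          ring
  refine (Finset.sum_le_sum fun C _ => hpt C).trans ?_
  rw [Finset.sum_add_distrib, ← Finset.mul_sum, Finset.sum_add_distrib, ← Finset.sum_mul,
    Finset.sum_comm]
  have s1 : ∑ C, μ C * F C ≤ A.card * H * A.card * c := by
    refine (sum_sum_chainCount_le hc hκ hb A (f := fun g => if g.1 ∈ P then 1 else 0)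
      fun g => by split_ifs <;> norm_num).trans (le_of_eq ?_)
    congr 2
    rw [hA, halfEdgesAt, Finset.card_filter]
    push_cast
    rfl
  have s2 : ∀ k, ∑ C, μ C * B k C ≤ A.card * H * (d k.1) * c := by
    intro k
    refine (sum_sum_chainCount_le hc hκ hb A (f := fun g => if g.1 = k.1 then 1 else 0)
      fun g => by split_ifs <;> norm_num).trans (le_of_eq ?_)
    congr 2
    rw [← card_fiber_vertex (d := d) k.1, Finset.card_filter]
    push_cast
    rfl
  have s3 : ∑ k : HalfEdge d, (A.card * H * (d k.1) * c : ℝ)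
      = A.card * H * (∑ v, (d v : ℝ) ^ 2) * c := by
    rw [Fintype.sum_sigma, Finset.mul_sum, Finset.sum_mul]
    refine Finset.sum_congr rfl fun v _ => ?_
    simp only [Finset.sum_const, Finset.card_univ, Fintype.card_fin, nsmul_eq_mul]
    ring
  have s4 : ∑ k, ∑ C, μ C * B k C ≤ A.card * H * (∑ v, (d v : ℝ) ^ 2) * c :=
    (Finset.sum_le_sum fun k _ => s2 k).trans s3.le
  have hD : 0 ≤ ∑ v, (d v : ℝ) ^ 2 := Finset.sum_nonneg fun v _ => by positivity
  calc ∑ C, μ C * F C + 8 * T / N * ((∑ C, μ C) * A.card + ∑ k, ∑ C, μ C * B k C)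
      ≤ A.card * H * A.card * c
        + 8 * T / N * (c * A.card + A.card * H * (∑ v, (d v : ℝ) ^ 2) * c) := by gcongr
    _ ≤ a * H * a * c + 8 * T / N * (c * a + a * H * (∑ v, (d v : ℝ) ^ 2) * c) := by gcongr
    _ = _ := by
      rw [stepBound]
      ring

end DynCM

/-! ### Paths of the initial configuration -/

namespace DynCM

variable {n : ℕ} {d : Fin n → ℕ} {α : ℝ} {K : Rule d}

lemma sum_sum_sibKer_mul (hd : ∀ v, 2 ≤ d v) (G : HalfEdge d → ℝ) :
    ∑ z, ∑ y, sibKer z y * G z = ∑ z, G z := by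
  refine Finset.sum_congr rfl fun z _ => ?_
  rw [← Finset.sum_mul, sum_sibKer_right hd, one_mul]

lemma joins_snoc {C : Config d} {l : List (HalfEdge d × HalfEdge d)} {y z : HalfEdge d} :
    Joins C (l ++ [(y, z)]) ↔ Joins C l ∧ C.1 y = z := by
  rw [joins_append, joins_cons, and_iff_left (joins_nil C)]

open Classical in
/-- The walk on the static configuration `ξ` follows a path of `ξ`. -/
lemma pathSum_joins (hd : ∀ v, 2 ≤ d v) (ξ : Config d) (t : ℕ) (x : HalfEdge d) :
    pathSum t (fun l _ => if Joins ξ l then 1 else 0) x = 1 := by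
  induction t with
  | zero => simp [pathSum, joins_nil]
  | succ t ih =>
    rw [pathSum_snoc]
    refine Eq.trans ?_ ih
    congr 1
    funext l y
    rw [sum_sum_sibKer_mul hd fun z => if Joins ξ (l ++ [(y, z)]) then (1 : ℝ) else 0]
    simp only [joins_snoc, ite_and]
    split_ifs <;> simp

open Classical in
/-- The expectation of the accumulated error, truncated at `1`, along the path that the walk follows
on the static configuration `ξ`. -/
noncomputable def staticErr (α : ℝ) (K : Rule d) (ρ : ℕ → ℝ) (ξ : Config d) (s : ℕ)
    (x : HalfEdge d) : ℝ :=
  pathSum s (fun l _ => (if Joins ξ l then 1 else 0) * min 1 (pathErr α K ρ l ξ)) x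

open Classical in
/-- The probability not to have crossed a rewired edge after having left the paths of the initial
configuration. -/
lemma pathSum_not_joins_le (hd : ∀ v, 2 ≤ d v) (hK : ∀ C x, K C x ⊆ edges C) (h0 : 0 ≤ α)
    (h1 : α ≤ 1) (ρ : ℕ → ℝ) (ξ : Config d) (t : ℕ) (x : HalfEdge d) :
    pathSum t (fun l _ => (if Joins ξ l then 0 else 1) *
      val α K l ξ Finset.univ fun _ _ => 1) x
      ≤ ∑ s ∈ Finset.range t, staticErr α K ρ ξ (s + 1) x := by
  induction t with
  | zero => simp [pathSum, joins_nil]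
  | succ t ih =>
    rw [Finset.sum_range_succ]
    refine le_trans ?_ (add_le_add_left ih _)
    rw [staticErr, pathSum_snoc, pathSum_snoc, ← pathSum_add]
    refine pathSum_mono (fun l y _ => ?_) x
    rw [sum_sum_sibKer_mul hd fun z => (if Joins ξ (l ++ [(y, z)]) then 0 else 1) *
        val α K (l ++ [(y, z)]) ξ Finset.univ fun _ _ => 1,
      sum_sum_sibKer_mul hd fun z => (if Joins ξ (l ++ [(y, z)]) then 1 else 0) *
        min 1 (pathErr α K ρ (l ++ [(y, z)]) ξ)]
    by_cases hl : Joins ξ l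
    · have e1 : ∑ z, (if Joins ξ (l ++ [(y, z)]) then (0 : ℝ) else 1) *
          val α K (l ++ [(y, z)]) ξ Finset.univ (fun _ _ => 1)
          = deviation α K l y (ξ.1 y) ξ Finset.univ := by
        rw [deviation, ← Finset.add_sum_erase _ _ (Finset.mem_univ (ξ.1 y))]
        rw [if_pos (joins_snoc.2 ⟨hl, rfl⟩), zero_mul, zero_add]
        refine Finset.sum_congr rfl fun z hz => ?_
        rw [if_neg fun h => (Finset.mem_erase.1 hz).1 (joins_snoc.1 h).2.symm, one_mul]
      have e2 : ∑ z, (if Joins ξ (l ++ [(y, z)]) then (1 : ℝ) else 0) *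
          min 1 (pathErr α K ρ (l ++ [(y, z)]) ξ)
          = min 1 (pathErr α K ρ (l ++ [(y, ξ.1 y)]) ξ) := by
        rw [Finset.sum_eq_single (ξ.1 y), if_pos (joins_snoc.2 ⟨hl, rfl⟩), one_mul]
        · intro z _ hz
          rw [if_neg fun h => hz (joins_snoc.1 h).2.symm, zero_mul]
        · exact fun h => absurd (Finset.mem_univ _) h
      rw [e1, e2, if_pos hl, zero_mul, zero_add]
      exact le_min (deviation_le_one hK h0 h1 _ _ _ _ _)
        (deviation_le hK h0 h1 ρ l y _ (fun _ _ => Finset.mem_univ _)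
          (joins_snoc.2 ⟨hl, rfl⟩))
    · have e1 : ∀ z, ¬ Joins ξ (l ++ [(y, z)]) := fun z h => hl (joins_snoc.1 h).1
      simp only [e1, hl, if_false, one_mul, zero_mul, Finset.sum_const_zero, add_zero]
      exact sum_val_snoc_le hK h0 h1 l y ξ Finset.univ

open Classical in
/-- The tail probability is close to a product, up to the errors along the paths of the initial
configuration. -/
lemma abs_tailVal_sub_prod_le (hd : ∀ v, 2 ≤ d v) (hK : ∀ C x, K C x ⊆ edges C) (h0 : 0 ≤ α)
    (h1 : α ≤ 1) {ρ : ℕ → ℝ} (hρ0 : ∀ i, 0 ≤ ρ i) (hρ1 : ∀ i, ρ i ≤ 1) (ξ : Config d) (t : ℕ)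
    (x : HalfEdge d) :
    |tailVal α K t x ξ Finset.univ - ∏ i ∈ Finset.range t, ρ (i + 1)|
      ≤ (∑ s ∈ Finset.range t, staticErr α K ρ ξ (s + 1) x) + staticErr α K ρ ξ t x := by
  set π := ∏ i ∈ Finset.range t, ρ (i + 1) with hπ
  have hπ0 : 0 ≤ π := Finset.prod_nonneg fun i _ => hρ0 _
  have hπ1 : π ≤ 1 := Finset.prod_le_one (fun i _ => hρ0 _) fun i _ => hρ1 _
  have e1 : tailVal α K t x ξ Finset.univ - π
      = pathSum t (fun l _ => (if Joins ξ l then 0 else 1) *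
          val α K l ξ Finset.univ fun _ _ => 1) x
        + pathSum t (fun l _ => (if Joins ξ l then 1 else 0) *
          ((val α K l ξ Finset.univ fun _ _ => 1) - π)) x := by
    have e2 : π = pathSum t (fun l _ => π * if Joins ξ l then 1 else 0) x := by
      rw [pathSum_const_mul, pathSum_joins hd, mul_one]
    rw [sub_eq_iff_eq_add]
    nth_rewrite 2 [e2]
    rw [← pathSum_add, ← pathSum_add, tailVal_eq_pathSum]
    congr 1
    funext l y
    split_ifs <;> ring
  have a1 := pathSum_not_joins_le hd hK h0 h1 ρ ξ t x
  have a2 : 0 ≤ pathSum t (fun l _ => (if Joins ξ l then 0 else 1) *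
          val α K l ξ Finset.univ fun _ _ => 1) x :=
    pathSum_nonneg (fun l _ _ => mul_nonneg (by split_ifs <;> norm_num)
      (val_nonneg h0 h1 fun _ _ => zero_le_one)) x
  rw [e1]
  refine (abs_add_le _ _).trans (add_le_add ((abs_of_nonneg a2).le.trans a1) ?_)
  refine (pathSum_abs_le _ _ _).trans (pathSum_mono (fun l _ hl => ?_) x)
  by_cases hJ : Joins ξ l
  · rw [if_pos hJ, one_mul, one_mul]
    refine le_min ?_ ?_
    · have b1 := val_le_one (K := K) hK h0 h1 l ξ Finset.univ
      have b2 : 0 ≤ val α K l ξ Finset.univ fun _ _ => 1 :=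
        val_nonneg h0 h1 fun _ _ => zero_le_one
      rw [abs_le]
      constructor <;> linarith
    · have := abs_val_sub_prod_le hK h0 h1 hρ0 hρ1 l (fun _ _ => Finset.mem_univ _) hJ
      rwa [hl] at this
  · simp [hJ]

/-! ### Self-avoiding paths -/

/-- The path visits distinct vertices of degree at most `Δ`. -/
def Nice (Δ : ℝ) (l : List (HalfEdge d × HalfEdge d)) (y : HalfEdge d) : Prop :=
  Follows l y ∧ (verts l y).Nodup ∧ ∀ v ∈ verts l y, (d v : ℝ) ≤ Δ

lemma verts_snoc (l : List (HalfEdge d × HalfEdge d)) (y z y' : HalfEdge d) :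
    verts (l ++ [(y, z)]) y' = verts l y ++ [y'.1] := by simp [verts]

lemma Follows.notMem_ends {l : List (HalfEdge d × HalfEdge d)} {y : HalfEdge d}
    (hf : Follows l y) (hnd : (verts l y).Nodup) : y ∉ ends l := by
  rcases List.eq_nil_or_concat l with rfl | ⟨l, ⟨x, z⟩, rfl⟩
  · simp [ends]
  rw [List.concat_eq_append] at *
  rw [verts_snoc, List.nodup_append] at hnd
  obtain ⟨hf1, hf2⟩ := follows_snoc.1 hf
  have hne : ∀ v ∈ verts l x, v ≠ y.1 := fun v hv => hnd.2.2 v hv _ (List.mem_singleton.2 rfl)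
  intro hy
  rw [ends_append, List.mem_append] at hy
  rcases hy with hy | hy
  · exact hne _ (hf1.mem_of_mem_ends hnd.1 hy) rfl
  · simp only [ends, List.flatMap_cons, List.flatMap_nil, List.append_nil, List.mem_cons,
      List.not_mem_nil, or_false] at hy
    rcases hy with rfl | rfl
    · exact hne y.1 (by simp [verts]) rfl
    · exact hf2.2 rfl

lemma numJoins_snoc (l : List (HalfEdge d × HalfEdge d)) (y z : HalfEdge d) :
    numJoins (l ++ [(y, z)]) = numJoins ((y, z) :: l) :=
  numJoins_congr fun ξ => by rw [joins_snoc, joins_cons, and_comm]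

lemma numJoins_snoc_le {l : List (HalfEdge d × HalfEdge d)} {k : ℝ}
    (hk : 2 * (l.length : ℝ) + 1 ≤ k) (hkN : k < Fintype.card (HalfEdge d)) {y : HalfEdge d}
    (hy : y ∉ ends l) (z : HalfEdge d) :
    numJoins (l ++ [(y, z)]) ≤ numJoins l / (Fintype.card (HalfEdge d) - k) := by
  rw [numJoins_snoc, numJoins_congr fun ξ => joins_cons_swap]
  exact numJoins_cons_le hk hkN z hy

/-- Few half-edges sit at vertices of large degree. -/
lemma card_heavy_le {Δ : ℝ} (hΔ : 0 < Δ) :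
    ((Finset.univ.filter fun z : HalfEdge d => Δ < d z.1).card : ℝ)
      ≤ (∑ v, (d v : ℝ) ^ 2) / Δ := by
  have h1 : ∑ v, (d v : ℝ) ^ 2 = ∑ z : HalfEdge d, (d z.1 : ℝ) := by
    rw [Fintype.sum_sigma]
    refine Finset.sum_congr rfl fun v _ => ?_
    simp [sq]
  rw [le_div_iff₀ hΔ, h1, ← nsmul_eq_mul]
  refine (Finset.card_nsmul_le_sum _ (fun z : HalfEdge d => (d z.1 : ℝ)) Δ fun z hz =>
    (Finset.mem_filter.1 hz).2.le).trans ?_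
  exact Finset.sum_le_sum_of_subset_of_nonneg (Finset.subset_univ _) fun z _ _ => by positivity

lemma Nice.card_halfEdgesAt_le {Δ : ℝ} {l : List (HalfEdge d × HalfEdge d)} {y : HalfEdge d}
    (h : Nice Δ l y) :
    ((halfEdgesAt d (verts l y).toFinset).card : ℝ) ≤ (l.length + 1) * Δ := by
  rw [card_halfEdgesAt]
  push_cast
  refine (Finset.sum_le_card_nsmul _ _ Δ fun v hv => h.2.2 v (List.mem_toFinset.1 hv)).trans ?_
  rw [nsmul_eq_mul, List.toFinset_card_of_nodup h.2.1, length_verts]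
  push_cast
  rfl

open Classical in
lemma pathSum_numJoins (hd : ∀ v, 2 ≤ d v) (s : ℕ) (x : HalfEdge d) :
    pathSum s (fun l _ => numJoins l) x = Fintype.card (Config d) := by
  unfold numJoins
  rw [pathSum_sum]
  simp [pathSum_joins hd]

open Classical in
/-- A self-avoiding path is unlikely to hit itself, or a vertex of large degree, in one step. -/
lemma sum_not_nice_snoc_le (hd : ∀ v, 2 ≤ d v) {Δ : ℝ} (hΔ : 0 < Δ) {T : ℕ} {k : ℝ}
    (hk : 2 * (T : ℝ) + 1 ≤ k) (hkN : k < Fintype.card (HalfEdge d))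
    {l : List (HalfEdge d × HalfEdge d)} {y : HalfEdge d} (hl : l.length ≤ T)
    (hn : Nice Δ l y) :
    ∑ z, ∑ y', sibKer z y' * (numJoins (l ++ [(y, z)]) *
        if Nice Δ (l ++ [(y, z)]) y' then 0 else 1)
      ≤ ((T + 1) * Δ + (∑ v, (d v : ℝ) ^ 2) / Δ) / (Fintype.card (HalfEdge d) - k) *
        numJoins l := by
  set N : ℝ := (Fintype.card (HalfEdge d) : ℝ) with hN
  have hz0 : ∀ z, 0 ≤ numJoins (l ++ [(y, z)]) := fun z => numJoins_nonneg _
  -- the bad half-edges `z`: those at a vertex of the path or at a vertex of large degree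
  set B : Finset (HalfEdge d) := halfEdgesAt d (verts l y).toFinset ∪
    Finset.univ.filter fun z : HalfEdge d => Δ < d z.1 with hB
  have hBc : (B.card : ℝ) ≤ (T + 1) * Δ + (∑ v, (d v : ℝ) ^ 2) / Δ := by
    have c1 : (B.card : ℝ) ≤ (halfEdgesAt d (verts l y).toFinset).card +
        (Finset.univ.filter fun z : HalfEdge d => Δ < d z.1).card := by
      exact_mod_cast Finset.card_union_le _ _
    have c2 := hn.card_halfEdgesAt_le
    have c3 := card_heavy_le (d := d) hΔ
    have c4 : ((l.length : ℝ) + 1) * Δ ≤ (T + 1) * Δ := by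
      have : (l.length : ℝ) ≤ T := by exact_mod_cast hl
      gcongr
    linarith
  have h1 : ∀ z, ∑ y', sibKer z y' * (numJoins (l ++ [(y, z)]) *
      if Nice Δ (l ++ [(y, z)]) y' then 0 else 1)
      ≤ if z ∈ B then numJoins l / (N - k) else 0 := by
    intro z
    have hle : ∀ y', sibKer z y' * (numJoins (l ++ [(y, z)]) *
        if Nice Δ (l ++ [(y, z)]) y' then 0 else 1)
        ≤ sibKer z y' * if z ∈ B then numJoins (l ++ [(y, z)]) else 0 := by
      intro y'
      by_cases hzy : Sibling z y'
      swap
      · simp [sibKer, hzy]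
      refine mul_le_mul_of_nonneg_left ?_ (sibKer_nonneg _ _)
      by_cases hzB : z ∈ B
      · rw [if_pos hzB]
        exact mul_le_of_le_one_right (hz0 z) (by split_ifs <;> norm_num)
      · rw [if_neg hzB, if_pos, mul_zero]
        rw [hB, Finset.mem_union, not_or, halfEdgesAt, Finset.mem_filter, Finset.mem_filter,
          List.mem_toFinset] at hzB
        simp only [Finset.mem_univ, true_and, not_lt] at hzB
        rw [hzy.1] at hzB
        refine ⟨follows_snoc.2 ⟨hn.1, hzy⟩, ?_, ?_⟩
        · rw [verts_snoc, List.nodup_append]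
          refine ⟨hn.2.1, List.nodup_singleton _, fun a ha b hb e => ?_⟩
          rw [List.mem_singleton.1 hb] at e
          exact hzB.1 (e ▸ ha)
        · intro v hv
          rw [verts_snoc, List.mem_append, List.mem_singleton] at hv
          rcases hv with hv | rfl
          exacts [hn.2.2 v hv, hzB.2]
    refine (Finset.sum_le_sum fun y' _ => hle y').trans ?_
    rw [← Finset.sum_mul, sum_sibKer_right hd, one_mul]
    split_ifs
    · refine numJoins_snoc_le ?_ hkN (hn.1.notMem_ends hn.2.1) z
      have : (l.length : ℝ) ≤ T := by exact_mod_cast hl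
      linarith
    · exact le_rfl
  refine (Finset.sum_le_sum fun z _ => h1 z).trans ?_
  rw [← Finset.sum_filter, Finset.sum_const, Finset.filter_univ_mem, nsmul_eq_mul,
    div_mul_eq_mul_div, mul_div_assoc]
  exact mul_le_mul_of_nonneg_right hBc (div_nonneg (numJoins_nonneg l) (by linarith))

open Classical in
/-- Most paths of a random configuration visit distinct vertices of moderate degree. -/
lemma pathSum_not_nice_le (hd : ∀ v, 2 ≤ d v) {Δ : ℝ} (hΔ : 0 < Δ) {T : ℕ} {k : ℝ}
    (hk : 2 * (T : ℝ) + 1 ≤ k) (hkN : k < Fintype.card (HalfEdge d)) {s : ℕ} (hs : s ≤ T)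
    (x : HalfEdge d) :
    pathSum s (fun l y => numJoins l * if Nice Δ l y then 0 else 1) x
      ≤ Fintype.card (Config d) * ((if Δ < d x.1 then 1 else 0) +
        s * (((T + 1) * Δ + (∑ v, (d v : ℝ) ^ 2) / Δ) / (Fintype.card (HalfEdge d) - k))) := by
  set N : ℝ := (Fintype.card (HalfEdge d) : ℝ) with hN
  set q := ((T + 1) * Δ + (∑ v, (d v : ℝ) ^ 2) / Δ) / (N - k) with hq
  induction s with
  | zero =>
    have e1 : numJoins ([] : List (HalfEdge d × HalfEdge d)) = Fintype.card (Config d) := by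
      simp [numJoins, joins_nil]
    rw [pathSum, e1, Nat.cast_zero, zero_mul, add_zero]
    refine mul_le_mul_of_nonneg_left ?_ (by positivity)
    by_cases hx : Δ < d x.1
    · rw [if_pos hx]
      split_ifs <;> norm_num
    · rw [if_neg hx, if_pos]
      refine ⟨trivial, by simp [verts], fun v hv => ?_⟩
      rw [verts, List.map_nil, List.nil_append, List.mem_singleton] at hv
      exact hv ▸ not_lt.1 hx
  | succ s ih =>
    have key : pathSum (s + 1) (fun l y => numJoins l * if Nice Δ l y then 0 else 1) x
        ≤ pathSum s (fun l y => numJoins l * if Nice Δ l y then 0 else 1) x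
          + q * pathSum s (fun l _ => numJoins l) x := by
      rw [pathSum_snoc, ← pathSum_const_mul, ← pathSum_add]
      refine pathSum_mono (fun l y hl => ?_) x
      have hz0 : ∀ z, 0 ≤ numJoins (l ++ [(y, z)]) := fun z => numJoins_nonneg _
      have hsum : ∑ z, numJoins (l ++ [(y, z)]) = numJoins l := by
        simp only [numJoins_snoc, sum_numJoins_cons]
      have hq0 : 0 ≤ q * numJoins l := by
        refine mul_nonneg (div_nonneg ?_ (by linarith)) (numJoins_nonneg l)
        have : 0 ≤ ∑ v, (d v : ℝ) ^ 2 := Finset.sum_nonneg fun v _ => by positivity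
        positivity
      by_cases hn : Nice Δ l y
      swap
      · rw [if_neg hn, mul_one]
        refine le_trans ?_ (le_add_of_nonneg_right hq0)
        rw [← hsum]
        refine le_trans ?_ (sum_sum_sibKer_mul hd fun z => numJoins (l ++ [(y, z)])).le
        refine Finset.sum_le_sum fun z _ => Finset.sum_le_sum fun y' _ =>
          mul_le_mul_of_nonneg_left ?_ (sibKer_nonneg _ _)
        exact mul_le_of_le_one_right (hz0 z) (by split_ifs <;> norm_num)
      rw [if_pos hn, mul_zero, zero_add]
      exact sum_not_nice_snoc_le hd hΔ hk hkN (by omega) hn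
    refine key.trans ?_
    rw [pathSum_numJoins hd]
    have := ih (by omega)
    push_cast
    linarith

end DynCM

/-! ### The tail probability under near rewiring -/

namespace DynCM

variable {n : ℕ} {d : Fin n → ℕ} {α : ℝ}

lemma keepProb_nonneg (h1 : α ≤ 1) (r i : ℕ) : 0 ≤ keepProb α r i :=
  pow_nonneg (by linarith) _

lemma keepProb_le_one (h0 : 0 ≤ α) (h1 : α ≤ 1) (r i : ℕ) : keepProb α r i ≤ 1 :=
  pow_le_one₀ (by linarith) (by linarith)

lemma stepBound_nonneg (T r : ℕ) {a κ : ℝ} (ha : 0 ≤ a) (hκ : 0 ≤ κ) :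
    0 ≤ stepBound d T r a κ := by
  have : 0 ≤ ∑ v, (d v : ℝ) ^ 2 := Finset.sum_nonneg fun v _ => by positivity
  unfold stepBound
  positivity

open Classical in
/-- The accumulated error along a self-avoiding path, averaged over the configurations that contain
the path. -/
lemma sum_joins_pathErr_le (hd : ∀ v, 2 ≤ d v) (h0 : 0 ≤ α) (h1 : α ≤ 1) {T r : ℕ} {k κ Δ : ℝ}
    (hk : 2 * (T : ℝ) + 2 * r + 1 ≤ k) (hkN : k < Fintype.card (HalfEdge d))
    (hr : 8 * (r : ℝ) ≤ Fintype.card (HalfEdge d))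
    (hκ : 1 / (Fintype.card (HalfEdge d) - k) * (1 + 44 * α) ^ T = κ)
    (hκα : 2 * (r : ℝ) * κ ≤ α) {l : List (HalfEdge d × HalfEdge d)} {y : HalfEdge d}
    (hn : Nice Δ l y) (hl : l.length ≤ T) (hΔ : 0 ≤ Δ) :
    ∑ ξ, (if Joins ξ l then 1 else 0) * pathErr α (nearRule r) (keepProb α r) l ξ
      ≤ T * (stepBound d T r ((T + 1) * Δ) κ * numJoins l) := by
  set N : ℝ := (Fintype.card (HalfEdge d) : ℝ) with hN
  have hr0 : (0 : ℝ) ≤ r := by positivity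
  have hlT : (l.length : ℝ) ≤ T := by exact_mod_cast hl
  have hl0 : (0 : ℝ) ≤ l.length := by positivity
  have hN0 : 0 < N := by linarith
  have hNpos : 0 < Fintype.card (HalfEdge d) := Nat.cast_pos.1 hN0
  have hNk : 0 < N - k := by linarith
  have hκ0 : 0 ≤ κ := by
    rw [← hκ]
    have : 0 ≤ 1 / (N - k) := by positivity
    positivity
  have hpair : ∀ U, FewCommon l (2 * r) U →
      PairBound (fun ξ : Config d => if Joins ξ l then 1 else 0) U (numJoins l) (1 / (N - k)) := by
    rintro U ⟨hU1, h₀, hU2⟩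
    exact pairBound_uniform l hU2 (by linarith) hkN
  have key := sum_pathErr_le (nearRule_subset r) h0 h1 (keepProb α r) (𝒰 := FewCommon l (2 * r))
    (u := 2 * r) (κ := 1 / (N - k)) (ε := stepBound d T r ((T + 1) * Δ) κ)
    (numJoins_nonneg l) hNpos (fun U hU => hU.1) (by linarith)
    (one_div_le_one_div_of_le hNk (by linarith)) (by rw [hκ]; exact hκα) l hl ?_ l []
    (fun ξ => if Joins ξ l then 1 else 0) (List.nil_append l)
    (fun C => by split_ifs <;> norm_num) (fun C hC => by simpa using hC) ?_
  · refine key.trans (mul_le_mul_of_nonneg_right hlT ?_)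
    exact mul_nonneg (stepBound_nonneg T r (by positivity) hκ0) (numJoins_nonneg l)
  · intro done e rem μ hdone hμ hsupp hb
    rw [hκ] at hb
    refine sum_stepErr_le hd h0 h1 hn.1 hn.2.1 hdone hl (numJoins_nonneg l) hκ0 ?_ hμ hsupp hb
    refine hn.card_halfEdgesAt_le.trans ?_
    gcongr
  · intro U hU
    simpa using hpair U hU

open Classical in
/-- The expected error along the path of the initial configuration, for a uniform initial state:
paths that are not self-avoiding, or visit a vertex of large degree, are given the error `1`. -/
lemma sum_staticErr_le (hd : ∀ v, 2 ≤ d v) (h0 : 0 ≤ α) (h1 : α ≤ 1) {T r : ℕ} {k κ Δ : ℝ}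
    (hk : 2 * (T : ℝ) + 2 * r + 1 ≤ k) (hkN : k < Fintype.card (HalfEdge d))
    (hr : 8 * (r : ℝ) ≤ Fintype.card (HalfEdge d))
    (hκ : 1 / (Fintype.card (HalfEdge d) - k) * (1 + 44 * α) ^ T = κ)
    (hκα : 2 * (r : ℝ) * κ ≤ α) (hΔ : 0 < Δ) {s : ℕ} (hs : s ≤ T) :
    ∑ x : HalfEdge d, ∑ ξ : Config d, staticErr α (nearRule r) (keepProb α r) ξ s x
      ≤ Fintype.card (HalfEdge d) * (Fintype.card (Config d) *
        (T * stepBound d T r ((T + 1) * Δ) κ +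
        T * (((T + 1) * Δ + (∑ v, (d v : ℝ) ^ 2) / Δ) / (Fintype.card (HalfEdge d) - k)) +
        (∑ v, (d v : ℝ) ^ 2) / Δ / Fintype.card (HalfEdge d))) := by
  set N : ℝ := (Fintype.card (HalfEdge d) : ℝ) with hN
  set D := ∑ v, (d v : ℝ) ^ 2 with hD
  have hD0 : 0 ≤ D := Finset.sum_nonneg fun v _ => by positivity
  set q := ((T + 1) * Δ + D / Δ) / (N - k) with hq
  set ε := stepBound d T r ((T + 1) * Δ) κ with hε
  have hr0 : (0 : ℝ) ≤ r := by positivity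
  have hT0 : (0 : ℝ) ≤ T := by positivity
  have hN0 : 0 < N := by linarith
  have hNk : 0 < N - k := by linarith
  have hq0 : 0 ≤ q := by positivity
  have hκ0 : 0 ≤ κ := by
    rw [← hκ]
    have : 0 ≤ 1 / (N - k) := by positivity
    positivity
  have hε0 : 0 ≤ ε := stepBound_nonneg T r (by positivity) hκ0
  have hx : ∀ x : HalfEdge d, ∑ ξ : Config d, staticErr α (nearRule r) (keepProb α r) ξ s x
      ≤ Fintype.card (Config d) * (T * ε + T * q + if Δ < d x.1 then 1 else 0) := by
    intro x
    unfold staticErr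
    rw [← pathSum_sum]
    have hpt : ∀ (l : List (HalfEdge d × HalfEdge d)) (y : HalfEdge d), l.length = s →
        ∑ ξ, (if Joins ξ l then 1 else 0) * min 1 (pathErr α (nearRule r) (keepProb α r) l ξ)
        ≤ T * ε * numJoins l + numJoins l * if Nice Δ l y then 0 else 1 := by
      intro l y hl
      by_cases hn : Nice Δ l y
      · rw [if_pos hn, mul_zero, add_zero, mul_assoc]
        refine le_trans (Finset.sum_le_sum fun ξ _ => mul_le_mul_of_nonneg_left (min_le_right _ _)
          (by split_ifs <;> norm_num)) ?_
        exact sum_joins_pathErr_le hd h0 h1 hk hkN hr hκ hκα hn (by omega) hΔ.le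
      · rw [if_neg hn, mul_one]
        have : 0 ≤ T * ε * numJoins l := mul_nonneg (by positivity) (numJoins_nonneg l)
        refine le_trans (Finset.sum_le_sum fun ξ _ => ?_) (le_add_of_nonneg_left this)
        exact mul_le_of_le_one_right (by split_ifs <;> norm_num) (min_le_left _ _)
    refine (pathSum_mono hpt x).trans ?_
    rw [pathSum_add, pathSum_const_mul, pathSum_numJoins hd]
    have hnot := pathSum_not_nice_le hd hΔ (T := T) (k := k) (by linarith) hkN hs x
    have hsT : (s : ℝ) ≤ T := by exact_mod_cast hs
    have hsq : s * q ≤ T * q := mul_le_mul_of_nonneg_right hsT hq0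
    have hM : (0 : ℝ) ≤ Fintype.card (Config d) := by positivity
    calc T * ε * Fintype.card (Config d) + pathSum s
          (fun l y => numJoins l * if Nice Δ l y then 0 else 1) x
        ≤ T * ε * Fintype.card (Config d) + Fintype.card (Config d) *
          ((if Δ < d x.1 then 1 else 0) + s * q) := by linarith
      _ ≤ T * ε * Fintype.card (Config d) + Fintype.card (Config d) *
          ((if Δ < d x.1 then 1 else 0) + T * q) := by gcongr
      _ = _ := by ring
  have hheavy : ∑ x : HalfEdge d, (if Δ < d x.1 then (1 : ℝ) else 0) ≤ D / Δ := by
    refine le_trans (le_of_eq ?_) (card_heavy_le hΔ)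
    rw [Finset.card_filter]
    push_cast
    rfl
  refine (Finset.sum_le_sum fun x _ => hx x).trans ?_
  rw [← Finset.mul_sum, Finset.sum_add_distrib, Finset.sum_const, Finset.card_univ, nsmul_eq_mul]
  have hM : (0 : ℝ) ≤ Fintype.card (Config d) := by positivity
  calc Fintype.card (Config d) * (N * (T * ε + T * q) +
        ∑ x : HalfEdge d, if Δ < d x.1 then (1 : ℝ) else 0)
      ≤ Fintype.card (Config d) * (N * (T * ε + T * q) + D / Δ) := by gcongr
    _ = _ := by
      field_simp

/-- Under near rewiring the tail probability is close to a product: when the walk has followed a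
path of the initial configuration, the next edges of the path are the only candidates for rewiring
that belong to the path. -/
theorem sum_abs_tailProb_near_sub_le (hd : ∀ v, 2 ≤ d v) (h0 : 0 ≤ α) (h1 : α ≤ 1) {T r : ℕ}
    {k κ Δ : ℝ} (hk : 2 * (T : ℝ) + 2 * r + 1 ≤ k) (hkN : k < Fintype.card (HalfEdge d))
    (hr : 8 * (r : ℝ) ≤ Fintype.card (HalfEdge d))
    (hκ : 1 / (Fintype.card (HalfEdge d) - k) * (1 + 44 * α) ^ T = κ)
    (hκα : 2 * (r : ℝ) * κ ≤ α) (hΔ : 0 < Δ) :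
    ∑ x : HalfEdge d, ∑ ξ : Config d,
        |tailProb α (nearRule r) x ξ T - ∏ i ∈ Finset.range T, keepProb α r (i + 1)|
      ≤ (T + 1) * (T * stepBound d T r ((T + 1) * Δ) κ +
        T * (((T + 1) * Δ + (∑ v, (d v : ℝ) ^ 2) / Δ) / (Fintype.card (HalfEdge d) - k)) +
        (∑ v, (d v : ℝ) ^ 2) / Δ / Fintype.card (HalfEdge d)) *
        (Fintype.card (HalfEdge d) * Fintype.card (Config d)) := by
  have hpt : ∀ (x : HalfEdge d) (ξ : Config d),
      |tailProb α (nearRule r) x ξ T - ∏ i ∈ Finset.range T, keepProb α r (i + 1)|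
      ≤ (∑ s ∈ Finset.range T, staticErr α (nearRule r) (keepProb α r) ξ (s + 1) x)
        + staticErr α (nearRule r) (keepProb α r) ξ T x := fun x ξ => by
    rw [tailProb_eq]
    exact abs_tailVal_sub_prod_le hd (nearRule_subset r) h0 h1 (keepProb_nonneg h1 r)
      (keepProb_le_one h0 h1 r) ξ T x
  refine (Finset.sum_le_sum fun x _ => Finset.sum_le_sum fun ξ _ => hpt x ξ).trans ?_
  have e1 : ∑ x : HalfEdge d, ∑ ξ : Config d, ((∑ s ∈ Finset.range T,
        staticErr α (nearRule r) (keepProb α r) ξ (s + 1) x)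
        + staticErr α (nearRule r) (keepProb α r) ξ T x)
      = (∑ s ∈ Finset.range T, ∑ x : HalfEdge d, ∑ ξ : Config d,
          staticErr α (nearRule r) (keepProb α r) ξ (s + 1) x)
        + ∑ x : HalfEdge d, ∑ ξ : Config d, staticErr α (nearRule r) (keepProb α r) ξ T x := by
    simp only [Finset.sum_add_distrib]
    congr 1
    rw [Finset.sum_comm' (t' := Finset.univ) (s' := fun _ => Finset.range T) (by simp)]
    refine Finset.sum_congr rfl fun x _ => ?_
    rw [Finset.sum_comm]
  rw [e1]
  have hs : ∀ s ≤ T, _ := fun s hs =>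
    sum_staticErr_le (s := s) hd h0 h1 hk hkN hr hκ hκα hΔ hs
  refine (add_le_add (Finset.sum_le_card_nsmul _ _ _ fun s h =>
    hs (s + 1) (Finset.mem_range.1 h)) (hs T le_rfl)).trans (le_of_eq ?_)
  rw [Finset.card_range, nsmul_eq_mul]
  ring

end DynCM

/-! ### Moments of the degrees -/

namespace DynCM

lemma tsum_mul_empDist {n : ℕ} (d : Fin n → ℕ) (f : ℕ → ℝ) :
    ∑' m, f m * empDist d m = (∑ v, f (d v)) / n := by
  have h1 : ∀ m, f m * empDist d m = ∑ v, if m = d v then f (d v) / n else 0 := by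
    intro m
    rw [empDist, Finset.card_filter]
    push_cast
    rw [Finset.sum_div, Finset.mul_sum]
    refine Finset.sum_congr rfl fun v _ => ?_
    by_cases h : d v = m
    · simp [h, div_eq_mul_inv]
    · simp [h, Ne.symm h]
  simp only [h1]
  rw [Summable.tsum_finsetSum fun v _ => (hasSum_ite_eq (d v) (f (d v) / n)).summable,
    Finset.sum_div]
  simp only [tsum_ite_eq]

lemma card_sibPairs_add {n : ℕ} (d : Fin n → ℕ) :
    ((sibPairs d).card : ℝ) = ∑ v, (d v : ℝ) ^ 2 - Fintype.card (HalfEdge d) := by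
  rw [card_sibPairs, card_halfEdge]
  push_cast
  rw [← Finset.sum_sub_distrib]
  refine Finset.sum_congr rfl fun v _ => ?_
  cases h : d v with
  | zero => simp
  | succ m =>
    rw [Nat.add_sub_cancel]
    push_cast
    ring

section

variable {d : (n : ℕ) → Fin n → ℕ} {p : ℕ → ℝ}

lemma DegreeRegular.tendsto_card (h : DegreeRegular d p) :
    Tendsto (fun n => (Fintype.card (HalfEdge (d n)) : ℝ) / n) (evenAtTop d)
      (𝓝 (∑' m : ℕ, (m : ℝ) * p m)) := by
  refine h.tendsto_first.congr fun n => ?_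
  rw [tsum_mul_empDist (d n) fun m => (m : ℝ), card_halfEdge]
  push_cast
  rfl

lemma DegreeRegular.tendsto_sq (h : DegreeRegular d p) :
    Tendsto (fun n => (∑ v, (d n v : ℝ) ^ 2) / n) (evenAtTop d)
      (𝓝 (∑' m : ℕ, (m : ℝ) ^ 2 * p m)) := by
  refine h.tendsto_second.congr fun n => ?_
  rw [tsum_mul_empDist (d n) fun m => (m : ℝ) ^ 2]

/-- The number of pairs of siblings per half-edge converges to the size-biased mean. -/
lemma DegreeRegular.tendsto_sibPairs (h : DegreeRegular d p) {k : ℕ → ℝ}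
    (hk : Tendsto (fun n => k n / n) (evenAtTop d) (𝓝 0)) :
    Tendsto (fun n => ((sibPairs (d n)).card : ℝ) / (Fintype.card (HalfEdge (d n)) - k n))
      (evenAtTop d) (𝓝 (sizeBiasedMean p)) := by
  have hm : (∑' m : ℕ, (m : ℝ) * p m) ≠ 0 := by
    intro e
    have := h.one_lt
    rw [sizeBiasedMean, e, div_zero] at this
    linarith
  have e1 : sizeBiasedMean p = ((∑' m : ℕ, (m : ℝ) ^ 2 * p m) - ∑' m : ℕ, (m : ℝ) * p m) /
      ((∑' m : ℕ, (m : ℝ) * p m) - 0) := by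
    rw [sizeBiasedMean, ← h.summable_second.tsum_sub h.summable_first, sub_zero]
    congr 1
    refine tsum_congr fun m => ?_
    ring
  rw [e1]
  refine ((h.tendsto_sq.sub h.tendsto_card).div (h.tendsto_card.sub hk)
    (by rwa [sub_zero])).congr' ?_
  filter_upwards [evenAtTop_le d (eventually_gt_atTop 0)] with n hn
  have : (n : ℝ) ≠ 0 := by positivity
  simp only [Pi.div_apply]
  rw [card_sibPairs_add, ← sub_div, ← sub_div, div_div_div_cancel_right₀ this]

end

/-! ### Near rewiring -/

lemma one_add_pow_le_exp {a : ℝ} (ha : 0 ≤ a) (T : ℕ) : (1 + a) ^ T ≤ Real.exp (a * T) := by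
  rw [mul_comm, Real.exp_nat_mul]
  exact pow_le_pow_left₀ (by linarith) (by linarith [Real.add_one_le_exp a]) T

/-- The error bound for near rewiring, in terms of the number `U` of steps and the cut-off `x`
for the degrees. -/
lemma near_error_le {T U x H N M D C q : ℝ} (hT : 0 ≤ T) (hTU : T + 1 ≤ U) (hx : 1 ≤ x)
    (hC : 0 ≤ C) (hH0 : 0 ≤ H) (hH : H ≤ U / x ^ 4) (hM : x ^ 4 ≤ M) (hN : M ≤ N) (hq : M ≤ q)
    (hD0 : 0 ≤ D) (hD : D ≤ C * M) :
    (T + 1) * (T * (((T + 1) * x) * H * ((T + 1) * x) +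
        8 * T / N * ((T + 1) * x + (T + 1) * x * H * D)) +
        T * (((T + 1) * x + D / x) / q) + D / x / N) ≤ (20 + 20 * C) * (U ^ 5 / x) := by
  have hU : 1 ≤ U := by linarith
  have hTU' : T ≤ U := by linarith
  have hx0 : 0 < x := by linarith
  have hM0 : 0 < M := lt_of_lt_of_le (by positivity) hM
  have hN0 : 0 < N := by linarith
  have hq0 : 0 < q := by linarith
  have hxx : x / x ^ 4 ≤ 1 / x := by
    rw [div_le_div_iff₀ (by positivity) hx0]
    nlinarith [pow_le_pow_right₀ hx (show 2 ≤ 4 by norm_num)]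
  have hxx2 : x ^ 2 / x ^ 4 ≤ 1 / x := by
    rw [div_le_div_iff₀ (by positivity) hx0]
    nlinarith [pow_le_pow_right₀ hx (show 3 ≤ 4 by norm_num)]
  have hxM : x / M ≤ 1 / x := (div_le_div_of_nonneg_left hx0.le (by positivity) hM).trans hxx
  have hDM : D / M ≤ C := by rwa [div_le_iff₀ hM0]
  have b1 : ((T + 1) * x) * H * ((T + 1) * x) ≤ U ^ 3 * (1 / x) := by
    calc ((T + 1) * x) * H * ((T + 1) * x) ≤ (U * x) * (U / x ^ 4) * (U * x) := by gcongr
      _ = U ^ 3 * (x ^ 2 / x ^ 4) := by ring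
      _ ≤ _ := by gcongr
  have b2 : 8 * T / N * ((T + 1) * x) ≤ 8 * U ^ 2 * (1 / x) := by
    calc 8 * T / N * ((T + 1) * x) ≤ 8 * U / M * (U * x) := by gcongr
      _ = 8 * U ^ 2 * (x / M) := by ring
      _ ≤ _ := by gcongr
  have b3 : 8 * T / N * ((T + 1) * x * H * D) ≤ 8 * C * U ^ 3 * (1 / x) := by
    calc 8 * T / N * ((T + 1) * x * H * D) ≤ 8 * U / M * (U * x * (U / x ^ 4) * D) := by gcongr
      _ = 8 * (D / M) * U ^ 3 * (x / x ^ 4) := by ring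
      _ ≤ _ := by gcongr
  have b4 : ((T + 1) * x + D / x) / q ≤ (U + C) * (1 / x) := by
    calc ((T + 1) * x + D / x) / q ≤ (U * x + D / x) / M := by gcongr
      _ = U * (x / M) + D / M * (1 / x) := by field_simp
      _ ≤ U * (1 / x) + C * (1 / x) := by gcongr
      _ = _ := by ring
  have b5 : D / x / N ≤ C * (1 / x) := by
    calc D / x / N ≤ D / x / M := by gcongr
      _ = D / M * (1 / x) := by field_simp
      _ ≤ _ := by gcongr
  have hu : ∀ j ≤ 5, U ^ j ≤ U ^ 5 := fun j hj => pow_le_pow_right₀ hU hj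
  have hix : 0 ≤ 1 / x := by positivity
  calc (T + 1) * (T * (((T + 1) * x) * H * ((T + 1) * x) +
        8 * T / N * ((T + 1) * x + (T + 1) * x * H * D)) +
        T * (((T + 1) * x + D / x) / q) + D / x / N)
      = (T + 1) * (T * (((T + 1) * x) * H * ((T + 1) * x) +
        (8 * T / N * ((T + 1) * x) + 8 * T / N * ((T + 1) * x * H * D))) +
        T * (((T + 1) * x + D / x) / q) + D / x / N) := by ring
    _ ≤ U * (U * (U ^ 3 * (1 / x) + (8 * U ^ 2 * (1 / x) + 8 * C * U ^ 3 * (1 / x))) +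
        U * ((U + C) * (1 / x)) + C * (1 / x)) := by
      have z1 : 0 ≤ ((T + 1) * x) * H * ((T + 1) * x) +
        (8 * T / N * ((T + 1) * x) + 8 * T / N * ((T + 1) * x * H * D)) := by positivity
      have z2 : 0 ≤ ((T + 1) * x + D / x) / q := by positivity
      gcongr
    _ = (U ^ 5 + 8 * U ^ 4 + 8 * C * U ^ 5 + U ^ 3 + C * U ^ 2 + C * U) * (1 / x) := by ring
    _ ≤ (U ^ 5 + 8 * U ^ 5 + 8 * C * U ^ 5 + U ^ 5 + C * U ^ 5 + C * U ^ 5) * (1 / x) := by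
      have e1 := hu 4 (by norm_num)
      have e2 := hu 3 (by norm_num)
      have e3 := hu 2 (by norm_num)
      have e4 := hu 1 (by norm_num)
      rw [pow_one] at e4
      gcongr
    _ ≤ _ := by
      rw [mul_one_div, mul_div_assoc']
      refine div_le_div_of_nonneg_right ?_ hx0.le
      have : 0 ≤ C * U ^ 5 := by positivity
      have : 0 ≤ U ^ 5 := by positivity
      nlinarith

/-- Scaling of the cross-rewired time for near rewiring, in terms of the limit of the product of
the probabilities to keep the path ahead. -/
theorem tailTendsto_near {d : (n : ℕ) → Fin n → ℕ} (hd : ∀ n v, 2 ≤ d n v) {α : ℕ → ℝ}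
    (hα : ∀ n, 0 < α n ∧ α n ≤ 1) {p : ℕ → ℝ} (hp : DegreeRegular d p) {r T : ℕ → ℕ} {ρ ℓ : ℝ}
    (hr1 : ∀ n, 1 ≤ r n) (hρ : ρ < 1 / Real.log (sizeBiasedMean p))
    (hr : Tendsto (fun n => (r n : ℝ) / Real.log n) (evenAtTop d) (𝓝 ρ))
    (hT : (fun n => (T n : ℝ)) =O[evenAtTop d] fun n => Real.log n)
    (hαT : Tendsto (fun n => α n * T n * r n / Real.log n) (evenAtTop d) (𝓝 0))
    (hα2 : (fun n => (α n)⁻¹) =O[evenAtTop d] fun n => Real.log n ^ 2)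
    (hℓ : Tendsto (fun n => ∏ i ∈ Finset.range (T n), keepProb (α n) (r n) (i + 1))
      (evenAtTop d) (𝓝 ℓ)) :
    TailTendsto d α (fun n => nearRule (r n)) T ℓ := by
  have hle := evenAtTop_le d
  set ν := sizeBiasedMean p with hν
  have hν1 : 1 < ν := hp.one_lt
  have hlogν : 0 < Real.log ν := Real.log_pos hν1
  have hρν : ρ * Real.log ν < 1 := (lt_div_iff₀ hlogν).1 hρ
  have hlog1 : ∀ᶠ n : ℕ in evenAtTop d, 1 < Real.log n :=
    ((Real.tendsto_log_atTop.comp tendsto_natCast_atTop_atTop).mono_left hle).eventually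
      (eventually_gt_atTop 1)
  have hrO : (fun n => (r n : ℝ)) =O[evenAtTop d] fun n => Real.log n := by
    refine isBigO_of_div_tendsto_nhds ?_ ρ hr
    filter_upwards [hlog1] with n hn h0
    linarith
  set U : ℕ → ℝ := fun n => (T n : ℝ) + r n + 1 with hU
  have hUO : U =O[evenAtTop d] fun n => Real.log n := isBigO_add_one hle (hT.add hrO)
  have hU1 : Tendsto (fun n => U n / n) (evenAtTop d) (𝓝 0) := by
    have := tendsto_pow_div_rpow hle hUO 1 one_pos
    simpa using this
  set k : ℕ → ℝ := fun n => 2 * (T n : ℝ) + 2 * r n + 1 with hk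
  have hk0 : Tendsto (fun n => k n / n) (evenAtTop d) (𝓝 0) := by
    have h2 := hU1.const_mul 2
    rw [mul_zero] at h2
    refine squeeze_zero (fun n => by positivity) (fun n => ?_) h2
    rw [← mul_div_assoc]
    refine div_le_div_of_nonneg_right ?_ (by positivity)
    simp only [hk, hU]
    linarith
  set g : ℕ → ℝ := fun n => ((sibPairs (d n)).card : ℝ) / (Fintype.card (HalfEdge (d n)) - k n)
    with hg
  have hgν : Tendsto g (evenAtTop d) (𝓝 ν) := hp.tendsto_sibPairs hk0
  -- the growth rate of the neighbourhoods leaves a margin `n ^ δ`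
  obtain ⟨δ, hδ0, hδ1, hδ⟩ : ∃ δ : ℝ, 0 < δ ∧ δ ≤ 1 ∧ ρ * Real.log ν < 1 - δ := by
    refine ⟨min 1 ((1 - ρ * Real.log ν) / 2), lt_min one_pos (by linarith), min_le_left _ _, ?_⟩
    have := min_le_right 1 ((1 - ρ * Real.log ν) / 2)
    linarith
  -- `88 = 2 * 44`: each generation of the neighbourhood contributes a factor `(1 + 44 * α) ^ T`, and
  -- the probability of a single pair contributes one more
  have hgrow : ∀ᶠ n in evenAtTop d,
      r n * Real.log (g n) + 88 * (α n * T n * r n) ≤ (1 - δ) * Real.log n := by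
    have h1 : Tendsto (fun n => (r n : ℝ) / Real.log n * Real.log (g n)
        + 88 * (α n * T n * r n / Real.log n)) (evenAtTop d) (𝓝 (ρ * Real.log ν + 88 * 0)) :=
      (hr.mul (hgν.log (by linarith))).add (hαT.const_mul 88)
    rw [mul_zero, add_zero] at h1
    filter_upwards [h1.eventually (gt_mem_nhds hδ), hlog1] with n h2 h3
    have h4 : (r n : ℝ) / Real.log n * Real.log (g n) + 88 * (α n * T n * r n / Real.log n)
        = (r n * Real.log (g n) + 88 * (α n * T n * r n)) / Real.log n := by ring
    rw [h4, div_lt_iff₀ (by linarith)] at h2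
    exact h2.le
  set C := (∑' m : ℕ, (m : ℝ) ^ 2 * p m) + 1 with hC
  have hC0 : 0 ≤ C := by
    have : 0 ≤ ∑' m : ℕ, (m : ℝ) ^ 2 * p m :=
      tsum_nonneg fun m => mul_nonneg (by positivity) (hp.nonneg m)
    linarith
  have hD : ∀ᶠ n in evenAtTop d, (∑ v, (d n v : ℝ) ^ 2) / n < C :=
    hp.tendsto_sq.eventually (gt_mem_nhds (by linarith))
  have hsmall : ∀ᶠ n in evenAtTop d, 2 * U n * (α n)⁻¹ / (n : ℝ) ^ δ < 1 := by
    have h1 : (fun n => 2 * U n * (α n)⁻¹) =O[evenAtTop d] fun n => Real.log n ^ 3 := by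
      have := (hUO.const_mul_left 2).mul hα2
      refine this.congr_right fun n => ?_
      ring
    have h2 := tendsto_pow_div_rpow hle (isBigO_refl (fun n : ℕ => Real.log n) _) 3 hδ0
    have h3 : (fun n => 2 * U n * (α n)⁻¹ / (n : ℝ) ^ δ)
        =O[evenAtTop d] fun n => Real.log n ^ 3 / (n : ℝ) ^ δ := by
      simp only [div_eq_mul_inv]
      exact h1.mul (isBigO_refl _ _)
    exact (h3.trans_tendsto h2).eventually (gt_mem_nhds one_pos)
  have hlim : Tendsto (fun n => (20 + 20 * C) * (U n ^ 5 / (n : ℝ) ^ (δ / 4)))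
      (evenAtTop d) (𝓝 0) := by
    simpa using (tendsto_pow_div_rpow hle hUO 5 (by positivity : 0 < δ / 4)).const_mul
      (20 + 20 * C)
  refine tailTendsto_of_sum_le hd hℓ hlim ?_
  filter_upwards [hgrow, hD, hsmall, hlog1, hgν.eventually (lt_mem_nhds hν1),
    hU1.eventually (gt_mem_nhds (show (0 : ℝ) < 1 / 8 by norm_num)),
    hle (eventually_ge_atTop 1)] with n e1 e2 e3 e4 e5 e6 e7
  obtain ⟨hα0, hα1⟩ := hα n
  set N : ℝ := (Fintype.card (HalfEdge (d n)) : ℝ) with hN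
  have hn1 : (1 : ℝ) ≤ n := by exact_mod_cast e7
  have hn0 : (0 : ℝ) < n := by linarith
  have hNn : 2 * (n : ℝ) ≤ N := by
    rw [hN]
    exact_mod_cast two_mul_le_card (hd n)
  have hT0 : (0 : ℝ) ≤ T n := by positivity
  have hr0 : (1 : ℝ) ≤ r n := by exact_mod_cast hr1 n
  rw [div_lt_iff₀ hn0] at e2 e6
  have hkn : k n ≤ n := by
    simp only [hk]
    simp only [hU] at e6
    linarith
  have hNk : (n : ℝ) ≤ N - k n := by linarith
  have hNk0 : 0 < N - k n := by linarith
  obtain ⟨κ, hκ⟩ : ∃ κ, 1 / (N - k n) * (1 + 44 * α n) ^ T n = κ := ⟨_, rfl⟩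
  have hκ0 : 0 ≤ κ := by
    rw [← hκ]
    positivity
  -- the expected number of excursions is at most `n ^ (-δ)`
  set G := max 1 (κ * ((sibPairs (d n)).card : ℝ)) ^ r n with hG
  have hG1 : 1 ≤ G := one_le_pow₀ (le_max_left _ _)
  have hexp : (1 + 44 * α n) ^ T n ≤ Real.exp (44 * α n * T n) :=
    one_add_pow_le_exp (by linarith) (T n)
  have hGκ : G * κ ≤ 1 / (n : ℝ) ^ δ := by
    have a1 : max 1 (κ * ((sibPairs (d n)).card : ℝ))
        ≤ Real.exp (Real.log (g n) + 44 * α n * T n) := by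
      rw [Real.exp_add, Real.exp_log (by linarith)]
      have h1 : 1 ≤ Real.exp (44 * α n * T n) := Real.one_le_exp (by positivity)
      refine max_le ?_ ?_
      · nlinarith
      · have : κ * ((sibPairs (d n)).card : ℝ) = g n * (1 + 44 * α n) ^ T n := by
          rw [← hκ]
          simp only [hg]
          ring
        rw [this]
        exact mul_le_mul_of_nonneg_left hexp (by linarith)
    have a2 : G ≤ Real.exp (r n * (Real.log (g n) + 44 * α n * T n)) := by
      rw [Real.exp_nat_mul]
      exact pow_le_pow_left₀ (by positivity) a1 _
    have a3 : κ ≤ Real.exp (44 * α n * T n) * (1 / n) := by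
      rw [← hκ, mul_comm]
      exact mul_le_mul hexp (one_div_le_one_div_of_le hn0 hNk) (by positivity) (by positivity)
    have a4 : 44 * α n * T n ≤ 44 * (α n * T n * r n) := by
      have : 0 ≤ α n * T n := by positivity
      nlinarith
    calc G * κ ≤ Real.exp (r n * (Real.log (g n) + 44 * α n * T n)) *
          (Real.exp (44 * α n * T n) * (1 / n)) := by gcongr
      _ = Real.exp (r n * (Real.log (g n) + 44 * α n * T n) + 44 * α n * T n) * (1 / n) := by
        rw [Real.exp_add]
        ring
      _ ≤ Real.exp ((1 - δ) * Real.log n) * (1 / n) := by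
        refine mul_le_mul_of_nonneg_right (Real.exp_le_exp.2 ?_) (by positivity)
        refine le_trans ?_ e1
        linarith
      _ = 1 / (n : ℝ) ^ δ := by
        rw [mul_comm (1 - δ), ← Real.rpow_def_of_pos hn0, Real.rpow_sub hn0, Real.rpow_one]
        field_simp
  have hκδ : κ ≤ 1 / (n : ℝ) ^ δ := (le_mul_of_one_le_left hκ0 hG1).trans hGκ
  have hnδ : 0 < (n : ℝ) ^ δ := by positivity
  have hκα : 2 * (r n : ℝ) * κ ≤ α n := by
    rw [div_lt_iff₀ hnδ, one_mul, mul_inv_lt_iff₀ hα0] at e3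
    have : 2 * (r n : ℝ) * κ ≤ 2 * U n * (1 / (n : ℝ) ^ δ) := by
      have : (r n : ℝ) ≤ U n := by
        simp only [hU]
        linarith
      gcongr
    refine this.trans ?_
    rw [mul_one_div, div_le_iff₀ hnδ]
    linarith
  -- the cut-off for the degrees has to tend to infinity, with its fourth power at most `n ^ δ`
  have hx : (1 : ℝ) ≤ (n : ℝ) ^ (δ / 4) := Real.one_le_rpow hn1 (by positivity)
  have hx4 : ((n : ℝ) ^ (δ / 4)) ^ 4 = (n : ℝ) ^ δ := by
    rw [← Real.rpow_natCast, ← Real.rpow_mul hn0.le]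
    congr 1
    push_cast
    ring
  refine (sum_abs_tailProb_near_sub_le (hd n) hα0.le hα1 (k := k n) (κ := κ)
    (Δ := (n : ℝ) ^ (δ / 4)) le_rfl (by linarith) ?_ hκ hκα (by positivity)).trans ?_
  · simp only [hU] at e6
    linarith
  refine mul_le_mul_of_nonneg_right ?_ (by positivity)
  unfold stepBound
  refine near_error_le (M := n) hT0 (U := U n) ?_ hx hC0 (by positivity) ?_ ?_ (by linarith) hNk
    (Finset.sum_nonneg fun v _ => by positivity) e2.le
  · simp only [hU]
    linarith
  · rw [hx4, mul_assoc]
    calc (r n : ℝ) * (G * κ) ≤ U n * (1 / (n : ℝ) ^ δ) := by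
          have : (r n : ℝ) ≤ U n := by
            simp only [hU]
            linarith
          have : 0 ≤ U n := by linarith
          gcongr
      _ = _ := by ring
  · rw [hx4]
    calc (n : ℝ) ^ δ ≤ (n : ℝ) ^ (1 : ℝ) := Real.rpow_le_rpow_of_exponent_le hn1 hδ1
      _ = n := Real.rpow_one _

end DynCM

/-! ### The three regimes of near rewiring -/

namespace DynCM

lemma prod_keepProb (a : ℝ) (r T : ℕ) :
    ∏ i ∈ Finset.range T, keepProb a r (i + 1) = (1 - a) ^ ∑ i ∈ Finset.range T, min r (i + 1) :=
  Finset.prod_pow_eq_pow_sum _ _ _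

lemma sum_min_of_le {r T : ℕ} (h : T ≤ r) :
    ((∑ i ∈ Finset.range T, min r (i + 1) : ℕ) : ℝ) = T * (T + 1) / 2 := by
  induction T with
  | zero => simp
  | succ T ih =>
    rw [Finset.sum_range_succ, min_eq_right h]
    push_cast at ih ⊢
    rw [ih (by omega)]
    ring

lemma sum_min_of_ge {r T : ℕ} (h : r ≤ T) :
    ((∑ i ∈ Finset.range T, min r (i + 1) : ℕ) : ℝ) = r * T - r * (r - 1) / 2 := by
  induction T, h using Nat.le_induction with
  | base =>
    rw [sum_min_of_le le_rfl]
    ring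
  | succ T h ih =>
    rw [Finset.sum_range_succ, min_eq_left (by omega)]
    push_cast at ih ⊢
    rw [ih]
    ring

section

variable {d : (n : ℕ) → Fin n → ℕ} {α : ℕ → ℝ} {p : ℕ → ℝ} {r : ℕ → ℕ} {ρ c : ℝ}

lemma tendsto_sqrt_nhds_zero {l : Filter ℕ} {a : ℕ → ℝ} (h : Tendsto a l (𝓝 0)) :
    Tendsto (fun n => √(a n)) l (𝓝 0) := by
  have := (Real.continuous_sqrt.tendsto 0).comp h
  rwa [Real.sqrt_zero] at this

/-- A lower bound for a rate from the order of the number of steps. -/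
lemma isBigO_inv_of_floor {l : Filter ℕ} (hl : l ≤ atTop) {a : ℕ → ℝ} (ha : ∀ n, 0 < a n)
    (hc : 0 < c) (h : (fun n => (⌊c / a n⌋₊ : ℝ)) =O[l] fun n => Real.log n) :
    (fun n => (a n)⁻¹) =O[l] fun n => Real.log n := by
  refine (IsBigO.of_bound c⁻¹ (Eventually.of_forall fun n => ?_)).trans (isBigO_add_one hl h)
  have h1 := (Nat.lt_floor_add_one (c / a n)).le
  have h2 : (0 : ℝ) ≤ ⌊c / a n⌋₊ := by positivity
  rw [Real.norm_of_nonneg (inv_pos.2 (ha n)).le, Real.norm_of_nonneg (by linarith)]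
  rw [inv_mul_eq_div, le_div_iff₀ hc, mul_comm, ← div_eq_mul_inv]
  exact h1

/-- The regime in which the walk is stopped before it leaves the range of rewiring. -/
theorem tailTendsto_near_large (hd : ∀ n v, 2 ≤ d n v) (hα : ∀ n, 0 < α n ∧ α n ≤ 1)
    (hα0 : Tendsto α (evenAtTop d) (𝓝 0)) (hp : DegreeRegular d p) (hr1 : ∀ n, 1 ≤ r n)
    (hρ : ρ < 1 / Real.log (sizeBiasedMean p))
    (hr : Tendsto (fun n => (r n : ℝ) / Real.log n) (evenAtTop d) (𝓝 ρ))
    (hαr : Tendsto (fun n => α n * (r n : ℝ) ^ 2) (evenAtTop d) atTop) (hc : 0 < c)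
    (hT : (fun n => (⌊c / √(α n)⌋₊ : ℝ)) =O[evenAtTop d] fun n => Real.log n) :
    TailTendsto d α (fun n => nearRule (r n)) (fun n => ⌊c / √(α n)⌋₊)
      (Real.exp (-c ^ 2 / 2)) := by
  have hs : ∀ n, 0 < √(α n) := fun n => Real.sqrt_pos.2 (hα n).1
  have hss : ∀ n, √(α n) * √(α n) = α n := fun n => Real.mul_self_sqrt (hα n).1.le
  have hs0 := tendsto_sqrt_nhds_zero hα0
  have hsT := tendsto_mul_floor_div hs hs0 hc
  refine tailTendsto_near hd hα hp hr1 hρ hr hT ?_ ?_ ?_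
  · have h := (hs0.mul hsT).mul hr
    simp only [zero_mul] at h
    refine h.congr fun n => ?_
    rw [← mul_assoc, hss, mul_div_assoc]
  · have h := isBigO_inv_of_floor (evenAtTop_le d) hs hc hT
    refine (h.mul h).congr (fun n => ?_) fun n => ?_
    · rw [← mul_inv, hss]
    · ring
  · simp only [prod_keepProb]
    have h1 : -c ^ 2 / 2 = -((c * c + 0 * c) / 2) := by ring
    rw [h1]
    refine tendsto_one_sub_pow (fun n => (hα n).1) hα0 ?_
    -- eventually `T ≤ r`, and the exponent is `T * (T + 1) / 2`
    refine (((hsT.mul hsT).add (hs0.mul hsT)).div_const 2).congr' ?_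
    filter_upwards [hαr.eventually (eventually_ge_atTop (c ^ 2))] with n hn
    have hle : ⌊c / √(α n)⌋₊ ≤ r n := by
      have h2 : c / √(α n) ≤ r n := by
        rw [div_le_iff₀ (hs n)]
        refine le_of_sq_le_sq ?_ (by positivity)
        rw [mul_pow, sq (√(α n)), hss]
        linarith
      exact Nat.floor_le_of_le h2
    rw [sum_min_of_le hle]
    linear_combination (⌊c / √(α n)⌋₊ * (⌊c / √(α n)⌋₊ + 1) / 2 : ℝ) * hss n

/-- The regime in which the walk is stopped at the scale of the range of rewiring. -/
theorem tailTendsto_near_critical (hd : ∀ n v, 2 ≤ d n v) (hα : ∀ n, 0 < α n ∧ α n ≤ 1)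
    (hα0 : Tendsto α (evenAtTop d) (𝓝 0)) (hp : DegreeRegular d p) (hr1 : ∀ n, 1 ≤ r n)
    (hρ : ρ < 1 / Real.log (sizeBiasedMean p))
    (hr : Tendsto (fun n => (r n : ℝ) / Real.log n) (evenAtTop d) (𝓝 ρ)) {β : ℝ} (hβ : 0 < β)
    (hαr : Tendsto (fun n => α n * (r n : ℝ) ^ 2) (evenAtTop d) (𝓝 β)) (hc : 0 < c) :
    TailTendsto d α (fun n => nearRule (r n)) (fun n => ⌊c * (r n : ℝ)⌋₊)
      (if c ≤ 1 then Real.exp (-β * c ^ 2 / 2) else Real.exp (-β * (2 * c - 1) / 2)) := by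
  have hle := evenAtTop_le d
  have hr0 : ∀ n, (0 : ℝ) < r n := fun n => by exact_mod_cast hr1 n
  have hloginf : Tendsto (fun n : ℕ => Real.log n) (evenAtTop d) atTop :=
    (Real.tendsto_log_atTop.comp tendsto_natCast_atTop_atTop).mono_left hle
  have hlog1 : ∀ᶠ n : ℕ in evenAtTop d, 1 < Real.log n :=
    hloginf.eventually (eventually_gt_atTop 1)
  have hrO : (fun n => (r n : ℝ)) =O[evenAtTop d] fun n => Real.log n := by
    refine isBigO_of_div_tendsto_nhds ?_ ρ hr
    filter_upwards [hlog1] with n hn h0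
    linarith
  have hri : Tendsto (fun n => (r n : ℝ)⁻¹) (evenAtTop d) (𝓝 0) := by
    have h1 := tendsto_sqrt_nhds_zero (by simpa using hα0.div hαr hβ.ne')
    refine h1.congr fun n => ?_
    have := (hα n).1
    have e1 : α n / (α n * (r n : ℝ) ^ 2) = ((r n : ℝ)⁻¹) ^ 2 := by
      have := hr0 n
      field_simp
    rw [Pi.div_apply, e1, Real.sqrt_sq (inv_pos.2 (hr0 n)).le]
  have hTle : ∀ n, (⌊c * (r n : ℝ)⌋₊ : ℝ) ≤ c * r n := fun n =>
    Nat.floor_le (mul_pos hc (hr0 n)).le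
  have hTr : Tendsto (fun n => (⌊c * (r n : ℝ)⌋₊ : ℝ) / r n) (evenAtTop d) (𝓝 c) := by
    have h1 : Tendsto (fun n => c - (r n : ℝ)⁻¹) (evenAtTop d) (𝓝 c) := by
      simpa using hri.const_sub c
    refine tendsto_of_tendsto_of_tendsto_of_le_of_le h1 tendsto_const_nhds (fun n => ?_)
      fun n => ?_
    · have h2 := Nat.lt_floor_add_one (c * (r n : ℝ))
      have h3 := hr0 n
      show c - (r n : ℝ)⁻¹ ≤ (⌊c * (r n : ℝ)⌋₊ : ℝ) / r n
      rw [le_div_iff₀ h3, sub_mul, inv_mul_cancel₀ h3.ne']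
      linarith
    · exact (div_le_iff₀ (hr0 n)).2 (hTle n)
  refine tailTendsto_near hd hα hp hr1 hρ hr ?_ ?_ ?_ ?_
  · refine (IsBigO.of_bound c (Eventually.of_forall fun n => ?_)).trans hrO
    rw [Real.norm_of_nonneg (by positivity), Real.norm_of_nonneg (by positivity)]
    exact hTle n
  · have h1 := (hαr.mul hTr).mul hloginf.inv_tendsto_atTop
    rw [mul_zero] at h1
    refine h1.congr fun n => ?_
    have := (hr0 n).ne'
    simp only [Pi.inv_apply]
    field_simp
  · have h1 : (fun n => (α n)⁻¹) =O[evenAtTop d] fun n => (r n : ℝ) ^ 2 := by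
      refine IsBigO.of_bound (2 / β) ?_
      filter_upwards [hαr.eventually (lt_mem_nhds (show β / 2 < β by linarith))] with n hn
      have := (hα n).1
      rw [Real.norm_of_nonneg (inv_pos.2 this).le, Real.norm_of_nonneg (by positivity),
        inv_le_iff_one_le_mul₀ this]
      have e1 : 2 / β * (r n : ℝ) ^ 2 * α n = 2 / β * (α n * (r n : ℝ) ^ 2) := by ring
      rw [e1]
      calc (1 : ℝ) = 2 / β * (β / 2) := by field_simp
        _ ≤ _ := by gcongr
    exact h1.trans (hrO.pow 2)
  · simp only [prod_keepProb]
    split_ifs with hc1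
    · have h1 : -β * c ^ 2 / 2 = -(β * (c * (c + 0) / 2)) := by ring
      rw [h1]
      refine tendsto_one_sub_pow (fun n => (hα n).1) hα0 ?_
      refine (hαr.mul ((hTr.mul (hTr.add hri)).div_const 2)).congr fun n => ?_
      have hle : ⌊c * (r n : ℝ)⌋₊ ≤ r n := by
        refine Nat.floor_le_of_le ?_
        have := hr0 n
        nlinarith
      rw [sum_min_of_le hle]
      have := (hr0 n).ne'
      field_simp
    · have h1 : -β * (2 * c - 1) / 2 = -(β * (c - (1 - 0) / 2)) := by ring
      rw [h1]
      refine tendsto_one_sub_pow (fun n => (hα n).1) hα0 ?_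
      refine (hαr.mul (hTr.sub ((hri.const_sub 1).div_const 2))).congr fun n => ?_
      have hle : r n ≤ ⌊c * (r n : ℝ)⌋₊ := by
        refine Nat.le_floor ?_
        have := hr0 n
        nlinarith
      rw [sum_min_of_ge hle]
      have := (hr0 n).ne'
      field_simp

/-- The regime in which the walk is stopped long after it has left the range of rewiring. -/
theorem tailTendsto_near_small (hd : ∀ n v, 2 ≤ d n v) (hα : ∀ n, 0 < α n ∧ α n ≤ 1)
    (hα0 : Tendsto α (evenAtTop d) (𝓝 0)) (hp : DegreeRegular d p) (hr1 : ∀ n, 1 ≤ r n)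
    (hρ : ρ < 1 / Real.log (sizeBiasedMean p))
    (hr : Tendsto (fun n => (r n : ℝ) / Real.log n) (evenAtTop d) (𝓝 ρ))
    (hαr : Tendsto (fun n => α n * (r n : ℝ) ^ 2) (evenAtTop d) (𝓝 0)) (hc : 0 < c)
    (hT : (fun n => (⌊c / (α n * (r n : ℝ))⌋₊ : ℝ)) =O[evenAtTop d] fun n => Real.log n) :
    TailTendsto d α (fun n => nearRule (r n)) (fun n => ⌊c / (α n * (r n : ℝ))⌋₊)
      (Real.exp (-c)) := by
  have hle := evenAtTop_le d
  have hr0 : ∀ n, (1 : ℝ) ≤ r n := fun n => by exact_mod_cast hr1 n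
  have hloginf : Tendsto (fun n : ℕ => Real.log n) (evenAtTop d) atTop :=
    (Real.tendsto_log_atTop.comp tendsto_natCast_atTop_atTop).mono_left hle
  have hlog1 : ∀ᶠ n : ℕ in evenAtTop d, 1 < Real.log n :=
    hloginf.eventually (eventually_gt_atTop 1)
  have hrO : (fun n => (r n : ℝ)) =O[evenAtTop d] fun n => Real.log n := by
    refine isBigO_of_div_tendsto_nhds ?_ ρ hr
    filter_upwards [hlog1] with n hn h0
    linarith
  have ha : ∀ n, 0 < α n * (r n : ℝ) := fun n =>
    mul_pos (hα n).1 (by linarith [hr0 n])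
  have ha0 : Tendsto (fun n => α n * (r n : ℝ)) (evenAtTop d) (𝓝 0) := by
    refine squeeze_zero (fun n => (ha n).le) (fun n => ?_) hαr
    have := hr0 n
    have := (hα n).1
    gcongr
    nlinarith
  have haT := tendsto_mul_floor_div ha ha0 hc
  refine tailTendsto_near hd hα hp hr1 hρ hr hT ?_ ?_ ?_
  · have h1 := haT.mul hloginf.inv_tendsto_atTop
    rw [mul_zero] at h1
    refine h1.congr fun n => ?_
    simp only [Pi.inv_apply]
    ring
  · have h := (isBigO_inv_of_floor hle ha hc hT).mul hrO
    refine h.congr (fun n => ?_) fun n => (sq _).symm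
    have := hr0 n
    have : (r n : ℝ) ≠ 0 := by linarith
    field_simp
  · simp only [prod_keepProb]
    have h1 : -c = -(c - (0 - 0) / 2) := by ring
    rw [h1]
    refine tendsto_one_sub_pow (fun n => (hα n).1) hα0 ?_
    -- eventually `r ≤ T`, and the exponent is `r * T - r * (r - 1) / 2`
    refine (haT.sub ((hαr.sub ha0).div_const 2)).congr' ?_
    filter_upwards [hαr.eventually (gt_mem_nhds (show (0 : ℝ) < c / 2 by linarith)),
      haT.eventually (lt_mem_nhds (show c / 2 < c by linarith))] with n h2 h3
    have hle : r n ≤ ⌊c / (α n * (r n : ℝ))⌋₊ := by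
      have h4 : (α n * (r n : ℝ)) * r n ≤ (α n * (r n : ℝ)) * ⌊c / (α n * (r n : ℝ))⌋₊ := by
        nlinarith
      exact_mod_cast le_of_mul_le_mul_left h4 (ha n)
    rw [sum_min_of_ge hle]
    ring

end

end DynCM

theorem theorem1p2
    (d : (n : ℕ) → Fin n → ℕ) (α : ℕ → ℝ)
    (hR1 : (fun n => (Fintype.card (DynCM.HalfEdge (d n)) : ℝ))
      =Θ[DynCM.evenAtTop d] fun n => (n : ℝ))
    (hR3 : ∀ n v, 2 ≤ d n v)
    (hα : ∀ n, 0 < α n ∧ α n ≤ 1)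
    (hα0 : Tendsto α (DynCM.evenAtTop d) (𝓝 0)) :
    -- (A) local-to-global rewiring
    (∀ c : ℝ, 0 < c →
      (fun n => (⌊c / α n⌋₊ : ℝ)) =O[DynCM.evenAtTop d] (fun n => Real.log n) →
      DynCM.TailTendsto d α (fun _ => DynCM.localRule) (fun n => ⌊c / α n⌋₊) (Real.exp (-c))) ∧
    -- (B) near-to-global rewiring
    (∀ (p : ℕ → ℝ) (r : ℕ → ℕ) (ρ : ℝ),
      DynCM.DegreeRegular d p →
      (∀ n, 1 < r n) →
      0 ≤ ρ → ρ < 1 / Real.log (DynCM.sizeBiasedMean p) →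
      Tendsto (fun n => (r n : ℝ) / Real.log n) (DynCM.evenAtTop d) (𝓝 ρ) →
      (Tendsto (fun n => α n * (r n : ℝ) ^ 2) (DynCM.evenAtTop d) atTop →
        ∀ c : ℝ, 0 < c →
          (fun n => (⌊c / √(α n)⌋₊ : ℝ)) =O[DynCM.evenAtTop d] (fun n => Real.log n) →
          DynCM.TailTendsto d α (fun n => DynCM.nearRule (r n)) (fun n => ⌊c / √(α n)⌋₊)
            (Real.exp (-c ^ 2 / 2))) ∧
      (∀ β : ℝ, 0 < β →
        Tendsto (fun n => α n * (r n : ℝ) ^ 2) (DynCM.evenAtTop d) (𝓝 β) →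
        ∀ c : ℝ, 0 < c →
          DynCM.TailTendsto d α (fun n => DynCM.nearRule (r n)) (fun n => ⌊c * (r n : ℝ)⌋₊)
            (if c ≤ 1 then Real.exp (-β * c ^ 2 / 2) else Real.exp (-β * (2 * c - 1) / 2))) ∧
      (Tendsto (fun n => α n * (r n : ℝ) ^ 2) (DynCM.evenAtTop d) (𝓝 0) →
        ∀ c : ℝ, 0 < c →
          (fun n => (⌊c / (α n * (r n : ℝ))⌋₊ : ℝ)) =O[DynCM.evenAtTop d]
            (fun n => Real.log n) →
          DynCM.TailTendsto d α (fun n => DynCM.nearRule (r n))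
            (fun n => ⌊c / (α n * (r n : ℝ))⌋₊) (Real.exp (-c)))) ∧
    -- (C) global-to-global rewiring
    (∀ c : ℝ, 0 < c →
      (fun n => (⌊c / √(α n)⌋₊ : ℝ)) =O[DynCM.evenAtTop d] (fun n => Real.log n) →
      DynCM.TailTendsto d α (fun _ => DynCM.globalRule) (fun n => ⌊c / √(α n)⌋₊)
        (Real.exp (-c ^ 2 / 2))) := by
  refine ⟨fun c hc _ => DynCM.tailTendsto_local hR3 hα hα0 hc, ?_,
    fun c hc hlog => DynCM.tailTendsto_global hR3 hα hα0 hc hlog⟩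
  intro p r ρ hp hr1 _ hρ hr
  have hr1 : ∀ n, 1 ≤ r n := fun n => (hr1 n).le
  exact ⟨fun hαr c hc hT => DynCM.tailTendsto_near_large hR3 hα hα0 hp hr1 hρ hr hαr hc hT,
    fun β hβ hαr c hc => DynCM.tailTendsto_near_critical hR3 hα hα0 hp hr1 hρ hr hβ hαr hc,
    fun hαr c hc hT => DynCM.tailTendsto_near_small hR3 hα hα0 hp hr1 hρ hr hαr hc hT⟩
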